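/- Let $\mathbb K\in\{\mathbb R,\mathbb C\}$ be the field of coefficients. Let $\mathfrak g\to M$ be a (real, finite-rank) Lie algebroid with anchor $\rho$ over a compact smooth manifold $M$ without boundary, and let $\pi:E\to M$ be a smooth oriented real vector bundle of rank $r$ (an orientation is given near each point by a local frame). *Notation.* $\Omega^k(\mathfrak g)$ is the space of smooth $\mathbb K$-valued alternating $k$-forms on $\mathfrak g$, with the Koszul differential $$d\alpha(X_0,\dots,X_k)=\sum_i(-1)^i\rho(X_i)\big(\alpha(X_0,\dots,\hat X_i,\dots,X_k)\big)+\sum_{i<j}(-1)^{i+j}\alpha([X_i,X_j],X_0,\dots,\hat X_i,\dots,\hat X_j,\dots,X_k),$$ $H^\bullet(\mathfrak g)$ is its cohomology, and $H^\bullet_c$ is the cohomology of the subcomplex of forms with compact support on the base; for $\mathfrak g=TP$ this is the (compactly supported) de Rham cohomology of $P$. The pull-back Lie algebroid $\pi^!\mathfrak g\to E$ has fibre $\{(X,\xi)\in\mathfrak g_{\pi(e)}\oplus T_eE:\rho(X)=d\pi(\xi)\}$ at $e$, anchor $(X,\xi)\mapsto\xi$, and bracket, for $f_i,h_j\in C^\infty(E)$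 and $X_i,Y_j\in\Gamma^\infty(M;\mathfrak g)$, $$\Big[\big(\textstyle\sum_i f_iX_i,\xi\big),\big(\sum_j h_jY_j,\eta\big)\Big]=\Big(\sum_{i,j}f_ih_j[X_i,Y_j]+\sum_j\xi(h_j)Y_j-\sum_i\eta(f_i)X_i,\ [\xi,\eta]\Big).$$ $Th^r\in H^r_c(\mathbb R^r)$ is the class of the compactly supported forms of integral $1$. The ordinary Thom class $Th(E)\in H^r_c(E)$ is the one and only class which, for all $x\in M$, restricts to $Th^r$ on the fibre $E_x$ (identified with $\mathbb R^r$ by any orientation-preserving linear isomorphism). The Lie algebroid Thom class is $Th^{\mathfrak g}(E):=\rho_{\pi^!\mathfrak g}^*Th(E)\in H^r_c(\pi^!\mathfrak g)$, the pull-back along the anchor $\rho_{\pi^!\mathfrak g}:\pi^!\mathfrak g\to TE$. **Theorem.** The classes $Th(E)$ and $Th^{\mathfrak g}(E)$ are well defined, and: 1. (Naturality) For every Lie algebroid $\mathfrak g'\to M'$ over a compact manifold and every morphism of Lie algebroids $(f,\varphi):\mathfrak g'\to\mathfrak g$, with canonical map $\tilde f:f^*E\to E$ and projection $\pi':f^*E\to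 M'$, pull-back along the induced bundle map $\pi'^!\mathfrak g'\to\pi^!\mathfrak g$, $(X,\xi)\mapsto(\varphi(X),T\tilde f(\xi))$, satisfies $$(f,\varphi)^*Th^{\mathfrak g}(E)=Th^{\mathfrak g'}(f^*E).$$ 2. (Restriction to fibres) For every $x\in M$ the inclusion $i_x:E_x\to E$ extends to a morphism of Lie algebroids $(i_x,\iota_x):TE_x\to\pi^!\mathfrak g$, $\iota_x(v)=(0,Ti_x(v))$, and $$(i_x,\iota_x)^*Th^{\mathfrak g}(E)=Th^r\in H^r_c(E_x)\cong H^r_c(\mathbb R^r).$$ 3. (Thom isomorphism) For every $k\ge0$ the map $[\alpha]\mapsto[\pi^*\alpha\wedge Th^{\mathfrak g}(E)]$ is a well-defined $\mathbb K$-linear isomorphism $H^k(\mathfrak g)\cong H^{k+r}_c(\pi^!\mathfrak g)$. 4. (Uniqueness) $Th^{\mathfrak g}(E)$ is the unique class with these properties; indeed any $c\in H^r_c(\pi^!\mathfrak g)$ with $(i_x,\iota_x)^*c=Th^r$ for all $x\in M$ equals $Th^{\mathfrak g}(E)$. -/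

import Mathlib

open Bundle Set Filter Topology MeasureTheory
open scoped Manifold ContDiff

noncomputable section

namespace ThomAlgebroid

/-! ## Lie algebroids on smooth vector bundles -/

/-- The derivative `v(f)` of a vector-valued function `f` on a manifold in the direction of the
tangent vector `v` at `x`. -/
def dirDeriv {EM : Type*} [NormedAddCommGroup EM] [NormedSpace ℝ EM]
    {HM : Type*} [TopologicalSpace HM] (I : ModelWithCorners ℝ EM HM)
    {M : Type*} [TopologicalSpace M] [ChartedSpace HM M]
    {V : Type*} [NormedAddCommGroup V] [NormedSpace ℝ V] (f : M → V) (x : M)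
    (v : TangentSpace I x) : V :=
  mfderiv I 𝓘(ℝ, V) f x v

/-- A Lie algebroid structure on the smooth real vector bundle `A → M` with model fibre `FA`:
a smooth bundle map `anchor : A → TM` over the identity and a Lie bracket on the space
`Γ^∞(M; A)` of global smooth sections, such that the anchor preserves brackets and the Leibniz
rule `[X, f Y] = f [X, Y] + ρ(X)(f) Y` holds. -/
structure LieAlgebroid {EM : Type*} [NormedAddCommGroup EM] [NormedSpace ℝ EM]
    {HM : Type*} [TopologicalSpace HM] (I : ModelWithCorners ℝ EM HM)
    {M : Type*} [TopologicalSpace M] [ChartedSpace HM M] [IsManifold I ∞ M]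
    (FA : Type*) [NormedAddCommGroup FA] [NormedSpace ℝ FA]
    (A : M → Type*) [TopologicalSpace (TotalSpace FA A)]
    [∀ x, AddCommGroup (A x)] [∀ x, Module ℝ (A x)] [∀ x, TopologicalSpace (A x)]
    [FiberBundle FA A] [VectorBundle ℝ FA A] where
  anchor : ∀ x, A x →ₗ[ℝ] TangentSpace I x
  contMDiff_anchor : ContMDiff (I.prod 𝓘(ℝ, FA)) I.tangent ∞
    (fun v : TotalSpace FA A => (⟨v.proj, anchor v.proj v.snd⟩ : TangentBundle I M))
  bracket : Cₛ^∞⟮I; FA, A⟯ → Cₛ^∞⟮I; FA, A⟯ → Cₛ^∞⟮I; FA, A⟯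
  bracket_add : ∀ X Y Z, bracket X (Y + Z) = bracket X Y + bracket X Z
  bracket_smul : ∀ (c : ℝ) X Y, bracket X (c • Y) = c • bracket X Y
  bracket_skew : ∀ X Y, bracket X Y = -bracket Y X
  jacobi : ∀ X Y Z, bracket X (bracket Y Z) = bracket (bracket X Y) Z + bracket Y (bracket X Z)
  anchor_bracket : ∀ (X Y : Cₛ^∞⟮I; FA, A⟯) (x : M),
    anchor x (bracket X Y x) =
      VectorField.mlieBracket I (fun y => anchor y (X y)) (fun y => anchor y (Y y)) x
  leibniz : ∀ (f : M → ℝ), ContMDiff I 𝓘(ℝ, ℝ) ∞ f → ∀ (X Y Z : Cₛ^∞⟮I; FA, A⟯),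
    (∀ x, Z x = f x • Y x) → ∀ x,
      bracket X Z x =
        f x • bracket X Y x + dirDeriv I f x (anchor x (X x)) • Y x

/-! ## The data from which Lie algebroid cohomology is computed

A given Lie algebroid, the tangent bundle of a manifold, and a pull-back algebroid are all put
into the following common form: the fibres, the set of smooth sections, the anchor, and the
bracket. (The value of `bracket` is only relevant on smooth sections.) This type is only used
for the three constructions below. -/

/-- Fibres, smooth sections, anchor and bracket of a Lie algebroid over `M`. -/
structure AlgebroidData {EM : Type*} [NormedAddCommGroup EM] [NormedSpace ℝ EM]
    {HM : Type*} [TopologicalSpace HM] (I : ModelWithCorners ℝ EM HM)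
    (M : Type*) [TopologicalSpace M] [ChartedSpace HM M] where
  Fib : M → Type*
  [addCommGroup : ∀ x, AddCommGroup (Fib x)]
  [module : ∀ x, Module ℝ (Fib x)]
  IsSmooth : (∀ x, Fib x) → Prop
  anchor : ∀ x, Fib x →ₗ[ℝ] TangentSpace I x
  bracket : (∀ x, Fib x) → (∀ x, Fib x) → (∀ x, Fib x)

attribute [instance] AlgebroidData.addCommGroup AlgebroidData.module

section Constructions

variable {EM : Type*} [NormedAddCommGroup EM] [NormedSpace ℝ EM]
    {HM : Type*} [TopologicalSpace HM] (I : ModelWithCorners ℝ EM HM)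
    (M : Type*) [TopologicalSpace M] [ChartedSpace HM M] [IsManifold I ∞ M]

/-- The tangent bundle `TM`, with the identity as anchor and the Lie bracket of vector fields. -/
def tangentAlgebroid : AlgebroidData I M where
  Fib x := TangentSpace I x
  IsSmooth X := ContMDiff I I.tangent ∞ (fun x => (⟨x, X x⟩ : TangentBundle I M))
  anchor _ := LinearMap.id
  bracket X Y := VectorField.mlieBracket I X Y

variable {I M}
  {FA : Type*} [NormedAddCommGroup FA] [NormedSpace ℝ FA]
  {A : M → Type*} [TopologicalSpace (TotalSpace FA A)]
  [∀ x, AddCommGroup (A x)] [∀ x, Module ℝ (A x)] [∀ x, TopologicalSpace (A x)]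
  [FiberBundle FA A] [VectorBundle ℝ FA A]

open Classical in
/-- The data of a Lie algebroid: all smooth sections of `A`, with the given anchor and bracket. -/
def LieAlgebroid.toData (L : LieAlgebroid I FA A) : AlgebroidData I M where
  Fib := A
  IsSmooth X := ContMDiff I (I.prod 𝓘(ℝ, FA)) ∞ (fun x => TotalSpace.mk' FA x (X x))
  anchor := L.anchor
  bracket X Y :=
    if h : ContMDiff I (I.prod 𝓘(ℝ, FA)) ∞ (fun x => TotalSpace.mk' FA x (X x)) ∧
        ContMDiff I (I.prod 𝓘(ℝ, FA)) ∞ (fun x => TotalSpace.mk' FA x (Y x)) then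
      ⇑(L.bracket ⟨X, h.1⟩ ⟨Y, h.2⟩)
    else 0

variable {EP : Type*} [NormedAddCommGroup EP] [NormedSpace ℝ EP]
    {HP : Type*} [TopologicalSpace HP] (IP : ModelWithCorners ℝ EP HP)
    {P : Type*} [TopologicalSpace P] [ChartedSpace HP P]

/-- The fibre `{(X, ξ) ∈ A_{f(p)} ⊕ T_pP | ρ(X) = df(ξ)}` of the pull-back algebroid. -/
def LieAlgebroid.pullbackFib (L : LieAlgebroid I FA A) (f : P → M) (p : P) :
    Submodule ℝ (A (f p) × TangentSpace IP p) :=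
  LinearMap.eqLocus ((L.anchor (f p)).comp (LinearMap.fst ℝ (A (f p)) (TangentSpace IP p)))
    ((mfderiv IP I f p).toLinearMap.comp (LinearMap.snd ℝ (A (f p)) (TangentSpace IP p)))

/-- `z` is the bracket of the sections `s = (∑ i, a i • X i ∘ f, ξ)` and
`t = (∑ j, b j • Y j ∘ f, η)` of the pull-back algebroid, where `X i`, `Y j` are smooth sections of
`A` and `a i`, `b j` are smooth functions on `P`: its components are
`∑ a i b j [X i, Y j] ∘ f + ∑ ξ(b j) Y j ∘ f - ∑ η(a i) X i ∘ f` and `[ξ, η]`. -/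
def LieAlgebroid.IsPullbackBracket (L : LieAlgebroid I FA A) (f : P → M)
    (s t z : ∀ p, L.pullbackFib IP f p) : Prop :=
  ∃ (m n : ℕ) (a : Fin m → P → ℝ) (X : Fin m → Cₛ^∞⟮I; FA, A⟯)
    (b : Fin n → P → ℝ) (Y : Fin n → Cₛ^∞⟮I; FA, A⟯),
    (∀ i, ContMDiff IP 𝓘(ℝ, ℝ) ∞ (a i)) ∧ (∀ j, ContMDiff IP 𝓘(ℝ, ℝ) ∞ (b j)) ∧
    (∀ p, (s p).1.1 = ∑ i, a i p • X i (f p)) ∧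
    (∀ p, (t p).1.1 = ∑ j, b j p • Y j (f p)) ∧
    ∀ p,
      (z p).1.1 =
        ∑ i, ∑ j, (a i p * b j p) • L.bracket (X i) (Y j) (f p) +
          ∑ j, dirDeriv IP (b j) p (s p).1.2 • Y j (f p) -
          ∑ i, dirDeriv IP (a i) p (t p).1.2 • X i (f p) ∧
      (z p).1.2 =
        VectorField.mlieBracket IP (fun q => (s q).1.2) (fun q => (t q).1.2) p

/-- The pull-back algebroid `f^!A` of `A` along a surjective submersion `f : P → M`. A section
`(X, ξ)` is smooth if both of its components are. The anchor is `(X, ξ) ↦ ξ`, and the bracket of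
two smooth sections is the one and only section singled out by the formula above. -/
def LieAlgebroid.pullback [IsManifold IP ∞ P] (L : LieAlgebroid I FA A) (f : P → M) : AlgebroidData IP P where
  Fib p := L.pullbackFib IP f p
  IsSmooth s :=
    ContMDiff IP (I.prod 𝓘(ℝ, FA)) ∞ (fun p => TotalSpace.mk' FA (f p) (s p).1.1) ∧
    ContMDiff IP IP.tangent ∞ (fun p => (⟨p, (s p).1.2⟩ : TangentBundle IP P))
  anchor p := (LinearMap.snd ℝ (A (f p)) (TangentSpace IP p)).comp (L.pullbackFib IP f p).subtype
  bracket s t := Classical.epsilon (L.IsPullbackBracket IP f s t)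

end Constructions

/-! ## Forms, the differential, and cohomology -/

section Cohomology

variable (𝕜 : Type*) [RCLike 𝕜]
    {EM : Type*} [NormedAddCommGroup EM] [NormedSpace ℝ EM]
    {HM : Type*} [TopologicalSpace HM] {I : ModelWithCorners ℝ EM HM}
    {M : Type*} [TopologicalSpace M] [ChartedSpace HM M]

/-- Fibrewise alternating `k`-forms on the fibres of `A` with values in `𝕜`. -/
def AlgebroidData.Form (A : AlgebroidData I M) (k : ℕ) :=
  ∀ x, A.Fib x [⋀^Fin k]→ₗ[ℝ] 𝕜

instance (A : AlgebroidData I M) (k : ℕ) : AddCommGroup (A.Form 𝕜 k) :=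
  inferInstanceAs (AddCommGroup (∀ x, A.Fib x [⋀^Fin k]→ₗ[ℝ] 𝕜))

instance (A : AlgebroidData I M) (k : ℕ) : Module 𝕜 (A.Form 𝕜 k) :=
  inferInstanceAs (Module 𝕜 (∀ x, A.Fib x [⋀^Fin k]→ₗ[ℝ] 𝕜))

variable {𝕜} in
@[simp] theorem AlgebroidData.Form.add_apply {A : AlgebroidData I M} {k : ℕ} (α β : A.Form 𝕜 k)
    (x : M) : (α + β) x = α x + β x := rfl

variable {𝕜} in
@[simp] theorem AlgebroidData.Form.smul_apply {A : AlgebroidData I M} {k : ℕ} (c : 𝕜)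
    (α : A.Form 𝕜 k) (x : M) : (c • α) x = c • α x := rfl

variable {𝕜}

/-- The form `τ` is smooth: its values on smooth sections are smooth functions. -/
def AlgebroidData.IsSmoothForm (A : AlgebroidData I M) {k : ℕ} (τ : A.Form 𝕜 k) : Prop :=
  ∀ X : Fin k → ∀ x, A.Fib x, (∀ i, A.IsSmooth (X i)) →
    ContMDiff I 𝓘(ℝ, 𝕜) ∞ (fun x => τ x (fun i => X i x))

variable (𝕜) in
/-- The space `Ω^k(A)` of smooth forms. -/
def AlgebroidData.smoothForms (A : AlgebroidData I M) (k : ℕ) : Submodule 𝕜 (A.Form 𝕜 k) where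
  carrier := {τ | A.IsSmoothForm τ}
  add_mem' {a b} ha hb X hX := (ha X hX).add (hb X hX)
  zero_mem' _ _ := contMDiff_const
  smul_mem' c τ hτ X hX := by
    have h : ContMDiff 𝓘(ℝ, 𝕜) 𝓘(ℝ, 𝕜) ∞ (fun z : 𝕜 => c • z) :=
      (contDiff_const_smul c).contMDiff
    exact h.comp (hτ X hX)

variable (𝕜) in
/-- The space `Ω^k_c(A)` of smooth forms that vanish outside of a compact subset of the base. -/
def AlgebroidData.compactForms (A : AlgebroidData I M) (k : ℕ) : Submodule 𝕜 (A.Form 𝕜 k) where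
  carrier := {τ | A.IsSmoothForm τ ∧ ∃ K : Set M, IsCompact K ∧ ∀ x ∉ K, τ x = 0}
  add_mem' := by
    rintro a b ⟨ha, K, hK, haK⟩ ⟨hb, K', hK', hbK⟩
    refine ⟨(A.smoothForms 𝕜 k).add_mem ha hb, K ∪ K', hK.union hK', fun x hx => ?_⟩
    rw [mem_union, not_or] at hx
    simp [haK x hx.1, hbK x hx.2]
  zero_mem' := ⟨(A.smoothForms 𝕜 k).zero_mem, ∅, isCompact_empty, fun _ _ => rfl⟩
  smul_mem' := by
    rintro c a ⟨ha, K, hK, haK⟩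
    exact ⟨(A.smoothForms 𝕜 k).smul_mem c ha, K, hK, fun x hx => by simp [haK x hx]⟩

/-- The second sum of the Koszul formula,
`∑_{i<j} (-1)^{i+j} α([X_i, X_j], X_0, …, X̂_i, …, X̂_j, …, X_k)`. It is empty for `k = 0`. -/
def AlgebroidData.koszulBracketSum (A : AlgebroidData I M) : {k : ℕ} → A.Form 𝕜 k →
    (Fin (k + 1) → ∀ x, A.Fib x) → M → 𝕜
  | 0, _, _, _ => 0
  | k + 1, α, X, x => ∑ j : Fin (k + 2), ∑ i : Fin (k + 1),
      if i.castSucc < j then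
        (-1 : 𝕜) ^ ((i : ℕ) + (j : ℕ)) *
          α x (Matrix.vecCons (A.bracket (X i.castSucc) (X j) x)
            (fun l : Fin k => X (j.succAbove (i.succAbove l)) x))
      else 0

/-- The value `(dα)(X_0, …, X_k)` at `x` according to the Koszul formula for the trivial
representation. -/
def AlgebroidData.koszul (A : AlgebroidData I M) {k : ℕ} (α : A.Form 𝕜 k)
    (X : Fin (k + 1) → ∀ x, A.Fib x) (x : M) : 𝕜 :=
  ∑ i : Fin (k + 1), (-1 : 𝕜) ^ (i : ℕ) *
      dirDeriv I (fun y => α y (fun l => X (i.succAbove l) y)) x (A.anchor x (X i x)) +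
    A.koszulBracketSum α X x

/-- `β = dα`: on smooth sections, the values of `β` are given by the Koszul formula. -/
def AlgebroidData.IsDifferential (A : AlgebroidData I M) {k : ℕ} (α : A.Form 𝕜 k)
    (β : A.Form 𝕜 (k + 1)) : Prop :=
  ∀ X : Fin (k + 1) → ∀ x, A.Fib x, (∀ i, A.IsSmooth (X i)) →
    ∀ x, β x (fun i => X i x) = A.koszul α X x

theorem AlgebroidData.koszulBracketSum_add (A : AlgebroidData I M) {k : ℕ} (α β : A.Form 𝕜 k)
    (X : Fin (k + 1) → ∀ x, A.Fib x) (x : M) :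
    A.koszulBracketSum (α + β) X x = A.koszulBracketSum α X x + A.koszulBracketSum β X x := by
  cases k with
  | zero => simp [koszulBracketSum]
  | succ k =>
    simp only [koszulBracketSum, ← Finset.sum_add_distrib]
    refine Finset.sum_congr rfl fun j _ => Finset.sum_congr rfl fun i _ => ?_
    split_ifs
    · simp [mul_add]
    · simp

theorem AlgebroidData.koszulBracketSum_smul (A : AlgebroidData I M) {k : ℕ} (c : 𝕜)
    (α : A.Form 𝕜 k) (X : Fin (k + 1) → ∀ x, A.Fib x) (x : M) :
    A.koszulBracketSum (c • α) X x = c * A.koszulBracketSum α X x := by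
  cases k with
  | zero => simp [koszulBracketSum]
  | succ k =>
    simp only [koszulBracketSum, Finset.mul_sum]
    refine Finset.sum_congr rfl fun j _ => Finset.sum_congr rfl fun i _ => ?_
    split_ifs
    · simp [mul_left_comm]
    · simp

theorem dirDeriv_add {V : Type*} [NormedAddCommGroup V] [NormedSpace ℝ V] {f g : M → V} {x : M}
    (hf : MDifferentiableAt I 𝓘(ℝ, V) f x) (hg : MDifferentiableAt I 𝓘(ℝ, V) g x)
    (v : TangentSpace I x) :
    dirDeriv I (fun y => f y + g y) x v = dirDeriv I f x v + dirDeriv I g x v :=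
  congrArg (fun T : TangentSpace I x →L[ℝ] V => T v) (mfderiv_add hf hg)

theorem dirDeriv_mul_left {f : M → 𝕜} {x : M} (c : 𝕜) (hf : MDifferentiableAt I 𝓘(ℝ, 𝕜) f x)
    (v : TangentSpace I x) :
    dirDeriv I (fun y => c * f y) x v = c * dirDeriv I f x v := by
  have h := ((ContinuousLinearMap.mul ℝ 𝕜 c).hasMFDerivAt (x := f x)).comp x hf.hasMFDerivAt
  exact congrArg (fun T : TangentSpace I x →L[ℝ] 𝕜 => T v) h.mfderiv

theorem AlgebroidData.koszul_add (A : AlgebroidData I M) {k : ℕ} {α β : A.Form 𝕜 k}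
    (hα : A.IsSmoothForm α) (hβ : A.IsSmoothForm β)
    {X : Fin (k + 1) → ∀ x, A.Fib x} (hX : ∀ i, A.IsSmooth (X i)) (x : M) :
    A.koszul (α + β) X x = A.koszul α X x + A.koszul β X x := by
  unfold koszul
  rw [A.koszulBracketSum_add, add_add_add_comm, ← Finset.sum_add_distrib]
  congr 1
  refine Finset.sum_congr rfl fun i _ => ?_
  rw [← mul_add, ← dirDeriv_add ((hα _ fun l => hX _).mdifferentiable (by simp) x)
      ((hβ _ fun l => hX _).mdifferentiable (by simp) x)]
  rfl

theorem AlgebroidData.koszul_smul (A : AlgebroidData I M) {k : ℕ} (c : 𝕜) {α : A.Form 𝕜 k}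
    (hα : A.IsSmoothForm α)
    {X : Fin (k + 1) → ∀ x, A.Fib x} (hX : ∀ i, A.IsSmooth (X i)) (x : M) :
    A.koszul (c • α) X x = c * A.koszul α X x := by
  unfold koszul
  rw [A.koszulBracketSum_smul, mul_add, Finset.mul_sum]
  congr 1
  refine Finset.sum_congr rfl fun i _ => ?_
  rw [mul_left_comm, ← dirDeriv_mul_left c ((hα _ fun l => hX _).mdifferentiable (by simp) x)]
  rfl

theorem AlgebroidData.IsDifferential.add {A : AlgebroidData I M} {k : ℕ} {α α' : A.Form 𝕜 k}
    {β β' : A.Form 𝕜 (k + 1)} (h : A.IsDifferential α β) (h' : A.IsDifferential α' β')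
    (hα : A.IsSmoothForm α) (hα' : A.IsSmoothForm α') :
    A.IsDifferential (α + α') (β + β') := fun X hX x => by
  rw [A.koszul_add hα hα' hX, ← h X hX, ← h' X hX]
  rfl

theorem AlgebroidData.IsDifferential.smul {A : AlgebroidData I M} {k : ℕ} {α : A.Form 𝕜 k}
    {β : A.Form 𝕜 (k + 1)} (c : 𝕜) (h : A.IsDifferential α β) (hα : A.IsSmoothForm α) :
    A.IsDifferential (c • α) (c • β) := fun X hX x => by
  rw [A.koszul_smul c hα hX, ← h X hX]
  rfl

theorem AlgebroidData.isDifferential_zero (A : AlgebroidData I M) (k : ℕ) :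
    A.IsDifferential (0 : A.Form 𝕜 k) 0 := fun X hX x => by
  have h := A.koszul_smul (0 : 𝕜) (A.smoothForms 𝕜 k).zero_mem hX x
  rw [smul_zero, zero_mul] at h
  rw [h]
  rfl

variable (𝕜) in
/-- The closed smooth forms of degree `k`. -/
def AlgebroidData.cocycles (A : AlgebroidData I M) (k : ℕ) : Submodule 𝕜 (A.Form 𝕜 k) where
  carrier := {τ | A.IsSmoothForm τ ∧ A.IsDifferential τ 0}
  add_mem' {a b} ha hb := ⟨(A.smoothForms 𝕜 k).add_mem ha.1 hb.1, by
    simpa using ha.2.add hb.2 ha.1 hb.1⟩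
  zero_mem' := ⟨(A.smoothForms 𝕜 k).zero_mem, A.isDifferential_zero k⟩
  smul_mem' c a ha := ⟨(A.smoothForms 𝕜 k).smul_mem c ha.1, by
    simpa using ha.2.smul c ha.1⟩

variable (𝕜) in
/-- The differentials of the elements of `Ω k`, where `Ω` is a subcomplex of the smooth forms. -/
def AlgebroidData.coboundaries (A : AlgebroidData I M)
    (Ω : ∀ k, Submodule 𝕜 (A.Form 𝕜 k)) (hΩ : ∀ k, Ω k ≤ A.smoothForms 𝕜 k) :
    (k : ℕ) → Submodule 𝕜 (A.Form 𝕜 k)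
  | 0 => ⊥
  | k + 1 =>
    { carrier := {β | ∃ α ∈ Ω k, A.IsDifferential α β}
      add_mem' := by
        rintro b b' ⟨a, ha, hab⟩ ⟨a', ha', hab'⟩
        exact ⟨a + a', (Ω k).add_mem ha ha', hab.add hab' (hΩ k ha) (hΩ k ha')⟩
      zero_mem' := ⟨0, (Ω k).zero_mem, A.isDifferential_zero k⟩
      smul_mem' := by
        rintro c b ⟨a, ha, hab⟩
        exact ⟨c • a, (Ω k).smul_mem c ha, hab.smul c (hΩ k ha)⟩ }

theorem AlgebroidData.compactForms_le (A : AlgebroidData I M) (k : ℕ) :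
    A.compactForms 𝕜 k ≤ A.smoothForms 𝕜 k := fun _ h => h.1

variable (𝕜) in
/-- The closed smooth forms of degree `k` with compact support. -/
def AlgebroidData.compactCocycles (A : AlgebroidData I M) (k : ℕ) : Submodule 𝕜 (A.Form 𝕜 k) :=
  A.compactForms 𝕜 k ⊓ A.cocycles 𝕜 k

variable (𝕜) in
/-- The Lie algebroid cohomology `H^k(A)` with values in the trivial representation `𝕜`. -/
abbrev AlgebroidData.Cohomology (A : AlgebroidData I M) (k : ℕ) : Type _ :=
  A.cocycles 𝕜 k ⧸
    (A.coboundaries 𝕜 (A.smoothForms 𝕜) (fun _ => le_rfl) k).submoduleOf (A.cocycles 𝕜 k)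

variable (𝕜) in
/-- The compactly supported Lie algebroid cohomology `H^k_c(A)`. -/
abbrev AlgebroidData.CompactCohomology (A : AlgebroidData I M) (k : ℕ) : Type _ :=
  A.compactCocycles 𝕜 k ⧸
    (A.coboundaries 𝕜 (A.compactForms 𝕜) A.compactForms_le k).submoduleOf
      (A.compactCocycles 𝕜 k)

/-- The class in `H^k(A)` of a closed form. -/
def AlgebroidData.cohomologyClass (A : AlgebroidData I M) {k : ℕ} (τ : A.Form 𝕜 k)
    (h : τ ∈ A.cocycles 𝕜 k) : A.Cohomology 𝕜 k :=
  Submodule.Quotient.mk ⟨τ, h⟩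

/-- The form `τ` is closed, has compact support, and represents the class `c ∈ H^k_c(A)`. -/
def AlgebroidData.Represents (A : AlgebroidData I M) {k : ℕ} (τ : A.Form 𝕜 k)
    (c : A.CompactCohomology 𝕜 k) : Prop :=
  ∃ h : τ ∈ A.compactCocycles 𝕜 k, Submodule.Quotient.mk ⟨τ, h⟩ = c

/-- The wedge product of forms (a sum over shuffles). -/
def AlgebroidData.wedge {A : AlgebroidData I M} {k l : ℕ} (α : A.Form 𝕜 k) (β : A.Form 𝕜 l) :
    A.Form 𝕜 (k + l) := fun x =>
  ((LinearMap.mul' ℝ 𝕜).compAlternatingMap ((α x).domCoprod (β x))).domDomCongr finSumFinEquiv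

end Cohomology

/-! ## Morphisms and pull-back of forms and classes -/

section Morphisms

variable {𝕜 : Type*} [RCLike 𝕜]
    {E₁ : Type*} [NormedAddCommGroup E₁] [NormedSpace ℝ E₁]
    {H₁ : Type*} [TopologicalSpace H₁] {I₁ : ModelWithCorners ℝ E₁ H₁}
    {M₁ : Type*} [TopologicalSpace M₁] [ChartedSpace H₁ M₁]
    {E₂ : Type*} [NormedAddCommGroup E₂] [NormedSpace ℝ E₂]
    {H₂ : Type*} [TopologicalSpace H₂] {I₂ : ModelWithCorners ℝ E₂ H₂}
    {M₂ : Type*} [TopologicalSpace M₂] [ChartedSpace H₂ M₂]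

/-- A decomposition `φ ∘ X = ∑ i, a i • (X' i ∘ f)` of the image of a section `X` of `A₁` under a
bundle map `φ : A₁ → A₂` over `f`, with smooth functions `a i` on `M₁` and smooth sections `X' i`
of `A₂`. -/
structure IsDecomposition {A₁ : AlgebroidData I₁ M₁} {A₂ : AlgebroidData I₂ M₂} {f : M₁ → M₂}
    (φ : ∀ x, A₁.Fib x →ₗ[ℝ] A₂.Fib (f x)) (X : ∀ x, A₁.Fib x) {n : ℕ}
    (a : Fin n → M₁ → ℝ) (X' : Fin n → ∀ y, A₂.Fib y) : Prop where
  smooth_coeff : ∀ i, ContMDiff I₁ 𝓘(ℝ, ℝ) ∞ (a i)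
  smooth_sec : ∀ i, A₂.IsSmooth (X' i)
  eq : ∀ x, φ x (X x) = ∑ i, a i x • X' i (f x)

/-- The pair `(f, φ)` is a morphism of Lie algebroids. The condition `decomposable` says that the
fibrewise linear map `φ` over the smooth map `f` is smooth: it maps every smooth section of `A₁` to
a smooth section of `f^*A₂`, and these are the finite sums `∑ i, a i • (X' i ∘ f)`. -/
structure IsMorphism (A₁ : AlgebroidData I₁ M₁) (A₂ : AlgebroidData I₂ M₂) (f : M₁ → M₂)
    (φ : ∀ x, A₁.Fib x →ₗ[ℝ] A₂.Fib (f x)) : Prop where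
  contMDiff : ContMDiff I₁ I₂ ∞ f
  decomposable : ∀ X, A₁.IsSmooth X →
    ∃ (n : ℕ) (a : Fin n → M₁ → ℝ) (X' : Fin n → ∀ y, A₂.Fib y), IsDecomposition φ X a X'
  anchor : ∀ x v, A₂.anchor (f x) (φ x v) = mfderiv I₁ I₂ f x (A₁.anchor x v)
  bracket : ∀ X Y, A₁.IsSmooth X → A₁.IsSmooth Y →
    ∀ (m n : ℕ) (a : Fin m → M₁ → ℝ) (X' : Fin m → ∀ y, A₂.Fib y)
      (b : Fin n → M₁ → ℝ) (Y' : Fin n → ∀ y, A₂.Fib y),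
      IsDecomposition φ X a X' → IsDecomposition φ Y b Y' → ∀ x,
      φ x (A₁.bracket X Y x) =
        ∑ i, ∑ j, (a i x * b j x) • A₂.bracket (X' i) (Y' j) (f x) +
          ∑ j, dirDeriv I₁ (b j) x (A₁.anchor x (X x)) • Y' j (f x) -
          ∑ i, dirDeriv I₁ (a i) x (A₁.anchor x (Y x)) • X' i (f x)

/-- The pull-back `(f, φ)^*τ` of a form. -/
def pullbackForm {A₁ : AlgebroidData I₁ M₁} {A₂ : AlgebroidData I₂ M₂} {f : M₁ → M₂}
    (φ : ∀ x, A₁.Fib x →ₗ[ℝ] A₂.Fib (f x)) {k : ℕ} (τ : A₂.Form 𝕜 k) : A₁.Form 𝕜 k :=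
  fun x => (τ (f x)).compLinearMap (φ x)

/-- `c₁ = (f, φ)^*c₂` in compactly supported cohomology: for every closed, compactly supported form
`τ` that represents `c₂`, the form `(f, φ)^*τ` is closed, compactly supported, and represents
`c₁`. -/
def IsPullbackClass {A₁ : AlgebroidData I₁ M₁} {A₂ : AlgebroidData I₂ M₂} {f : M₁ → M₂}
    (φ : ∀ x, A₁.Fib x →ₗ[ℝ] A₂.Fib (f x)) {k : ℕ}
    (c₂ : A₂.CompactCohomology 𝕜 k) (c₁ : A₁.CompactCohomology 𝕜 k) : Prop :=
  ∀ τ, A₂.Represents τ c₂ → A₁.Represents (pullbackForm φ τ) c₁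

/-- The derivative `Tf : TM₁ → TM₂`. -/
def tangentMapHom [IsManifold I₁ ∞ M₁] [IsManifold I₂ ∞ M₂] (f : M₁ → M₂) :
    ∀ x, (tangentAlgebroid I₁ M₁).Fib x →ₗ[ℝ] (tangentAlgebroid I₂ M₂).Fib (f x) :=
  fun x => (mfderiv I₁ I₂ f x).toLinearMap

end Morphisms

/-! ## Bundle maps related to pull-back algebroids -/

section PullbackMaps

variable {EM : Type*} [NormedAddCommGroup EM] [NormedSpace ℝ EM]
    {HM : Type*} [TopologicalSpace HM] {I : ModelWithCorners ℝ EM HM}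
    {M : Type*} [TopologicalSpace M] [ChartedSpace HM M] [IsManifold I ∞ M]
    {FA : Type*} [NormedAddCommGroup FA] [NormedSpace ℝ FA]
    {A : M → Type*} [TopologicalSpace (TotalSpace FA A)]
    [∀ x, AddCommGroup (A x)] [∀ x, Module ℝ (A x)] [∀ x, TopologicalSpace (A x)]
    [FiberBundle FA A] [VectorBundle ℝ FA A]
    {EP : Type*} [NormedAddCommGroup EP] [NormedSpace ℝ EP]
    {HP : Type*} [TopologicalSpace HP] (IP : ModelWithCorners ℝ EP HP)
    {P : Type*} [TopologicalSpace P] [ChartedSpace HP P] [IsManifold IP ∞ P]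

/-- The projection `f^!A → A`, `(X, ξ) ↦ X`, over `f`. -/
def projHom (L : LieAlgebroid I FA A) (f : P → M) :
    ∀ p, (L.pullback IP f).Fib p →ₗ[ℝ] L.toData.Fib (f p) := fun p =>
  (LinearMap.fst ℝ (A (f p)) (TangentSpace IP p)).comp (L.pullbackFib IP f p).subtype

/-- The anchor `f^!A → TP`, `(X, ξ) ↦ ξ`, over the identity of `P`. -/
def anchorHom (L : LieAlgebroid I FA A) (f : P → M) :
    ∀ p, (L.pullback IP f).Fib p →ₗ[ℝ] (tangentAlgebroid IP P).Fib (id p) :=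
  (L.pullback IP f).anchor

/-- A map `j : Q → P` whose image lies in a fibre of `f : P → M` induces the bundle map
`TQ → f^!A`, `v ↦ (0, Tj(v))` over `j`. -/
def verticalHom {EQ : Type*} [NormedAddCommGroup EQ] [NormedSpace ℝ EQ]
    {HQ : Type*} [TopologicalSpace HQ] (IQ : ModelWithCorners ℝ EQ HQ)
    {Q : Type*} [TopologicalSpace Q] [ChartedSpace HQ Q] [IsManifold IQ ∞ Q]
    (L : LieAlgebroid I FA A) (f : P → M) (hf : MDifferentiable IP I f) (j : Q → P) (x : M)
    (hj : ∀ q, f (j q) = x) :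
    ∀ q, (tangentAlgebroid IQ Q).Fib q →ₗ[ℝ] (L.pullback IP f).Fib (j q) := fun q =>
  LinearMap.codRestrict (L.pullbackFib IP f (j q))
    (LinearMap.prod (0 : TangentSpace IQ q →ₗ[ℝ] A (f (j q)))
      (mfderiv IQ IP j q).toLinearMap) (by
    intro v
    change L.anchor (f (j q)) 0 = mfderiv IP I f (j q) (mfderiv IQ IP j q v)
    rw [map_zero]
    by_cases h : MDifferentiableAt IQ IP j q
    · have h1 : mfderiv IQ I (f ∘ j) q = 0 := by
        have : f ∘ j = fun _ => x := funext hj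
        rw [this]
        exact mfderiv_const
      rw [mfderiv_comp q (hf (j q)) h] at h1
      exact (congrArg (fun T => T v) h1).symm
    · rw [mfderiv_zero_of_not_mdifferentiableAt h]
      exact (map_zero (mfderiv IP I f (j q))).symm)

theorem contMDiff_pullbackLift
    {EM' : Type*} [NormedAddCommGroup EM'] [NormedSpace ℝ EM']
    {HM' : Type*} [TopologicalSpace HM'] {I' : ModelWithCorners ℝ EM' HM'}
    {M' : Type*} [TopologicalSpace M'] [ChartedSpace HM' M']
    (F : Type*) [NormedAddCommGroup F] [NormedSpace ℝ F]
    (E : M → Type*) [TopologicalSpace (TotalSpace F E)]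
    [∀ x, AddCommMonoid (E x)] [∀ x, Module ℝ (E x)] [∀ x, TopologicalSpace (E x)]
    [FiberBundle F E] [VectorBundle ℝ F E] (f : C^∞⟮I', M'; I, M⟯) :
    ContMDiff (I'.prod 𝓘(ℝ, F)) (I.prod 𝓘(ℝ, F)) ∞
      (Pullback.lift f : TotalSpace F (f *ᵖ E) → TotalSpace F E) := by
  intro z
  rw [contMDiffAt_totalSpace]
  have h := (contMDiffAt_totalSpace (IM := I'.prod 𝓘(ℝ, F)) (IB := I') (n := ∞)
    (f := (id : TotalSpace F (f *ᵖ E) → TotalSpace F (f *ᵖ E))) (x₀ := z)).1 contMDiffAt_id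
  exact ⟨f.contMDiff.contMDiffAt.comp z h.1, h.2⟩

/-- Let `φ : A' → A` be a bundle map over `f : M' → M` that is compatible with the anchors, let
`π : E → M` be a vector bundle and `π' : f^*E → M'` its pull-back. The bundle map
`π'^!A' → π^!A`, `(X, ξ) ↦ (φ(X), Tf̃(ξ))` over the canonical map `f̃ : f^*E → E`. -/
def inducedHom
    {EM' : Type*} [NormedAddCommGroup EM'] [NormedSpace ℝ EM']
    {HM' : Type*} [TopologicalSpace HM'] {I' : ModelWithCorners ℝ EM' HM'}
    {M' : Type*} [TopologicalSpace M'] [ChartedSpace HM' M'] [IsManifold I' ∞ M']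
    {FA' : Type*} [NormedAddCommGroup FA'] [NormedSpace ℝ FA']
    {A' : M' → Type*} [TopologicalSpace (TotalSpace FA' A')]
    [∀ x, AddCommGroup (A' x)] [∀ x, Module ℝ (A' x)] [∀ x, TopologicalSpace (A' x)]
    [FiberBundle FA' A'] [VectorBundle ℝ FA' A']
    (F : Type*) [NormedAddCommGroup F] [NormedSpace ℝ F]
    (E : M → Type*) [TopologicalSpace (TotalSpace F E)]
    [∀ x, AddCommMonoid (E x)] [∀ x, Module ℝ (E x)] [∀ x, TopologicalSpace (E x)]
    [FiberBundle F E] [VectorBundle ℝ F E] [ContMDiffVectorBundle ∞ F E I]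
    (L' : LieAlgebroid I' FA' A') (L : LieAlgebroid I FA A) (f : C^∞⟮I', M'; I, M⟯)
    (φ : ∀ x, A' x →ₗ[ℝ] A (f x))
    (hφ : ∀ x v, L.anchor (f x) (φ x v) = mfderiv I' I f x (L'.anchor x v)) :
    ∀ q, (L'.pullback (I'.prod 𝓘(ℝ, F)) (π F (f *ᵖ E))).Fib q →ₗ[ℝ]
      (L.pullback (I.prod 𝓘(ℝ, F)) (π F E)).Fib (Pullback.lift f q) := fun q =>
  LinearMap.restrict
    ((φ q.proj).prodMap
      (mfderiv (I'.prod 𝓘(ℝ, F)) (I.prod 𝓘(ℝ, F))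
        (Pullback.lift f : TotalSpace F (f *ᵖ E) → TotalSpace F E) q).toLinearMap)
    (p := L'.pullbackFib (I'.prod 𝓘(ℝ, F)) (π F (f *ᵖ E)) q)
    (q := L.pullbackFib (I.prod 𝓘(ℝ, F)) (π F E) (Pullback.lift f q)) (by
    rintro ⟨X, ξ⟩ hX
    change L'.anchor q.proj X = mfderiv (I'.prod 𝓘(ℝ, F)) I' (π F (f *ᵖ E)) q ξ at hX
    change L.anchor (f q.proj) (φ q.proj X) =
      mfderiv (I.prod 𝓘(ℝ, F)) I (π F E) (Pullback.lift f q)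
        (mfderiv (I'.prod 𝓘(ℝ, F)) (I.prod 𝓘(ℝ, F)) (Pullback.lift f) q ξ)
    have hl : MDifferentiableAt (I'.prod 𝓘(ℝ, F)) (I.prod 𝓘(ℝ, F))
        (Pullback.lift f : TotalSpace F (f *ᵖ E) → TotalSpace F E) q :=
      (contMDiff_pullbackLift F E f).mdifferentiable (by simp) q
    have hp : MDifferentiableAt (I.prod 𝓘(ℝ, F)) I (π F E) (Pullback.lift f q) :=
      (contMDiff_proj E (n := ∞)).mdifferentiable (by simp) _
    have hp' : MDifferentiableAt (I'.prod 𝓘(ℝ, F)) I' (π F (f *ᵖ E)) q :=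
      (contMDiff_proj (f *ᵖ E) (n := ∞)).mdifferentiable (by simp) _
    have hf : MDifferentiableAt I' I f (π F (f *ᵖ E) q) :=
      f.contMDiff.mdifferentiable (by simp) _
    have h1 := mfderiv_comp q hp hl
    have h2 := mfderiv_comp q hf hp'
    have h3 : (π F E) ∘ (Pullback.lift f : TotalSpace F (f *ᵖ E) → TotalSpace F E) =
        f ∘ (π F (f *ᵖ E)) := rfl
    rw [hφ, hX]
    rw [h3, h2] at h1
    exact congrArg (fun T => T ξ) h1)

end PullbackMaps

/-! ## Oriented vector bundles and their Thom classes -/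

/-- The manifold `ℝ^r` carries its tangent algebroid. -/
abbrev euclideanTangent (r : ℕ) :
    AlgebroidData 𝓘(ℝ, EuclideanSpace ℝ (Fin r)) (EuclideanSpace ℝ (Fin r)) :=
  tangentAlgebroid 𝓘(ℝ, EuclideanSpace ℝ (Fin r)) (EuclideanSpace ℝ (Fin r))

/-- `c` is the canonical generator `Th^r` of `H^r_c(ℝ^r)`: it is represented by a closed, compactly
supported form with integral `1`. -/
def IsCanonicalGenerator {𝕜 : Type*} [RCLike 𝕜] {r : ℕ}
    (c : (euclideanTangent r).CompactCohomology 𝕜 r) : Prop :=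
  ∃ τ : (euclideanTangent r).Form 𝕜 r, (euclideanTangent r).Represents τ c ∧
    ∫ v : EuclideanSpace ℝ (Fin r),
      τ v (fun i => (EuclideanSpace.single i 1 : EuclideanSpace ℝ (Fin r))) = 1

section Thom

variable (𝕜 : Type*) [RCLike 𝕜]
    {EM : Type*} [NormedAddCommGroup EM] [NormedSpace ℝ EM]
    {HM : Type*} [TopologicalSpace HM] (I : ModelWithCorners ℝ EM HM)
    {M : Type*} [TopologicalSpace M] [ChartedSpace HM M] [IsManifold I ∞ M]
    (F : Type*) [NormedAddCommGroup F] [NormedSpace ℝ F]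
    {E : M → Type*} [TopologicalSpace (TotalSpace F E)]
    [∀ x, AddCommMonoid (E x)] [∀ x, Module ℝ (E x)] [∀ x, TopologicalSpace (E x)]
    [FiberBundle F E] [VectorBundle ℝ F E]
    {r : ℕ}

/-- The orientations `o x` of the fibres are an orientation of the vector bundle `E` of rank `r`:
near each point they are induced by a fixed basis of the model fibre through the local
trivialization. -/
def IsBundleOrientation (o : ∀ x, Orientation ℝ (E x) (Fin r)) : Prop :=
  ∀ x₀ : M, ∃ b : Module.Basis (Fin r) ℝ F, ∀ᶠ y in 𝓝 x₀,
    ∀ hy : y ∈ (trivializationAt F E x₀).baseSet,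
      Orientation.map (Fin r) ((trivializationAt F E x₀).linearEquivAt ℝ y hy) (o y) =
        b.orientation

/-- The linear isomorphism `u : ℝ^r ≃ V` preserves orientations. -/
def IsOriented {V : Type*} [AddCommMonoid V] [Module ℝ V] (o : Orientation ℝ V (Fin r))
    (u : EuclideanSpace ℝ (Fin r) ≃ₗ[ℝ] V) : Prop :=
  Orientation.map (Fin r) u (EuclideanSpace.basisFun (Fin r) ℝ).toBasis.orientation = o

/-- The inclusion `i_x : E_x → E` of a fibre, where `E_x` is identified with `ℝ^r` by `u`. -/
def fibreInclusion (x : M) (u : EuclideanSpace ℝ (Fin r) ≃ₗ[ℝ] E x) :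
    EuclideanSpace ℝ (Fin r) → TotalSpace F E := fun v => ⟨x, u v⟩

variable [ContMDiffVectorBundle ∞ F E I]

variable {𝕜} in
/-- `c ∈ H^r_c(E)` is the Thom class of the oriented vector bundle `E`: it restricts to the
canonical generator `Th^r` on each fibre `E_x ≅ ℝ^r`. -/
def IsThomClass (o : ∀ x, Orientation ℝ (E x) (Fin r))
    (c : (tangentAlgebroid (I.prod 𝓘(ℝ, F)) (TotalSpace F E)).CompactCohomology 𝕜 r) : Prop :=
  ∀ (x : M) (u : EuclideanSpace ℝ (Fin r) ≃ₗ[ℝ] E x), IsOriented (o x) u →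
    ∃ g : (euclideanTangent r).CompactCohomology 𝕜 r, IsCanonicalGenerator g ∧
      IsPullbackClass (tangentMapHom (I₁ := 𝓘(ℝ, EuclideanSpace ℝ (Fin r)))
        (I₂ := I.prod 𝓘(ℝ, F)) (fibreInclusion F x u)) c g

/-- The Thom class `Th(E) ∈ H^r_c(E)` of the oriented vector bundle `E`. -/
def thomClass (o : ∀ x, Orientation ℝ (E x) (Fin r)) :
    (tangentAlgebroid (I.prod 𝓘(ℝ, F)) (TotalSpace F E)).CompactCohomology 𝕜 r :=
  Classical.epsilon (IsThomClass I F o)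

variable {I}
  {FA : Type*} [NormedAddCommGroup FA] [NormedSpace ℝ FA]
  {A : M → Type*} [TopologicalSpace (TotalSpace FA A)]
  [∀ x, AddCommGroup (A x)] [∀ x, Module ℝ (A x)] [∀ x, TopologicalSpace (A x)]
  [FiberBundle FA A] [VectorBundle ℝ FA A]

variable (E) in
/-- The pull-back Lie algebroid `π^!A` along the projection `π : E → M` of a vector bundle. -/
abbrev LieAlgebroid.bundlePullback (L : LieAlgebroid I FA A) :
    AlgebroidData (I.prod 𝓘(ℝ, F)) (TotalSpace F E) :=
  L.pullback (I.prod 𝓘(ℝ, F)) (π F E)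

/-- The Lie algebroid Thom class `Th^A(E) ∈ H^r_c(π^!A)`: the pull-back of the Thom class of `E`
along the anchor of `π^!A`. -/
def LieAlgebroid.thomClass (L : LieAlgebroid I FA A) (o : ∀ x, Orientation ℝ (E x) (Fin r)) :
    (L.bundlePullback F E).CompactCohomology 𝕜 r :=
  Classical.epsilon (IsPullbackClass (anchorHom (I.prod 𝓘(ℝ, F)) L (π F E))
    (ThomAlgebroid.thomClass 𝕜 I F o))

/-- The bundle map `ι_x : TE_x → π^!A`, `v ↦ (0, Ti_x(v))` over the inclusion `i_x : E_x → E` of a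
fibre, where `E_x` is identified with `ℝ^r` by `u`. -/
def fibreHom (L : LieAlgebroid I FA A) (x : M) (u : EuclideanSpace ℝ (Fin r) ≃ₗ[ℝ] E x) :
    ∀ v, (euclideanTangent r).Fib v →ₗ[ℝ]
      (L.bundlePullback F E).Fib (fibreInclusion F x u v) :=
  verticalHom (I.prod 𝓘(ℝ, F)) 𝓘(ℝ, EuclideanSpace ℝ (Fin r)) L (π F E)
    ((contMDiff_proj E (n := ∞)).mdifferentiable (by simp)) (fibreInclusion F x u) x
    (fun _ => rfl)

end Thom

end ThomAlgebroid

/-!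
The Thom isomorphism is proved by integration over the fibres of `π : E → M`. The bracket of an
algebroid is only known on global sections, so `AFrame` provides globally defined sections which form
a frame near a point. In such a frame the Koszul differential is a first order operator with
structure constants, `chev` (`IsAlgebroid.isDifferentialAt_iff_chev`), and its compatibility with
products and with bundle maps is linear algebra (`chev_wedgeL`, `chev_pull`). A bundle map that
preserves anchors and brackets in the sense of `IsHomAt` pulls back closed forms to closed forms. The
bracket of `π^!L` is determined by decompositions of sections; these exist by compactness of `M`
(`exists_generators`), and the frames of `L` lift to frames of `π^!L` (`pullbackFrameOn`) in which
nothing depends on the fibre coordinates.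

A form `γ` on `L` is the fibre integral of a form `τ` on `π^!L` (`IsFibInt`) if the integrals of `τ`
over the oriented fibres, with the remaining arguments lifted arbitrarily, are the values of `γ`.
Fibre integrals of compactly supported forms exist (`exists_isFibInt`), and fibre integration commutes
with the differential up to the sign `(-1) ^ r` (`IsFibInt.isDifferential`). Everything else rests
on `exists_primitive_of_fibNull`: a closed, compactly supported form with vanishing fibre integrals has
a compactly supported primitive. Over a patch this is the compactly supported Poincaré lemma, one fibre
direction at a time (`VertCoords.exists_primitive`). Its primitive vanishes over points where the form
does, so the form can be killed over one patch after the other; its other property, vanishing on tuples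
that contain a basis of the fibre direction, ensures that cutting off does not change fibre integrals.

Consequently there is a Thom form, a closed compactly supported form with fibre integral `1`
(`exists_thomForm`): glue local bump forms and correct the result by a primitive of its differential.
Any two closed, compactly supported forms with the same fibre integral are cohomologous
(`sub_mem_compactCoboundaries`), and a form of degree `r` restricts to the generator on each fibre if
and only if it is a Thom form (`isThomForm_iff_isPullbackClass`); the uniqueness statements and naturality
(`isPullbackClass_inducedHom`) follow. Forms on `TE` are treated as forms on the pull-back of the
tangent algebroid `TM`, which is isomorphic to `TE` through `tangentLift`. Finally the fibre integral
of `π^*α ∧ τ` is `±α` for a Thom form `τ` (`isFibInt_wedge`). So if `π^*α ∧ τ` has a primitive, its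
fibre integral is a primitive of `α` up to sign, and each closed form is cohomologous to `π^*α ∧ τ`,
where `±α` is its fibre integral (`exists_thomIsomorphism`).
-/

set_option linter.unusedSectionVars false

namespace ThomAlgebroid

/-! ### Alternating cochains -/

section CochainAlgebra

open AlternatingMap

variable {Γ V N : Type*} [AddCommGroup Γ] [Module ℝ Γ] [AddCommGroup V] [Module ℝ V]
  [AddCommGroup N] [Module ℝ N]

/-- `altU D` is the antisymmetrisation `v ↦ ∑ i, (-1)^i D(v i)(v without i)`. -/
abbrev altU {n : ℕ} (D : Γ →ₗ[ℝ] Γ [⋀^Fin n]→ₗ[ℝ] N) : Γ [⋀^Fin (n + 1)]→ₗ[ℝ] N :=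
  AlternatingMap.alternatizeUncurryFin D

/-- `altU` as a linear map. -/
abbrev altUL {n : ℕ} : (Γ →ₗ[ℝ] Γ [⋀^Fin n]→ₗ[ℝ] N) →ₗ[ℝ] Γ [⋀^Fin (n + 1)]→ₗ[ℝ] N :=
  alternatizeUncurryFinLM

theorem altU_sub {n : ℕ} (f g : Γ →ₗ[ℝ] Γ [⋀^Fin n]→ₗ[ℝ] N) : altU (f - g) = altU f - altU g :=
  map_sub (altUL (N := N)) f g

theorem altU_add {n : ℕ} (f g : Γ →ₗ[ℝ] Γ [⋀^Fin n]→ₗ[ℝ] N) : altU (f + g) = altU f + altU g :=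
  map_add (altUL (N := N)) f g

theorem altU_smul {n : ℕ} (r : ℝ) (f : Γ →ₗ[ℝ] Γ [⋀^Fin n]→ₗ[ℝ] N) : altU (r • f) = r • altU f :=
  map_smul (altUL (N := N)) r f

theorem altU_zero {n : ℕ} : altU (0 : Γ →ₗ[ℝ] Γ [⋀^Fin n]→ₗ[ℝ] N) = 0 :=
  map_zero (altUL (N := N))

theorem altU_neg {n : ℕ} (f : Γ →ₗ[ℝ] Γ [⋀^Fin n]→ₗ[ℝ] N) : altU (-f) = -altU f :=
  map_neg (altUL (N := N)) f

theorem altU_altU_add_flip {n : ℕ} (f : Γ →ₗ[ℝ] Γ →ₗ[ℝ] Γ [⋀^Fin n]→ₗ[ℝ] N) :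
    altU (altUL ∘ₗ f) + altU (altUL ∘ₗ f.flip) = 0 := by
  have h := alternatizeUncurryFin_alternatizeUncurryFinLM_comp_of_symmetric (f := f + f.flip)
    (fun x y => by simp [add_comm])
  rwa [LinearMap.comp_add, alternatizeUncurryFin_add] at h

theorem altU_altU_flip {n : ℕ} (f : Γ →ₗ[ℝ] Γ →ₗ[ℝ] Γ [⋀^Fin n]→ₗ[ℝ] N) :
    altU (altUL ∘ₗ f.flip) = -altU (altUL ∘ₗ f) :=
  (neg_eq_of_add_eq_zero_right (altU_altU_add_flip f)).symm

/-- The contraction of a cochain with a vector. -/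
abbrev iota {n : ℕ} (b : Γ) : Γ [⋀^Fin (n + 1)]→ₗ[ℝ] N →ₗ[ℝ] Γ [⋀^Fin n]→ₗ[ℝ] N :=
  curryLeftLinearMap.flip b

theorem iota_apply {n : ℕ} (b : Γ) (c : Γ [⋀^Fin (n + 1)]→ₗ[ℝ] N) (v : Fin n → Γ) :
    iota b c v = c (Matrix.vecCons b v) := rfl

theorem iota_iota {n : ℕ} (a b : Γ) (c : Γ [⋀^Fin (n + 2)]→ₗ[ℝ] N) :
    iota a (iota b c) = -iota b (iota a c) := by
  have h := (c.curryLeft_same (a + b))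
  rw [map_add] at h
  ext v
  have h' := congrArg (fun f => f v) h
  have h1 := congrArg (fun f => f v) (c.curryLeft_same a)
  have h2 := congrArg (fun f => f v) (c.curryLeft_same b)
  simp only [curryLeft_add, LinearMap.add_apply, map_add, AlternatingMap.add_apply,
    AlternatingMap.zero_apply, curryLeft_apply_apply] at h' h1 h2
  change c (Matrix.vecCons b (Matrix.vecCons a v)) = -c (Matrix.vecCons a (Matrix.vecCons b v))
  rw [h1, h2, zero_add, add_zero] at h'
  exact eq_neg_of_add_eq_zero_left h'

theorem iota_altU {n : ℕ} (D : Γ →ₗ[ℝ] Γ [⋀^Fin (n + 1)]→ₗ[ℝ] N) (b : Γ) :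
    iota b (altU D) = D b - altU (iota b ∘ₗ D) := by
  ext v
  rw [iota_apply, alternatizeUncurryFin_apply, Fin.sum_univ_succ, AlternatingMap.sub_apply,
    alternatizeUncurryFin_apply, sub_eq_add_neg, ← Finset.sum_neg_distrib]
  congr 1
  · rw [Fin.val_zero, pow_zero, one_smul]
    rfl
  · refine Finset.sum_congr rfl fun i _ => ?_
    rw [Fin.val_succ, pow_succ, mul_neg_one, neg_smul, Matrix.cons_val_succ]
    congr 2
    change D (v i) _ = D (v i) (Matrix.vecCons b _)
    congr 1
    funext j
    refine Fin.cases ?_ (fun j => ?_) j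
    · simp [Fin.removeNth_apply]
    · simp [Fin.removeNth_apply, Fin.succ_succAbove_succ]

theorem iota_altU_zero (D : Γ →ₗ[ℝ] Γ [⋀^Fin 0]→ₗ[ℝ] N) (b : Γ) :
    iota b (altU D) = D b := by
  ext v
  rw [iota_apply, alternatizeUncurryFin_apply, Fin.sum_univ_succ, Finset.univ_eq_empty,
    Finset.sum_empty, add_zero, Fin.val_zero, pow_zero, one_smul]
  change D b _ = D b _
  congr 1

/-- Pull-back of cochains along a linear map. -/
def pullL {n : ℕ} (L : Γ →ₗ[ℝ] V) : V [⋀^Fin n]→ₗ[ℝ] N →ₗ[ℝ] Γ [⋀^Fin n]→ₗ[ℝ] N where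
  toFun c := c.compLinearMap L
  map_add' _ _ := rfl
  map_smul' _ _ := rfl

theorem pullL_apply {n : ℕ} (L : Γ →ₗ[ℝ] V) (c : V [⋀^Fin n]→ₗ[ℝ] N) (v : Fin n → Γ) :
    pullL L c v = c (fun i => L (v i)) := rfl

theorem iota_pullL {n : ℕ} (L : Γ →ₗ[ℝ] V) (c : V [⋀^Fin (n + 1)]→ₗ[ℝ] N) (b : Γ) :
    iota b (pullL L c) = pullL L (iota (L b) c) :=
  curryLeft_compLinearMap L c b

theorem pullL_altU {n : ℕ} (L : Γ →ₗ[ℝ] V) (D : V →ₗ[ℝ] V [⋀^Fin n]→ₗ[ℝ] N) :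
    pullL L (altU D) = altU (pullL L ∘ₗ D ∘ₗ L) := by
  ext v
  rw [pullL_apply, alternatizeUncurryFin_apply, alternatizeUncurryFin_apply]
  rfl

/-- The antisymmetrisation of `c(T(X, Z), ·)` in all arguments. For `T` the bracket this is, up to
the factor `-1/2`, the second sum of the Koszul formula. -/
def bracketTerm (L : Γ →ₗ[ℝ] V) (T : Γ →ₗ[ℝ] Γ →ₗ[ℝ] V) :
    {k : ℕ} → V [⋀^Fin k]→ₗ[ℝ] N → Γ [⋀^Fin (k + 1)]→ₗ[ℝ] N
  | 0, _ => 0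
  | _ + 1, c => altU (altUL ∘ₗ T.compr₂ (pullL L ∘ₗ c.curryLeft))

theorem iota_bracketTerm (L : Γ →ₗ[ℝ] V) (T : Γ →ₗ[ℝ] Γ →ₗ[ℝ] V) {k : ℕ}
    (c : V [⋀^Fin (k + 1)]→ₗ[ℝ] N) (b : Γ) :
    iota b (bracketTerm L T c) =
      altU ((pullL L ∘ₗ c.curryLeft) ∘ₗ (T b - T.flip b)) - bracketTerm L T (iota (L b) c) := by
  rw [bracketTerm, iota_altU, LinearMap.comp_sub, altU_sub]
  cases k with
  | zero =>
    have : iota b ∘ₗ (altUL ∘ₗ T.compr₂ (pullL L ∘ₗ c.curryLeft)) =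
        (pullL L ∘ₗ c.curryLeft) ∘ₗ T.flip b :=
      LinearMap.ext fun X => iota_altU_zero _ _
    rw [this, bracketTerm, sub_zero]
    rfl
  | succ k =>
    have : iota b ∘ₗ (altUL ∘ₗ T.compr₂ (pullL L ∘ₗ c.curryLeft)) =
        (pullL L ∘ₗ c.curryLeft) ∘ₗ T.flip b +
          altUL ∘ₗ T.compr₂ (pullL L ∘ₗ (iota (L b) c).curryLeft) := by
      refine LinearMap.ext fun X => ?_
      refine (iota_altU _ _).trans ?_
      rw [LinearMap.add_apply, sub_eq_add_neg]
      congr 1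
      rw [← altU_neg]
      change altU _ = altU _
      congr 1
      refine LinearMap.ext fun Z => ?_
      change -(iota b (pullL L (iota (T X Z) c))) = pullL L (iota (T X Z) (iota (L b) c))
      rw [iota_pullL, iota_iota, map_neg, neg_neg]
    rw [this, altU_add, bracketTerm]
    change altU ((pullL L ∘ₗ c.curryLeft) ∘ₗ T b) - _ = _
    abel

theorem bracketTerm_add_right (L : Γ →ₗ[ℝ] V) (T T' : Γ →ₗ[ℝ] Γ →ₗ[ℝ] V) {k : ℕ}
    (c : V [⋀^Fin k]→ₗ[ℝ] N) :
    bracketTerm L (T + T') c = bracketTerm L T c + bracketTerm L T' c := by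
  cases k with
  | zero => simp [bracketTerm]
  | succ k =>
    rw [bracketTerm, bracketTerm, bracketTerm, ← altU_add]
    congr 1
    refine LinearMap.ext fun X => ?_
    refine Eq.trans ?_ (altU_add _ _)
    change altU _ = altU _
    congr 1
    ext Z : 1
    simp

theorem bracketTerm_flip (L : Γ →ₗ[ℝ] V) (T : Γ →ₗ[ℝ] Γ →ₗ[ℝ] V) {k : ℕ}
    (c : V [⋀^Fin k]→ₗ[ℝ] N) :
    bracketTerm L T.flip c = -bracketTerm L T c := by
  cases k with
  | zero => simp [bracketTerm]
  | succ k => exact altU_altU_flip (T.compr₂ (pullL L ∘ₗ c.curryLeft))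

theorem bracketTerm_add (L : Γ →ₗ[ℝ] V) (T : Γ →ₗ[ℝ] Γ →ₗ[ℝ] V) {k : ℕ}
    (c c' : V [⋀^Fin k]→ₗ[ℝ] N) :
    bracketTerm L T (c + c') = bracketTerm L T c + bracketTerm L T c' := by
  cases k with
  | zero => simp [bracketTerm]
  | succ k =>
    rw [bracketTerm, bracketTerm, bracketTerm, ← altU_add]
    congr 1
    refine LinearMap.ext fun X => ?_
    refine Eq.trans ?_ (altU_add _ _)
    rfl

theorem bracketTerm_smul (L : Γ →ₗ[ℝ] V) (T : Γ →ₗ[ℝ] Γ →ₗ[ℝ] V) {k : ℕ} (r : ℝ)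
    (c : V [⋀^Fin k]→ₗ[ℝ] N) :
    bracketTerm L T (r • c) = r • bracketTerm L T c := by
  cases k with
  | zero => simp [bracketTerm]
  | succ k =>
    rw [bracketTerm, bracketTerm, ← altU_smul]
    congr 1
    refine LinearMap.ext fun X => ?_
    refine Eq.trans ?_ (altU_smul _ _)
    rfl

theorem bracketTerm_pull {Γ' : Type*} [AddCommGroup Γ'] [Module ℝ Γ'] (φ : Γ' →ₗ[ℝ] Γ)
    (L : Γ →ₗ[ℝ] V) (T : Γ →ₗ[ℝ] Γ →ₗ[ℝ] V) {k : ℕ} (c : V [⋀^Fin k]→ₗ[ℝ] N) :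
    pullL φ (bracketTerm L T c) = bracketTerm (L ∘ₗ φ) (T.compl₁₂ φ φ) c := by
  cases k with
  | zero => rfl
  | succ k =>
    rw [bracketTerm, bracketTerm, pullL_altU]
    congr 1
    refine LinearMap.ext fun X => ?_
    change pullL φ (altU _) = altU _
    rw [pullL_altU]
    rfl

theorem bracketTerm_pull_form {V' : Type*} [AddCommGroup V'] [Module ℝ V'] (φ : V' →ₗ[ℝ] V)
    (L : Γ →ₗ[ℝ] V') (T : Γ →ₗ[ℝ] Γ →ₗ[ℝ] V') {k : ℕ} (c : V [⋀^Fin k]→ₗ[ℝ] N) :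
    bracketTerm L T (pullL φ c) = bracketTerm (φ ∘ₗ L) (T.compr₂ φ) c := by
  cases k with
  | zero => rfl
  | succ k =>
    rw [bracketTerm, bracketTerm]
    congr 1
    refine LinearMap.ext fun X => ?_
    change altU _ = altU _
    congr 1
    refine LinearMap.ext fun Z => ?_
    change pullL L (iota (T X Z) (pullL φ c)) = pullL L (pullL φ (iota (φ (T X Z)) c))
    rw [iota_pullL]

/-- The Koszul differential of a cochain at a point, in terms of the values `D X` of the
derivatives of the cochain, the evaluation `L` of sections at the point, and the bracket `br`. -/
def chev (L : Γ →ₗ[ℝ] V) (br : Γ →ₗ[ℝ] Γ →ₗ[ℝ] V) {k : ℕ} (D : Γ →ₗ[ℝ] Γ [⋀^Fin k]→ₗ[ℝ] N)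
    (c : V [⋀^Fin k]→ₗ[ℝ] N) : Γ [⋀^Fin (k + 1)]→ₗ[ℝ] N :=
  altU D - (1 / 2 : ℝ) • bracketTerm L br c

/-- The Cartan formula for contraction with a vector that commutes with everything. -/
theorem iota_chev_of_central (L : Γ →ₗ[ℝ] V) (br : Γ →ₗ[ℝ] Γ →ₗ[ℝ] V) {k : ℕ}
    (D : Γ →ₗ[ℝ] Γ [⋀^Fin (k + 1)]→ₗ[ℝ] N) (c : V [⋀^Fin (k + 1)]→ₗ[ℝ] N) (b : Γ)
    (hb : ∀ X, br b X = 0) (hb' : ∀ X, br X b = 0) :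
    iota b (chev L br D c) = D b - chev L br (iota b ∘ₗ D) (iota (L b) c) := by
  have h : br b - br.flip b = 0 := LinearMap.ext fun X => by simp [hb, hb']
  rw [chev, map_sub, map_smul, iota_altU, iota_bracketTerm, h, chev, LinearMap.comp_zero]
  rw [altU_zero, zero_sub, smul_neg]
  abel

theorem iota_chev_zero (L : Γ →ₗ[ℝ] V) (br : Γ →ₗ[ℝ] Γ →ₗ[ℝ] V)
    (D : Γ →ₗ[ℝ] Γ [⋀^Fin 0]→ₗ[ℝ] N) (c : V [⋀^Fin 0]→ₗ[ℝ] N) (b : Γ) :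
    iota b (chev L br D c) = D b := by
  rw [chev, map_sub, iota_altU_zero]
  simp [bracketTerm]

/-- The wedge product of a covector with a cochain. -/
def covecWedge {k : ℕ} (l : V →ₗ[ℝ] ℝ) (c : V [⋀^Fin k]→ₗ[ℝ] N) : V [⋀^Fin (k + 1)]→ₗ[ℝ] N :=
  altU (l.smulRight c)

theorem covecWedge_apply {k : ℕ} (l : V →ₗ[ℝ] ℝ) (c : V [⋀^Fin k]→ₗ[ℝ] N) (v : Fin (k + 1) → V) :
    covecWedge l c v = ∑ i : Fin (k + 1), (-1 : ℝ) ^ (i : ℕ) • (l (v i) • c (i.removeNth v)) := by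
  rw [covecWedge, alternatizeUncurryFin_apply]
  refine Finset.sum_congr rfl fun i _ => ?_
  rcases neg_one_pow_eq_or ℤ (i : ℕ) with h | h
  · rw [h]
    have : (-1 : ℝ) ^ (i : ℕ) = 1 := by exact_mod_cast congrArg (Int.cast : ℤ → ℝ) h
    rw [this, one_smul, one_smul]; rfl
  · rw [h]
    have : (-1 : ℝ) ^ (i : ℕ) = -1 := by exact_mod_cast congrArg (Int.cast : ℤ → ℝ) h
    rw [this, neg_smul, neg_smul, one_smul, one_smul]; rfl

theorem iota_covecWedge {k : ℕ} (l : V →ₗ[ℝ] ℝ) (c : V [⋀^Fin (k + 1)]→ₗ[ℝ] N) (b : V) :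
    iota b (covecWedge l c) = l b • c - covecWedge l (iota b c) := by
  rw [covecWedge, iota_altU]
  rfl

theorem iota_covecWedge_zero (l : V →ₗ[ℝ] ℝ) (c : V [⋀^Fin 0]→ₗ[ℝ] N) (b : V) :
    iota b (covecWedge l c) = l b • c := by
  rw [covecWedge, iota_altU_zero]; rfl

theorem pullL_covecWedge {k : ℕ} (L : Γ →ₗ[ℝ] V) (l : V →ₗ[ℝ] ℝ) (c : V [⋀^Fin k]→ₗ[ℝ] N) :
    pullL L (covecWedge l c) = covecWedge (l ∘ₗ L) (pullL L c) := by
  rw [covecWedge, pullL_altU]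
  rfl

/-- `covecWedge` as a linear map in the cochain. -/
def covecWedgeL {k : ℕ} (l : V →ₗ[ℝ] ℝ) : V [⋀^Fin k]→ₗ[ℝ] N →ₗ[ℝ] V [⋀^Fin (k + 1)]→ₗ[ℝ] N :=
  altUL ∘ₗ LinearMap.smulRightₗ l

theorem covecWedge_anticomm {k : ℕ} (l l' : V →ₗ[ℝ] ℝ) (c : V [⋀^Fin k]→ₗ[ℝ] N) :
    covecWedge l (covecWedge l' c) = -covecWedge l' (covecWedge l c) := by
  let f : V →ₗ[ℝ] V →ₗ[ℝ] V [⋀^Fin k]→ₗ[ℝ] N := l.smulRight (l'.smulRight c)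
  have h := altU_altU_flip f
  have h1 : altU (altUL ∘ₗ f) = covecWedge l (covecWedge l' c) := by
    rw [covecWedge]; congr 1; ext X : 1
    change altU (l X • l'.smulRight c) = l X • _
    exact altU_smul _ _
  have h2 : altU (altUL ∘ₗ f.flip) = covecWedge l' (covecWedge l c) := by
    rw [covecWedge]; congr 1; ext X : 1
    change altU _ = l' X • covecWedge l c
    rw [covecWedge, ← altU_smul]
    congr 1
    ext Z : 1
    change l Z • l' X • c = l' X • l Z • c
    rw [smul_comm]
  rw [h1, h2] at h
  rw [h, neg_neg]

theorem derTerm_apply {k : ℕ} (L T : Γ →ₗ[ℝ] V) (c : V [⋀^Fin (k + 1)]→ₗ[ℝ] N)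
    (v : Fin (k + 1) → Γ) :
    altU ((pullL L ∘ₗ c.curryLeft) ∘ₗ T) v =
      ∑ i, c (Function.update (fun j => L (v j)) i (T (v i))) := by
  rw [alternatizeUncurryFin_apply]
  refine Finset.sum_congr rfl fun i _ => ?_
  have h := map_insertNth c i (T (v i)) (i.removeNth fun j => L (v j))
  rw [Fin.insertNth_removeNth] at h
  rw [h]
  rcases neg_one_pow_eq_or ℤ (i : ℕ) with h' | h' <;> rw [h'] <;> rfl

/-- The Koszul differential of a pull-back. The coefficients `T` account for the derivatives of the
components of the transported sections in a frame; being symmetrised by the bracket, they drop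
out. -/
theorem chev_pull {W : Type*} [AddCommGroup W] [Module ℝ W] {k : ℕ} (L : Γ →ₗ[ℝ] V)
    (br : Γ →ₗ[ℝ] Γ →ₗ[ℝ] V) (φ : V →ₗ[ℝ] W) (B : W →ₗ[ℝ] W →ₗ[ℝ] W) (T : Γ →ₗ[ℝ] Γ →ₗ[ℝ] W)
    (D₁ : Γ →ₗ[ℝ] Γ [⋀^Fin k]→ₗ[ℝ] N) (D₂ : W →ₗ[ℝ] W [⋀^Fin k]→ₗ[ℝ] N) (c : W [⋀^Fin k]→ₗ[ℝ] N)
    (hD : ∀ X v, D₁ X v = D₂ (φ (L X)) (fun i => φ (L (v i))) +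
      ∑ i, c (Function.update (fun j => φ (L (v j))) i (T X (v i))))
    (hbr : ∀ X Z, φ (br X Z) = B (φ (L X)) (φ (L Z)) + T X Z - T Z X) :
    chev L br D₁ (pullL φ c) = pullL (φ ∘ₗ L) (chev LinearMap.id B D₂ c) := by
  have h1 : altU D₁ = pullL (φ ∘ₗ L) (altU D₂) + bracketTerm (φ ∘ₗ L) T c := by
    rw [pullL_altU]
    cases k with
    | zero =>
      rw [bracketTerm, add_zero]
      congr 1
      ext X v
      have := hD X v
      rw [Finset.univ_eq_empty, Finset.sum_empty, add_zero] at this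
      exact this
    | succ k =>
      rw [bracketTerm, ← altU_add]
      congr 1
      ext X v
      rw [hD]
      refine congrArg (_ + ·) ?_
      exact (derTerm_apply (φ ∘ₗ L) (T X) c v).symm
  have h2 : br.compr₂ φ = B.compl₁₂ (φ ∘ₗ L) (φ ∘ₗ L) + T + -T.flip :=
    LinearMap.ext₂ fun X Z => by simpa [sub_eq_add_neg] using hbr X Z
  have h3 : bracketTerm (φ ∘ₗ L) (-T.flip) c = bracketTerm (φ ∘ₗ L) T c := by
    have := bracketTerm_flip (φ ∘ₗ L) (-T) c
    have h4 := bracketTerm_add_right (φ ∘ₗ L) (-T) T c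
    rw [neg_add_cancel] at h4
    have h5 : bracketTerm (φ ∘ₗ L) (0 : Γ →ₗ[ℝ] Γ →ₗ[ℝ] W) c = 0 := by
      have := bracketTerm_add_right (φ ∘ₗ L) (0 : Γ →ₗ[ℝ] Γ →ₗ[ℝ] W) 0 c
      rw [add_zero] at this
      exact left_eq_add.mp this
    rw [h5] at h4
    have h6 : (-T).flip = -T.flip := rfl
    rw [← h6, this]
    exact neg_eq_of_add_eq_zero_right h4.symm
  rw [chev, bracketTerm_pull_form, h2, bracketTerm_add_right, bracketTerm_add_right, h3, h1, chev,
    map_sub, map_smul, bracketTerm_pull]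
  rw [smul_add, smul_add]
  have : (1 / 2 : ℝ) • bracketTerm (φ ∘ₗ L) T c + (1 / 2 : ℝ) • bracketTerm (φ ∘ₗ L) T c =
      bracketTerm (φ ∘ₗ L) T c := by
    rw [← add_smul]; norm_num
  rw [add_assoc ((1 / 2 : ℝ) • _), this]
  change _ = _ - (1 / 2 : ℝ) • bracketTerm (φ ∘ₗ L) _ c
  abel

theorem bracketTerm_succ_apply {k : ℕ} (L : Γ →ₗ[ℝ] V) (br : Γ →ₗ[ℝ] Γ →ₗ[ℝ] V)
    (hbr : ∀ X Y, br X Y = -br Y X) (c : V [⋀^Fin (k + 1)]→ₗ[ℝ] N) (v : Fin (k + 2) → Γ) :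
    -((1 / 2 : ℝ) • bracketTerm L br c v) = ∑ j : Fin (k + 2), ∑ i : Fin (k + 1),
      if i.castSucc < j then (-1 : ℤ) ^ ((i : ℕ) + (j : ℕ)) •
        c (Matrix.vecCons (br (v i.castSucc) (v j))
          (fun l => L (v (j.succAbove (i.succAbove l))))) else 0 := by
  have hs : ∀ (n : ℕ) (x : N), -((1 / 2 : ℝ) • (-1 : ℤ) ^ n • (x - -x)) = (-1 : ℤ) ^ (n + 1) • x := by
    intro n x
    rw [sub_neg_eq_add, ← two_smul ℝ x, smul_comm ((-1 : ℤ) ^ n) (2 : ℝ) x, smul_smul, pow_succ,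
      mul_neg_one, neg_smul]
    norm_num
  rw [bracketTerm, alternatizeUncurryFin_alternatizeUncurryFinLM_comp_apply, Finset.sum_comm'
    (t' := Finset.univ) (s' := fun j => Finset.Iic j) (by intro i j; simp),
    Finset.smul_sum, ← Finset.sum_neg_distrib]
  conv_rhs => rw [Fin.sum_univ_succ]
  simp only [Fin.not_lt_zero, if_false, Finset.sum_const_zero, zero_add]
  refine Finset.sum_congr rfl fun j _ => ?_
  rw [← Finset.sum_filter, Finset.smul_sum, ← Finset.sum_neg_distrib]
  refine Finset.sum_congr ?_ fun i hi => ?_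
  · ext i
    rw [Finset.mem_Iic, Finset.mem_filter, Fin.castSucc_lt_succ_iff]
    exact ⟨fun h => ⟨Finset.mem_univ _, h⟩, fun h => h.2⟩
  have hij : i ≤ j := Fin.castSucc_lt_succ_iff.mp (Finset.mem_filter.mp hi).2
  have e1 : ∀ l, (j.removeNth (i.castSucc.removeNth v)) l =
      v (j.succ.succAbove (i.succAbove l)) := by
    intro l
    have : i.castSucc.succAbove (j.succAbove l) = j.succ.succAbove (i.succAbove l) := by
      simp only [Fin.ext_iff, Fin.succAbove, Fin.lt_def] at *
      have : (i : ℕ) ≤ j := hij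
      split_ifs <;> simp_all <;> omega
    simp only [Fin.removeNth_apply, this]
  have e2 : j.removeNth (i.castSucc.removeNth v) = fun l => v (j.succ.succAbove (i.succAbove l)) :=
    funext e1
  rw [e2, Fin.val_succ, ← add_assoc, ← hs]
  congr 3
  change c (Matrix.vecCons _ _) - c (Matrix.vecCons _ _) = _
  congr 1
  rw [hbr (v j.succ), ← neg_one_smul ℝ, AlternatingMap.map_vecCons_smul, neg_one_smul]

end CochainAlgebra

section CovectorWedge

open AlternatingMap

variable {Γ V N : Type*} [AddCommGroup Γ] [Module ℝ Γ] [AddCommGroup V] [Module ℝ V]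
  [AddCommGroup N] [Module ℝ N]

theorem altU_covecWedgeL {k : ℕ} (l : Γ →ₗ[ℝ] ℝ) (D : Γ →ₗ[ℝ] Γ [⋀^Fin k]→ₗ[ℝ] N) :
    altU (covecWedgeL l ∘ₗ D) = -covecWedge l (altU D) := by
  let h : Γ →ₗ[ℝ] Γ →ₗ[ℝ] Γ [⋀^Fin k]→ₗ[ℝ] N := LinearMap.smulRightₗ l ∘ₗ D
  have h2 : altUL ∘ₗ h.flip = l.smulRight (altU D) := by
    ext X : 1
    change altU (h.flip X) = l X • altU D
    rw [← altU_smul]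
    rfl
  have h3 := altU_altU_flip h.flip
  rw [h2] at h3
  exact h3

/-- A product of a differential `l = df` with a cochain is differentiated by the rule
`d(df ∧ β) = -df ∧ dβ`. The symmetric part of the second derivatives `S` of `f` drops out, the
antisymmetric part is cancelled by the bracket. -/
theorem chev_covecWedge {k : ℕ} (L : Γ →ₗ[ℝ] V) (br : Γ →ₗ[ℝ] Γ →ₗ[ℝ] V)
    (l : V →ₗ[ℝ] ℝ) (S : Γ →ₗ[ℝ] Γ →ₗ[ℝ] ℝ) (hS : ∀ X Z, S X Z - S Z X = l (br X Z))
    (D : Γ →ₗ[ℝ] Γ [⋀^Fin (k + 1)]→ₗ[ℝ] N) (Dβ : Γ →ₗ[ℝ] Γ [⋀^Fin k]→ₗ[ℝ] N)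
    (β : V [⋀^Fin k]→ₗ[ℝ] N)
    (hD : ∀ X, D X = covecWedge (S X) (pullL L β) + covecWedge (l ∘ₗ L) (Dβ X)) :
    chev L br D (covecWedge l β) = -covecWedge (l ∘ₗ L) (chev L br Dβ β) := by
  let f : Γ →ₗ[ℝ] Γ →ₗ[ℝ] Γ [⋀^Fin k]→ₗ[ℝ] N :=
    S.compr₂ (LinearMap.toSpanSingleton ℝ _ (pullL L β))
  let g : Γ →ₗ[ℝ] Γ →ₗ[ℝ] Γ [⋀^Fin k]→ₗ[ℝ] N :=
    br.compr₂ ((LinearMap.toSpanSingleton ℝ _ (pullL L β)) ∘ₗ l)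
  have hfg : f + -f.flip = g := by
    refine LinearMap.ext₂ fun X Z => ?_
    change S X Z • pullL L β + -(S Z X • pullL L β) = l (br X Z) • pullL L β
    rw [← hS, sub_smul, sub_eq_add_neg]
  have h1 : altU (altUL ∘ₗ f) = (1 / 2 : ℝ) • altU (altUL ∘ₗ g) := by
    have h3 : altU (altUL ∘ₗ g) = (2 : ℝ) • altU (altUL ∘ₗ f) := by
      rw [← hfg, LinearMap.comp_add, altU_add, LinearMap.comp_neg, altU_neg, altU_altU_flip,
        neg_neg, two_smul]
    rw [h3, smul_smul]; norm_num
  have h2 : altU D = (1 / 2 : ℝ) • altU (altUL ∘ₗ g) - covecWedge (l ∘ₗ L) (altU Dβ) := by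
    have : D = altUL ∘ₗ f + covecWedgeL (l ∘ₗ L) ∘ₗ Dβ := LinearMap.ext hD
    rw [this, altU_add, h1, altU_covecWedgeL, sub_eq_add_neg]
  have hneg : ∀ a b : Γ [⋀^Fin (k + 1)]→ₗ[ℝ] N, covecWedge (l ∘ₗ L) (a - b) =
      covecWedge (l ∘ₗ L) a - covecWedge (l ∘ₗ L) b :=
    fun a b => map_sub (covecWedgeL (l ∘ₗ L)) a b
  have hsm : ∀ (r : ℝ) (a : Γ [⋀^Fin (k + 1)]→ₗ[ℝ] N), covecWedge (l ∘ₗ L) (r • a) =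
      r • covecWedge (l ∘ₗ L) a := fun r a => map_smul (covecWedgeL (l ∘ₗ L)) r a
  rw [chev, h2, chev, hneg, hsm]
  cases k with
  | zero =>
    have : bracketTerm L br (covecWedge l β) = altU (altUL ∘ₗ g) := by
      rw [bracketTerm]
      congr 2
      refine LinearMap.ext₂ fun X Z => ?_
      change pullL L (iota (br X Z) (covecWedge l β)) = l (br X Z) • pullL L β
      rw [iota_covecWedge_zero, map_smul]
    have h0 : bracketTerm L br β = 0 := rfl
    have h0' : covecWedge (l ∘ₗ L) (0 : Γ [⋀^Fin 1]→ₗ[ℝ] N) = 0 :=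
      map_zero (covecWedgeL (l ∘ₗ L))
    rw [this, h0, h0', smul_zero]
    abel
  | succ k =>
    have : bracketTerm L br (covecWedge l β) =
        altU (altUL ∘ₗ g) - covecWedge (l ∘ₗ L) (bracketTerm L br β) := by
      have e1 : covecWedge (l ∘ₗ L) (bracketTerm L br β) =
          altU (altUL ∘ₗ br.compr₂ (covecWedgeL (l ∘ₗ L) ∘ₗ pullL L ∘ₗ β.curryLeft)) := by
        rw [bracketTerm, ← neg_eq_iff_eq_neg.mpr (altU_covecWedgeL (l ∘ₗ L) _), ← altU_neg]
        congr 1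
        ext X : 1
        change -covecWedge (l ∘ₗ L) (altU _) = altU _
        rw [← altU_covecWedgeL]
        rfl
      rw [e1, ← altU_sub, ← LinearMap.comp_sub, bracketTerm]
      congr 2
      refine LinearMap.ext₂ fun X Z => ?_
      change pullL L (iota (br X Z) (covecWedge l β)) =
        l (br X Z) • pullL L β - covecWedge (l ∘ₗ L) (pullL L (iota (br X Z) β))
      rw [iota_covecWedge, map_sub, map_smul, pullL_covecWedge]
    rw [this, smul_sub]
    abel

end CovectorWedge

/-! ### The wedge product and the differential -/

section WedgeAlgebra

open AlternatingMap MultilinearMap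

variable {Γ V N : Type*} [AddCommGroup Γ] [Module ℝ Γ] [AddCommGroup V] [Module ℝ V]
  [AddCommGroup N] [Module ℝ N]

theorem alternatization_succ {n : ℕ} (m : MultilinearMap ℝ (fun _ : Fin (n + 1) => Γ) N)
    (D : Γ →ₗ[ℝ] Γ [⋀^Fin n]→ₗ[ℝ] N) (hD : ∀ X, D X = alternatization (m.curryLeft X)) :
    alternatization m = altU D := by
  ext v
  rw [MultilinearMap.alternatization_apply, alternatizeUncurryFin_apply,
    ← Equiv.Perm.decomposeFin.symm.sum_comp, Fintype.sum_prod_type]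
  refine Finset.sum_congr rfl fun p _ => ?_
  rw [hD, MultilinearMap.alternatization_apply, Finset.smul_sum]
  simp only [MultilinearMap.domDomCongr_apply, MultilinearMap.curryLeft_apply]
  refine Fin.cases ?_ (fun i => ?_) p
  · refine Finset.sum_congr rfl fun e _ => ?_
    rw [Fin.val_zero, pow_zero, one_smul, Equiv.Perm.decomposeFin.symm_sign, if_pos rfl, one_mul]
    congr 2
    funext j
    refine Fin.cases ?_ (fun j => ?_) j
    · simp
    · simp [Fin.removeNth_apply]
  · refine Fintype.sum_equiv (Equiv.mulLeft i.cycleRange) _ _ fun e => ?_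
    rw [Equiv.Perm.decomposeFin.symm_sign, if_neg (Fin.succ_ne_zero i), Equiv.coe_mulLeft,
      Equiv.Perm.sign_mul, Fin.sign_cycleRange, Fin.val_succ]
    have h1 : (fun j => v ((Equiv.Perm.decomposeFin.symm (i.succ, e)) j)) =
        Fin.cons (v i.succ) (fun j => i.succ.removeNth v ((i.cycleRange * e) j)) := by
      funext j
      refine Fin.cases ?_ (fun j => ?_) j
      · simp
      · simp [Fin.removeNth_apply, Fin.succAbove_cycleRange]
    rw [h1, pow_succ]
    have h2 : (-1 : ℤ) ^ (i : ℕ) = (((-1 : ℤˣ) ^ (i : ℕ) : ℤˣ) : ℤ) := by push_cast; rfl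
    rw [h2]
    rcases Int.units_eq_one_or (Equiv.Perm.sign e) with h | h <;>
      rcases neg_one_pow_eq_or ℤˣ (i : ℕ) with h'' | h'' <;> rw [h, h''] <;> simp

theorem alternatization_domDomCongr {ι ι' : Type*} [Fintype ι] [DecidableEq ι] [Fintype ι']
    [DecidableEq ι'] (e : ι ≃ ι') (m : MultilinearMap ℝ (fun _ : ι => Γ) N) :
    alternatization (m.domDomCongr e) = (alternatization m).domDomCongr e := by
  ext v
  rw [MultilinearMap.alternatization_apply, AlternatingMap.domDomCongr_apply,
    MultilinearMap.alternatization_apply]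
  refine Fintype.sum_equiv e.symm.permCongr _ _ fun σ => ?_
  rw [Equiv.Perm.sign_permCongr]
  simp [Function.comp_def]

variable {𝕜 : Type*} [RCLike 𝕜]

/-- The product of two multilinear forms in separate groups of arguments. -/
def tensorForm {ι κ : Type*} (m : MultilinearMap ℝ (fun _ : ι => V) 𝕜)
    (m' : MultilinearMap ℝ (fun _ : κ => V) 𝕜) : MultilinearMap ℝ (fun _ : ι ⊕ κ => V) 𝕜 :=
  (LinearMap.mul' ℝ 𝕜).compMultilinearMap (m.domCoprod m')

/-- The wedge product of alternating forms as a bilinear map. -/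
def wedgeL {k l : ℕ} : V [⋀^Fin k]→ₗ[ℝ] 𝕜 →ₗ[ℝ] V [⋀^Fin l]→ₗ[ℝ] 𝕜 →ₗ[ℝ]
    V [⋀^Fin (k + l)]→ₗ[ℝ] 𝕜 :=
  (TensorProduct.mk ℝ _ _).compr₂ ((domDomCongrₗ ℝ finSumFinEquiv).toLinearMap ∘ₗ
    LinearMap.compAlternatingMapₗ ℝ (LinearMap.mul' ℝ 𝕜) ∘ₗ AlternatingMap.domCoprod')

theorem wedgeL_apply {k l : ℕ} (a : V [⋀^Fin k]→ₗ[ℝ] 𝕜) (b : V [⋀^Fin l]→ₗ[ℝ] 𝕜) :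
    wedgeL a b = ((LinearMap.mul' ℝ 𝕜).compAlternatingMap
      (a.domCoprod b)).domDomCongr finSumFinEquiv := rfl

theorem alternatization_tensorForm {k l : ℕ} (m : MultilinearMap ℝ (fun _ : Fin k => V) 𝕜)
    (m' : MultilinearMap ℝ (fun _ : Fin l => V) 𝕜) :
    (alternatization (tensorForm m m')).domDomCongr finSumFinEquiv =
      wedgeL (alternatization m) (alternatization m') := by
  rw [tensorForm, LinearMap.compMultilinearMap_alternatization,
    MultilinearMap.domCoprod_alternization, wedgeL_apply]

theorem alternatization_coe_fin {k : ℕ} (a : V [⋀^Fin k]→ₗ[ℝ] N) :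
    alternatization (a : MultilinearMap ℝ (fun _ : Fin k => V) N) = (k.factorial : ℝ) • a := by
  rw [AlternatingMap.coe_alternatization, Fintype.card_fin, Nat.cast_smul_eq_nsmul]

theorem alternatization_tensorForm_coe {k l : ℕ} (a : V [⋀^Fin k]→ₗ[ℝ] 𝕜)
    (b : V [⋀^Fin l]→ₗ[ℝ] 𝕜) :
    (alternatization (tensorForm (a : MultilinearMap ℝ (fun _ : Fin k => V) 𝕜) b)).domDomCongr
      finSumFinEquiv = ((k.factorial : ℝ) * (l.factorial : ℝ)) • wedgeL a b := by
  rw [alternatization_tensorForm, alternatization_coe_fin, alternatization_coe_fin, map_smul,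
    map_smul, LinearMap.smul_apply, smul_smul, mul_comm]

theorem factorial_mul_ne_zero (k l : ℕ) : ((k.factorial : ℝ) * (l.factorial : ℝ)) ≠ 0 :=
  mul_ne_zero (Nat.cast_ne_zero.mpr k.factorial_ne_zero) (Nat.cast_ne_zero.mpr l.factorial_ne_zero)

/-- The wedge product as a sum over all permutations. -/
theorem factorial_smul_wedgeL_apply {k l : ℕ} (a : V [⋀^Fin k]→ₗ[ℝ] 𝕜) (b : V [⋀^Fin l]→ₗ[ℝ] 𝕜)
    (v : Fin (k + l) → V) :
    ((k.factorial : ℝ) * (l.factorial : ℝ)) • wedgeL a b v =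
      ∑ σ : Equiv.Perm (Fin k ⊕ Fin l), Equiv.Perm.sign σ •
        (a (fun i => v (finSumFinEquiv (σ (Sum.inl i)))) *
          b (fun i => v (finSumFinEquiv (σ (Sum.inr i))))) := by
  rw [← AlternatingMap.smul_apply, ← alternatization_tensorForm_coe,
    AlternatingMap.domDomCongr_apply, MultilinearMap.alternatization_apply]
  rfl

theorem pullL_wedgeL {k l : ℕ} (L : Γ →ₗ[ℝ] V) (a : V [⋀^Fin k]→ₗ[ℝ] 𝕜)
    (b : V [⋀^Fin l]→ₗ[ℝ] 𝕜) : pullL L (wedgeL a b) = wedgeL (pullL L a) (pullL L b) := by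
  ext v
  refine smul_right_injective 𝕜 (factorial_mul_ne_zero k l) ?_
  change _ • wedgeL a b (fun i => L (v i)) = _ • wedgeL (pullL L a) (pullL L b) v
  rw [factorial_smul_wedgeL_apply, factorial_smul_wedgeL_apply]
  rfl

theorem altU_wedgeL_left {k l : ℕ} (G : Γ →ₗ[ℝ] Γ [⋀^Fin k]→ₗ[ℝ] 𝕜) (b : Γ [⋀^Fin l]→ₗ[ℝ] 𝕜) :
    altU (wedgeL.flip b ∘ₗ G) =
      (wedgeL (altU G) b).domDomCongr (finCongr (Nat.add_right_comm k 1 l)) := by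
  let G' : MultilinearMap ℝ (fun _ : Fin (k + 1) => Γ) 𝕜 :=
    LinearMap.uncurryLeft (toMultilinearMapLM ∘ₗ G)
  have hG' : alternatization G' = (k.factorial : ℝ) • altU G := by
    rw [← altU_smul]
    refine alternatization_succ _ _ fun X => ?_
    exact (alternatization_coe_fin (G X)).symm
  let e : Fin (k + 1) ⊕ Fin l ≃ Fin (k + l + 1) :=
    finSumFinEquiv.trans (finCongr (Nat.add_right_comm k 1 l))
  have h := alternatization_succ ((tensorForm G' b).domDomCongr e)
    (((k.factorial : ℝ) * (l.factorial : ℝ)) • (wedgeL.flip b ∘ₗ G)) fun X => by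
      refine (alternatization_tensorForm_coe (G X) b).symm.trans ?_
      rw [← alternatization_domDomCongr]
      congr 1
      ext v
      change G X _ * b _ = G _ _ * b _
      have e0 : (e (Sum.inl 0)) = 0 := rfl
      have e1 : ∀ i : Fin k, e (Sum.inl i.succ) = (Fin.castAdd l i).succ := fun i => rfl
      have e2 : ∀ i : Fin l, e (Sum.inr i) = (Fin.natAdd k i).succ := fun i => by
        ext; simp [e]; omega
      congr 2
      funext i
      simp only [e2, Fin.cons_succ]
      rfl
  rw [altU_smul, alternatization_domDomCongr, AlternatingMap.domDomCongr_trans, alternatization_tensorForm, hG',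
    alternatization_coe_fin, map_smul, map_smul, LinearMap.smul_apply, smul_smul, mul_comm,
    domDomCongr_smul] at h
  exact (smul_right_injective _ (factorial_mul_ne_zero k l) h).symm

/-- Moving the first argument behind `k` others. -/
def shiftEquiv (k l : ℕ) : Fin k ⊕ Fin (l + 1) ≃ Fin (k + l + 1) where
  toFun := Sum.elim (fun i => (Fin.castAdd l i).succ)
    (Fin.cases 0 (fun j => (Fin.natAdd k j).succ))
  invFun := Fin.cases (Sum.inr 0) (fun q => Sum.map id Fin.succ (finSumFinEquiv.symm q))
  left_inv := by
    rintro (i | i)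
    · simp
    · refine Fin.cases ?_ (fun j => ?_) i <;> simp
  right_inv := by
    intro p
    refine Fin.cases ?_ (fun q => ?_) p
    · simp
    · obtain ⟨s, rfl⟩ := finSumFinEquiv.surjective q
      rcases s with i | i <;> simp

/-- The sign with which a derivation of degree one passes a form of degree `k`. -/
def wedgeSign (k l : ℕ) : ℤˣ :=
  Equiv.Perm.sign (finSumFinEquiv.symm.trans (shiftEquiv k l) : Equiv.Perm (Fin (k + (l + 1))))

theorem altU_wedgeL_right {k l : ℕ} (a : Γ [⋀^Fin k]→ₗ[ℝ] 𝕜) (G : Γ →ₗ[ℝ] Γ [⋀^Fin l]→ₗ[ℝ] 𝕜) :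
    altU (wedgeL a ∘ₗ G) = wedgeSign k l • wedgeL a (altU G) := by
  let G' : MultilinearMap ℝ (fun _ : Fin (l + 1) => Γ) 𝕜 :=
    LinearMap.uncurryLeft (toMultilinearMapLM ∘ₗ G)
  have hG' : alternatization G' = (l.factorial : ℝ) • altU G := by
    rw [← altU_smul]
    refine alternatization_succ _ _ fun X => ?_
    exact (alternatization_coe_fin (G X)).symm
  have h := alternatization_succ ((tensorForm (a : MultilinearMap ℝ (fun _ : Fin k => Γ) 𝕜)
      G').domDomCongr (shiftEquiv k l))
    (((k.factorial : ℝ) * (l.factorial : ℝ)) • (wedgeL a ∘ₗ G)) fun X => by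
      refine (alternatization_tensorForm_coe a (G X)).symm.trans ?_
      rw [← alternatization_domDomCongr]
      rfl
  have e : shiftEquiv k l = finSumFinEquiv.trans
      (finSumFinEquiv.symm.trans (shiftEquiv k l) : Equiv.Perm (Fin (k + (l + 1)))) := by
    ext x; simp
  rw [altU_smul, alternatization_domDomCongr, e, AlternatingMap.domDomCongr_trans, alternatization_tensorForm, hG',
    alternatization_coe_fin, map_smul, map_smul, LinearMap.smul_apply, smul_smul, mul_comm,
    domDomCongr_perm, smul_comm] at h
  exact (smul_right_injective _ (factorial_mul_ne_zero k l) h).symm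

/-- The action of an infinitesimal transformation `T` on a cochain. -/
def derC (L T : Γ →ₗ[ℝ] V) : {k : ℕ} → V [⋀^Fin k]→ₗ[ℝ] N → Γ [⋀^Fin k]→ₗ[ℝ] N
  | 0, _ => 0
  | _ + 1, c => altU ((pullL L ∘ₗ c.curryLeft) ∘ₗ T)

theorem derC_apply (L T : Γ →ₗ[ℝ] V) {k : ℕ} (c : V [⋀^Fin k]→ₗ[ℝ] N) (v : Fin k → Γ) :
    derC L T c v = ∑ i, c (Function.update (fun j => L (v j)) i (T (v i))) := by
  cases k with
  | zero => simp [derC]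
  | succ k => exact derTerm_apply L T c v

/-- `derC` as a linear map in the transformation. -/
def derCL (L : Γ →ₗ[ℝ] V) {k : ℕ} (c : V [⋀^Fin k]→ₗ[ℝ] N) :
    (Γ →ₗ[ℝ] V) →ₗ[ℝ] Γ [⋀^Fin k]→ₗ[ℝ] N where
  toFun T := derC L T c
  map_add' T T' := by
    ext v
    simp [derC_apply, Finset.sum_add_distrib]
  map_smul' r T := by
    ext v
    simp [derC_apply, Finset.smul_sum]

theorem derC_wedgeL {k l : ℕ} (L T : Γ →ₗ[ℝ] V) (a : V [⋀^Fin k]→ₗ[ℝ] 𝕜)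
    (b : V [⋀^Fin l]→ₗ[ℝ] 𝕜) :
    derC L T (wedgeL a b) = wedgeL (derC L T a) (pullL L b) + wedgeL (pullL L a) (derC L T b) := by
  ext v
  refine smul_right_injective 𝕜 (factorial_mul_ne_zero k l) ?_
  change _ • derC L T (wedgeL a b) v = _ • (wedgeL _ _ v + wedgeL _ _ v)
  rw [smul_add, factorial_smul_wedgeL_apply, factorial_smul_wedgeL_apply, derC_apply,
    Finset.smul_sum]
  simp only [factorial_smul_wedgeL_apply]
  rw [Finset.sum_comm, ← Finset.sum_add_distrib]
  refine Finset.sum_congr rfl fun σ _ => ?_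
  rw [← Finset.smul_sum, ← smul_add]
  congr 1
  rw [derC_apply, derC_apply, Finset.sum_mul, Finset.mul_sum,
    ← (σ.trans finSumFinEquiv).sum_comp, Fintype.sum_sum_type]
  have hu : ∀ x y : Fin k ⊕ Fin l, Function.update (fun j => L (v j)) (finSumFinEquiv (σ x))
      (T (v (finSumFinEquiv (σ x)))) (finSumFinEquiv (σ y)) =
      if y = x then T (v (finSumFinEquiv (σ x))) else L (v (finSumFinEquiv (σ y))) := by
    intro x y
    rw [Function.update_apply]
    simp
  simp only [Equiv.trans_apply, hu, Sum.inl.injEq, Sum.inr.injEq, reduceCtorEq, if_false]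
  congr 1
  · refine Finset.sum_congr rfl fun i _ => ?_
    refine congrArg₂ (· * ·) (congrArg a (funext fun j => ?_)) rfl
    rw [Function.update_apply]
  · refine Finset.sum_congr rfl fun i _ => ?_
    refine congrArg₂ (· * ·) rfl (congrArg b (funext fun j => ?_))
    rw [Function.update_apply]

theorem chev_eq_altU (L : Γ →ₗ[ℝ] V) (br : Γ →ₗ[ℝ] Γ →ₗ[ℝ] V) {k : ℕ}
    (D : Γ →ₗ[ℝ] Γ [⋀^Fin k]→ₗ[ℝ] N) (c : V [⋀^Fin k]→ₗ[ℝ] N) :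
    chev L br D c = altU (D - (1 / 2 : ℝ) • (derCL L c ∘ₗ br)) := by
  rw [chev, altU_sub, altU_smul]
  congr 2
  cases k with
  | zero =>
    rw [bracketTerm, ← altU_zero]
    rfl
  | succ k => rfl

/-- The Leibniz rule for the wedge product of cochains. -/
theorem chev_wedgeL {k l : ℕ} (L : Γ →ₗ[ℝ] V) (br : Γ →ₗ[ℝ] Γ →ₗ[ℝ] V)
    (Da : Γ →ₗ[ℝ] Γ [⋀^Fin k]→ₗ[ℝ] 𝕜) (Db : Γ →ₗ[ℝ] Γ [⋀^Fin l]→ₗ[ℝ] 𝕜)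
    (D : Γ →ₗ[ℝ] Γ [⋀^Fin (k + l)]→ₗ[ℝ] 𝕜) (a : V [⋀^Fin k]→ₗ[ℝ] 𝕜) (b : V [⋀^Fin l]→ₗ[ℝ] 𝕜)
    (hD : ∀ X, D X = wedgeL (Da X) (pullL L b) + wedgeL (pullL L a) (Db X)) :
    chev L br D (wedgeL a b) =
      (wedgeL (chev L br Da a) (pullL L b)).domDomCongr (finCongr (Nat.add_right_comm k 1 l)) +
        wedgeSign k l • wedgeL (pullL L a) (chev L br Db b) := by
  rw [chev_eq_altU, chev_eq_altU, chev_eq_altU, ← altU_wedgeL_left, ← altU_wedgeL_right, ← altU_add]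
  congr 1
  refine LinearMap.ext fun X => ?_
  change D X - (1 / 2 : ℝ) • derC L (br X) (wedgeL a b) =
    wedgeL (Da X - (1 / 2 : ℝ) • derC L (br X) a) (pullL L b) +
      wedgeL (pullL L a) (Db X - (1 / 2 : ℝ) • derC L (br X) b)
  rw [hD, derC_wedgeL]
  simp only [map_sub, map_smul, LinearMap.sub_apply, LinearMap.smul_apply, smul_add]
  abel

end WedgeAlgebra

/-! ### Directional derivatives on manifolds -/

section DirDeriv

variable {EM : Type*} [NormedAddCommGroup EM] [NormedSpace ℝ EM]
    {HM : Type*} [TopologicalSpace HM] {I : ModelWithCorners ℝ EM HM}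
    {M : Type*} [TopologicalSpace M] [ChartedSpace HM M]
    {EN : Type*} [NormedAddCommGroup EN] [NormedSpace ℝ EN]
    {HN : Type*} [TopologicalSpace HN] {J : ModelWithCorners ℝ EN HN}
    {N : Type*} [TopologicalSpace N] [ChartedSpace HN N]
    {V V' : Type*} [NormedAddCommGroup V] [NormedSpace ℝ V]
    [NormedAddCommGroup V'] [NormedSpace ℝ V']

theorem dirDeriv_congr {f g : M → V} {x : M} (h : f =ᶠ[𝓝 x] g) (v : TangentSpace I x) :
    dirDeriv I f x v = dirDeriv I g x v := by
  unfold dirDeriv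
  rw [h.mfderiv_eq]
  rfl

theorem dirDeriv_add_vec (f : M → V) (x : M) (v w : TangentSpace I x) :
    dirDeriv I f x (v + w) = dirDeriv I f x v + dirDeriv I f x w :=
  map_add (mfderiv I 𝓘(ℝ, V) f x) v w

theorem dirDeriv_smul_vec (f : M → V) (x : M) (r : ℝ) (v : TangentSpace I x) :
    dirDeriv I f x (r • v) = r • dirDeriv I f x v :=
  map_smul (mfderiv I 𝓘(ℝ, V) f x) r v

theorem dirDeriv_zero_vec (f : M → V) (x : M) :
    dirDeriv I f x 0 = 0 :=
  map_zero (mfderiv I 𝓘(ℝ, V) f x)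

theorem dirDeriv_const (c : V) (x : M) (v : TangentSpace I x) :
    dirDeriv I (fun _ => c) x v = 0 := by
  unfold dirDeriv
  rw [mfderiv_const]
  rfl

theorem dirDeriv_comp_map {f : M → N} {h : N → V} {x : M}
    (hh : MDifferentiableAt J 𝓘(ℝ, V) h (f x)) (hf : MDifferentiableAt I J f x)
    (v : TangentSpace I x) :
    dirDeriv I (fun y => h (f y)) x v = dirDeriv J h (f x) (mfderiv I J f x v) :=
  mfderiv_comp_apply x hh hf v

theorem dirDeriv_comp {Φ : V → V'} {f : M → V} {x : M} (hΦ : DifferentiableAt ℝ Φ (f x))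
    (hf : MDifferentiableAt I 𝓘(ℝ, V) f x) (v : TangentSpace I x) :
    dirDeriv I (fun y => Φ (f y)) x v = fderiv ℝ Φ (f x) (dirDeriv I f x v) := by
  refine (dirDeriv_comp_map hΦ.mdifferentiableAt hf v).trans ?_
  unfold dirDeriv
  rw [mfderiv_eq_fderiv]
  rfl

theorem dirDeriv_clm (T : V →L[ℝ] V') {f : M → V} {x : M}
    (hf : MDifferentiableAt I 𝓘(ℝ, V) f x) (v : TangentSpace I x) :
    dirDeriv I (fun y => T (f y)) x v = T (dirDeriv I f x v) := by
  rw [dirDeriv_comp T.differentiableAt hf, T.fderiv]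

theorem dirDeriv_prodMk {f : M → V} {g : M → V'} {x : M}
    (hf : MDifferentiableAt I 𝓘(ℝ, V) f x) (hg : MDifferentiableAt I 𝓘(ℝ, V') g x)
    (v : TangentSpace I x) :
    dirDeriv I (fun y => (f y, g y)) x v = (dirDeriv I f x v, dirDeriv I g x v) := by
  have h1 := dirDeriv_clm (ContinuousLinearMap.fst ℝ V V') (hf.prodMk_space hg) v
  have h2 := dirDeriv_clm (ContinuousLinearMap.snd ℝ V V') (hf.prodMk_space hg) v
  exact Prod.ext h1.symm h2.symm

theorem dirDeriv_pi {ι : Type*} [Fintype ι] {f : ι → M → V} {x : M}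
    (hf : MDifferentiableAt I 𝓘(ℝ, ι → V) (fun y i => f i y) x) (v : TangentSpace I x) :
    dirDeriv I (fun y i => f i y) x v = fun i => dirDeriv I (f i) x v :=
  funext fun i => (dirDeriv_clm (ContinuousLinearMap.proj i) hf v).symm

theorem dirDeriv_fun_smul {a : M → ℝ} {f : M → V} {x : M}
    (ha : MDifferentiableAt I 𝓘(ℝ, ℝ) a x) (hf : MDifferentiableAt I 𝓘(ℝ, V) f x)
    (v : TangentSpace I x) :
    dirDeriv I (fun y => a y • f y) x v = a x • dirDeriv I f x v + dirDeriv I a x v • f x := by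
  have hs : HasFDerivAt (fun z : ℝ × V => z.1 • z.2)
      ((a x) • ContinuousLinearMap.snd ℝ ℝ V + (ContinuousLinearMap.fst ℝ ℝ V).smulRight (f x))
      (a x, f x) :=
    (hasFDerivAt_fst (p := (a x, f x))).smul (hasFDerivAt_snd (𝕜 := ℝ) (p := (a x, f x)))
  have h := dirDeriv_comp (f := fun y => (a y, f y)) hs.differentiableAt (ha.prodMk_space hf) v
  rw [hs.fderiv, dirDeriv_prodMk ha hf] at h
  simpa using h

theorem dirDeriv_const_smul (r : ℝ) {f : M → V} {x : M} (hf : MDifferentiableAt I 𝓘(ℝ, V) f x)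
    (v : TangentSpace I x) : dirDeriv I (fun y => r • f y) x v = r • dirDeriv I f x v :=
  dirDeriv_clm (r • ContinuousLinearMap.id ℝ V) hf v

theorem dirDeriv_sum {ι : Type*} (s : Finset ι) {f : ι → M → V} {x : M}
    (hf : ∀ i ∈ s, MDifferentiableAt I 𝓘(ℝ, V) (f i) x) (v : TangentSpace I x) :
    dirDeriv I (fun y => ∑ i ∈ s, f i y) x v = ∑ i ∈ s, dirDeriv I (f i) x v := by
  classical
  have : MDifferentiableAt I 𝓘(ℝ, V) (fun y => ∑ i ∈ s, f i y) x ∧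
      dirDeriv I (fun y => ∑ i ∈ s, f i y) x v = ∑ i ∈ s, dirDeriv I (f i) x v := by
    induction s using Finset.induction_on with
    | empty => exact ⟨by simpa using mdifferentiableAt_const, by simpa using dirDeriv_const 0 x v⟩
    | insert i s hi ih =>
      obtain ⟨h1, h2⟩ := ih fun j hj => hf j (Finset.mem_insert_of_mem hj)
      have hi' := hf i (Finset.mem_insert_self i s)
      simp only [Finset.sum_insert hi]
      exact ⟨hi'.add h1, by rw [dirDeriv_add hi' h1, h2]⟩
  exact this.2

variable [IsManifold I ∞ M]

omit [IsManifold I ∞ M] in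
theorem mdiffAt_of_contMDiffAt {f : M → V} {x : M} (hf : ContMDiffAt I 𝓘(ℝ, V) ∞ f x) :
    MDifferentiableAt I 𝓘(ℝ, V) f x :=
  hf.mdifferentiableAt (by simp)

theorem eventually_mdifferentiableAt {f : M → V} {x : M} (hf : ContMDiffAt I 𝓘(ℝ, V) ∞ f x) :
    ∀ᶠ y in 𝓝 x, MDifferentiableAt I 𝓘(ℝ, V) f y := by
  have : IsManifold I 1 M := IsManifold.of_le (n := ∞) (by simp)
  have h1 : ContMDiffAt I 𝓘(ℝ, V) 1 f x := hf.of_le (by simp)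
  filter_upwards [(contMDiffAt_iff_contMDiffAt_nhds (by simp)).1 h1] with y hy
  exact hy.mdifferentiableAt (by simp)

/-- The components of a vector field in a chart. -/
theorem contMDiffAt_dirDeriv_extChartAt {X : ∀ x, TangentSpace I x} {p : M}
    (hX : ContMDiffAt I I.tangent ∞ (fun x => (⟨x, X x⟩ : TangentBundle I M)) p) :
    ContMDiffAt I 𝓘(ℝ, EM) ∞ (fun q => dirDeriv I (extChartAt I p) q (X q)) p := by
  have : IsManifold I 1 M := IsManifold.of_le (n := ∞) (by simp)
  refine ((contMDiffAt_section p).1 hX).congr_of_eventuallyEq ?_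
  filter_upwards [(chartAt HM p).open_source.mem_nhds (mem_chart_source HM p)] with q hq
  have h := TangentBundle.continuousLinearMapAt_trivializationAt (I := I) hq
  unfold dirDeriv
  rw [← h]
  exact (trivializationAt EM (TangentSpace I) p).coe_linearMapAt_of_mem (R := ℝ)
    (by simpa using hq) ▸ rfl

theorem contMDiffAt_of_dirDeriv_extChartAt {X : ∀ x, TangentSpace I x} {p : M}
    (hX : ContMDiffAt I 𝓘(ℝ, EM) ∞ (fun q => dirDeriv I (extChartAt I p) q (X q)) p) :
    ContMDiffAt I I.tangent ∞ (fun x => (⟨x, X x⟩ : TangentBundle I M)) p := by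
  have : IsManifold I 1 M := IsManifold.of_le (n := ∞) (by simp)
  refine (contMDiffAt_section p).2 (hX.congr_of_eventuallyEq ?_)
  filter_upwards [(chartAt HM p).open_source.mem_nhds (mem_chart_source HM p)] with q hq
  have h := TangentBundle.continuousLinearMapAt_trivializationAt (I := I) hq
  unfold dirDeriv
  rw [← h]
  exact (trivializationAt EM (TangentSpace I) p).coe_linearMapAt_of_mem (R := ℝ)
    (by simpa using hq) ▸ rfl

theorem mpullbackWithin_extChartAt_symm (X : ∀ x, TangentSpace I x) {p q : M}
    (hq : q ∈ (extChartAt I p).source) :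
    VectorField.mpullbackWithin 𝓘(ℝ, EM) I (extChartAt I p).symm X (range I) (extChartAt I p q) =
      dirDeriv I (extChartAt I p) q (X q) := by
  have : IsManifold I 1 M := IsManifold.of_le (n := ∞) (by simp)
  have hz := (extChartAt I p).map_source hq
  have h1 := mfderiv_extChartAt_comp_mfderivWithin_extChartAt_symm (I := I) hz
  have h2 := mfderivWithin_extChartAt_symm_comp_mfderiv_extChartAt (I := I) hz
  rw [VectorField.mpullbackWithin_apply, ContinuousLinearMap.inverse_eq h2 h1]
  unfold dirDeriv
  rw [(extChartAt I p).left_inv hq]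

/-- A tangent vector is determined by its derivatives of the chart functions. -/
theorem tangent_ext {p q : M} (hq : q ∈ (extChartAt I p).source) {v w : TangentSpace I q}
    (h : dirDeriv I (extChartAt I p) q v = dirDeriv I (extChartAt I p) q w) : v = w := by
  have : IsManifold I 1 M := IsManifold.of_le (n := ∞) (by simp)
  obtain ⟨T, hT⟩ := isInvertible_mfderiv_extChartAt (I := I) hq
  unfold dirDeriv at h
  rw [← hT] at h
  exact T.injective h

variable [I.Boundaryless]

theorem contDiffAt_comp_extChartAt_symm {f : M → V} {p q : M} (hq : q ∈ (extChartAt I p).source)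
    {n : ℕ∞} (hf : ContMDiffAt I 𝓘(ℝ, V) n f q) :
    ContDiffAt ℝ n (f ∘ (extChartAt I p).symm) (extChartAt I p q) := by
  have : IsManifold I n M := IsManifold.of_le (n := ∞) (mod_cast le_top)
  have h1 : ContMDiffAt 𝓘(ℝ, EM) I n (extChartAt I p).symm (extChartAt I p q) :=
    (contMDiffOn_extChartAt_symm p).contMDiffAt (extChartAt_target_mem_nhds' ((extChartAt I p).map_source hq))
  have h2 : ContMDiffAt I 𝓘(ℝ, V) n f ((extChartAt I p).symm (extChartAt I p q)) := by
    rwa [(extChartAt I p).left_inv hq]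
  exact (h2.comp _ h1).contDiffAt

theorem dirDeriv_eq_fderiv_chart {f : M → V} {p q : M} (hq : q ∈ (extChartAt I p).source)
    (hf : MDifferentiableAt I 𝓘(ℝ, V) f q) (v : TangentSpace I q) :
    dirDeriv I f q v = fderiv ℝ (f ∘ (extChartAt I p).symm) (extChartAt I p q)
      (dirDeriv I (extChartAt I p) q v) := by
  have : IsManifold I 1 M := IsManifold.of_le (n := ∞) (by simp)
  have h1 : MDifferentiableAt 𝓘(ℝ, EM) I (extChartAt I p).symm (extChartAt I p q) :=
    ((contMDiffOn_extChartAt_symm (n := 1) p).contMDiffAt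
      (extChartAt_target_mem_nhds' ((extChartAt I p).map_source hq))).mdifferentiableAt (by simp)
  have h2 : MDifferentiableAt I 𝓘(ℝ, V) f ((extChartAt I p).symm (extChartAt I p q)) := by
    rwa [(extChartAt I p).left_inv hq]
  have h3 : DifferentiableAt ℝ (f ∘ (extChartAt I p).symm) (extChartAt I p q) :=
    mdifferentiableAt_iff_differentiableAt.1 (h2.comp _ h1)
  have h4 : MDifferentiableAt I 𝓘(ℝ, EM) (extChartAt I p) q :=
    mdifferentiableAt_extChartAt (by rwa [extChartAt_source] at hq)
  rw [← dirDeriv_comp h3 h4]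
  refine dirDeriv_congr ?_ v
  filter_upwards [extChartAt_source_mem_nhds' hq] with y hy
  exact congrArg f ((extChartAt I p).left_inv hy).symm

theorem contMDiffAt_dirDeriv {f : M → V} {p : M} (hf : ContMDiffAt I 𝓘(ℝ, V) ∞ f p)
    {X : ∀ x, TangentSpace I x}
    (hX : ContMDiffAt I I.tangent ∞ (fun x => (⟨x, X x⟩ : TangentBundle I M)) p) :
    ContMDiffAt I 𝓘(ℝ, V) ∞ (fun q => dirDeriv I f q (X q)) p := by
  have h1 := contDiffAt_comp_extChartAt_symm (mem_extChartAt_source (I := I) p) hf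
  have h2 := h1.fderiv_right (m := ∞) (by simp)
  have h3 : ContMDiffAt I 𝓘(ℝ, EM →L[ℝ] V) ∞
      (fun q => fderiv ℝ (f ∘ (extChartAt I p).symm) (extChartAt I p q)) p :=
    h2.contMDiffAt.comp p (contMDiffAt_extChartAt (x := p))
  refine (h3.clm_apply (contMDiffAt_dirDeriv_extChartAt hX)).congr_of_eventuallyEq ?_
  filter_upwards [eventually_mdifferentiableAt hf, extChartAt_source_mem_nhds (I := I) p]
    with q hq hq'
  exact dirDeriv_eq_fderiv_chart hq' hq _

/-- The Lie bracket of vector fields is the commutator of the derivations. -/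
theorem dirDeriv_mlieBracket [CompleteSpace EM] {f : M → V} {p : M}
    (hf : ContMDiffAt I 𝓘(ℝ, V) ∞ f p) {X Y : ∀ x, TangentSpace I x}
    (hX : ContMDiffAt I I.tangent ∞ (fun x => (⟨x, X x⟩ : TangentBundle I M)) p)
    (hY : ContMDiffAt I I.tangent ∞ (fun x => (⟨x, Y x⟩ : TangentBundle I M)) p) :
    dirDeriv I f p (VectorField.mlieBracket I X Y p) =
      dirDeriv I (fun q => dirDeriv I f q (Y q)) p (X p) -
        dirDeriv I (fun q => dirDeriv I f q (X q)) p (Y p) := by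
  have h2 : (2 : ℕ∞ω) ≤ ∞ := WithTop.coe_le_coe.2 (le_top : (2 : ℕ∞) ≤ ⊤)
  have : IsManifold I 2 M := IsManifold.of_le (n := ∞) h2
  have : IsManifold I 1 M := IsManifold.of_le (n := ∞) (by simp)
  have hps := mem_extChartAt_source (I := I) p
  -- In a chart the claim is `VectorField.fderiv_apply_lieBracket`.
  let X' : EM → EM := VectorField.mpullbackWithin 𝓘(ℝ, EM) I (extChartAt I p).symm X (range I)
  let Y' : EM → EM := VectorField.mpullbackWithin 𝓘(ℝ, EM) I (extChartAt I p).symm Y (range I)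
  let F : EM → V := f ∘ (extChartAt I p).symm
  have hF : ContDiffAt ℝ ∞ F (extChartAt I p p) := contDiffAt_comp_extChartAt_symm hps hf
  have hd : ∀ Z : ∀ x, TangentSpace I x,
      ContMDiffAt I I.tangent ∞ (fun x => (⟨x, Z x⟩ : TangentBundle I M)) p →
      DifferentiableAt ℝ (VectorField.mpullbackWithin 𝓘(ℝ, EM) I (extChartAt I p).symm Z (range I))
        (extChartAt I p p) := by
    intro Z hZ
    have h := (hZ.mdifferentiableAt (by simp)).mdifferentiableWithinAt (s := univ)
    have h' := MDifferentiableWithinAt.differentiableWithinAt_mpullbackWithin_vectorField h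
    rw [preimage_univ, univ_inter] at h'
    refine DifferentiableWithinAt.differentiableAt h' ?_
    rw [I.range_eq_univ]
    exact univ_mem
  have hb : VectorField.mlieBracket I X Y p = (mfderiv I 𝓘(ℝ, EM) (extChartAt I p) p).inverse
      (VectorField.lieBracket ℝ X' Y' (extChartAt I p p) : EM) := by
    have e : VectorField.lieBracketWithin ℝ X' Y' (range I) (extChartAt I p p) =
        VectorField.lieBracket ℝ X' Y' (extChartAt I p p) := by
      rw [I.range_eq_univ, VectorField.lieBracketWithin_univ]
    rw [← VectorField.mlieBracketWithin_univ, VectorField.mlieBracketWithin_apply, preimage_univ,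
      univ_inter]
    exact congrArg _ e
  have hi : dirDeriv I (extChartAt I p) p (VectorField.mlieBracket I X Y p) =
      (VectorField.lieBracket ℝ X' Y' (extChartAt I p p) : EM) := by
    rw [hb]
    obtain ⟨T, hT⟩ := isInvertible_mfderiv_extChartAt (I := I) hps
    unfold dirDeriv
    rw [← hT, ContinuousLinearMap.inverse_equiv]
    exact T.apply_symm_apply _
  have hY' := hd Y hY
  have hX' := hd X hX
  have hc : ∀ Z : ∀ x, TangentSpace I x,
      DifferentiableAt ℝ (VectorField.mpullbackWithin 𝓘(ℝ, EM) I (extChartAt I p).symm Z (range I))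
        (extChartAt I p p) → ∀ v : TangentSpace I p,
      dirDeriv I (fun q => dirDeriv I f q (Z q)) p v = fderiv ℝ (fun z => fderiv ℝ F z
        (VectorField.mpullbackWithin 𝓘(ℝ, EM) I (extChartAt I p).symm Z (range I) z))
        (extChartAt I p p) (dirDeriv I (extChartAt I p) p v) := by
    intro Z hZ v
    have h1 : DifferentiableAt ℝ (fun z => fderiv ℝ F z
        (VectorField.mpullbackWithin 𝓘(ℝ, EM) I (extChartAt I p).symm Z (range I) z))
        (extChartAt I p p) :=
      ((hF.fderiv_right (m := 1) (by norm_cast)).differentiableAt (by simp)).clm_apply hZ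
    rw [← dirDeriv_comp h1 (mdifferentiableAt_extChartAt (mem_chart_source HM p))]
    refine dirDeriv_congr ?_ v
    filter_upwards [eventually_mdifferentiableAt hf, extChartAt_source_mem_nhds (I := I) p]
      with q hq hq'
    rw [mpullbackWithin_extChartAt_symm Z hq']
    exact dirDeriv_eq_fderiv_chart hq' hq _
  rw [hc Y hY', hc X hX', ← mpullbackWithin_extChartAt_symm X hps,
    ← mpullbackWithin_extChartAt_symm Y hps,
    dirDeriv_eq_fderiv_chart hps (mdiffAt_of_contMDiffAt hf), hi]
  exact VectorField.fderiv_apply_lieBracket hF (by simpa using h2) hY' hX'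

end DirDeriv

/-! ### Alternating maps on finite-dimensional spaces -/

section ContAlt

variable {W : Type*} [NormedAddCommGroup W] [NormedSpace ℝ W] [FiniteDimensional ℝ W]
  {N : Type*} [NormedAddCommGroup N] [NormedSpace ℝ N] {k : ℕ}

theorem alt_apply_eq_sum_basis (c : W [⋀^Fin k]→ₗ[ℝ] N) (v : Fin k → W) :
    c v = ∑ r : Fin k → Fin (Module.finrank ℝ W),
      (∏ i, (Module.finBasis ℝ W).coord (r i) (v i)) •
        c (fun i => Module.finBasis ℝ W (r i)) := by
  have h : v = fun i => ∑ j, (Module.finBasis ℝ W).coord j (v i) • Module.finBasis ℝ W j :=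
    funext fun i => ((Module.finBasis ℝ W).sum_repr (v i)).symm
  conv_lhs => rw [h]
  refine (c.toMultilinearMap.map_sum _).trans (Finset.sum_congr rfl fun r _ => ?_)
  exact c.toMultilinearMap.map_smul_univ _ _

/-- An alternating map on a finite-dimensional space is continuous. -/
def toContAlt : W [⋀^Fin k]→ₗ[ℝ] N →ₗ[ℝ] W [⋀^Fin k]→L[ℝ] N where
  toFun c := { c with
    cont := by
      have h : (c : (Fin k → W) → N) = fun v => ∑ r : Fin k → Fin (Module.finrank ℝ W),
          (∏ i, (Module.finBasis ℝ W).coord (r i) (v i)) • c (fun i => Module.finBasis ℝ W (r i)) :=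
        funext fun v => alt_apply_eq_sum_basis c v
      change Continuous c
      rw [h]
      refine continuous_finsetSum _ fun r _ => Continuous.smul ?_ continuous_const
      refine continuous_finsetProd _ fun i _ => ?_
      exact (LinearMap.continuous_of_finiteDimensional _).comp (continuous_apply i) }
  map_add' _ _ := rfl
  map_smul' _ _ := rfl
@[simp] theorem toContAlt_apply (c : W [⋀^Fin k]→ₗ[ℝ] N) (v : Fin k → W) :
    toContAlt c v = c v := rfl

/-- The values of an alternating map on tuples of basis vectors. -/
def altCoords : W [⋀^Fin k]→L[ℝ] N →ₗ[ℝ] (Fin k → Fin (Module.finrank ℝ W)) → N where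
  toFun c r := c (fun i => Module.finBasis ℝ W (r i))
  map_add' _ _ := rfl
  map_smul' _ _ := rfl

theorem altCoords_injective : Function.Injective (altCoords : W [⋀^Fin k]→L[ℝ] N →ₗ[ℝ] _) := by
  intro c c' h
  ext v
  change c.toAlternatingMap v = c'.toAlternatingMap v
  rw [alt_apply_eq_sum_basis, alt_apply_eq_sum_basis c'.toAlternatingMap]
  refine Finset.sum_congr rfl fun r _ => ?_
  congr 1
  exact congrFun h r

instance [FiniteDimensional ℝ N] : FiniteDimensional ℝ (W [⋀^Fin k]→L[ℝ] N) :=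
  FiniteDimensional.of_injective altCoords altCoords_injective

/-- Recovery of an alternating map from its values on tuples of basis vectors. -/
theorem exists_altCoords_leftInverse [FiniteDimensional ℝ N] :
    ∃ T : ((Fin k → Fin (Module.finrank ℝ W)) → N) →L[ℝ] W [⋀^Fin k]→L[ℝ] N,
      ∀ c, T (altCoords c) = c := by
  obtain ⟨T, hT⟩ := LinearMap.exists_leftInverse_of_injective
    (altCoords : W [⋀^Fin k]→L[ℝ] N →ₗ[ℝ] _) (LinearMap.ker_eq_bot.2 altCoords_injective)
  exact ⟨LinearMap.toContinuousLinearMap T, fun c => LinearMap.congr_fun hT c⟩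

theorem contDiff_alt_apply :
    ContDiff ℝ ∞ (fun z : (W [⋀^Fin k]→L[ℝ] N) × (Fin k → W) => z.1 z.2) := by
  have h : (fun z : (W [⋀^Fin k]→L[ℝ] N) × (Fin k → W) => z.1 z.2) =
      fun z => ∑ r : Fin k → Fin (Module.finrank ℝ W),
      (∏ i, (LinearMap.toContinuousLinearMap ((Module.finBasis ℝ W).coord (r i))) (z.2 i)) •
        (ContinuousAlternatingMap.apply ℝ W N (fun i => Module.finBasis ℝ W (r i))) z.1 :=
    funext fun z => alt_apply_eq_sum_basis z.1.toAlternatingMap z.2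
  rw [h]
  refine ContDiff.sum fun r _ => ContDiff.smul (contDiff_prod fun i _ => ?_) ?_
  · exact (ContinuousLinearMap.contDiff _).comp ((contDiff_apply ℝ W i).comp contDiff_snd)
  · exact (ContinuousLinearMap.contDiff _).comp contDiff_fst

variable {EM : Type*} [NormedAddCommGroup EM] [NormedSpace ℝ EM]
    {HM : Type*} [TopologicalSpace HM] {I : ModelWithCorners ℝ EM HM}
    {M : Type*} [TopologicalSpace M] [ChartedSpace HM M]

theorem contMDiffAt_toContAlt [FiniteDimensional ℝ N] {c : M → W [⋀^Fin k]→ₗ[ℝ] N} {p : M}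
    (h : ∀ v, ContMDiffAt I 𝓘(ℝ, N) ∞ (fun q => c q v) p) :
    ContMDiffAt I 𝓘(ℝ, W [⋀^Fin k]→L[ℝ] N) ∞ (fun q => toContAlt (c q)) p := by
  obtain ⟨T, hT⟩ := exists_altCoords_leftInverse (W := W) (N := N) (k := k)
  have h1 : ContMDiffAt I 𝓘(ℝ, (Fin k → Fin (Module.finrank ℝ W)) → N) ∞
      (fun q => altCoords (toContAlt (c q))) p := contMDiffAt_pi_space.2 fun r => h _
  have h2 := T.contMDiff.contMDiffAt.comp p h1
  refine h2.congr_of_eventuallyEq (Eventually.of_forall fun q => (hT _).symm)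

theorem contMDiffAt_alt_apply {g : M → W [⋀^Fin k]→L[ℝ] N} {c : Fin k → M → W} {p : M}
    (hg : ContMDiffAt I 𝓘(ℝ, W [⋀^Fin k]→L[ℝ] N) ∞ g p)
    (hc : ∀ i, ContMDiffAt I 𝓘(ℝ, W) ∞ (c i) p) :
    ContMDiffAt I 𝓘(ℝ, N) ∞ (fun q => g q (fun i => c i q)) p :=
  (contDiff_alt_apply.contMDiff.contMDiffAt).comp (f := fun q => (g q, fun i => c i q)) p
    (hg.prodMk_space (contMDiffAt_pi_space.2 hc))

omit [FiniteDimensional ℝ W] in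
theorem dirDeriv_alt_apply {g : M → W [⋀^Fin k]→L[ℝ] N} {c : Fin k → M → W} {p : M}
    (hg : ContMDiffAt I 𝓘(ℝ, W [⋀^Fin k]→L[ℝ] N) ∞ g p)
    (hc : ∀ i, ContMDiffAt I 𝓘(ℝ, W) ∞ (c i) p) (v : TangentSpace I p) :
    dirDeriv I (fun q => g q (fun i => c i q)) p v = dirDeriv I g p v (fun i => c i p) +
      ∑ i, g p (Function.update (fun j => c j p) i (dirDeriv I (c i) p v)) := by
  have hc' : MDifferentiableAt I 𝓘(ℝ, Fin k → W) (fun q i => c i q) p :=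
    (contMDiffAt_pi_space.2 hc).mdifferentiableAt (by simp)
  have hg' := mdiffAt_of_contMDiffAt hg
  have h1 := (hasFDerivAt_fst (𝕜 := ℝ) (p := (g p, fun i => c i p))).continuousAlternatingMap_apply
    (g := fun i (z : (W [⋀^Fin k]→L[ℝ] N) × (Fin k → W)) => z.2 i)
    (g' := fun i => (ContinuousLinearMap.proj i).comp (ContinuousLinearMap.snd ℝ _ _))
    (fun i => ((ContinuousLinearMap.proj (R := ℝ) i).comp
      (ContinuousLinearMap.snd ℝ (W [⋀^Fin k]→L[ℝ] N) (Fin k → W))).hasFDerivAt)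
  have h2 := dirDeriv_comp (f := fun q => (g q, fun i => c i q)) h1.differentiableAt
    (hg'.prodMk_space hc') v
  refine h2.trans ?_
  rw [h1.fderiv, dirDeriv_prodMk hg' hc', dirDeriv_pi hc']
  simp

end ContAlt

/-! ### Algebroids with local frames -/

section Frames

variable {𝕜 : Type*} [RCLike 𝕜]
    {EM : Type*} [NormedAddCommGroup EM] [NormedSpace ℝ EM]
    {HM : Type*} [TopologicalSpace HM] {I : ModelWithCorners ℝ EM HM}
    {M : Type*} [TopologicalSpace M] [ChartedSpace HM M]

/-- A local frame near `p`, modelled on the vector space `W`: globally defined smooth sections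
`sec w` that depend linearly on `w` and span the fibres near `p`, and the coordinates with respect
to them. The bilinear map `B` consists of the structure constants of the bracket at `p`. -/
structure AFrame (A : AlgebroidData I M) (W : Type*) [NormedAddCommGroup W] [NormedSpace ℝ W]
    (p : M) where
  coord : ∀ q, A.Fib q →ₗ[ℝ] W
  sec : W →ₗ[ℝ] ∀ q, A.Fib q
  B : W →ₗ[ℝ] W →ₗ[ℝ] W
  isSmooth_sec : ∀ w, A.IsSmooth (sec w)
  coord_sec : ∀ᶠ q in 𝓝 p, ∀ w, coord q (sec w q) = w
  sec_coord : ∀ᶠ q in 𝓝 p, ∀ v, sec (coord q v) q = v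
  smooth_coord : ∀ X, A.IsSmooth X → ContMDiffAt I 𝓘(ℝ, W) ∞ (fun q => coord q (X q)) p
  B_skew : ∀ w w', B w w' = -B w' w
  bracket : ∀ X Y, A.IsSmooth X → A.IsSmooth Y → coord p (A.bracket X Y p) =
    B (coord p (X p)) (coord p (Y p)) + dirDeriv I (fun q => coord q (Y q)) p (A.anchor p (X p)) -
      dirDeriv I (fun q => coord q (X q)) p (A.anchor p (Y p))

/-- The properties of the standard constructions of algebroids that the calculus of forms rests
on. The Jacobi identity plays no role. -/
structure IsAlgebroid [IsManifold I ∞ M] (A : AlgebroidData I M) (W : Type*) [NormedAddCommGroup W]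
    [NormedSpace ℝ W] : Prop where
  zero : A.IsSmooth 0
  add : ∀ X Y, A.IsSmooth X → A.IsSmooth Y → A.IsSmooth (X + Y)
  smul : ∀ (r : ℝ) X, A.IsSmooth X → A.IsSmooth (r • X)
  anchor_smooth : ∀ X, A.IsSmooth X →
    ContMDiff I I.tangent ∞ (fun x => (⟨x, A.anchor x (X x)⟩ : TangentBundle I M))
  anchor_bracket : ∀ X Y, A.IsSmooth X → A.IsSmooth Y → ∀ x, A.anchor x (A.bracket X Y x) =
    VectorField.mlieBracket I (fun y => A.anchor y (X y)) (fun y => A.anchor y (Y y)) x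
  frame : ∀ p, Nonempty (AFrame A W p)

/-- The form `τ` is smooth near `p`. -/
def SmoothFormAt {A : AlgebroidData I M} {k : ℕ} (τ : A.Form 𝕜 k) (p : M) : Prop :=
  ∀ X : Fin k → ∀ x, A.Fib x, (∀ i, A.IsSmooth (X i)) →
    ContMDiffAt I 𝓘(ℝ, 𝕜) ∞ (fun x => τ x (fun i => X i x)) p

/-- The form `τ'` is the differential of `τ` at the point `p`. -/
def IsDifferentialAt {A : AlgebroidData I M} {k : ℕ} (τ : A.Form 𝕜 k) (τ' : A.Form 𝕜 (k + 1))
    (p : M) : Prop :=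
  ∀ X : Fin (k + 1) → ∀ x, A.Fib x, (∀ i, A.IsSmooth (X i)) →
    τ' p (fun i => X i p) = A.koszul τ X p

theorem isSmoothForm_iff {A : AlgebroidData I M} {k : ℕ} {τ : A.Form 𝕜 k} :
    A.IsSmoothForm τ ↔ ∀ p, SmoothFormAt τ p :=
  ⟨fun h p X hX => h X hX p, fun h X hX p => h p X hX⟩

theorem isDifferential_iff {A : AlgebroidData I M} {k : ℕ} {τ : A.Form 𝕜 k}
    {τ' : A.Form 𝕜 (k + 1)} : A.IsDifferential τ τ' ↔ ∀ p, IsDifferentialAt τ τ' p :=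
  ⟨fun h p X hX => h X hX p, fun h X hX p => h p X hX⟩

/-- A bundle map `φ` over `f` is compatible with anchors and brackets at `p`, in terms of a frame of
the target near `f p`. -/
structure IsHomAt
    {EN : Type*} [NormedAddCommGroup EN] [NormedSpace ℝ EN]
    {HN : Type*} [TopologicalSpace HN] {J : ModelWithCorners ℝ EN HN}
    {N : Type*} [TopologicalSpace N] [ChartedSpace HN N]
    {W : Type*} [NormedAddCommGroup W] [NormedSpace ℝ W]
    {A₁ : AlgebroidData I M} {A₂ : AlgebroidData J N} {f : M → N}
    (φ : ∀ x, A₁.Fib x →ₗ[ℝ] A₂.Fib (f x)) (p : M) (fr : AFrame A₂ W (f p)) : Prop where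
  map_smooth : ContMDiffAt I J ∞ f p
  anchor : ∀ v, A₂.anchor (f p) (φ p v) = mfderiv I J f p (A₁.anchor p v)
  smooth_coord : ∀ X, A₁.IsSmooth X →
    ContMDiffAt I 𝓘(ℝ, W) ∞ (fun q => fr.coord (f q) (φ q (X q))) p
  bracket : ∀ X Y, A₁.IsSmooth X → A₁.IsSmooth Y → fr.coord (f p) (φ p (A₁.bracket X Y p)) =
    fr.B (fr.coord (f p) (φ p (X p))) (fr.coord (f p) (φ p (Y p))) +
      dirDeriv I (fun q => fr.coord (f q) (φ q (Y q))) p (A₁.anchor p (X p)) -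
      dirDeriv I (fun q => fr.coord (f q) (φ q (X q))) p (A₁.anchor p (Y p))

section Basic

variable {W : Type*} [NormedAddCommGroup W] [NormedSpace ℝ W]
variable {A : AlgebroidData I M} {p : M}

theorem AFrame.coord_sec_self (fr : AFrame A W p) (w : W) : fr.coord p (fr.sec w p) = w :=
  fr.coord_sec.self_of_nhds w

theorem AFrame.sec_coord_self (fr : AFrame A W p) (v : A.Fib p) : fr.sec (fr.coord p v) p = v :=
  fr.sec_coord.self_of_nhds v

theorem AFrame.coord_injective (fr : AFrame A W p) : Function.Injective (fr.coord p) :=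
  fun v v' hv => by rw [← fr.sec_coord_self v, hv, fr.sec_coord_self]

theorem AFrame.isHomAt_id (fr : AFrame A W p) :
    IsHomAt (A₁ := A) (A₂ := A) (f := id) (fun _ => LinearMap.id) p fr where
  map_smooth := contMDiffAt_id
  anchor v := by rw [mfderiv_id]; rfl
  smooth_coord := fr.smooth_coord
  bracket := fr.bracket

/-- The components of a form with respect to a frame. -/
def AFrame.repA (fr : AFrame A W p) {k : ℕ} (τ : A.Form 𝕜 k) (q : M) : W [⋀^Fin k]→ₗ[ℝ] 𝕜 :=
  (τ q).compLinearMap (LinearMap.proj q ∘ₗ fr.sec)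

theorem AFrame.repA_apply (fr : AFrame A W p) {k : ℕ} (τ : A.Form 𝕜 k) (q : M) (w : Fin k → W) :
    fr.repA τ q w = τ q (fun i => fr.sec (w i) q) := rfl

theorem AFrame.exists_section_eq (fr : AFrame A W p) (v : A.Fib p) :
    ∃ X, A.IsSmooth X ∧ X p = v :=
  ⟨fr.sec (fr.coord p v), fr.isSmooth_sec _, fr.sec_coord_self v⟩

variable [IsManifold I ∞ M]

/-- The smooth sections as a vector space. -/
def IsAlgebroid.sections (h : IsAlgebroid A W) : Submodule ℝ (∀ x, A.Fib x) where
  carrier := {X | A.IsSmooth X}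
  add_mem' {X Y} hX hY := h.add X Y hX hY
  zero_mem' := h.zero
  smul_mem' r X hX := h.smul r X hX

/-- Evaluation of smooth sections at a point. -/
def IsAlgebroid.ev (h : IsAlgebroid A W) (p : M) : h.sections →ₗ[ℝ] A.Fib p :=
  LinearMap.proj p ∘ₗ h.sections.subtype

theorem IsAlgebroid.ev_apply (h : IsAlgebroid A W) (p : M) (X : h.sections) :
    h.ev p X = (X : ∀ x, A.Fib x) p := rfl

theorem IsAlgebroid.pullL_ev_injective (h : IsAlgebroid A W) (p : M) {k : ℕ}
    {c c' : A.Fib p [⋀^Fin k]→ₗ[ℝ] 𝕜} (hc : pullL (h.ev p) c = pullL (h.ev p) c') : c = c' := by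
  obtain ⟨fr⟩ := h.frame p
  ext v
  choose X hX hv using fun i => fr.exists_section_eq (v i)
  have := congrArg (fun m => m (fun i => (⟨X i, hX i⟩ : h.sections))) hc
  simp only [pullL_apply, h.ev_apply, hv] at this
  exact this

theorem IsAlgebroid.smoothForm_mdiff {h : IsAlgebroid A W} {k : ℕ} {τ : A.Form 𝕜 k}
    (hτ : SmoothFormAt τ p) (Y : Fin k → h.sections) :
    MDifferentiableAt I 𝓘(ℝ, 𝕜) (fun q => pullL (h.ev q) (τ q) Y) p :=
  mdiffAt_of_contMDiffAt (hτ (fun i => Y i) fun i => (Y i).2)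

/-- The derivatives at `p` of the values of a form on smooth sections. -/
def IsAlgebroid.formD (h : IsAlgebroid A W) {k : ℕ} {τ : A.Form 𝕜 k} (hτ : SmoothFormAt τ p) :
    h.sections →ₗ[ℝ] h.sections [⋀^Fin k]→ₗ[ℝ] 𝕜 where
  toFun X :=
    { toFun := fun Y => dirDeriv I (fun q => pullL (h.ev q) (τ q) Y) p (A.anchor p (h.ev p X))
      map_update_add' := by
        intro _ Y i Z Z'
        rw [← dirDeriv_add (h.smoothForm_mdiff hτ _) (h.smoothForm_mdiff hτ _)]
        congr 1
        funext q
        convert (pullL (h.ev q) (τ q)).map_update_add Y i Z Z'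
      map_update_smul' := by
        intro _ Y i r Z
        rw [← dirDeriv_const_smul r (h.smoothForm_mdiff hτ _)]
        congr 1
        funext q
        convert (pullL (h.ev q) (τ q)).map_update_smul Y i r Z
      map_eq_zero_of_eq' := by
        intro Y i j hij hne
        have : (fun q => pullL (h.ev q) (τ q) Y) = fun _ => 0 :=
          funext fun q => (pullL (h.ev q) (τ q)).map_eq_zero_of_eq Y hij hne
        change dirDeriv I (fun q => pullL (h.ev q) (τ q) Y) p _ = 0
        rw [this, dirDeriv_const] }
  map_add' X X' := by
    ext Y
    change dirDeriv I (fun q => pullL (h.ev q) (τ q) Y) p (A.anchor p (h.ev p (X + X'))) =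
      dirDeriv I (fun q => pullL (h.ev q) (τ q) Y) p (A.anchor p (h.ev p X)) +
        dirDeriv I (fun q => pullL (h.ev q) (τ q) Y) p (A.anchor p (h.ev p X'))
    rw [map_add, map_add, dirDeriv_add_vec]
  map_smul' r X := by
    ext Y
    change dirDeriv I (fun q => pullL (h.ev q) (τ q) Y) p (A.anchor p (h.ev p (r • X))) =
      r • dirDeriv I (fun q => pullL (h.ev q) (τ q) Y) p (A.anchor p (h.ev p X))
    rw [map_smul, map_smul, dirDeriv_smul_vec]

theorem IsAlgebroid.formD_apply (h : IsAlgebroid A W) {k : ℕ} {τ : A.Form 𝕜 k}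
    (hτ : SmoothFormAt τ p) (X : h.sections) (Y : Fin k → h.sections) :
    h.formD hτ X Y =
      dirDeriv I (fun q => pullL (h.ev q) (τ q) Y) p (A.anchor p (h.ev p X)) := rfl

theorem AFrame.coord_mdiff (fr : AFrame A W p) {h : IsAlgebroid A W} (X : h.sections) :
    MDifferentiableAt I 𝓘(ℝ, W) (fun q => fr.coord q (h.ev q X)) p :=
  mdiffAt_of_contMDiffAt (fr.smooth_coord X X.2)

theorem IsAlgebroid.coord_bracket (h : IsAlgebroid A W) (fr : AFrame A W p) (X Y : h.sections) :
    fr.coord p (A.bracket X Y p) = fr.B (fr.coord p (h.ev p X)) (fr.coord p (h.ev p Y)) +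
      dirDeriv I (fun q => fr.coord q (h.ev q Y)) p (A.anchor p (h.ev p X)) -
      dirDeriv I (fun q => fr.coord q (h.ev q X)) p (A.anchor p (h.ev p Y)) :=
  fr.bracket X Y X.2 Y.2

/-- The bracket at the point `p` as a bilinear map on smooth sections. -/
def IsAlgebroid.br (h : IsAlgebroid A W) (p : M) : h.sections →ₗ[ℝ] h.sections →ₗ[ℝ] A.Fib p :=
  LinearMap.mk₂ ℝ (fun X Y => A.bracket X Y p)
    (fun X X' Y => by
      obtain ⟨fr⟩ := h.frame p
      refine fr.coord_injective ?_
      simp only [h.coord_bracket fr, map_add, LinearMap.add_apply, dirDeriv_add_vec,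
        dirDeriv_add (fr.coord_mdiff X) (fr.coord_mdiff X')]
      abel)
    (fun r X Y => by
      obtain ⟨fr⟩ := h.frame p
      refine fr.coord_injective ?_
      simp only [h.coord_bracket fr, map_smul, LinearMap.smul_apply, dirDeriv_smul_vec,
        dirDeriv_const_smul r (fr.coord_mdiff X)]
      module)
    (fun X Y Y' => by
      obtain ⟨fr⟩ := h.frame p
      refine fr.coord_injective ?_
      simp only [h.coord_bracket fr, map_add, dirDeriv_add_vec,
        dirDeriv_add (fr.coord_mdiff Y) (fr.coord_mdiff Y')]
      abel)
    (fun r X Y => by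
      obtain ⟨fr⟩ := h.frame p
      refine fr.coord_injective ?_
      simp only [h.coord_bracket fr, map_smul, dirDeriv_smul_vec,
        dirDeriv_const_smul r (fr.coord_mdiff Y)]
      module)

theorem IsAlgebroid.br_apply (h : IsAlgebroid A W) (p : M) (X Y : h.sections) :
    h.br p X Y = A.bracket X Y p := rfl

theorem IsAlgebroid.br_skew (h : IsAlgebroid A W) (p : M) (X Y : h.sections) :
    h.br p X Y = -h.br p Y X := by
  obtain ⟨fr⟩ := h.frame p
  refine fr.coord_injective ?_
  rw [map_neg, br_apply, br_apply, h.coord_bracket fr, h.coord_bracket fr, fr.B_skew]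
  abel

/-- The Koszul formula as an antisymmetrisation. -/
theorem IsAlgebroid.koszul_eq_chev (h : IsAlgebroid A W) {k : ℕ} {τ : A.Form 𝕜 k}
    (hτ : SmoothFormAt τ p) (Y : Fin (k + 1) → h.sections) :
    A.koszul τ (fun i => Y i) p = chev (h.ev p) (h.br p) (h.formD hτ) (τ p) Y := by
  have hs : ∀ (n : ℕ) (z : 𝕜), (-1 : ℤ) ^ n • z = (-1 : 𝕜) ^ n * z := by
    intro n z
    rcases neg_one_pow_eq_or ℤ n with h | h <;> rcases Nat.even_or_odd n with h' | h' <;>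
      simp [h'.neg_one_pow]
  rw [AlgebroidData.koszul, chev, AlternatingMap.sub_apply, sub_eq_add_neg,
    AlternatingMap.alternatizeUncurryFin_apply]
  congr 1
  · refine Finset.sum_congr rfl fun i _ => ?_
    rw [hs]
    rfl
  · cases k with
    | zero => simp [AlgebroidData.koszulBracketSum, bracketTerm]
    | succ k =>
      rw [AlternatingMap.smul_apply, bracketTerm_succ_apply _ _ (h.br_skew p)]
      refine Finset.sum_congr rfl fun j _ => Finset.sum_congr rfl fun i _ => ?_
      rw [hs]
      rfl

theorem IsAlgebroid.isDifferentialAt_iff_chev (h : IsAlgebroid A W) {k : ℕ} {τ : A.Form 𝕜 k}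
    (hτ : SmoothFormAt τ p) (τ' : A.Form 𝕜 (k + 1)) :
    IsDifferentialAt τ τ' p ↔
      pullL (h.ev p) (τ' p) = chev (h.ev p) (h.br p) (h.formD hτ) (τ p) := by
  constructor
  · intro hd
    ext Y
    rw [← h.koszul_eq_chev hτ]
    exact hd _ fun i => (Y i).2
  · intro hd X hX
    have := congrArg (fun m => m (fun i => (⟨X i, hX i⟩ : h.sections))) hd
    exact this.trans (h.koszul_eq_chev hτ (fun i => ⟨X i, hX i⟩)).symm

end Basic

end Frames

section Pullback

variable {𝕜 : Type*} [RCLike 𝕜]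
    {EM : Type*} [NormedAddCommGroup EM] [NormedSpace ℝ EM]
    {HM : Type*} [TopologicalSpace HM] {I : ModelWithCorners ℝ EM HM}
    {M : Type*} [TopologicalSpace M] [ChartedSpace HM M] [IsManifold I ∞ M]
    {EN : Type*} [NormedAddCommGroup EN] [NormedSpace ℝ EN]
    {HN : Type*} [TopologicalSpace HN] {J : ModelWithCorners ℝ EN HN}
    {N : Type*} [TopologicalSpace N] [ChartedSpace HN N] [IsManifold J ∞ N]
    {W₁ : Type*} [NormedAddCommGroup W₁] [NormedSpace ℝ W₁]
    {W : Type*} [NormedAddCommGroup W] [NormedSpace ℝ W] [FiniteDimensional ℝ W]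
    {A₁ : AlgebroidData I M} {A : AlgebroidData J N}

omit [IsManifold J ∞ N] in
theorem AFrame.contMDiffAt_rep {n : N} (fr : AFrame A W n) {k : ℕ} {τ : A.Form 𝕜 k}
    (hτ : SmoothFormAt τ n) :
    ContMDiffAt J 𝓘(ℝ, W [⋀^Fin k]→L[ℝ] 𝕜) ∞ (fun q => toContAlt (fr.repA τ q)) n :=
  contMDiffAt_toContAlt fun w => hτ (fun i => fr.sec (w i)) fun _ => fr.isSmooth_sec _

/-- The derivatives of the components of a form along the vectors of a frame. -/
def AFrame.repD {n : N} (fr : AFrame A W n) {k : ℕ} (τ : A.Form 𝕜 k) :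
    W →ₗ[ℝ] W [⋀^Fin k]→ₗ[ℝ] 𝕜 where
  toFun w := (dirDeriv J (fun q => toContAlt (fr.repA τ q)) n
    (A.anchor n (fr.sec w n))).toAlternatingMap
  map_add' w w' := by
    rw [map_add, Pi.add_apply, map_add, dirDeriv_add_vec]
    rfl
  map_smul' r w := by
    rw [map_smul, Pi.smul_apply, map_smul, dirDeriv_smul_vec]
    rfl

/-- The differential of a form at a point in the coordinates of a frame. -/
def AFrame.dhat {n : N} (fr : AFrame A W n) {k : ℕ} (τ : A.Form 𝕜 k) :
    W [⋀^Fin (k + 1)]→ₗ[ℝ] 𝕜 :=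
  chev LinearMap.id fr.B (fr.repD τ) (fr.repA τ n)

variable {f : M → N} {φ : ∀ x, A₁.Fib x →ₗ[ℝ] A.Fib (f x)} {p : M}

omit [IsManifold I ∞ M] [FiniteDimensional ℝ W] [IsManifold J ∞ N] in
theorem IsHomAt.pullbackForm_eventuallyEq {fr : AFrame A W (f p)} (hφ : IsHomAt φ p fr) {k : ℕ}
    (τ : A.Form 𝕜 k) (X : Fin k → ∀ x, A₁.Fib x) :
    (fun q => pullbackForm φ τ q (fun i => X i q)) =ᶠ[𝓝 p]
      fun q => fr.repA τ (f q) (fun i => fr.coord (f q) (φ q (X i q))) := by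
  filter_upwards [hφ.map_smooth.continuousAt.eventually fr.sec_coord] with q hq
  rw [fr.repA_apply]
  simp only [hq]
  rfl

omit [IsManifold I ∞ M] [IsManifold J ∞ N] in
theorem IsHomAt.smoothFormAt {fr : AFrame A W (f p)} (hφ : IsHomAt φ p fr) {k : ℕ}
    {τ : A.Form 𝕜 k} (hτ : SmoothFormAt τ (f p)) : SmoothFormAt (pullbackForm φ τ) p := by
  intro X hX
  refine ContMDiffAt.congr_of_eventuallyEq ?_ (hφ.pullbackForm_eventuallyEq τ X)
  exact contMDiffAt_alt_apply (g := fun q => toContAlt (fr.repA τ (f q)))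
    ((fr.contMDiffAt_rep hτ).comp p hφ.map_smooth) fun i => hφ.smooth_coord _ (hX i)

omit [IsManifold J ∞ N] in
/-- The Koszul formula for a pull-back in terms of a frame of the target. -/
theorem IsHomAt.koszul_pullbackForm (h₁ : IsAlgebroid A₁ W₁) {fr : AFrame A W (f p)}
    (hφ : IsHomAt φ p fr) {k : ℕ} {τ : A.Form 𝕜 k} (hτ : SmoothFormAt τ (f p))
    (Y : Fin (k + 1) → h₁.sections) :
    A₁.koszul (pullbackForm φ τ) (fun i => Y i) p =
      fr.dhat τ (fun i => fr.coord (f p) (φ p (h₁.ev p (Y i)))) := by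
  have hc : ∀ X : h₁.sections, ContMDiffAt I 𝓘(ℝ, W) ∞
      (fun q => fr.coord (f q) (φ q (h₁.ev q X))) p := fun X => hφ.smooth_coord X X.2
  let T : h₁.sections →ₗ[ℝ] h₁.sections →ₗ[ℝ] W := LinearMap.mk₂ ℝ
    (fun X Z => dirDeriv I (fun q => fr.coord (f q) (φ q (h₁.ev q Z))) p (A₁.anchor p (h₁.ev p X)))
    (fun X X' Z => by rw [map_add, map_add, dirDeriv_add_vec])
    (fun r X Z => by rw [map_smul, map_smul, dirDeriv_smul_vec])
    (fun X Z Z' => by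
      simp only [map_add]
      rw [dirDeriv_add (mdiffAt_of_contMDiffAt (hc Z))
        (mdiffAt_of_contMDiffAt (hc Z'))])
    (fun r X Z => by
      simp only [map_smul]
      rw [dirDeriv_const_smul r (mdiffAt_of_contMDiffAt (hc Z))])
  have hpb : pullbackForm φ τ p = pullL (fr.coord (f p) ∘ₗ φ p) (fr.repA τ (f p)) := by
    ext v
    change τ (f p) _ = τ (f p) _
    congr 1
    funext i
    exact (fr.sec_coord_self _).symm
  rw [h₁.koszul_eq_chev (hφ.smoothFormAt hτ), hpb]
  have key := chev_pull (h₁.ev p) (h₁.br p) (fr.coord (f p) ∘ₗ φ p) fr.B T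
    (h₁.formD (hφ.smoothFormAt hτ)) (fr.repD τ) (fr.repA τ (f p)) (fun X v => ?_) (fun X Z => ?_)
  · rw [key]
    rfl
  · rw [h₁.formD_apply]
    have h1 := dirDeriv_congr (I := I) (hφ.pullbackForm_eventuallyEq τ fun i => v i)
      (A₁.anchor p (h₁.ev p X))
    have hg : ContMDiffAt I 𝓘(ℝ, W [⋀^Fin k]→L[ℝ] 𝕜) ∞ (fun q => toContAlt (fr.repA τ (f q))) p :=
      (fr.contMDiffAt_rep hτ).comp p hφ.map_smooth
    have h2 := dirDeriv_alt_apply hg (fun i => hc (v i)) (A₁.anchor p (h₁.ev p X))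
    refine (h1.trans h2).trans ?_
    congr 1
    rw [dirDeriv_comp_map (mdiffAt_of_contMDiffAt (fr.contMDiffAt_rep hτ))
      (hφ.map_smooth.mdifferentiableAt (by simp)), ← hφ.anchor]
    have h3 := fr.sec_coord_self (φ p (h₁.ev p X))
    exact (congrArg (fun z => (dirDeriv J (fun q => toContAlt (fr.repA τ q)) (f p)
      (A.anchor (f p) z)) (fun i => fr.coord (f p) (φ p (h₁.ev p (v i))))) h3).symm
  · exact hφ.bracket X Z X.2 Z.2

theorem AFrame.isDifferentialAt_iff (h : IsAlgebroid A W) {n : N} (fr : AFrame A W n) {k : ℕ}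
    {τ : A.Form 𝕜 k} (hτ : SmoothFormAt τ n) (τ' : A.Form 𝕜 (k + 1)) :
    IsDifferentialAt τ τ' n ↔ fr.repA τ' n = fr.dhat τ := by
  have key := (fr.isHomAt_id).koszul_pullbackForm h hτ
  constructor
  · intro hd
    ext w
    have h1 := hd (fun i => fr.sec (w i)) fun i => fr.isSmooth_sec _
    have h2 := key fun i => ⟨fr.sec (w i), fr.isSmooth_sec _⟩
    refine (h1.trans h2).trans ?_
    congr 1
    funext i
    exact fr.coord_sec_self _
  · intro hd X hX
    refine Eq.trans ?_ (key fun i => ⟨X i, hX i⟩).symm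
    rw [← hd]
    change τ' n _ = τ' n _
    congr 1
    funext i
    exact (fr.sec_coord_self _).symm

/-- The differential is natural. -/
theorem IsHomAt.isDifferentialAt (h₁ : IsAlgebroid A₁ W₁) (h : IsAlgebroid A W)
    {fr : AFrame A W (f p)} (hφ : IsHomAt φ p fr) {k : ℕ} {τ : A.Form 𝕜 k}
    {τ' : A.Form 𝕜 (k + 1)} (hτ : SmoothFormAt τ (f p)) (hd : IsDifferentialAt τ τ' (f p)) :
    IsDifferentialAt (pullbackForm φ τ) (pullbackForm φ τ') p := by
  intro X hX
  have key := hφ.koszul_pullbackForm h₁ hτ fun i => ⟨X i, hX i⟩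
  rw [← (fr.isDifferentialAt_iff h hτ τ').1 hd] at key
  refine Eq.trans ?_ key.symm
  change τ' (f p) _ = τ' (f p) _
  congr 1
  funext i
  exact (fr.sec_coord_self _).symm

end Pullback

section FormCalculus

variable {𝕜 : Type*} [RCLike 𝕜]
    {EM : Type*} [NormedAddCommGroup EM] [NormedSpace ℝ EM]
    {HM : Type*} [TopologicalSpace HM] {I : ModelWithCorners ℝ EM HM}
    {M : Type*} [TopologicalSpace M] [ChartedSpace HM M]
    {A : AlgebroidData I M} {p : M} {k l : ℕ}

theorem contMDiffAt_fun_smul {V : Type*} [NormedAddCommGroup V] [NormedSpace ℝ V] {a : M → ℝ}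
    {g : M → V} (ha : ContMDiffAt I 𝓘(ℝ, ℝ) ∞ a p) (hg : ContMDiffAt I 𝓘(ℝ, V) ∞ g p) :
    ContMDiffAt I 𝓘(ℝ, V) ∞ (fun x => a x • g x) p := ha.smul hg

/-- The product of a form with a real function. -/
def fsmul (f : M → ℝ) (τ : A.Form 𝕜 k) : A.Form 𝕜 k := fun x => f x • τ x

/-- The differential of a function as a covector at each point. -/
def dcov (A : AlgebroidData I M) (f : M → ℝ) (x : M) : A.Fib x →ₗ[ℝ] ℝ where
  toFun v := dirDeriv I f x (A.anchor x v)
  map_add' v w := by rw [map_add, dirDeriv_add_vec]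
  map_smul' r v := by rw [map_smul, dirDeriv_smul_vec]; rfl

/-- The form `df ∧ τ`. -/
def dwedge (f : M → ℝ) (τ : A.Form 𝕜 k) : A.Form 𝕜 (k + 1) := fun x => covecWedge (dcov A f x) (τ x)

theorem SmoothFormAt.add {τ σ : A.Form 𝕜 k} (hτ : SmoothFormAt τ p) (hσ : SmoothFormAt σ p) :
    SmoothFormAt (τ + σ) p := fun X hX => (hτ X hX).add (hσ X hX)

theorem SmoothFormAt.congr {τ σ : A.Form 𝕜 k} (hτ : SmoothFormAt τ p) (h : ∀ᶠ x in 𝓝 p, σ x = τ x) :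
    SmoothFormAt σ p := fun X hX => (hτ X hX).congr_of_eventuallyEq (by
  filter_upwards [h] with x hx
  rw [hx])

theorem smoothFormAt_zero : SmoothFormAt (0 : A.Form 𝕜 k) p := fun _ _ => contMDiffAt_const

theorem SmoothFormAt.fsmul {τ : A.Form 𝕜 k} (hτ : SmoothFormAt τ p) {f : M → ℝ}
    (hf : ContMDiffAt I 𝓘(ℝ, ℝ) ∞ f p) : SmoothFormAt (fsmul f τ) p :=
  fun X hX => hf.smul (hτ X hX)

theorem SmoothFormAt.neg {τ : A.Form 𝕜 k} (hτ : SmoothFormAt τ p) : SmoothFormAt (-τ) p :=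
  fun X hX => (hτ X hX).neg

theorem SmoothFormAt.sum {ι : Type*} {s : Finset ι} {τ : ι → A.Form 𝕜 k}
    (h : ∀ i ∈ s, SmoothFormAt (τ i) p) : SmoothFormAt (∑ i ∈ s, τ i) p := by
  classical
  induction s using Finset.induction_on with
  | empty => simpa using smoothFormAt_zero
  | insert i s hi ih =>
    rw [Finset.sum_insert hi]
    exact (h i (Finset.mem_insert_self i s)).add (ih fun j hj => h j (Finset.mem_insert_of_mem hj))

theorem SmoothFormAt.wedge {τ : A.Form 𝕜 k} {σ : A.Form 𝕜 l} (hτ : SmoothFormAt τ p)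
    (hσ : SmoothFormAt σ p) : SmoothFormAt (AlgebroidData.wedge τ σ) p := by
  intro X hX
  have h : (fun x => AlgebroidData.wedge τ σ x (fun i => X i x)) = fun x =>
      ((k.factorial : ℝ) * (l.factorial : ℝ))⁻¹ •
      ∑ s : Equiv.Perm (Fin k ⊕ Fin l), (((Equiv.Perm.sign s : ℤˣ) : ℤ) : ℝ) •
        (τ x (fun i => X (finSumFinEquiv (s (Sum.inl i))) x) *
          σ x (fun i => X (finSumFinEquiv (s (Sum.inr i))) x)) := by
    funext x
    have := factorial_smul_wedgeL_apply (τ x) (σ x) (fun i => X i x)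
    rw [eq_inv_smul_iff₀ (factorial_mul_ne_zero k l)]
    refine this.trans (Finset.sum_congr rfl fun s _ => ?_)
    rw [Int.cast_smul_eq_zsmul, Units.smul_def]
  rw [h]
  refine contMDiffAt_fun_smul contMDiffAt_const (contMDiffAt_finsetSum fun s _ => ?_)
  refine contMDiffAt_fun_smul contMDiffAt_const ?_
  have hm : ContDiff ℝ ∞ (fun z : 𝕜 × 𝕜 => z.1 * z.2) := contDiff_mul
  exact hm.contMDiff.contMDiffAt.comp (f := fun x =>
    (τ x (fun i => X (finSumFinEquiv (s (Sum.inl i))) x),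
      σ x (fun i => X (finSumFinEquiv (s (Sum.inr i))) x))) p
    ((hτ _ fun i => hX _).prodMk_space (hσ _ fun i => hX _))

theorem IsDifferentialAt.congr {τ σ : A.Form 𝕜 k} {τ' : A.Form 𝕜 (k + 1)}
    (hd : IsDifferentialAt τ τ' p) (h : ∀ᶠ x in 𝓝 p, σ x = τ x) : IsDifferentialAt σ τ' p := by
  intro X hX
  rw [hd X hX]
  have h0 := h.self_of_nhds
  unfold AlgebroidData.koszul
  congr 1
  · refine Finset.sum_congr rfl fun i _ => ?_
    congr 1
    refine dirDeriv_congr ?_ _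
    filter_upwards [h] with x hx
    rw [hx]
  · cases k with
    | zero => rfl
    | succ k => simp only [AlgebroidData.koszulBracketSum, h0]

theorem IsDifferentialAt.congr_right {τ : A.Form 𝕜 k} {τ' σ' : A.Form 𝕜 (k + 1)}
    (hd : IsDifferentialAt τ τ' p) (h : σ' p = τ' p) : IsDifferentialAt τ σ' p := by
  intro X hX
  rw [h, hd X hX]

variable [IsManifold I ∞ M] {W : Type*} [NormedAddCommGroup W] [NormedSpace ℝ W]

theorem IsDifferentialAt.add (h : IsAlgebroid A W) {τ σ : A.Form 𝕜 k} {τ' σ' : A.Form 𝕜 (k + 1)}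
    (hd : IsDifferentialAt τ τ' p) (hd' : IsDifferentialAt σ σ' p) (hτ : SmoothFormAt τ p)
    (hσ : SmoothFormAt σ p) : IsDifferentialAt (τ + σ) (τ' + σ') p := by
  rw [h.isDifferentialAt_iff_chev hτ] at hd
  rw [h.isDifferentialAt_iff_chev hσ] at hd'
  rw [h.isDifferentialAt_iff_chev (hτ.add hσ)]
  change pullL (h.ev p) (τ' p + σ' p) = chev _ _ _ (τ p + σ p)
  have : h.formD (hτ.add hσ) = h.formD hτ + h.formD hσ := by
    ext X Y
    exact dirDeriv_add (h.smoothForm_mdiff hτ _) (h.smoothForm_mdiff hσ _) _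
  rw [map_add, hd, hd', this]
  simp only [chev, altU_add, bracketTerm_add, smul_add]
  abel

/-- The Leibniz rule `d(fτ) = df ∧ τ + f dτ`. -/
theorem IsDifferentialAt.fsmul (h : IsAlgebroid A W) {τ : A.Form 𝕜 k} {τ' : A.Form 𝕜 (k + 1)}
    (hd : IsDifferentialAt τ τ' p) (hτ : SmoothFormAt τ p) {f : M → ℝ}
    (hf : ContMDiffAt I 𝓘(ℝ, ℝ) ∞ f p) :
    IsDifferentialAt (fsmul f τ) (dwedge f τ + ThomAlgebroid.fsmul f τ') p := by
  rw [h.isDifferentialAt_iff_chev hτ] at hd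
  rw [h.isDifferentialAt_iff_chev (hτ.fsmul hf)]
  change pullL (h.ev p) (covecWedge (dcov A f p) (τ p) + f p • τ' p) = chev _ _ _ (f p • τ p)
  have : h.formD (hτ.fsmul hf) = f p • h.formD hτ +
      (dcov A f p ∘ₗ h.ev p).smulRight (pullL (h.ev p) (τ p)) := by
    ext X Y
    exact dirDeriv_fun_smul (mdiffAt_of_contMDiffAt hf) (h.smoothForm_mdiff hτ _) _
  rw [map_add, map_smul, hd, this, pullL_covecWedge, covecWedge]
  simp only [chev, altU_add, altU_smul, bracketTerm_smul, smul_sub]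
  rw [smul_comm (f p)]
  abel

theorem IsDifferentialAt.neg (h : IsAlgebroid A W) {τ : A.Form 𝕜 k} {τ' : A.Form 𝕜 (k + 1)}
    (hd : IsDifferentialAt τ τ' p) (hτ : SmoothFormAt τ p) : IsDifferentialAt (-τ) (-τ') p := by
  have h1 := hd.fsmul h hτ (f := fun _ => (-1 : ℝ)) contMDiffAt_const
  have e1 : ThomAlgebroid.fsmul (fun _ => (-1 : ℝ)) τ = -τ := funext fun x => neg_one_smul ℝ (τ x)
  have e2 : ThomAlgebroid.fsmul (fun _ => (-1 : ℝ)) τ' = -τ' := funext fun x => neg_one_smul ℝ (τ' x)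
  rw [e1, e2] at h1
  refine h1.congr_right ?_
  have e3 : dcov A (fun _ : M => (-1 : ℝ)) p = 0 := by
    ext v
    exact dirDeriv_const _ _ _
  change -τ' p = covecWedge (dcov A (fun _ => (-1 : ℝ)) p) (τ p) + -τ' p
  rw [e3, covecWedge]
  have : LinearMap.smulRight (0 : A.Fib p →ₗ[ℝ] ℝ) (τ p) = 0 := by ext; simp
  rw [this, altU_zero, zero_add]

theorem IsDifferentialAt.sub (h : IsAlgebroid A W) {τ σ : A.Form 𝕜 k} {τ' σ' : A.Form 𝕜 (k + 1)}
    (hd : IsDifferentialAt τ τ' p) (hd' : IsDifferentialAt σ σ' p) (hτ : SmoothFormAt τ p)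
    (hσ : SmoothFormAt σ p) : IsDifferentialAt (τ - σ) (τ' - σ') p := by
  rw [sub_eq_add_neg, sub_eq_add_neg]
  exact hd.add h (hd'.neg h hσ) hτ hσ.neg

theorem IsDifferentialAt.sum (h : IsAlgebroid A W) {ι : Type*} {s : Finset ι}
    {τ : ι → A.Form 𝕜 k} {τ' : ι → A.Form 𝕜 (k + 1)}
    (hd : ∀ i ∈ s, IsDifferentialAt (τ i) (τ' i) p) (hτ : ∀ i ∈ s, SmoothFormAt (τ i) p) :
    IsDifferentialAt (∑ i ∈ s, τ i) (∑ i ∈ s, τ' i) p := by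
  classical
  induction s using Finset.induction_on with
  | empty =>
    intro X hX
    exact A.isDifferential_zero k X hX p
  | insert i s hi ih =>
    rw [Finset.sum_insert hi, Finset.sum_insert hi]
    exact (hd i (Finset.mem_insert_self i s)).add h
      (ih (fun j hj => hd j (Finset.mem_insert_of_mem hj))
        fun j hj => hτ j (Finset.mem_insert_of_mem hj)) (hτ i (Finset.mem_insert_self i s))
      (SmoothFormAt.sum fun j hj => hτ j (Finset.mem_insert_of_mem hj))

theorem IsDifferentialAt.unique (h : IsAlgebroid A W) {τ : A.Form 𝕜 k} {τ' τ'' : A.Form 𝕜 (k + 1)}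
    (hd : IsDifferentialAt τ τ' p) (hd' : IsDifferentialAt τ τ'' p) (hτ : SmoothFormAt τ p) :
    τ' p = τ'' p := by
  rw [h.isDifferentialAt_iff_chev hτ] at hd hd'
  exact h.pullL_ev_injective p (hd.trans hd'.symm)

/-- The Leibniz rule for the wedge product. -/
theorem IsDifferentialAt.wedge (h : IsAlgebroid A W) {τ : A.Form 𝕜 k} {τ' : A.Form 𝕜 (k + 1)}
    {σ : A.Form 𝕜 l} {σ' : A.Form 𝕜 (l + 1)} (hd : IsDifferentialAt τ τ' p)
    (hd' : IsDifferentialAt σ σ' p) (hτ : SmoothFormAt τ p) (hσ : SmoothFormAt σ p) :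
    IsDifferentialAt (AlgebroidData.wedge τ σ) (fun x =>
      (AlgebroidData.wedge τ' σ x).domDomCongr (finCongr (Nat.add_right_comm k 1 l)) +
        wedgeSign k l • AlgebroidData.wedge τ σ' x) p := by
  rw [h.isDifferentialAt_iff_chev hτ] at hd
  rw [h.isDifferentialAt_iff_chev hσ] at hd'
  refine (h.isDifferentialAt_iff_chev (hτ.wedge hσ) _).2 ?_
  have hD : ∀ X, h.formD (hτ.wedge hσ) X = wedgeL (h.formD hτ X) (pullL (h.ev p) (σ p)) +
      wedgeL (pullL (h.ev p) (τ p)) (h.formD hσ X) := by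
    intro X
    ext Y
    refine smul_right_injective 𝕜 (factorial_mul_ne_zero k l) ?_
    change _ • dirDeriv I (fun q => pullL (h.ev q) (wedgeL (τ q) (σ q)) Y) p
      (A.anchor p (h.ev p X)) = _ • (wedgeL _ _ Y + wedgeL _ _ Y)
    have hm : MDifferentiableAt I 𝓘(ℝ, 𝕜) (fun q => pullL (h.ev q) (wedgeL (τ q) (σ q)) Y) p :=
      h.smoothForm_mdiff (hτ.wedge hσ) Y
    rw [← dirDeriv_const_smul _ hm, smul_add, factorial_smul_wedgeL_apply,
      factorial_smul_wedgeL_apply, ← Finset.sum_add_distrib]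
    have e : (fun q => ((k.factorial : ℝ) * (l.factorial : ℝ)) •
        pullL (h.ev q) (wedgeL (τ q) (σ q)) Y) = fun q => ∑ s : Equiv.Perm (Fin k ⊕ Fin l),
        (((Equiv.Perm.sign s : ℤˣ) : ℤ) : ℝ) •
        (pullL (h.ev q) (τ q) (fun i => Y (finSumFinEquiv (s (Sum.inl i)))) *
          pullL (h.ev q) (σ q) (fun i => Y (finSumFinEquiv (s (Sum.inr i))))) := by
      funext q
      rw [pullL_wedgeL, factorial_smul_wedgeL_apply]
      refine Finset.sum_congr rfl fun s _ => ?_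
      rw [Int.cast_smul_eq_zsmul, Units.smul_def]
    have hmul : ∀ z : 𝕜 × 𝕜, HasFDerivAt (fun z : 𝕜 × 𝕜 => z.1 * z.2)
        (z.1 • ContinuousLinearMap.snd ℝ 𝕜 𝕜 + z.2 • ContinuousLinearMap.fst ℝ 𝕜 𝕜) z :=
      fun z => (hasFDerivAt_fst (𝕜 := ℝ) (p := z)).mul (hasFDerivAt_snd (𝕜 := ℝ) (p := z))
    have ha := fun s : Equiv.Perm (Fin k ⊕ Fin l) =>
      h.smoothForm_mdiff hτ fun i => Y (finSumFinEquiv (s (Sum.inl i)))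
    have hb := fun s : Equiv.Perm (Fin k ⊕ Fin l) =>
      h.smoothForm_mdiff hσ fun i => Y (finSumFinEquiv (s (Sum.inr i)))
    have hab := fun s : Equiv.Perm (Fin k ⊕ Fin l) =>
      (hmul _).differentiableAt.mdifferentiableAt.comp (f := fun q =>
        (pullL (h.ev q) (τ q) (fun i => Y (finSumFinEquiv (s (Sum.inl i)))),
          pullL (h.ev q) (σ q) (fun i => Y (finSumFinEquiv (s (Sum.inr i)))))) p
          ((ha s).prodMk_space (hb s))
    have hab' : ∀ s : Equiv.Perm (Fin k ⊕ Fin l), MDifferentiableAt I 𝓘(ℝ, 𝕜)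
        (fun q => (((Equiv.Perm.sign s : ℤˣ) : ℤ) : ℝ) •
          (pullL (h.ev q) (τ q) (fun i => Y (finSumFinEquiv (s (Sum.inl i)))) *
            pullL (h.ev q) (σ q) (fun i => Y (finSumFinEquiv (s (Sum.inr i)))))) p :=
      fun s => mdifferentiableAt_const.smul (hab s)
    rw [e, dirDeriv_sum _ fun s _ => hab' s]
    refine Finset.sum_congr rfl fun s _ => ?_
    rw [← smul_add]
    refine (dirDeriv_const_smul _ (hab s) _).trans ?_
    rw [Int.cast_smul_eq_zsmul, Units.smul_def]
    congr 1
    refine (dirDeriv_comp (f := fun q =>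
        (pullL (h.ev q) (τ q) (fun i => Y (finSumFinEquiv (s (Sum.inl i)))),
          pullL (h.ev q) (σ q) (fun i => Y (finSumFinEquiv (s (Sum.inr i))))))
          (hmul _).differentiableAt ((ha s).prodMk_space (hb s)) _).trans ?_
    rw [(hmul _).fderiv, dirDeriv_prodMk (ha s) (hb s)]
    simp only [add_apply, smul_apply,
      ContinuousLinearMap.coe_snd', ContinuousLinearMap.coe_fst', smul_eq_mul]
    rw [add_comm, mul_comm (pullL (h.ev p) (σ p) _)]
    rfl
  have key := chev_wedgeL (h.ev p) (h.br p) _ _ _ (τ p) (σ p) hD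
  rw [← hd, ← hd', ← pullL_wedgeL, ← pullL_wedgeL] at key
  exact key.symm

variable [CompleteSpace EM] [I.Boundaryless]

omit [CompleteSpace EM] in
theorem SmoothFormAt.dwedge (h : IsAlgebroid A W) {τ : A.Form 𝕜 k} (hτ : SmoothFormAt τ p)
    {f : M → ℝ} (hf : ContMDiffAt I 𝓘(ℝ, ℝ) ∞ f p) : SmoothFormAt (dwedge f τ) p := by
  intro X hX
  have e : (fun x => ThomAlgebroid.dwedge f τ x (fun i => X i x)) = fun x => ∑ i : Fin (k + 1),
      (-1 : ℝ) ^ (i : ℕ) • (dirDeriv I f x (A.anchor x (X i x)) •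
        τ x (fun j => X (i.succAbove j) x)) := funext fun x => covecWedge_apply _ _ _
  rw [e]
  refine contMDiffAt_finsetSum fun i _ => ?_
  refine contMDiffAt_fun_smul contMDiffAt_const (contMDiffAt_fun_smul ?_ ?_)
  · exact contMDiffAt_dirDeriv hf (h.anchor_smooth _ (hX i)).contMDiffAt
  · exact hτ _ fun j => hX _

/-- The rule `d(df ∧ τ) = -df ∧ dτ`. -/
theorem IsDifferentialAt.dwedge (h : IsAlgebroid A W) {τ : A.Form 𝕜 k} {τ' : A.Form 𝕜 (k + 1)}
    (hd : IsDifferentialAt τ τ' p) (hτ : SmoothFormAt τ p) {f : M → ℝ}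
    (hf : ContMDiffAt I 𝓘(ℝ, ℝ) ∞ f p) :
    IsDifferentialAt (dwedge f τ) (-ThomAlgebroid.dwedge f τ') p := by
  rw [h.isDifferentialAt_iff_chev hτ] at hd
  rw [h.isDifferentialAt_iff_chev (hτ.dwedge h hf)]
  have hs : ∀ Z : h.sections, MDifferentiableAt I 𝓘(ℝ, ℝ) (fun q => dcov A f q (h.ev q Z)) p :=
    fun Z => mdiffAt_of_contMDiffAt
      (contMDiffAt_dirDeriv hf (h.anchor_smooth _ Z.2).contMDiffAt)
  let S : h.sections →ₗ[ℝ] h.sections →ₗ[ℝ] ℝ := LinearMap.mk₂ ℝ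
    (fun X Z => dirDeriv I (fun q => dcov A f q (h.ev q Z)) p (A.anchor p (h.ev p X)))
    (fun X X' Z => by rw [map_add, map_add, dirDeriv_add_vec])
    (fun r X Z => by rw [map_smul, map_smul, dirDeriv_smul_vec])
    (fun X Z Z' => by
      simp only [map_add]
      rw [dirDeriv_add (hs Z) (hs Z')])
    (fun r X Z => by
      simp only [map_smul]
      rw [← dirDeriv_const_smul r (hs Z)])
  have hS : ∀ X Z, S X Z - S Z X = dcov A f p (h.br p X Z) := by
    intro X Z
    change _ = dirDeriv I f p (A.anchor p (A.bracket X Z p))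
    rw [h.anchor_bracket X Z X.2 Z.2, dirDeriv_mlieBracket hf
      (h.anchor_smooth _ X.2).contMDiffAt (h.anchor_smooth _ Z.2).contMDiffAt]
    rfl
  refine Eq.trans ?_ (chev_covecWedge (h.ev p) (h.br p) (dcov A f p) S hS
    (h.formD (hτ.dwedge h hf)) (h.formD hτ) (τ p) ?_).symm
  · rw [← hd, ← pullL_covecWedge]
    rfl
  · intro X
    ext Y
    have hm : ∀ i : Fin (k + 1), MDifferentiableAt I 𝓘(ℝ, 𝕜) (fun q => dcov A f q (h.ev q (Y i)) •
        pullL (h.ev q) (τ q) (i.removeNth Y)) p := fun i =>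
      (hs (Y i)).smul (h.smoothForm_mdiff hτ _)
    have e : (fun q => pullL (h.ev q) (ThomAlgebroid.dwedge f τ q) Y) = fun q => ∑ i : Fin (k + 1),
        (-1 : ℝ) ^ (i : ℕ) • (dcov A f q (h.ev q (Y i)) • pullL (h.ev q) (τ q) (i.removeNth Y)) :=
      funext fun q => covecWedge_apply _ _ _
    have hm' : ∀ i : Fin (k + 1), MDifferentiableAt I 𝓘(ℝ, 𝕜) (fun q => (-1 : ℝ) ^ (i : ℕ) •
        (dcov A f q (h.ev q (Y i)) • pullL (h.ev q) (τ q) (i.removeNth Y))) p := fun i =>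
      mdifferentiableAt_const.smul (hm i)
    rw [h.formD_apply, e, dirDeriv_sum _ fun i _ => hm' i,
      AlternatingMap.add_apply, covecWedge_apply, covecWedge_apply, ← Finset.sum_add_distrib]
    refine Finset.sum_congr rfl fun i _ => ?_
    rw [dirDeriv_const_smul _ (hm i), ← smul_add,
      dirDeriv_fun_smul (hs (Y i)) (h.smoothForm_mdiff hτ _)]
    exact congrArg (fun z => (-1 : ℝ) ^ (i : ℕ) • z) (add_comm _ _)

end FormCalculus

/-! ### Decompositions of sections along a map -/

section Decomposition

variable
    {EM : Type*} [NormedAddCommGroup EM] [NormedSpace ℝ EM]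
    {HM : Type*} [TopologicalSpace HM] {I : ModelWithCorners ℝ EM HM}
    {M : Type*} [TopologicalSpace M] [ChartedSpace HM M]
    {EN : Type*} [NormedAddCommGroup EN] [NormedSpace ℝ EN]
    {HN : Type*} [TopologicalSpace HN] {J : ModelWithCorners ℝ EN HN}
    {N : Type*} [TopologicalSpace N] [ChartedSpace HN N]
    {W : Type*} [NormedAddCommGroup W] [NormedSpace ℝ W] {A : AlgebroidData J N}

theorem dirDeriv_sum_smul_comp {f : M → N} {p : M} (hf : MDifferentiableAt I J f p)
    {κ : Type*} [Fintype κ] {b : κ → M → ℝ} {g : κ → N → W}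
    (hb : ∀ j, MDifferentiableAt I 𝓘(ℝ, ℝ) (b j) p)
    (hg : ∀ j, MDifferentiableAt J 𝓘(ℝ, W) (g j) (f p)) (ξ : TangentSpace I p) :
    dirDeriv I (fun q => ∑ j, b j q • g j (f q)) p ξ =
      ∑ j, (b j p • dirDeriv J (g j) (f p) (mfderiv I J f p ξ) + dirDeriv I (b j) p ξ • g j (f p)) := by
  have hgf : ∀ j, MDifferentiableAt I 𝓘(ℝ, W) (fun q => g j (f q)) p := fun j => (hg j).comp p hf
  have hm : ∀ j, MDifferentiableAt I 𝓘(ℝ, W) (fun q => b j q • g j (f q)) p := fun j =>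
    (hb j).smul (hgf j)
  rw [dirDeriv_sum _ fun j _ => hm j]
  refine Finset.sum_congr rfl fun j _ => ?_
  rw [dirDeriv_fun_smul (hb j) (hgf j), dirDeriv_comp_map (hg j) hf]

theorem dirDeriv_anchor_sum {κ : Type*} [Fintype κ] (g : N → W) (x : N) (e : κ → ℝ)
    (Z : κ → A.Fib x) : dirDeriv J g x (A.anchor x (∑ i, e i • Z i)) =
      ∑ i, e i • dirDeriv J g x (A.anchor x (Z i)) := by
  let l : A.Fib x →ₗ[ℝ] W := (mfderiv J 𝓘(ℝ, W) g x).toLinearMap ∘ₗ A.anchor x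
  change l (∑ i, e i • Z i) = ∑ i, e i • l (Z i)
  simp only [map_sum, map_smul]

/-- Suppose that `c` is a family of linear maps for which the bracket has the usual expression.
Then the expression that defines the bracket of sections `∑ a i • X i ∘ f` along a map `f` has the
same form. In particular, it only depends on the values of `c` on these sections. -/
theorem apply_bracket_decomposition (c : ∀ q, A.Fib q →ₗ[ℝ] W) (B : W →ₗ[ℝ] W →ₗ[ℝ] W) {f : M → N}
    {p : M} (hf : MDifferentiableAt I J f p) {ι κ : Type*} [Fintype ι] [Fintype κ]
    {a : ι → M → ℝ} {X : ι → ∀ q, A.Fib q} {b : κ → M → ℝ} {Y : κ → ∀ q, A.Fib q}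
    (ha : ∀ i, MDifferentiableAt I 𝓘(ℝ, ℝ) (a i) p)
    (hb : ∀ j, MDifferentiableAt I 𝓘(ℝ, ℝ) (b j) p)
    (hX : ∀ i, MDifferentiableAt J 𝓘(ℝ, W) (fun q => c q (X i q)) (f p))
    (hY : ∀ j, MDifferentiableAt J 𝓘(ℝ, W) (fun q => c q (Y j q)) (f p))
    (hbr : ∀ i j, c (f p) (A.bracket (X i) (Y j) (f p)) =
      B (c (f p) (X i (f p))) (c (f p) (Y j (f p))) +
        dirDeriv J (fun q => c q (Y j q)) (f p) (A.anchor (f p) (X i (f p))) -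
        dirDeriv J (fun q => c q (X i q)) (f p) (A.anchor (f p) (Y j (f p))))
    (ξ η : TangentSpace I p) (hξ : mfderiv I J f p ξ = A.anchor (f p) (∑ i, a i p • X i (f p)))
    (hη : mfderiv I J f p η = A.anchor (f p) (∑ j, b j p • Y j (f p))) :
    c (f p) (∑ i, ∑ j, (a i p * b j p) • A.bracket (X i) (Y j) (f p) +
        ∑ j, dirDeriv I (b j) p ξ • Y j (f p) - ∑ i, dirDeriv I (a i) p η • X i (f p)) =
      B (c (f p) (∑ i, a i p • X i (f p))) (c (f p) (∑ j, b j p • Y j (f p))) +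
        dirDeriv I (fun q => c (f q) (∑ j, b j q • Y j (f q))) p ξ -
        dirDeriv I (fun q => c (f q) (∑ i, a i q • X i (f q))) p η := by
  simp only [map_add, map_sub, map_sum, map_smul]
  rw [dirDeriv_sum_smul_comp (g := fun j q => c q (Y j q)) hf hb hY,
    dirDeriv_sum_smul_comp (g := fun j q => c q (X j q)) hf ha hX]
  simp only [hbr, hξ, hη, dirDeriv_anchor_sum, Finset.sum_add_distrib, smul_sub, smul_add,
    Finset.sum_sub_distrib, Finset.smul_sum, LinearMap.sum_apply, LinearMap.smul_apply, smul_smul]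
  have h1 : ∀ (i : ι) (j : κ), b j p * a i p = a i p * b j p := fun i j => mul_comm _ _
  simp only [h1]
  have h2 : ∀ g : ι → κ → W, ∑ i, ∑ j, g i j = ∑ j, ∑ i, g i j := fun g => Finset.sum_comm
  rw [h2 fun i j => (a i p * b j p) • dirDeriv J (fun q => c q (Y j q)) (f p)
      (A.anchor (f p) (X i (f p))), h2 fun i j => (a i p * b j p) •
      B (c (f p) (X i (f p))) (c (f p) (Y j (f p)))]
  abel

end Decomposition

/-! ### Frames over open sets -/

section FrameOn

variable {EM : Type*} [NormedAddCommGroup EM] [NormedSpace ℝ EM]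
    {HM : Type*} [TopologicalSpace HM] {I : ModelWithCorners ℝ EM HM}
    {M : Type*} [TopologicalSpace M] [ChartedSpace HM M]

/-- A local frame over the set `U`, with the structure constants of the bracket as functions. -/
structure AFrameOn (A : AlgebroidData I M) (W : Type*) [NormedAddCommGroup W] [NormedSpace ℝ W]
    (U : Set M) where
  coord : ∀ q, A.Fib q →ₗ[ℝ] W
  sec : W →ₗ[ℝ] ∀ q, A.Fib q
  B : M → W →ₗ[ℝ] W →ₗ[ℝ] W
  isSmooth_sec : ∀ w, A.IsSmooth (sec w)
  coord_sec : ∀ q ∈ U, ∀ w, coord q (sec w q) = w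
  sec_coord : ∀ q ∈ U, ∀ v, sec (coord q v) q = v
  smooth_coord : ∀ X, A.IsSmooth X → ∀ q ∈ U, ContMDiffAt I 𝓘(ℝ, W) ∞ (fun q => coord q (X q)) q
  B_skew : ∀ q w w', B q w w' = -B q w' w
  bracket : ∀ X Y, A.IsSmooth X → A.IsSmooth Y → ∀ p ∈ U, coord p (A.bracket X Y p) =
    B p (coord p (X p)) (coord p (Y p)) + dirDeriv I (fun q => coord q (Y q)) p (A.anchor p (X p)) -
      dirDeriv I (fun q => coord q (X q)) p (A.anchor p (Y p))

variable {A : AlgebroidData I M} {W : Type*} [NormedAddCommGroup W] [NormedSpace ℝ W] {U : Set M}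

/-- The frame near a point of `U`. -/
def AFrameOn.at (fr : AFrameOn A W U) (hU : IsOpen U) {p : M} (hp : p ∈ U) : AFrame A W p where
  coord := fr.coord
  sec := fr.sec
  B := fr.B p
  isSmooth_sec := fr.isSmooth_sec
  coord_sec := by filter_upwards [hU.mem_nhds hp] with q hq using fr.coord_sec q hq
  sec_coord := by filter_upwards [hU.mem_nhds hp] with q hq using fr.sec_coord q hq
  smooth_coord X hX := fr.smooth_coord X hX p hp
  B_skew := fr.B_skew p
  bracket X Y hX hY := fr.bracket X Y hX hY p hp

end FrameOn

/-! ### Frames of a Lie algebroid -/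

section LieAlgebroidFrames

variable {EM : Type*} [NormedAddCommGroup EM] [NormedSpace ℝ EM]
    {HM : Type*} [TopologicalSpace HM] {I : ModelWithCorners ℝ EM HM}
    {M : Type*} [TopologicalSpace M] [ChartedSpace HM M] [IsManifold I ∞ M]
    {FA : Type*} [NormedAddCommGroup FA] [NormedSpace ℝ FA] [FiniteDimensional ℝ FA]
    {A : M → Type*} [TopologicalSpace (TotalSpace FA A)]
    [∀ x, AddCommGroup (A x)] [∀ x, Module ℝ (A x)] [∀ x, TopologicalSpace (A x)]
    [FiberBundle FA A] [VectorBundle ℝ FA A] [ContMDiffVectorBundle ∞ FA A I]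
    (L : LieAlgebroid I FA A)

theorem LieAlgebroid.toData_bracket (X Y : Cₛ^∞⟮I; FA, A⟯) :
    L.toData.bracket X Y = L.bracket X Y :=
  dif_pos ⟨X.contMDiff, Y.contMDiff⟩

theorem LieAlgebroid.bracket_add_left (X Y Z : Cₛ^∞⟮I; FA, A⟯) :
    L.bracket (X + Y) Z = L.bracket X Z + L.bracket Y Z := by
  rw [L.bracket_skew, L.bracket_add, neg_add, ← L.bracket_skew, ← L.bracket_skew]

theorem LieAlgebroid.bracket_smul_left (c : ℝ) (X Y : Cₛ^∞⟮I; FA, A⟯) :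
    L.bracket (c • X) Y = c • L.bracket X Y := by
  rw [L.bracket_skew, L.bracket_smul, ← smul_neg, ← L.bracket_skew]

/-- The bracket as a bilinear map. -/
def LieAlgebroid.bracketL : Cₛ^∞⟮I; FA, A⟯ →ₗ[ℝ] Cₛ^∞⟮I; FA, A⟯ →ₗ[ℝ] Cₛ^∞⟮I; FA, A⟯ :=
  LinearMap.mk₂ ℝ L.bracket L.bracket_add_left L.bracket_smul_left L.bracket_add L.bracket_smul

/-- The coordinates of a bundle in a trivialization. -/
def trivCoord (x₀ : M) (q : M) : A q →ₗ[ℝ] FA := (trivializationAt FA A x₀).linearMapAt ℝ q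

theorem contMDiffAt_trivCoord {x₀ q : M} (hq : q ∈ (trivializationAt FA A x₀).baseSet)
    {X : ∀ q, A q} (hX : ContMDiffAt I (I.prod 𝓘(ℝ, FA)) ∞ (fun x => TotalSpace.mk' FA x (X x)) q) :
    ContMDiffAt I 𝓘(ℝ, FA) ∞ (fun q => trivCoord (FA := FA) x₀ q (X q)) q := by
  refine (((trivializationAt FA A x₀).contMDiffAt_section_iff hq).1 hX).congr_of_eventuallyEq ?_
  filter_upwards [(trivializationAt FA A x₀).open_baseSet.mem_nhds hq] with y hy
  exact congrFun ((trivializationAt FA A x₀).coe_linearMapAt_of_mem (R := ℝ) hy) (X y)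

/-- The constant sections of a trivialization, cut off by a bump function. -/
def trivSection (x₀ : M) (ψ : M → ℝ) (w : FA) (q : M) : A q :=
  ψ q • (trivializationAt FA A x₀).symmₗ ℝ q w

theorem contMDiff_trivSection {x₀ : M} {ψ : M → ℝ} (hψ : ContMDiff I 𝓘(ℝ, ℝ) ∞ ψ)
    (hs : tsupport ψ ⊆ (trivializationAt FA A x₀).baseSet) (w : FA) :
    ContMDiff I (I.prod 𝓘(ℝ, FA)) ∞ (fun x => TotalSpace.mk' FA x (trivSection (A := A) x₀ ψ w x)) := by
  intro q
  by_cases hq : q ∈ tsupport ψ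
  · refine ((trivializationAt FA A x₀).contMDiffAt_section_iff (hs hq)).2 ?_
    have h : ContMDiffAt I 𝓘(ℝ, FA) ∞ (fun y => ψ y • w) q :=
      contMDiffAt_fun_smul (hψ q) contMDiffAt_const
    refine h.congr_of_eventuallyEq ?_
    filter_upwards [(trivializationAt FA A x₀).open_baseSet.mem_nhds (hs hq)] with y hy
    have h1 := congrFun ((trivializationAt FA A x₀).coe_linearMapAt_of_mem (R := ℝ) hy)
      (trivSection (FA := FA) x₀ ψ w y)
    refine h1.symm.trans ?_
    rw [trivSection, map_smul, Trivialization.linearMapAt_symmₗ _ hy]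
  · have h0 : ContMDiffAt I (I.prod 𝓘(ℝ, FA)) ∞ (fun x => TotalSpace.mk' FA x (0 : A x)) q :=
      (0 : Cₛ^∞⟮I; FA, A⟯).contMDiff q
    refine h0.congr_of_eventuallyEq ?_
    filter_upwards [(isClosed_tsupport ψ).isOpen_compl.mem_nhds hq] with y hy
    rw [trivSection, image_eq_zero_of_notMem_tsupport hy, zero_smul]

/-- The deviation of the bracket from the commutator in the coordinates of a trivialization. -/
def LieAlgebroid.torsion (x₀ q : M) (X Y : Cₛ^∞⟮I; FA, A⟯) : FA :=
  trivCoord x₀ q (L.bracket X Y q) -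
    dirDeriv I (fun q => trivCoord (FA := FA) x₀ q (Y q)) q (L.anchor q (X q)) +
    dirDeriv I (fun q => trivCoord (FA := FA) x₀ q (X q)) q (L.anchor q (Y q))

variable {x₀ q : M}

theorem mdifferentiableAt_trivCoord (hq : q ∈ (trivializationAt FA A x₀).baseSet)
    (X : Cₛ^∞⟮I; FA, A⟯) :
    MDifferentiableAt I 𝓘(ℝ, FA) (fun q => trivCoord (FA := FA) x₀ q (X q)) q :=
  mdiffAt_of_contMDiffAt (contMDiffAt_trivCoord hq (X.contMDiff q))

theorem LieAlgebroid.torsion_skew (X Y : Cₛ^∞⟮I; FA, A⟯) :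
    L.torsion x₀ q X Y = -L.torsion x₀ q Y X := by
  unfold torsion
  rw [L.bracket_skew X Y]
  simp only [ContMDiffSection.coe_neg, Pi.neg_apply, map_neg]
  abel

theorem LieAlgebroid.torsion_add (hq : q ∈ (trivializationAt FA A x₀).baseSet)
    (X Y Z : Cₛ^∞⟮I; FA, A⟯) :
    L.torsion x₀ q X (Y + Z) = L.torsion x₀ q X Y + L.torsion x₀ q X Z := by
  unfold torsion
  rw [L.bracket_add X Y]
  simp only [ContMDiffSection.coe_add, Pi.add_apply, map_add, dirDeriv_add_vec]
  rw [dirDeriv_add (mdifferentiableAt_trivCoord hq Y) (mdifferentiableAt_trivCoord hq Z)]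
  abel

theorem LieAlgebroid.torsion_smul (hq : q ∈ (trivializationAt FA A x₀).baseSet)
    (X Y Z : Cₛ^∞⟮I; FA, A⟯) {f : M → ℝ} (hf : ContMDiff I 𝓘(ℝ, ℝ) ∞ f)
    (hZ : ∀ x, Z x = f x • Y x) : L.torsion x₀ q X Z = f q • L.torsion x₀ q X Y := by
  unfold torsion
  rw [L.leibniz f hf X Y Z hZ]
  simp only [hZ, map_add, map_smul, dirDeriv_smul_vec]
  rw [dirDeriv_fun_smul (mdiffAt_of_contMDiffAt (hf q)) (mdifferentiableAt_trivCoord hq Y)]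
  module

theorem LieAlgebroid.torsion_sum (hq : q ∈ (trivializationAt FA A x₀).baseSet)
    (X : Cₛ^∞⟮I; FA, A⟯) {ι : Type*} (s : Finset ι) (Y : ι → Cₛ^∞⟮I; FA, A⟯) :
    L.torsion x₀ q X (∑ i ∈ s, Y i) = ∑ i ∈ s, L.torsion x₀ q X (Y i) := by
  classical
  induction s using Finset.induction_on with
  | empty =>
    have h := L.torsion_smul hq X 0 0 (f := fun _ => 0) contMDiff_const (by simp)
    simpa using h
  | insert i s hi ih => rw [Finset.sum_insert hi, Finset.sum_insert hi, L.torsion_add hq, ih]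

/-- The cut-off constant section of a trivialization as a smooth section. -/
def trivSmoothSection {x₀ : M} {ψ : M → ℝ} (hψ : ContMDiff I 𝓘(ℝ, ℝ) ∞ ψ)
    (hs : tsupport ψ ⊆ (trivializationAt FA A x₀).baseSet) : FA →ₗ[ℝ] Cₛ^∞⟮I; FA, A⟯ where
  toFun w := ⟨trivSection x₀ ψ w, contMDiff_trivSection hψ hs w⟩
  map_add' w w' := by
    ext q
    change trivSection (A := A) x₀ ψ (w + w') q = trivSection x₀ ψ w q + trivSection x₀ ψ w' q
    rw [trivSection, map_add, smul_add, trivSection, trivSection]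
  map_smul' r w := by
    ext q
    change trivSection (A := A) x₀ ψ (r • w) q = r • trivSection x₀ ψ w q
    rw [trivSection, map_smul, smul_comm, trivSection]

theorem trivSmoothSection_apply {x₀ : M} {ψ : M → ℝ} (hψ : ContMDiff I 𝓘(ℝ, ℝ) ∞ ψ)
    (hs : tsupport ψ ⊆ (trivializationAt FA A x₀).baseSet) (w : FA) (q : M) :
    trivSmoothSection hψ hs w q = ψ q • (trivializationAt FA A x₀).symmₗ ℝ q w := rfl

theorem contMDiff_bump_smul_trivCoord {x₀ : M} {ψ : M → ℝ} (hψ : ContMDiff I 𝓘(ℝ, ℝ) ∞ ψ)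
    (hs : tsupport ψ ⊆ (trivializationAt FA A x₀).baseSet) (X : Cₛ^∞⟮I; FA, A⟯) :
    ContMDiff I 𝓘(ℝ, FA) ∞ (fun q => ψ q • trivCoord (FA := FA) x₀ q (X q)) := by
  intro q
  by_cases hq : q ∈ tsupport ψ
  · exact contMDiffAt_fun_smul (hψ q) (contMDiffAt_trivCoord (hs hq) (X.contMDiff q))
  · refine (contMDiffAt_const (c := (0 : FA))).congr_of_eventuallyEq ?_
    filter_upwards [(isClosed_tsupport ψ).isOpen_compl.mem_nhds hq] with y hy
    rw [image_eq_zero_of_notMem_tsupport hy, zero_smul]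

theorem trivSection_trivCoord {x₀ y : M} (ψ : M → ℝ) (hs : tsupport ψ ⊆ (trivializationAt FA A x₀).baseSet)
    (v : A y) : ψ y • (trivializationAt FA A x₀).symmₗ ℝ y (trivCoord x₀ y v) = ψ y • v := by
  by_cases hy : y ∈ tsupport ψ
  · rw [trivCoord, Trivialization.symmₗ_linearMapAt _ (hs hy)]
  · rw [image_eq_zero_of_notMem_tsupport hy, zero_smul, zero_smul]

/-- The torsion is tensorial. -/
theorem LieAlgebroid.torsion_eq {ψ : M → ℝ} (hψ : ContMDiff I 𝓘(ℝ, ℝ) ∞ ψ)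
    (hs : tsupport ψ ⊆ (trivializationAt FA A x₀).baseSet) (hq : ψ q = 1) (X Y : Cₛ^∞⟮I; FA, A⟯) :
    L.torsion x₀ q X Y =
      L.torsion x₀ q X (trivSmoothSection hψ hs (trivCoord x₀ q (Y q))) := by
  have hqb : q ∈ (trivializationAt FA A x₀).baseSet :=
    hs (subset_tsupport _ (by rw [Function.mem_support, hq]; exact one_ne_zero))
  let b := Module.finBasis ℝ FA
  -- The coordinates `y i` of `ψ Y`; then `ψ ^ 2 Y` is a combination of the sections of the frame.
  let y : Fin (Module.finrank ℝ FA) → M → ℝ := fun i x =>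
    b.coord i (ψ x • trivCoord (FA := FA) x₀ x (Y x))
  have hy : ∀ i, ContMDiff I 𝓘(ℝ, ℝ) ∞ (y i) := fun i =>
    (LinearMap.toContinuousLinearMap (b.coord i)).contDiff.contMDiff.comp
      (contMDiff_bump_smul_trivCoord hψ hs Y)
  let S : Fin (Module.finrank ℝ FA) → Cₛ^∞⟮I; FA, A⟯ := fun i => trivSmoothSection hψ hs (b i)
  let T : Fin (Module.finrank ℝ FA) → Cₛ^∞⟮I; FA, A⟯ := fun i =>
    ⟨fun x => y i x • S i x, (hy i).smul_section (S i).contMDiff⟩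
  have hf : ContMDiff I 𝓘(ℝ, ℝ) ∞ (fun x => 1 - ψ x * ψ x) :=
    contMDiff_const.sub (hψ.smul hψ)
  let R : Cₛ^∞⟮I; FA, A⟯ := ⟨fun x => (1 - ψ x * ψ x) • Y x, hf.smul_section Y.contMDiff⟩
  have hsum : ∀ x, ∑ i, y i x • S i x = (ψ x * ψ x) • Y x := by
    intro x
    have h1 : ∀ i, y i x • S i x = (ψ x * ψ x) • (trivializationAt FA A x₀).symmₗ ℝ x
        (b.repr (trivCoord x₀ x (Y x)) i • b i) := by
      intro i
      change b.coord i (ψ x • trivCoord (FA := FA) x₀ x (Y x)) •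
        (ψ x • (trivializationAt FA A x₀).symmₗ ℝ x (b i)) = _
      rw [map_smul, map_smul, smul_smul, smul_smul, Module.Basis.coord_apply, smul_eq_mul]
      congr 1
      ring
    simp only [h1]
    rw [← Finset.smul_sum, ← map_sum, b.sum_repr, mul_smul, trivSection_trivCoord ψ hs, ← mul_smul]
  have hY : Y = R + ∑ i, T i := by
    ext x
    have h2 : (∑ i, T i : Cₛ^∞⟮I; FA, A⟯) x = ∑ i, y i x • S i x := by
      have h3 := congrFun (map_sum (ContMDiffSection.coeAddHom I FA ∞ A) T Finset.univ) x
      rw [Finset.sum_apply] at h3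
      exact h3
    rw [ContMDiffSection.coe_add, Pi.add_apply, h2, hsum]
    change Y x = (1 - ψ x * ψ x) • Y x + _
    module
  -- `R` does not contribute, as its coefficient `1 - ψ ^ 2` vanishes at `q`.
  have hR : L.torsion x₀ q X R = 0 := by
    rw [L.torsion_smul hqb X Y R hf fun _ => rfl, hq]
    simp
  have hT : ∀ i, L.torsion x₀ q X (T i) = L.torsion x₀ q X
      (trivSmoothSection hψ hs (b.repr (trivCoord x₀ q (Y q)) i • b i)) := by
    intro i
    rw [L.torsion_smul hqb X (S i) (T i) (hy i) fun _ => rfl,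
      L.torsion_smul hqb X (S i) (trivSmoothSection hψ hs (b.repr (trivCoord x₀ q (Y q)) i • b i))
        (f := fun _ => b.repr (trivCoord x₀ q (Y q)) i) contMDiff_const fun x => by
          rw [map_smul]
          rfl]
    change b.coord i (ψ q • trivCoord (FA := FA) x₀ q (Y q)) • _ = _
    rw [hq, one_smul]
    rfl
  conv_lhs => rw [hY, L.torsion_add hqb, hR, zero_add, L.torsion_sum hqb]
  simp only [hT]
  rw [← L.torsion_sum hqb, ← map_sum, b.sum_repr]

/-- The frame of a Lie algebroid that is given by a trivialization of the vector bundle. -/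
def LieAlgebroid.frameOn (x₀ : M) {ψ : M → ℝ} (hψ : ContMDiff I 𝓘(ℝ, ℝ) ∞ ψ)
    (hs : tsupport ψ ⊆ (trivializationAt FA A x₀).baseSet) {U : Set M} (hU : IsOpen U)
    (hU1 : ∀ q ∈ U, ψ q = 1) : AFrameOn L.toData FA U :=
  have hb : ∀ q ∈ U, q ∈ (trivializationAt FA A x₀).baseSet := fun q hq =>
    hs (subset_tsupport _ (by rw [Function.mem_support, hU1 q hq]; exact one_ne_zero))
  have hcs : ∀ q ∈ U, ∀ w, trivCoord x₀ q (trivSmoothSection (A := A) hψ hs w q) = w := by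
    intro q hq w
    rw [trivSmoothSection_apply, hU1 q hq, one_smul, trivCoord,
      Trivialization.linearMapAt_symmₗ _ (hb q hq)]
  { coord := fun q => trivCoord (FA := FA) (A := A) x₀ q
    sec :=
      { toFun := fun w => trivSmoothSection hψ hs w
        map_add' := fun w w' => by rw [map_add]; rfl
        map_smul' := fun r w => by rw [map_smul]; rfl }
    B := fun q => ((L.bracketL.compl₁₂ (trivSmoothSection hψ hs) (trivSmoothSection hψ hs))).compr₂
      { toFun := fun X : Cₛ^∞⟮I; FA, A⟯ => trivCoord x₀ q (X q)
        map_add' := fun X Y => map_add _ _ _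
        map_smul' := fun r X => map_smul _ _ _ }
    isSmooth_sec := fun w => (trivSmoothSection hψ hs w).contMDiff
    coord_sec := hcs
    sec_coord := fun q hq v => by
      refine (trivSection_trivCoord (A := A) ψ hs v).trans ?_
      rw [hU1 q hq]
      exact one_smul ℝ (v : A q)
    smooth_coord := fun X hX q hq => contMDiffAt_trivCoord (hb q hq) (hX q)
    B_skew := fun q w w' => by
      change trivCoord x₀ q (L.bracket _ _ q) = -trivCoord x₀ q (L.bracket _ _ q)
      rw [L.bracket_skew, ContMDiffSection.coe_neg, Pi.neg_apply, map_neg]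
    bracket := fun X Y hX hY q hq => by
      let X' : Cₛ^∞⟮I; FA, A⟯ := ⟨X, hX⟩
      let Y' : Cₛ^∞⟮I; FA, A⟯ := ⟨Y, hY⟩
      have h1 := L.torsion_eq hψ hs (hU1 q hq) X' Y'
      rw [L.torsion_skew X' (trivSmoothSection hψ hs _), L.torsion_eq hψ hs (hU1 q hq) _ X',
        ← L.torsion_skew] at h1
      have hc : ∀ w : FA, ∀ v, dirDeriv I
          (fun y => trivCoord (FA := FA) x₀ y (trivSmoothSection (A := A) hψ hs w y)) q v = 0 := by
        intro w v
        rw [← dirDeriv_const w q v]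
        refine dirDeriv_congr ?_ v
        filter_upwards [hU.mem_nhds hq] with y hy using hcs y hy w
      have h2 : L.torsion x₀ q (trivSmoothSection hψ hs (trivCoord x₀ q (X' q)))
          (trivSmoothSection hψ hs (trivCoord x₀ q (Y' q))) = trivCoord x₀ q (L.bracket
            (trivSmoothSection hψ hs (trivCoord x₀ q (X' q)))
            (trivSmoothSection hψ hs (trivCoord x₀ q (Y' q))) q) := by
        rw [torsion, hc, hc, sub_zero, add_zero]
      rw [h2] at h1
      have h3 : L.toData.bracket X Y = L.bracket X' Y' := L.toData_bracket X' Y'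
      rw [h3]
      change _ = trivCoord x₀ q (L.bracket
            (trivSmoothSection hψ hs (trivCoord x₀ q (X' q)))
            (trivSmoothSection hψ hs (trivCoord x₀ q (Y' q))) q) + _ - _
      rw [← h1, torsion]
      change trivCoord x₀ q (L.bracket X' Y' q) = trivCoord x₀ q (L.bracket X' Y' q) -
        dirDeriv I (fun q => trivCoord (FA := FA) (A := A) x₀ q (Y q)) q (L.anchor q (X q)) +
        dirDeriv I (fun q => trivCoord (FA := FA) (A := A) x₀ q (X q)) q (L.anchor q (Y q)) +
        dirDeriv I (fun q => trivCoord (FA := FA) (A := A) x₀ q (Y q)) q (L.anchor q (X q)) -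
        dirDeriv I (fun q => trivCoord (FA := FA) (A := A) x₀ q (X q)) q (L.anchor q (Y q))
      abel }

/-- Every neighbourhood of a point supports a smooth function that is `1` near the point. -/
theorem exists_bump [FiniteDimensional ℝ EM] [T2Space M] (x₀ : M) {S : Set M} (hS : S ∈ 𝓝 x₀) :
    ∃ (ψ : M → ℝ) (U : Set M), ContMDiff I 𝓘(ℝ, ℝ) ∞ ψ ∧ tsupport ψ ⊆ S ∧ IsOpen U ∧ x₀ ∈ U ∧
      ∀ q ∈ U, ψ q = 1 := by
  obtain ⟨ψ, -, hψ⟩ := (SmoothBumpFunction.nhds_basis_tsupport (I := I) x₀).mem_iff.1 hS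
  obtain ⟨U, hU, hUo, hxU⟩ := eventually_nhds_iff.1 ψ.eventuallyEq_one
  exact ⟨ψ, U, ψ.contMDiff, hψ, hUo, hxU, hU⟩

theorem LieAlgebroid.isAlgebroid [FiniteDimensional ℝ EM] [T2Space M] :
    IsAlgebroid L.toData FA where
  zero := (0 : Cₛ^∞⟮I; FA, A⟯).contMDiff
  add X Y hX hY := ((⟨X, hX⟩ : Cₛ^∞⟮I; FA, A⟯) + (⟨Y, hY⟩ : Cₛ^∞⟮I; FA, A⟯)).contMDiff
  smul r X hX := (r • (⟨X, hX⟩ : Cₛ^∞⟮I; FA, A⟯)).contMDiff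
  anchor_smooth X hX := L.contMDiff_anchor.comp hX
  anchor_bracket X Y hX hY x := by
    have h3 : L.toData.bracket X Y = L.bracket ⟨X, hX⟩ ⟨Y, hY⟩ := L.toData_bracket ⟨X, hX⟩ ⟨Y, hY⟩
    rw [h3]
    exact L.anchor_bracket ⟨X, hX⟩ ⟨Y, hY⟩ x
  frame p := by
    obtain ⟨ψ, U, hψ, hs, hU, hp, h1⟩ := exists_bump (I := I) p
      ((trivializationAt FA A p).open_baseSet.mem_nhds (mem_baseSet_trivializationAt FA A p))
    exact ⟨(L.frameOn p hψ hs hU h1).at hU hp⟩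

end LieAlgebroidFrames

/-! ### The tangent algebroid -/

section Tangent

variable {EM : Type*} [NormedAddCommGroup EM] [NormedSpace ℝ EM] [CompleteSpace EM]
    {HM : Type*} [TopologicalSpace HM] {I : ModelWithCorners ℝ EM HM} [I.Boundaryless]
    {M : Type*} [TopologicalSpace M] [ChartedSpace HM M] [IsManifold I ∞ M]

theorem contMDiffAt_extChartAt_of_mem {p q : M} (hq : q ∈ (chartAt HM p).source) :
    ContMDiffAt I 𝓘(ℝ, EM) ∞ (extChartAt I p) q :=
  contMDiffAt_extChartAt' hq

theorem contMDiffAt_vectorField_iff {X : ∀ x, TangentSpace I x} {p q : M}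
    (hq : q ∈ (chartAt HM p).source) :
    ContMDiffAt I I.tangent ∞ (fun x => (⟨x, X x⟩ : TangentBundle I M)) q ↔
      ContMDiffAt I 𝓘(ℝ, EM) ∞ (fun y => dirDeriv I (extChartAt I p) y (X y)) q := by
  constructor
  · intro h
    exact contMDiffAt_dirDeriv (contMDiffAt_extChartAt_of_mem hq) h
  · intro h
    have hq' : q ∈ (extChartAt I p).source := by rwa [extChartAt_source]
    refine contMDiffAt_of_dirDeriv_extChartAt ?_
    have hf := contMDiffAt_extChartAt (I := I) (n := ∞) (x := q)
    have h1 := contDiffAt_comp_extChartAt_symm hq' hf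
    have h3 : ContMDiffAt I 𝓘(ℝ, EM →L[ℝ] EM) ∞ (fun y =>
        fderiv ℝ (extChartAt I q ∘ (extChartAt I p).symm) (extChartAt I p y)) q :=
      (h1.fderiv_right (m := ∞) (by simp)).contMDiffAt.comp q (contMDiffAt_extChartAt_of_mem hq)
    refine (h3.clm_apply h).congr_of_eventuallyEq ?_
    filter_upwards [eventually_mdifferentiableAt hf, extChartAt_source_mem_nhds' (I := I) hq']
      with y hy hy'
    exact dirDeriv_eq_fderiv_chart hy' hy _

/-- The tangent vector with given components in a chart. -/
def chartVec (p q : M) : EM →ₗ[ℝ] TangentSpace I q :=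
  (mfderiv I 𝓘(ℝ, EM) (extChartAt I p) q).inverse.toLinearMap

theorem dirDeriv_chartVec {p q : M} (hq : q ∈ (chartAt HM p).source) (w : EM) :
    dirDeriv I (extChartAt I p) q (chartVec p q w) = w := by
  have : IsManifold I 1 M := IsManifold.of_le (n := ∞) (by simp)
  have hq' : q ∈ (extChartAt I p).source := by rwa [extChartAt_source]
  obtain ⟨T, hT⟩ := isInvertible_mfderiv_extChartAt (I := I) hq'
  unfold dirDeriv chartVec
  rw [← hT, ContinuousLinearMap.inverse_equiv]
  exact T.apply_symm_apply _

theorem contMDiffAt_zero_vectorField (q : M) :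
    ContMDiffAt I I.tangent ∞ (fun x => (⟨x, 0⟩ : TangentBundle I M)) q := by
  rw [contMDiffAt_vectorField_iff (mem_chart_source HM q)]
  simp only [dirDeriv_zero_vec]
  exact contMDiffAt_const

variable (I M) in
/-- Every chart domain contains the support of a function that is `1` near the base point. -/
def HasChartBumps : Prop := ∀ p : M, ∃ (ψ : M → ℝ) (U : Set M), ContMDiff I 𝓘(ℝ, ℝ) ∞ ψ ∧
  tsupport ψ ⊆ (chartAt HM p).source ∧ IsOpen U ∧ p ∈ U ∧ ∀ q ∈ U, ψ q = 1

/-- The coordinate frame of the tangent bundle. -/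
def tangentFrameOn (p : M) {ψ : M → ℝ} (hψ : ContMDiff I 𝓘(ℝ, ℝ) ∞ ψ)
    (hs : tsupport ψ ⊆ (chartAt HM p).source) {U : Set M} (hU1 : ∀ q ∈ U, ψ q = 1) :
    AFrameOn (tangentAlgebroid I M) EM U :=
  have hb : ∀ q ∈ U, q ∈ (chartAt HM p).source := fun q hq =>
    hs (subset_tsupport _ (by rw [Function.mem_support, hU1 q hq]; exact one_ne_zero))
  { coord := fun q => (mfderiv I 𝓘(ℝ, EM) (extChartAt I p) q).toLinearMap
    sec := LinearMap.pi fun q => ψ q • chartVec p q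
    B := 0
    isSmooth_sec := fun w q => by
      by_cases hq : q ∈ tsupport ψ
      · refine (contMDiffAt_vectorField_iff (hs hq)).2 ?_
        have h : ContMDiffAt I 𝓘(ℝ, EM) ∞ (fun y => ψ y • w) q :=
          contMDiffAt_fun_smul (hψ q) contMDiffAt_const
        refine h.congr_of_eventuallyEq ?_
        filter_upwards [(chartAt HM p).open_source.mem_nhds (hs hq)] with y hy
        change dirDeriv I (extChartAt I p) y (ψ y • chartVec p y w) = _
        rw [dirDeriv_smul_vec, dirDeriv_chartVec hy]
      · refine (contMDiffAt_zero_vectorField q).congr_of_eventuallyEq ?_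
        filter_upwards [(isClosed_tsupport ψ).isOpen_compl.mem_nhds hq] with y hy
        change (⟨y, ψ y • chartVec p y w⟩ : TangentBundle I M) = _
        rw [image_eq_zero_of_notMem_tsupport hy, zero_smul]
    coord_sec := fun q hq w => by
      change dirDeriv I (extChartAt I p) q (ψ q • chartVec p q w) = w
      rw [dirDeriv_smul_vec, dirDeriv_chartVec (hb q hq), hU1 q hq, one_smul]
    sec_coord := fun q hq v => by
      have key : ∀ v : TangentSpace I q,
          ψ q • chartVec p q (dirDeriv I (extChartAt I p) q v) = v := fun v => by
        refine tangent_ext (p := p) (by rw [extChartAt_source]; exact hb q hq) ?_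
        rw [dirDeriv_smul_vec, dirDeriv_chartVec (hb q hq), hU1 q hq, one_smul]
      exact key v
    smooth_coord := fun X hX q hq => (contMDiffAt_vectorField_iff (hb q hq)).1 (hX q)
    B_skew := fun q w w' => by simp
    bracket := fun X Y hX hY q hq => by
      have h := dirDeriv_mlieBracket (contMDiffAt_extChartAt_of_mem (hb q hq)) (hX q) (hY q)
      refine h.trans ?_
      simp only [Pi.zero_apply, LinearMap.zero_apply, zero_add]
      rfl }

theorem isAlgebroid_tangent (hb : HasChartBumps I M) : IsAlgebroid (tangentAlgebroid I M) EM where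
  zero := contMDiffAt_zero_vectorField
  add X Y hX hY q := by
    refine (contMDiffAt_vectorField_iff (mem_chart_source HM q)).2 ?_
    have h := ((contMDiffAt_vectorField_iff (mem_chart_source HM q)).1 (hX q)).add
      ((contMDiffAt_vectorField_iff (mem_chart_source HM q)).1 (hY q))
    exact h.congr_of_eventuallyEq (Eventually.of_forall fun y => dirDeriv_add_vec _ _ _ _)
  smul r X hX q := by
    refine (contMDiffAt_vectorField_iff (mem_chart_source HM q)).2 ?_
    have h := contMDiffAt_fun_smul (a := fun _ => r) contMDiffAt_const
      ((contMDiffAt_vectorField_iff (mem_chart_source HM q)).1 (hX q))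
    exact h.congr_of_eventuallyEq (Eventually.of_forall fun y => dirDeriv_smul_vec _ _ _ _)
  anchor_smooth X hX := hX
  anchor_bracket X Y _ _ x := rfl
  frame p := by
    obtain ⟨ψ, U, hψ, hs, hU, hp, h1⟩ := hb p
    exact ⟨(tangentFrameOn p hψ hs h1).at hU hp⟩

end Tangent

section TangentLie

variable {EM : Type*} [NormedAddCommGroup EM] [NormedSpace ℝ EM] [FiniteDimensional ℝ EM]
    {M : Type*} [TopologicalSpace M] [ChartedSpace EM M] [IsManifold 𝓘(ℝ, EM) ∞ M]

theorem hasChartBumps [T2Space M] : HasChartBumps 𝓘(ℝ, EM) M := fun p =>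
  exists_bump p ((chartAt EM p).open_source.mem_nhds (mem_chart_source EM p))

theorem contMDiffAt_mlieBracket {X Y : ∀ x : M, TangentSpace 𝓘(ℝ, EM) x} {p : M}
    (hX : ContMDiff 𝓘(ℝ, EM) 𝓘(ℝ, EM).tangent ∞ (fun x => (⟨x, X x⟩ : TangentBundle 𝓘(ℝ, EM) M)))
    (hY : ContMDiff 𝓘(ℝ, EM) 𝓘(ℝ, EM).tangent ∞ (fun x => (⟨x, Y x⟩ : TangentBundle 𝓘(ℝ, EM) M))) :
    ContMDiffAt 𝓘(ℝ, EM) 𝓘(ℝ, EM).tangent ∞ (fun x => (⟨x, VectorField.mlieBracket 𝓘(ℝ, EM) X Y x⟩ :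
      TangentBundle 𝓘(ℝ, EM) M)) p := by
  have hp := mem_chart_source EM p
  refine (contMDiffAt_vectorField_iff hp).2 ?_
  have hc := contMDiffAt_extChartAt_of_mem (I := 𝓘(ℝ, EM)) hp
  refine ((contMDiffAt_dirDeriv (contMDiffAt_dirDeriv hc (hY p)) (hX p)).sub
    (contMDiffAt_dirDeriv (contMDiffAt_dirDeriv hc (hX p)) (hY p))).congr_of_eventuallyEq ?_
  filter_upwards [(chartAt EM p).open_source.mem_nhds hp] with y hy
  exact dirDeriv_mlieBracket (contMDiffAt_extChartAt_of_mem hy) (hX y) (hY y)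

variable (EM M) in
/-- The tangent bundle as a Lie algebroid. -/
def tangentLieAlgebroid : LieAlgebroid 𝓘(ℝ, EM) EM (TangentSpace 𝓘(ℝ, EM) : M → Type _) :=
  have h2 : (2 : ℕ∞ω) ≤ ∞ := WithTop.coe_le_coe.2 (le_top : (2 : ℕ∞) ≤ ⊤)
  have h3 : (3 : ℕ∞ω) ≤ ∞ := WithTop.coe_le_coe.2 (le_top : (3 : ℕ∞) ≤ ⊤)
  have : IsManifold 𝓘(ℝ, EM) 2 M := IsManifold.of_le (n := ∞) h2
  have : IsManifold 𝓘(ℝ, EM) (minSmoothness ℝ 3) M :=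
    IsManifold.of_le (n := ∞) (by simpa using h3)
  have hd : ∀ (X : Cₛ^∞⟮𝓘(ℝ, EM); EM, (TangentSpace 𝓘(ℝ, EM) : M → Type _)⟯) (x : M),
      MDifferentiableAt 𝓘(ℝ, EM) 𝓘(ℝ, EM).tangent
        (fun x => (⟨x, X x⟩ : TangentBundle 𝓘(ℝ, EM) M)) x := fun X x =>
    X.contMDiff.mdifferentiable (by simp) x
  have hs : ∀ (X : Cₛ^∞⟮𝓘(ℝ, EM); EM, (TangentSpace 𝓘(ℝ, EM) : M → Type _)⟯),
      ContMDiff 𝓘(ℝ, EM) 𝓘(ℝ, EM).tangent (minSmoothness ℝ 2)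
        (fun x => (⟨x, X x⟩ : TangentBundle 𝓘(ℝ, EM) M)) := fun X =>
    X.contMDiff.of_le (by simpa using h2)
  { anchor := fun _ => LinearMap.id
    contMDiff_anchor := contMDiff_id
    bracket := fun X Y => ⟨VectorField.mlieBracket 𝓘(ℝ, EM) X Y, fun _ =>
      contMDiffAt_mlieBracket X.contMDiff Y.contMDiff⟩
    bracket_add := fun X Y Z => by
      ext x
      exact VectorField.mlieBracket_add_right (hd Y x) (hd Z x)
    bracket_smul := fun c X Y => by
      ext x
      exact VectorField.mlieBracket_const_smul_right (hd Y x)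
    bracket_skew := fun X Y => by
      ext x
      exact congrFun VectorField.mlieBracket_swap x
    jacobi := fun X Y Z => by
      ext x
      exact congrFun (VectorField.leibniz_identity_mlieBracket (hs X) (hs Y) (hs Z)) x
    anchor_bracket := fun X Y x => rfl
    leibniz := fun f hf X Y Z hZ x => by
      have e : (Z : ∀ x, TangentSpace 𝓘(ℝ, EM) x) = f • (Y : ∀ x, TangentSpace 𝓘(ℝ, EM) x) :=
        funext hZ
      change VectorField.mlieBracket 𝓘(ℝ, EM) X Z x =
        f x • VectorField.mlieBracket 𝓘(ℝ, EM) X Y x + dirDeriv 𝓘(ℝ, EM) f x (X x) • Y x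
      rw [e, VectorField.mlieBracket_smul_right (hf.mdifferentiable (by simp) x) (hd Y x), add_comm]
      rfl }

end TangentLie

/-! ### The pull-back algebroid of a vector bundle -/

section BundlePullback

variable {EM : Type*} [NormedAddCommGroup EM] [NormedSpace ℝ EM] [FiniteDimensional ℝ EM]
    {M : Type*} [TopologicalSpace M] [ChartedSpace EM M] [IsManifold 𝓘(ℝ, EM) ∞ M]
    [T2Space M]
    {FA : Type*} [NormedAddCommGroup FA] [NormedSpace ℝ FA] [FiniteDimensional ℝ FA]
    {A : M → Type*} [TopologicalSpace (TotalSpace FA A)]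
    [∀ x, AddCommGroup (A x)] [∀ x, Module ℝ (A x)] [∀ x, TopologicalSpace (A x)]
    [FiberBundle FA A] [VectorBundle ℝ FA A] [ContMDiffVectorBundle ∞ FA A 𝓘(ℝ, EM)]
    (L : LieAlgebroid 𝓘(ℝ, EM) FA A)

variable {EP : Type*} [NormedAddCommGroup EP] [NormedSpace ℝ EP] {HP : Type*} [TopologicalSpace HP]
  {IP : ModelWithCorners ℝ EP HP} {P : Type*} [TopologicalSpace P] [ChartedSpace HP P]

theorem contMDiffAt_trivCoord_comp {f : P → M} {x₀ : M} {p : P}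
    (hp : f p ∈ (trivializationAt FA A x₀).baseSet) {s : ∀ p, A (f p)}
    (hs : ContMDiffAt IP (𝓘(ℝ, EM).prod 𝓘(ℝ, FA)) ∞ (fun p => TotalSpace.mk' FA (f p) (s p)) p) :
    ContMDiffAt IP 𝓘(ℝ, FA) ∞ (fun p => trivCoord (FA := FA) x₀ (f p) (s p)) p := by
  have h := ((trivializationAt FA A x₀).contMDiffAt_iff (f := fun p => TotalSpace.mk' FA (f p) (s p))
    ((trivializationAt FA A x₀).mem_source.2 hp)).1 hs
  refine h.2.congr_of_eventuallyEq ?_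
  filter_upwards [h.1.continuousAt.preimage_mem_nhds
    ((trivializationAt FA A x₀).open_baseSet.mem_nhds hp)] with y hy
  exact congrFun ((trivializationAt FA A x₀).coe_linearMapAt_of_mem (R := ℝ) hy) (s y)

theorem contMDiffAt_of_trivCoord_comp {f : P → M} {x₀ : M} {p : P}
    (hp : f p ∈ (trivializationAt FA A x₀).baseSet) {s : ∀ p, A (f p)}
    (hf : ContMDiffAt IP 𝓘(ℝ, EM) ∞ f p)
    (hs : ContMDiffAt IP 𝓘(ℝ, FA) ∞ (fun p => trivCoord (FA := FA) x₀ (f p) (s p)) p) :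
    ContMDiffAt IP (𝓘(ℝ, EM).prod 𝓘(ℝ, FA)) ∞ (fun p => TotalSpace.mk' FA (f p) (s p)) p := by
  refine ((trivializationAt FA A x₀).contMDiffAt_iff (f := fun p => TotalSpace.mk' FA (f p) (s p))
    ((trivializationAt FA A x₀).mem_source.2 hp)).2 ⟨hf, ?_⟩
  refine hs.congr_of_eventuallyEq ?_
  filter_upwards [hf.continuousAt.preimage_mem_nhds
    ((trivializationAt FA A x₀).open_baseSet.mem_nhds hp)] with y hy
  exact (congrFun ((trivializationAt FA A x₀).coe_linearMapAt_of_mem (R := ℝ) hy) (s y)).symm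

variable (IP P FA A) in
/-- Finitely many sections of a vector bundle over a compact manifold span all sections of its
pull-backs, with smooth coefficients. -/
theorem exists_generators [CompactSpace M] : ∃ (n : ℕ) (S : Fin n → Cₛ^∞⟮𝓘(ℝ, EM); FA, A⟯),
    ∀ (f : P → M) (_ : ContMDiff IP 𝓘(ℝ, EM) ∞ f) (s : ∀ p, A (f p))
      (_ : ContMDiff IP (𝓘(ℝ, EM).prod 𝓘(ℝ, FA)) ∞ (fun p => TotalSpace.mk' FA (f p) (s p))),
      ∃ a : Fin n → P → ℝ, (∀ i, ContMDiff IP 𝓘(ℝ, ℝ) ∞ (a i)) ∧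
        ∀ p, s p = ∑ i, a i p • S i (f p) := by
  classical
  choose ψ U hψ hs hU hx h1 using fun x : M => exists_bump (I := 𝓘(ℝ, EM)) x
    ((trivializationAt FA A x).open_baseSet.mem_nhds (mem_baseSet_trivializationAt FA A x))
  obtain ⟨t, ht⟩ := isCompact_univ.elim_finite_subcover U hU
    (fun x _ => mem_iUnion.2 ⟨x, hx x⟩)
  let b := Module.finBasis ℝ FA
  let ι := t × Fin (Module.finrank ℝ FA)
  let S : ι → Cₛ^∞⟮𝓘(ℝ, EM); FA, A⟯ := fun i => trivSmoothSection (hψ i.1) (hs i.1) (b i.2)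
  let e := Fintype.equivFin ι
  -- `Q` has no zeros, so that the coordinates `ψ x s` can be divided by it.
  let Q : M → ℝ := fun y => ∑ x : t, ψ x y * ψ x y
  have hQ : ContMDiff 𝓘(ℝ, EM) 𝓘(ℝ, ℝ) ∞ Q := contMDiff_finsetSum fun x _ => (hψ x).smul (hψ x)
  have hQ0 : ∀ y, Q y ≠ 0 := by
    intro y
    obtain ⟨x, hxt, hy⟩ := mem_iUnion₂.1 (ht (mem_univ y))
    have h2 : ψ x y * ψ x y ≤ Q y := Finset.single_le_sum (f := fun x : t => ψ x y * ψ x y)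
      (fun z _ => mul_self_nonneg (ψ z y)) (Finset.mem_univ (⟨x, hxt⟩ : t))
    rw [h1 x y hy] at h2
    exact (lt_of_lt_of_le one_pos (by simpa using h2)).ne'
  refine ⟨Fintype.card ι, fun i => S (e.symm i), fun f hf s hsm => ?_⟩
  let c : M → P → FA := fun x p => ψ x (f p) • trivCoord (FA := FA) x (f p) (s p)
  have hc : ∀ x, ContMDiff IP 𝓘(ℝ, FA) ∞ (c x) := by
    intro x p
    by_cases hp : f p ∈ tsupport (ψ x)
    · exact contMDiffAt_fun_smul (((hψ x).comp hf) p)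
        (contMDiffAt_trivCoord_comp (hs x hp) (hsm p))
    · refine (contMDiffAt_const (c := (0 : FA))).congr_of_eventuallyEq ?_
      filter_upwards [hf.continuous.continuousAt.preimage_mem_nhds
        ((isClosed_tsupport (ψ x)).isOpen_compl.mem_nhds hp)] with y hy
      change ψ x (f y) • _ = _
      rw [image_eq_zero_of_notMem_tsupport hy, zero_smul]
  let a : ι → P → ℝ := fun i p => (Q (f p))⁻¹ * b.coord i.2 (c i.1 p)
  refine ⟨fun i => a (e.symm i), fun i => ?_, fun p => ?_⟩
  · have h3 : ContMDiff IP 𝓘(ℝ, ℝ) ∞ (fun p => (Q (f p))⁻¹) :=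
      (hQ.comp hf).inv₀ fun p => hQ0 (f p)
    have h4 : ContMDiff IP 𝓘(ℝ, ℝ) ∞ (fun p => b.coord (e.symm i).2 (c (e.symm i).1 p)) :=
      (LinearMap.toContinuousLinearMap (b.coord (e.symm i).2)).contDiff.contMDiff.comp (hc _)
    exact h3.smul h4
  · rw [Equiv.sum_comp e.symm (fun i => a i p • S i (f p)), Fintype.sum_prod_type]
    have h5 : ∀ x : t, ∑ j, a (x, j) p • S (x, j) (f p) =
        ((Q (f p))⁻¹ * (ψ x (f p) * ψ x (f p))) • s p := by
      intro x
      have h6 : ∀ j, a (x, j) p • S (x, j) (f p) = ((Q (f p))⁻¹ * ψ x (f p)) •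
          (trivializationAt FA A (x : M)).symmₗ ℝ (f p) (b.repr (c x p) j • b j) := by
        intro j
        change ((Q (f p))⁻¹ * b.coord j (c x p)) • (ψ x (f p) •
          (trivializationAt FA A (x : M)).symmₗ ℝ (f p) (b j)) = _
        rw [((trivializationAt FA A (x : M)).symmₗ ℝ (f p)).map_smul, smul_smul, smul_smul,
          Module.Basis.coord_apply]
        congr 1
        ring
      simp only [h6]
      rw [← Finset.smul_sum, ← map_sum, b.sum_repr]
      change _ • (trivializationAt FA A (x : M)).symmₗ ℝ (f p)
        (ψ x (f p) • trivCoord (FA := FA) (x : M) (f p) (s p)) = _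
      rw [map_smul, trivSection_trivCoord (ψ x) (hs x), smul_smul, mul_assoc]
    simp only [h5]
    rw [← Finset.sum_smul, ← Finset.mul_sum, inv_mul_cancel₀ (hQ0 (f p)), one_smul]

end BundlePullback

/-! ### Homomorphisms and decompositions of sections -/

section Decompositions

variable {E₁ : Type*} [NormedAddCommGroup E₁] [NormedSpace ℝ E₁]
    {H₁ : Type*} [TopologicalSpace H₁] {I₁ : ModelWithCorners ℝ E₁ H₁}
    {M₁ : Type*} [TopologicalSpace M₁] [ChartedSpace H₁ M₁]
    {E₂ : Type*} [NormedAddCommGroup E₂] [NormedSpace ℝ E₂]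
    {H₂ : Type*} [TopologicalSpace H₂] {I₂ : ModelWithCorners ℝ E₂ H₂}
    {M₂ : Type*} [TopologicalSpace M₂] [ChartedSpace H₂ M₂]
    {A₁ : AlgebroidData I₁ M₁} {A₂ : AlgebroidData I₂ M₂} {f : M₁ → M₂}
    {φ : ∀ x, A₁.Fib x →ₗ[ℝ] A₂.Fib (f x)} {p : M₁}
    {W : Type*} [NormedAddCommGroup W] [NormedSpace ℝ W] {fr : AFrame A₂ W (f p)}

theorem AFrame.apply_bracket_decomposition (fr : AFrame A₂ W (f p))
    (hf : ContMDiffAt I₁ I₂ ∞ f p)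
    (ha : ∀ v, A₂.anchor (f p) (φ p v) = mfderiv I₁ I₂ f p (A₁.anchor p v))
    {X Y : ∀ x, A₁.Fib x} {m n : ℕ} {a : Fin m → M₁ → ℝ}
    {X' : Fin m → ∀ y, A₂.Fib y} {b : Fin n → M₁ → ℝ} {Y' : Fin n → ∀ y, A₂.Fib y}
    (hX : IsDecomposition φ X a X') (hY : IsDecomposition φ Y b Y') :
    fr.coord (f p) (∑ i, ∑ j, (a i p * b j p) • A₂.bracket (X' i) (Y' j) (f p) +
          ∑ j, dirDeriv I₁ (b j) p (A₁.anchor p (X p)) • Y' j (f p) -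
          ∑ i, dirDeriv I₁ (a i) p (A₁.anchor p (Y p)) • X' i (f p)) =
      fr.B (fr.coord (f p) (φ p (X p))) (fr.coord (f p) (φ p (Y p))) +
        dirDeriv I₁ (fun q => fr.coord (f q) (φ q (Y q))) p (A₁.anchor p (X p)) -
        dirDeriv I₁ (fun q => fr.coord (f q) (φ q (X q))) p (A₁.anchor p (Y p)) := by
  simp only [hX.eq, hY.eq]
  refine ThomAlgebroid.apply_bracket_decomposition fr.coord fr.B
    (hf.mdifferentiableAt (by simp))
    (fun i => mdiffAt_of_contMDiffAt (hX.smooth_coeff i p))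
    (fun i => mdiffAt_of_contMDiffAt (hY.smooth_coeff i p))
    (fun i => mdiffAt_of_contMDiffAt (fr.smooth_coord _ (hX.smooth_sec i)))
    (fun i => mdiffAt_of_contMDiffAt (fr.smooth_coord _ (hY.smooth_sec i)))
    (fun i j => fr.bracket _ _ (hX.smooth_sec i) (hY.smooth_sec j)) _ _ ?_ ?_
  · rw [← hX.eq, ha]
  · rw [← hY.eq, ha]

/-- The composition of a homomorphism with a bundle map whose bracket is given by decompositions. -/
theorem IsHomAt.comp_of_decomposition {E₃ : Type*} [NormedAddCommGroup E₃] [NormedSpace ℝ E₃]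
    {H₃ : Type*} [TopologicalSpace H₃] {I₃ : ModelWithCorners ℝ E₃ H₃}
    {M₃ : Type*} [TopologicalSpace M₃] [ChartedSpace H₃ M₃] {A₃ : AlgebroidData I₃ M₃} {g : M₂ → M₃}
    {ψ : ∀ x, A₂.Fib x →ₗ[ℝ] A₃.Fib (g x)} {fr : AFrame A₃ W (g (f p))} (hψ : IsHomAt ψ (f p) fr)
    (hf : ContMDiffAt I₁ I₂ ∞ f p)
    (ha : ∀ v, A₂.anchor (f p) (φ p v) = mfderiv I₁ I₂ f p (A₁.anchor p v))
    (h : ∀ X Y, A₁.IsSmooth X → A₁.IsSmooth Y →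
      ∃ (m n : ℕ) (a : Fin m → M₁ → ℝ) (X' : Fin m → ∀ y, A₂.Fib y)
        (b : Fin n → M₁ → ℝ) (Y' : Fin n → ∀ y, A₂.Fib y),
        IsDecomposition φ X a X' ∧ IsDecomposition φ Y b Y' ∧ φ p (A₁.bracket X Y p) =
        ∑ i, ∑ j, (a i p * b j p) • A₂.bracket (X' i) (Y' j) (f p) +
          ∑ j, dirDeriv I₁ (b j) p (A₁.anchor p (X p)) • Y' j (f p) -
          ∑ i, dirDeriv I₁ (a i) p (A₁.anchor p (Y p)) • X' i (f p)) :
    IsHomAt (A₁ := A₁) (A₂ := A₃) (f := fun x => g (f x)) (fun x => ψ (f x) ∘ₗ φ x) p fr where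
  map_smooth := hψ.map_smooth.comp p hf
  anchor v := by
    have h1 := mfderiv_comp_apply p (hψ.map_smooth.mdifferentiableAt (by simp))
      (hf.mdifferentiableAt (by simp)) (A₁.anchor p v)
    refine Eq.trans ?_ h1.symm
    rw [← ha]
    exact hψ.anchor _
  smooth_coord X hX := by
    obtain ⟨m, -, a, X', -, -, hd, -, -⟩ := h X X hX hX
    simp only [LinearMap.comp_apply, hd.eq, map_sum, map_smul]
    exact contMDiffAt_finsetSum fun i _ => contMDiffAt_fun_smul (hd.smooth_coeff i p)
      ((hψ.smooth_coord _ (hd.smooth_sec i)).comp p hf)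
  bracket X Y hX hY := by
    obtain ⟨m, n, a, X', b, Y', hdX, hdY, e⟩ := h X Y hX hY
    simp only [LinearMap.comp_apply, e]
    simp only [hdX.eq, hdY.eq]
    refine ThomAlgebroid.apply_bracket_decomposition (fun q => fr.coord (g q) ∘ₗ ψ q) fr.B
      (hf.mdifferentiableAt (by simp))
      (fun i => mdiffAt_of_contMDiffAt (hdX.smooth_coeff i p))
      (fun i => mdiffAt_of_contMDiffAt (hdY.smooth_coeff i p))
      (fun i => mdiffAt_of_contMDiffAt (hψ.smooth_coord _ (hdX.smooth_sec i)))
      (fun i => mdiffAt_of_contMDiffAt (hψ.smooth_coord _ (hdY.smooth_sec i)))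
      (fun i j => hψ.bracket _ _ (hdX.smooth_sec i) (hdY.smooth_sec j)) _ _ ?_ ?_
    · rw [← hdX.eq, ha]
    · rw [← hdY.eq, ha]

theorem IsHomAt.of_decomposition (hf : ContMDiffAt I₁ I₂ ∞ f p)
    (ha : ∀ v, A₂.anchor (f p) (φ p v) = mfderiv I₁ I₂ f p (A₁.anchor p v))
    (h : ∀ X Y, A₁.IsSmooth X → A₁.IsSmooth Y →
      ∃ (m n : ℕ) (a : Fin m → M₁ → ℝ) (X' : Fin m → ∀ y, A₂.Fib y)
        (b : Fin n → M₁ → ℝ) (Y' : Fin n → ∀ y, A₂.Fib y),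
        IsDecomposition φ X a X' ∧ IsDecomposition φ Y b Y' ∧ φ p (A₁.bracket X Y p) =
        ∑ i, ∑ j, (a i p * b j p) • A₂.bracket (X' i) (Y' j) (f p) +
          ∑ j, dirDeriv I₁ (b j) p (A₁.anchor p (X p)) • Y' j (f p) -
          ∑ i, dirDeriv I₁ (a i) p (A₁.anchor p (Y p)) • X' i (f p)) : IsHomAt φ p fr :=
  IsHomAt.comp_of_decomposition fr.isHomAt_id hf ha h

theorem IsMorphism.isHomAt (h : IsMorphism A₁ A₂ f φ) : IsHomAt φ p fr :=
  IsHomAt.of_decomposition (h.contMDiff p) (h.anchor p) fun X Y hX hY => by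
    obtain ⟨m, a, X', hdX⟩ := h.decomposable X hX
    obtain ⟨n, b, Y', hdY⟩ := h.decomposable Y hY
    exact ⟨m, n, a, X', b, Y', hdX, hdY, h.bracket X Y hX hY m n a X' b Y' hdX hdY p⟩

end Decompositions

/-! ### The bracket of a pull-back algebroid -/

section PullbackBracket

variable {EM : Type*} [NormedAddCommGroup EM] [NormedSpace ℝ EM] [FiniteDimensional ℝ EM]
    {M : Type*} [TopologicalSpace M] [ChartedSpace EM M] [IsManifold 𝓘(ℝ, EM) ∞ M]
    [T2Space M] [CompactSpace M]
    {FA : Type*} [NormedAddCommGroup FA] [NormedSpace ℝ FA] [FiniteDimensional ℝ FA]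
    {A : M → Type*} [TopologicalSpace (TotalSpace FA A)]
    [∀ x, AddCommGroup (A x)] [∀ x, Module ℝ (A x)] [∀ x, TopologicalSpace (A x)]
    [FiberBundle FA A] [VectorBundle ℝ FA A] [ContMDiffVectorBundle ∞ FA A 𝓘(ℝ, EM)]
    (L : LieAlgebroid 𝓘(ℝ, EM) FA A)
    {EP : Type*} [NormedAddCommGroup EP] [NormedSpace ℝ EP] [CompleteSpace EP]
    {HP : Type*} [TopologicalSpace HP] {IP : ModelWithCorners ℝ EP HP} [IP.Boundaryless]
    {P : Type*} [TopologicalSpace P] [ChartedSpace HP P] [IsManifold IP ∞ P]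

/-- The two components in the definition of the bracket of a pull-back algebroid form an element of
its fibre. -/
theorem LieAlgebroid.anchor_bracket_decomposition {f : P → M} (hf : ContMDiff IP 𝓘(ℝ, EM) ∞ f)
    {m n : ℕ} {a : Fin m → P → ℝ} {X : Fin m → Cₛ^∞⟮𝓘(ℝ, EM); FA, A⟯}
    {b : Fin n → P → ℝ} {Y : Fin n → Cₛ^∞⟮𝓘(ℝ, EM); FA, A⟯}
    (ha : ∀ i, ContMDiff IP 𝓘(ℝ, ℝ) ∞ (a i)) (hb : ∀ j, ContMDiff IP 𝓘(ℝ, ℝ) ∞ (b j))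
    {ξ η : ∀ p, TangentSpace IP p}
    (hξ : ContMDiff IP IP.tangent ∞ (fun p => (⟨p, ξ p⟩ : TangentBundle IP P)))
    (hη : ContMDiff IP IP.tangent ∞ (fun p => (⟨p, η p⟩ : TangentBundle IP P)))
    (eξ : ∀ p, mfderiv IP 𝓘(ℝ, EM) f p (ξ p) = L.anchor (f p) (∑ i, a i p • X i (f p)))
    (eη : ∀ p, mfderiv IP 𝓘(ℝ, EM) f p (η p) = L.anchor (f p) (∑ j, b j p • Y j (f p))) (p : P) :
    L.anchor (f p) (∑ i, ∑ j, (a i p * b j p) • L.bracket (X i) (Y j) (f p) +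
          ∑ j, dirDeriv IP (b j) p (ξ p) • Y j (f p) -
          ∑ i, dirDeriv IP (a i) p (η p) • X i (f p)) =
      mfderiv IP 𝓘(ℝ, EM) f p (VectorField.mlieBracket IP ξ η p) := by
  set g := extChartAt 𝓘(ℝ, EM) (f p) with hg
  have hgs : ContMDiffAt 𝓘(ℝ, EM) 𝓘(ℝ, EM) ∞ g (f p) :=
    contMDiffAt_extChartAt_of_mem (mem_chart_source EM (f p))
  have hfm : ∀ q, MDifferentiableAt IP 𝓘(ℝ, EM) f q := fun q =>
    hf.mdifferentiable (by simp) q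
  let c : ∀ q, L.toData.Fib q →ₗ[ℝ] EM := fun q =>
    (mfderiv 𝓘(ℝ, EM) 𝓘(ℝ, EM) g q).toLinearMap ∘ₗ L.anchor q
  have hc : ∀ X : Cₛ^∞⟮𝓘(ℝ, EM); FA, A⟯,
      ContMDiffAt 𝓘(ℝ, EM) 𝓘(ℝ, EM) ∞ (fun q => c q (X q)) (f p) := fun X =>
    contMDiffAt_dirDeriv hgs ((L.contMDiff_anchor.comp X.contMDiff) (f p))
  refine tangent_ext (p := f p) (mem_extChartAt_source _) ?_
  have h1 := ThomAlgebroid.apply_bracket_decomposition c 0 (hfm p) (a := a) (b := b)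
    (X := fun i => ⇑(X i)) (Y := fun j => ⇑(Y j))
    (fun i => mdiffAt_of_contMDiffAt (ha i p))
    (fun i => mdiffAt_of_contMDiffAt (hb i p))
    (fun i => mdiffAt_of_contMDiffAt (hc (X i)))
    (fun i => mdiffAt_of_contMDiffAt (hc (Y i)))
    (fun i j => by
      rw [L.toData_bracket, LinearMap.zero_apply, LinearMap.zero_apply, zero_add]
      change dirDeriv _ g (f p) (L.anchor (f p) (L.bracket (X i) (Y j) (f p))) = _
      rw [L.anchor_bracket]
      exact dirDeriv_mlieBracket hgs ((L.contMDiff_anchor.comp (X i).contMDiff) (f p))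
        ((L.contMDiff_anchor.comp (Y j).contMDiff) (f p))) (ξ p) (η p) (eξ p) (eη p)
  simp only [L.toData_bracket, LinearMap.zero_apply, zero_add] at h1
  refine h1.trans ?_
  have h2 : ContMDiffAt IP 𝓘(ℝ, EM) ∞ (fun q => g (f q)) p := hgs.comp p (hf p)
  rw [← dirDeriv_comp_map (mdiffAt_of_contMDiffAt hgs) (hfm p),
    dirDeriv_mlieBracket h2 (hξ p) (hη p)]
  have h3 : ∀ (ζ : ∀ p, TangentSpace IP p) (z : ∀ q, A (f q)),
      (∀ q, mfderiv IP 𝓘(ℝ, EM) f q (ζ q) = L.anchor (f q) (z q)) → ∀ v : TangentSpace IP p,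
      dirDeriv IP (fun q => c (f q) (z q)) p v =
        dirDeriv IP (fun q => dirDeriv IP (fun q => g (f q)) q (ζ q)) p v := by
    intro ζ z hz v
    refine dirDeriv_congr ?_ v
    filter_upwards [hf.continuous.continuousAt.preimage_mem_nhds
      (extChartAt_source_mem_nhds (I := 𝓘(ℝ, EM)) (f p))] with q hq
    rw [dirDeriv_comp_map (mdifferentiableAt_extChartAt (by rwa [← extChartAt_source 𝓘(ℝ, EM)]))
      (hfm q), hz]
    rfl
  exact congrArg₂ (· - ·) (h3 _ _ eη _) (h3 _ _ eξ _)

theorem LieAlgebroid.pullback_bracket_spec {f : P → M} (hf : ContMDiff IP 𝓘(ℝ, EM) ∞ f)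
    {s t : ∀ p, L.pullbackFib IP f p} (hs : (L.pullback IP f).IsSmooth s)
    (ht : (L.pullback IP f).IsSmooth t) :
    L.IsPullbackBracket IP f s t ((L.pullback IP f).bracket s t) := by
  have hex : ∃ z, L.IsPullbackBracket IP f s t z := by
    obtain ⟨n, S, hS⟩ := exists_generators (EM := EM) (IP := IP) (P := P) (FA := FA) (A := A)
    obtain ⟨a, ha, ea⟩ := hS f hf _ hs.1
    obtain ⟨b, hb, eb⟩ := hS f hf _ ht.1
    have hm := L.anchor_bracket_decomposition hf ha hb (X := S) (Y := S) hs.2 ht.2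
      (fun p => by rw [← ea]; exact (s p).2.symm) (fun p => by rw [← eb]; exact (t p).2.symm)
    exact ⟨fun p => ⟨(_, _), hm p⟩, n, n, a, S, b, S, ha, hb, ea, eb, fun p => ⟨rfl, rfl⟩⟩
  exact Classical.epsilon_spec hex

theorem IsHomAt.comp_projHom {f : P → M} (hf : ContMDiff IP 𝓘(ℝ, EM) ∞ f) {p : P} {W : Type*}
    [NormedAddCommGroup W] [NormedSpace ℝ W] {E₃ : Type*} [NormedAddCommGroup E₃] [NormedSpace ℝ E₃]
    {H₃ : Type*} [TopologicalSpace H₃] {I₃ : ModelWithCorners ℝ E₃ H₃}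
    {M₃ : Type*} [TopologicalSpace M₃] [ChartedSpace H₃ M₃] {A₃ : AlgebroidData I₃ M₃} {g : M → M₃}
    {ψ : ∀ x, L.toData.Fib x →ₗ[ℝ] A₃.Fib (g x)} {fr : AFrame A₃ W (g (f p))}
    (hψ : IsHomAt ψ (f p) fr) : IsHomAt (A₁ := L.pullback IP f) (A₂ := A₃) (f := fun p => g (f p))
      (fun p => ψ (f p) ∘ₗ projHom IP L f p) p fr :=
  hψ.comp_of_decomposition (hf p) (fun v => v.2) fun s t hs ht => by
    obtain ⟨m, n, a, X, b, Y, ha, hb, ea, eb, e⟩ := L.pullback_bracket_spec hf hs ht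
    refine ⟨m, n, a, fun i => X i, b, fun i => Y i, ⟨ha, fun i => (X i).contMDiff, ea⟩,
      ⟨hb, fun i => (Y i).contMDiff, eb⟩, ?_⟩
    simp only [L.toData_bracket]
    exact (e p).1

theorem isHomAt_projHom {f : P → M} (hf : ContMDiff IP 𝓘(ℝ, EM) ∞ f) {p : P} {W : Type*}
    [NormedAddCommGroup W] [NormedSpace ℝ W] (fr : AFrame L.toData W (f p)) :
    IsHomAt (projHom IP L f) p fr :=
  IsHomAt.comp_projHom L hf fr.isHomAt_id

theorem LieAlgebroid.pullback_anchor_bracket {f : P → M} (hf : ContMDiff IP 𝓘(ℝ, EM) ∞ f)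
    {s t : ∀ p, L.pullbackFib IP f p} (hs : (L.pullback IP f).IsSmooth s)
    (ht : (L.pullback IP f).IsSmooth t) (p : P) :
    (L.pullback IP f).anchor p ((L.pullback IP f).bracket s t p) =
      VectorField.mlieBracket IP (fun q => (L.pullback IP f).anchor q (s q))
        (fun q => (L.pullback IP f).anchor q (t q)) p := by
  obtain ⟨m, n, a, X, b, Y, ha, hb, ea, eb, e⟩ := L.pullback_bracket_spec hf hs ht
  exact (e p).2

end PullbackBracket

/-! ### Charts of the total space of a vector bundle -/

section BundleCharts

variable {EM : Type*} [NormedAddCommGroup EM] [NormedSpace ℝ EM] [FiniteDimensional ℝ EM]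
    {M : Type*} [TopologicalSpace M] [ChartedSpace EM M] [IsManifold 𝓘(ℝ, EM) ∞ M]
    {F : Type*} [NormedAddCommGroup F] [NormedSpace ℝ F] [FiniteDimensional ℝ F]
    {E : M → Type*} [TopologicalSpace (TotalSpace F E)]
    [∀ x, AddCommMonoid (E x)] [∀ x, Module ℝ (E x)] [∀ x, TopologicalSpace (E x)]
    [FiberBundle F E] [VectorBundle ℝ F E] [ContMDiffVectorBundle ∞ F E 𝓘(ℝ, EM)]

/-- The base points over which a chart of `M` and the trivialization of `E` are defined. -/
def patch (F : Type*) [NormedAddCommGroup F] [NormedSpace ℝ F]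
    (E : M → Type*) [TopologicalSpace (TotalSpace F E)]
    [∀ x, AddCommMonoid (E x)] [∀ x, Module ℝ (E x)] [∀ x, TopologicalSpace (E x)]
    [FiberBundle F E] (x₀ : M) : Set M :=
  (chartAt EM x₀).source ∩ (trivializationAt F E x₀).baseSet

theorem isOpen_patch (x₀ : M) : IsOpen (patch (EM := EM) F E x₀) :=
  (chartAt EM x₀).open_source.inter (trivializationAt F E x₀).open_baseSet

theorem mem_patch (x₀ : M) : x₀ ∈ patch (EM := EM) F E x₀ :=
  ⟨mem_chart_source EM x₀, mem_baseSet_trivializationAt F E x₀⟩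

/-- The chart of the total space with base point on the zero section. -/
def bundleChart (F : Type*) [NormedAddCommGroup F] [NormedSpace ℝ F]
    (E : M → Type*) [TopologicalSpace (TotalSpace F E)]
    [∀ x, AddCommMonoid (E x)] [∀ x, Module ℝ (E x)] [∀ x, TopologicalSpace (E x)]
    [FiberBundle F E] (x₀ : M) : PartialEquiv (TotalSpace F E) (EM × F) :=
  extChartAt (𝓘(ℝ, EM).prod 𝓘(ℝ, F)) (⟨x₀, 0⟩ : TotalSpace F E)

theorem mem_bundleChart_source {x₀ : M} {q : TotalSpace F E} :
    q ∈ (bundleChart (EM := EM) F E x₀).source ↔ q.proj ∈ patch (EM := EM) F E x₀ := by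
  rw [bundleChart, FiberBundle.extChartAt]
  simp only [PartialEquiv.trans_source, PartialEquiv.prod_source, PartialEquiv.refl_source, mem_inter_iff,
    mem_preimage, mem_prod, mem_univ, and_true, OpenPartialHomeomorph.toFun_eq_coe,
    Trivialization.mem_source, extChartAt_source, patch]
  exact ⟨fun h => ⟨by rw [← Trivialization.coe_fst' _ h.1]; exact h.2, h.1⟩,
    fun h => ⟨h.2, by erw [Trivialization.coe_fst' _ h.2]; exact h.1⟩⟩

theorem bundleChart_apply (x₀ : M) (q : TotalSpace F E) : bundleChart (EM := EM) F E x₀ q =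
    (chartAt EM x₀ (trivializationAt F E x₀ q).1, (trivializationAt F E x₀ q).2) := by
  rw [bundleChart, FiberBundle.extChartAt]
  rfl

theorem bundleChart_fst {x₀ : M} {q : TotalSpace F E} (hq : q.proj ∈ patch (EM := EM) F E x₀) :
    (bundleChart (EM := EM) F E x₀ q).1 = extChartAt 𝓘(ℝ, EM) x₀ q.proj := by
  rw [bundleChart_apply, Trivialization.coe_fst' _ hq.2]
  rfl

theorem bundleChart_target (x₀ : M) : (bundleChart (EM := EM) F E x₀).target =
    ((chartAt EM x₀).target ∩ (chartAt EM x₀).symm ⁻¹' (trivializationAt F E x₀).baseSet) ×ˢ univ := by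
  rw [bundleChart, FiberBundle.extChartAt_target]
  simp

theorem bundleChart_symm (x₀ : M) (z : EM × F) : (bundleChart (EM := EM) F E x₀).symm z =
    (trivializationAt F E x₀).toOpenPartialHomeomorph.symm ((chartAt EM x₀).symm z.1, z.2) := by
  rw [bundleChart, FiberBundle.extChartAt]
  rfl

theorem isOpen_preimage_proj {U : Set M} (hU : IsOpen U) : IsOpen (π F E ⁻¹' U) :=
  hU.preimage (FiberBundle.continuous_proj F E)

theorem bundleChart_source_eq {x₀ : M} {q : TotalSpace F E} (hq : q.proj ∈ patch (EM := EM) F E x₀) :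
    q ∈ (chartAt (ModelProd EM F) (⟨x₀, 0⟩ : TotalSpace F E)).source := by
  rw [← extChartAt_source (𝓘(ℝ, EM).prod 𝓘(ℝ, F))]
  exact mem_bundleChart_source.2 hq

theorem contMDiffAt_bundleChart {x₀ : M} {q : TotalSpace F E}
    (hq : q.proj ∈ patch (EM := EM) F E x₀) :
    ContMDiffAt (𝓘(ℝ, EM).prod 𝓘(ℝ, F)) 𝓘(ℝ, EM × F) ∞ (bundleChart (EM := EM) F E x₀) q :=
  contMDiffAt_extChartAt_of_mem (bundleChart_source_eq hq)

theorem dirDeriv_bundleChart_fst {x₀ : M} {q : TotalSpace F E}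
    (hq : q.proj ∈ patch (EM := EM) F E x₀) (v : TangentSpace (𝓘(ℝ, EM).prod 𝓘(ℝ, F)) q) :
    (dirDeriv (𝓘(ℝ, EM).prod 𝓘(ℝ, F)) (bundleChart (EM := EM) F E x₀) q v).1 =
      dirDeriv 𝓘(ℝ, EM) (extChartAt 𝓘(ℝ, EM) x₀) q.proj
        (mfderiv (𝓘(ℝ, EM).prod 𝓘(ℝ, F)) 𝓘(ℝ, EM) (π F E) q v) := by
  have hp : MDifferentiableAt (𝓘(ℝ, EM).prod 𝓘(ℝ, F)) 𝓘(ℝ, EM) (π F E) q :=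
    (contMDiff_proj E (n := ∞)).mdifferentiable (by simp) _
  have h1 := dirDeriv_clm (ContinuousLinearMap.fst ℝ EM F)
    (mdiffAt_of_contMDiffAt (contMDiffAt_bundleChart hq)) v
  have h2 := dirDeriv_comp_map (mdiffAt_of_contMDiffAt
    (contMDiffAt_extChartAt_of_mem (I := 𝓘(ℝ, EM)) hq.1)) hp v
  refine h1.symm.trans (Eq.trans (dirDeriv_congr ?_ v) h2)
  filter_upwards [(isOpen_preimage_proj (isOpen_patch x₀)).mem_nhds hq] with y hy
    using bundleChart_fst hy

theorem hasChartBumps_totalSpace [T2Space M] :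
    HasChartBumps (𝓘(ℝ, EM).prod 𝓘(ℝ, F)) (TotalSpace F E) := fun p => by
  have hc : (chartAt (ModelProd EM F) p).source =
      π F E ⁻¹' patch (EM := EM) F E p.proj := by
    ext q
    rw [mem_preimage, ← mem_bundleChart_source, bundleChart, extChartAt_source,
      FiberBundle.chartedSpace_chartAt, FiberBundle.chartedSpace_chartAt]
  obtain ⟨ψ, U, hψ, hs, hU, hp, h1⟩ := exists_bump (I := 𝓘(ℝ, EM)) p.proj
    ((isOpen_patch (EM := EM) (F := F) (E := E) p.proj).mem_nhds (mem_patch _))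
  refine ⟨ψ ∘ π F E, π F E ⁻¹' U, hψ.comp (contMDiff_proj E), ?_, isOpen_preimage_proj hU, hp,
    fun q hq => h1 _ hq⟩
  rw [hc]
  exact (closure_minimal (fun (x : TotalSpace F E) (hx : ψ x.proj ≠ 0) => subset_tsupport ψ hx)
    ((isClosed_tsupport ψ).preimage (FiberBundle.continuous_proj F E))).trans
    (preimage_mono hs)

end BundleCharts

/-! ### Frames of the pull-back algebroid -/

section PullbackFrames

variable {EM : Type*} [NormedAddCommGroup EM] [NormedSpace ℝ EM] [FiniteDimensional ℝ EM]
    {M : Type*} [TopologicalSpace M] [ChartedSpace EM M] [IsManifold 𝓘(ℝ, EM) ∞ M]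
    [T2Space M] [CompactSpace M]
    {FA : Type*} [NormedAddCommGroup FA] [NormedSpace ℝ FA] [FiniteDimensional ℝ FA]
    {A : M → Type*} [TopologicalSpace (TotalSpace FA A)]
    [∀ x, AddCommGroup (A x)] [∀ x, Module ℝ (A x)] [∀ x, TopologicalSpace (A x)]
    [FiberBundle FA A] [VectorBundle ℝ FA A] [ContMDiffVectorBundle ∞ FA A 𝓘(ℝ, EM)]
    {L : LieAlgebroid 𝓘(ℝ, EM) FA A}
    {F : Type*} [NormedAddCommGroup F] [NormedSpace ℝ F] [FiniteDimensional ℝ F]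
    {E : M → Type*} [TopologicalSpace (TotalSpace F E)]
    [∀ x, AddCommMonoid (E x)] [∀ x, Module ℝ (E x)] [∀ x, TopologicalSpace (E x)]
    [FiberBundle F E] [VectorBundle ℝ F E] [ContMDiffVectorBundle ∞ F E 𝓘(ℝ, EM)]

/-- The element of a fibre of the pull-back algebroid with components `v` in `A` and `c` in the
direction of the fibres of `E`. -/
def bundleLift {x₀ : M} {q : TotalSpace F E} (hq : q.proj ∈ patch (EM := EM) F E x₀) :
    A q.proj × F →ₗ[ℝ] (L.bundlePullback F E).Fib q :=
  LinearMap.codRestrict (L.pullbackFib (𝓘(ℝ, EM).prod 𝓘(ℝ, F)) (π F E) q)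
    ((LinearMap.fst ℝ (A q.proj) F).prod
      (chartVec (I := 𝓘(ℝ, EM).prod 𝓘(ℝ, F)) (⟨x₀, 0⟩ : TotalSpace F E) q ∘ₗ
        (((mfderiv 𝓘(ℝ, EM) 𝓘(ℝ, EM) (extChartAt 𝓘(ℝ, EM) x₀) q.proj).toLinearMap ∘ₗ
          L.anchor q.proj).prodMap LinearMap.id))) (fun w => by
      refine tangent_ext (p := x₀) (by rw [extChartAt_source]; exact hq.1) ?_
      refine Eq.trans ?_ (dirDeriv_bundleChart_fst hq _)
      exact (congrArg Prod.fst (dirDeriv_chartVec (bundleChart_source_eq hq)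
        (dirDeriv 𝓘(ℝ, EM) (extChartAt 𝓘(ℝ, EM) x₀) q.proj (L.anchor q.proj w.1), w.2))).symm)

theorem dirDeriv_bundleLift {x₀ : M} {q : TotalSpace F E} (hq : q.proj ∈ patch (EM := EM) F E x₀)
    (w : A q.proj × F) : dirDeriv (𝓘(ℝ, EM).prod 𝓘(ℝ, F)) (bundleChart (EM := EM) F E x₀) q
      (bundleLift (L := L) hq w).1.2 =
      (dirDeriv 𝓘(ℝ, EM) (extChartAt 𝓘(ℝ, EM) x₀) q.proj (L.anchor q.proj w.1), w.2) :=
  dirDeriv_chartVec (bundleChart_source_eq hq) _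

/-- The component in the direction of the fibres of `E`, with respect to a trivialization. -/
def fibreCoord (L : LieAlgebroid 𝓘(ℝ, EM) FA A) (x₀ : M) (q : TotalSpace F E) :
    (L.bundlePullback F E).Fib q →ₗ[ℝ] F where
  toFun z := (dirDeriv (𝓘(ℝ, EM).prod 𝓘(ℝ, F)) (bundleChart (EM := EM) F E x₀) q z.1.2).2
  map_add' z z' := by
    change (dirDeriv _ (bundleChart (EM := EM) F E x₀) q (z.1.2 + z'.1.2)).2 = _
    rw [dirDeriv_add_vec]
    rfl
  map_smul' r z := by
    change (dirDeriv _ (bundleChart (EM := EM) F E x₀) q (r • z.1.2)).2 = _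
    rw [dirDeriv_smul_vec]
    rfl

theorem fibreCoord_bundleLift {x₀ : M} {q : TotalSpace F E}
    (hq : q.proj ∈ patch (EM := EM) F E x₀) (w : A q.proj × F) :
    fibreCoord L x₀ q (bundleLift (L := L) hq w) = w.2 :=
  congrArg Prod.snd (dirDeriv_bundleLift (L := L) hq w)

theorem pullbackFib_ext {x₀ : M} {q : TotalSpace F E} (hq : q.proj ∈ patch (EM := EM) F E x₀)
    {z z' : (L.bundlePullback F E).Fib q} (h1 : z.1.1 = z'.1.1)
    (h2 : fibreCoord L x₀ q z = fibreCoord L x₀ q z') : z = z' := by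
  refine Subtype.ext (Prod.ext h1 ?_)
  refine tangent_ext (p := (⟨x₀, 0⟩ : TotalSpace F E)) (mem_bundleChart_source.2 hq) ?_
  refine Prod.ext ?_ h2
  refine (dirDeriv_bundleChart_fst hq _).trans (Eq.trans ?_ (dirDeriv_bundleChart_fst hq _).symm)
  exact congrArg _ ((z.2.symm.trans (congrArg (L.anchor q.proj) h1)).trans z'.2)

theorem isAlgebroid_totalSpace :
    IsAlgebroid (tangentAlgebroid (𝓘(ℝ, EM).prod 𝓘(ℝ, F)) (TotalSpace F E)) (EM × F) :=
  isAlgebroid_tangent hasChartBumps_totalSpace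

theorem contMDiff_bundleProj : ContMDiff (𝓘(ℝ, EM).prod 𝓘(ℝ, F)) 𝓘(ℝ, EM) ∞ (π F E) :=
  contMDiff_proj E

theorem contMDiffAt_fibreCoord {x₀ : M} {s : ∀ q, (L.bundlePullback F E).Fib q}
    (hs : (L.bundlePullback F E).IsSmooth s) {q : TotalSpace F E}
    (hq : q.proj ∈ patch (EM := EM) F E x₀) :
    ContMDiffAt (𝓘(ℝ, EM).prod 𝓘(ℝ, F)) 𝓘(ℝ, F) ∞ (fun q => fibreCoord L x₀ q (s q)) q :=
  (contDiff_snd (E := EM)).contMDiff.contMDiffAt.comp q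
    (contMDiffAt_dirDeriv (contMDiffAt_bundleChart hq) (hs.2 q))

open Classical in
/-- The section of the pull-back algebroid with given components, cut off by a function on the
base. -/
def bundleSec {x₀ : M} (ψ : M → ℝ) (s : FA →ₗ[ℝ] ∀ x, L.toData.Fib x) :
    FA × F →ₗ[ℝ] ∀ q, (L.bundlePullback F E).Fib q where
  toFun w q := if hq : q.proj ∈ patch (EM := EM) F E x₀ then
      ψ q.proj • bundleLift (L := L) hq (s w.1 q.proj, w.2) else 0
  map_add' w w' := by
    funext q
    by_cases hq : q.proj ∈ patch (EM := EM) F E x₀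
    · simp only [dif_pos hq, Pi.add_apply]
      rw [← smul_add]
      congr 1
      refine Eq.trans ?_ (map_add (bundleLift (L := L) hq) _ _)
      congr 1
      exact Prod.ext (congrFun (map_add s _ _) _) rfl
    · simp only [dif_neg hq, Pi.add_apply]
      exact (add_zero 0).symm
  map_smul' r w := by
    funext q
    by_cases hq : q.proj ∈ patch (EM := EM) F E x₀
    · simp only [dif_pos hq, Pi.smul_apply]
      rw [smul_comm]
      congr 1
      refine Eq.trans ?_ (map_smul (bundleLift (L := L) hq) _ _)
      congr 1
      exact Prod.ext (congrFun (map_smul s _ _) _) rfl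
    · simp only [dif_neg hq, Pi.smul_apply]
      exact (smul_zero _).symm

theorem bundleSec_of_mem {x₀ : M} {q : TotalSpace F E} (hq : q.proj ∈ patch (EM := EM) F E x₀)
    (ψ : M → ℝ) (s : FA →ₗ[ℝ] ∀ x, L.toData.Fib x) (w : FA × F) :
    bundleSec (x₀ := x₀) ψ s w q = ψ q.proj • bundleLift (L := L) hq (s w.1 q.proj, w.2) :=
  dif_pos hq

theorem bundleSec_of_eq_zero {x₀ : M} {q : TotalSpace F E} {ψ : M → ℝ} (hq : ψ q.proj = 0)
    (s : FA →ₗ[ℝ] ∀ x, L.toData.Fib x) (w : FA × F) :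
    bundleSec (x₀ := x₀) (E := E) ψ s w q = 0 := by
  by_cases h : q.proj ∈ patch (EM := EM) F E x₀
  · rw [bundleSec_of_mem h, hq, zero_smul]
  · exact dif_neg h

/-- The frame of the pull-back algebroid that is given by a frame of the algebroid, a chart of the
base and a trivialization of the bundle. -/
def pullbackFrameOn {x₀ : M} {U : Set M} (hU : IsOpen U) (fr : AFrameOn L.toData FA U)
    {ψ : M → ℝ} (hψ : ContMDiff 𝓘(ℝ, EM) 𝓘(ℝ, ℝ) ∞ ψ) (hs : tsupport ψ ⊆ patch (EM := EM) F E x₀)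
    (hU1 : ∀ x ∈ U, ψ x = 1) : AFrameOn (L.bundlePullback F E) (FA × F) (π F E ⁻¹' U) :=
  have hb : ∀ x ∈ U, x ∈ patch (EM := EM) F E x₀ := fun q hq =>
    hs (subset_tsupport _ (by rw [Function.mem_support, hU1 q hq]; exact one_ne_zero))
  have h1 : ∀ q (hq : q ∈ π F E ⁻¹' U), ∀ w, bundleSec (x₀ := x₀) ψ fr.sec w q =
      bundleLift (L := L) (hb _ hq) (fr.sec w.1 q.proj, w.2) := fun q hq w => by
    rw [bundleSec_of_mem (hb _ hq), hU1 _ hq, one_smul]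
  { coord := fun q => (fr.coord q.proj ∘ₗ projHom (𝓘(ℝ, EM).prod 𝓘(ℝ, F)) L (π F E) q).prod
      (fibreCoord L x₀ q)
    sec := bundleSec (x₀ := x₀) ψ fr.sec
    -- The fibre components of the sections are constant, so only the brackets of `fr` contribute.
    B := fun q => ((fr.B q.proj).compl₁₂ (LinearMap.fst ℝ FA F) (LinearMap.fst ℝ FA F)).compr₂
      (LinearMap.inl ℝ FA F)
    isSmooth_sec := fun w => by
      have hψ' : ContMDiff (𝓘(ℝ, EM).prod 𝓘(ℝ, F)) 𝓘(ℝ, ℝ) ∞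
          (fun q : TotalSpace F E => ψ q.proj) := hψ.comp contMDiff_bundleProj
      constructor
      · let Z : Cₛ^∞⟮𝓘(ℝ, EM); FA, A⟯ :=
          ⟨fun x => ψ x • (fr.sec w.1 x : A x), hψ.smul_section (fr.isSmooth_sec w.1)⟩
        refine (Z.contMDiff.comp (contMDiff_bundleProj (F := F) (E := E))).congr fun q => ?_
        simp only [Function.comp_apply]
        congr 1
        by_cases hq : ψ q.proj = 0
        · rw [bundleSec_of_eq_zero hq]
          change (0 : A q.proj) = ψ q.proj • (fr.sec w.1 q.proj : A q.proj)
          rw [hq]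
          exact (zero_smul ℝ _).symm
        · rw [bundleSec_of_mem (hs (subset_tsupport _ hq))]
          rfl
      · intro q
        by_cases hq : q.proj ∈ tsupport ψ
        · have hq' := hs hq
          refine (contMDiffAt_vectorField_iff (bundleChart_source_eq hq')).2 ?_
          have h1 : ContMDiffAt 𝓘(ℝ, EM) 𝓘(ℝ, EM) ∞ (fun x => dirDeriv 𝓘(ℝ, EM)
              (extChartAt 𝓘(ℝ, EM) x₀) x (L.anchor x (fr.sec w.1 x))) q.proj :=
            contMDiffAt_dirDeriv (contMDiffAt_extChartAt_of_mem hq'.1)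
              (L.contMDiff_anchor.comp (fr.isSmooth_sec w.1) q.proj)
          have h2 := contMDiffAt_fun_smul (hψ' q) ((h1.comp q (contMDiff_bundleProj q)).prodMk_space
            (contMDiffAt_const (c := w.2)))
          refine h2.congr_of_eventuallyEq ?_
          filter_upwards [(isOpen_preimage_proj (isOpen_patch x₀)).mem_nhds hq'] with y hy
          have hy' : y.proj ∈ patch (EM := EM) F E x₀ := hy
          rw [bundleSec_of_mem hy']
          refine (dirDeriv_smul_vec _ _ _ _).trans ?_
          exact congrArg _ (dirDeriv_bundleLift (L := L) hy' (fr.sec w.1 y.proj, w.2))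
        · refine (contMDiffAt_zero_vectorField q).congr_of_eventuallyEq ?_
          filter_upwards [(isOpen_preimage_proj (isClosed_tsupport ψ).isOpen_compl).mem_nhds hq]
            with y hy
          rw [bundleSec_of_eq_zero (image_eq_zero_of_notMem_tsupport hy)]
          rfl
    coord_sec := fun q hq w => by
      rw [h1 q hq]
      refine Prod.ext (fr.coord_sec _ hq w.1) ?_
      exact fibreCoord_bundleLift (L := L) (hb _ hq) _
    sec_coord := fun q hq v => by
      rw [h1 q hq]
      refine pullbackFib_ext (hb _ hq) ?_ ?_
      · exact fr.sec_coord _ hq v.1.1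
      · exact fibreCoord_bundleLift (L := L) (hb _ hq) _
    smooth_coord := fun s hs q hq =>
      ((isHomAt_projHom L contMDiff_bundleProj (fr.at hU hq)).smooth_coord s hs).prodMk_space
        (contMDiffAt_fibreCoord hs (hb _ hq))
    B_skew := fun q w w' => by
      change LinearMap.inl ℝ FA F (fr.B q.proj w.1 w'.1) = -LinearMap.inl ℝ FA F (fr.B q.proj w'.1 w.1)
      rw [fr.B_skew, map_neg]
    bracket := fun s t hs ht q hq => by
      have hq' := hb _ hq
      have h1 := isHomAt_projHom L contMDiff_bundleProj (fr.at hU hq)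
      have ds := mdiffAt_of_contMDiffAt (h1.smooth_coord s hs)
      have dt := mdiffAt_of_contMDiffAt (h1.smooth_coord t ht)
      have es := mdiffAt_of_contMDiffAt (contMDiffAt_fibreCoord hs hq')
      have et := mdiffAt_of_contMDiffAt (contMDiffAt_fibreCoord ht hq')
      refine Eq.trans ?_ (congrArg₂ (· - ·) (congrArg₂ (· + ·) rfl
        (dirDeriv_prodMk dt et _).symm) (dirDeriv_prodMk ds es _).symm)
      refine Prod.ext (h1.bracket s t hs ht) ?_
      have h2 : ∀ {s}, (L.bundlePullback F E).IsSmooth s → ∀ v, dirDeriv (𝓘(ℝ, EM).prod 𝓘(ℝ, F))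
          (fun q => fibreCoord L x₀ q (s q)) q v =
          (dirDeriv (𝓘(ℝ, EM).prod 𝓘(ℝ, F)) (fun q => dirDeriv (𝓘(ℝ, EM).prod 𝓘(ℝ, F))
            (bundleChart (EM := EM) F E x₀) q (s q).1.2) q v).2 := fun hs v =>
        dirDeriv_clm (ContinuousLinearMap.snd ℝ EM F) (mdiffAt_of_contMDiffAt
          (contMDiffAt_dirDeriv (contMDiffAt_bundleChart hq') (hs.2 q))) v
      refine Eq.trans ?_ (congrArg₂ (· - ·) ((zero_add _).trans (h2 ht _)) (h2 hs _)).symm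
      refine Eq.trans ?_ (congrArg Prod.snd (dirDeriv_mlieBracket (contMDiffAt_bundleChart hq')
        (hs.2 q) (ht.2 q)))
      exact congrArg (fun v => (dirDeriv (𝓘(ℝ, EM).prod 𝓘(ℝ, F))
        (bundleChart (EM := EM) F E x₀) q v).2)
        (L.pullback_anchor_bracket contMDiff_bundleProj hs ht q) }

variable (L F E) in
/-- A local frame of `L` together with the cut-off function that is needed to lift it to a frame of
the pull-back algebroid. -/
structure PatchFrame (x₀ : M) where
  U : Set M
  isOpen : IsOpen U
  ψ : M → ℝ
  smooth : ContMDiff 𝓘(ℝ, EM) 𝓘(ℝ, ℝ) ∞ ψ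
  tsupport_subset : tsupport ψ ⊆ patch (EM := EM) F E x₀
  eq_one : ∀ x ∈ U, ψ x = 1
  base : AFrameOn L.toData FA U

theorem exists_patchFrame (x₀ : M) : ∃ pf : PatchFrame L F E x₀, x₀ ∈ pf.U := by
  obtain ⟨ψ, U, hψ, hs, hU, hp, h1⟩ := exists_bump (I := 𝓘(ℝ, EM)) x₀
    (((isOpen_patch (EM := EM) (F := F) (E := E) x₀).inter
      (trivializationAt FA A x₀).open_baseSet).mem_nhds
      ⟨mem_patch x₀, mem_baseSet_trivializationAt FA A x₀⟩)
  exact ⟨⟨U, hU, ψ, hψ, hs.trans inter_subset_left, h1,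
    L.frameOn x₀ hψ (hs.trans inter_subset_right) hU h1⟩, hp⟩

/-- The induced frame of the pull-back algebroid. -/
def PatchFrame.total {x₀ : M} (pf : PatchFrame L F E x₀) :
    AFrameOn (L.bundlePullback F E) (FA × F) (π F E ⁻¹' pf.U) :=
  pullbackFrameOn pf.isOpen pf.base pf.smooth pf.tsupport_subset pf.eq_one

theorem PatchFrame.isOpen_preimage {x₀ : M} (pf : PatchFrame L F E x₀) : IsOpen (π F E ⁻¹' pf.U) :=
  isOpen_preimage_proj pf.isOpen

theorem PatchFrame.subset_patch {x₀ : M} (pf : PatchFrame L F E x₀) :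
    pf.U ⊆ patch (EM := EM) F E x₀ := fun q hq =>
  pf.tsupport_subset (subset_tsupport _ (by
    rw [Function.mem_support, pf.eq_one q hq]; exact one_ne_zero))

theorem contMDiff_sectionAlong {EP : Type*} [NormedAddCommGroup EP] [NormedSpace ℝ EP]
    {HP : Type*} [TopologicalSpace HP] {IP : ModelWithCorners ℝ EP HP} {P : Type*}
    [TopologicalSpace P] [ChartedSpace HP P] {f : P → M} (hf : ContMDiff IP 𝓘(ℝ, EM) ∞ f)
    {s : ∀ p, A (f p)}
    (hs : ∀ p, ContMDiffAt IP 𝓘(ℝ, FA) ∞ (fun q => trivCoord (FA := FA) (f p) (f q) (s q)) p) :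
    ContMDiff IP (𝓘(ℝ, EM).prod 𝓘(ℝ, FA)) ∞ (fun p => TotalSpace.mk' FA (f p) (s p)) := fun p =>
  contMDiffAt_of_trivCoord_comp (mem_baseSet_trivializationAt FA A (f p)) (hf p) (hs p)

theorem contMDiffAt_trivCoord_self {EP : Type*} [NormedAddCommGroup EP] [NormedSpace ℝ EP]
    {HP : Type*} [TopologicalSpace HP] {IP : ModelWithCorners ℝ EP HP} {P : Type*}
    [TopologicalSpace P] [ChartedSpace HP P] {f : P → M} {s : ∀ p, A (f p)}
    (hs : ContMDiff IP (𝓘(ℝ, EM).prod 𝓘(ℝ, FA)) ∞ (fun p => TotalSpace.mk' FA (f p) (s p))) (p : P) :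
    ContMDiffAt IP 𝓘(ℝ, FA) ∞ (fun q => trivCoord (FA := FA) (f p) (f q) (s q)) p :=
  contMDiffAt_trivCoord_comp (mem_baseSet_trivializationAt FA A (f p)) (hs p)

variable (L F E) in
theorem isAlgebroid_bundlePullback : IsAlgebroid (L.bundlePullback F E) (FA × F) where
  zero := ⟨(0 : Cₛ^∞⟮𝓘(ℝ, EM); FA, A⟯).contMDiff.comp contMDiff_bundleProj,
    isAlgebroid_totalSpace.zero⟩
  add s t hs ht := ⟨contMDiff_sectionAlong contMDiff_bundleProj fun p =>
      ((contMDiffAt_trivCoord_self hs.1 p).add (contMDiffAt_trivCoord_self ht.1 p)).congr_of_eventuallyEq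
        (Eventually.of_forall fun q => map_add (trivCoord (FA := FA) (A := A) _ _) _ _),
    isAlgebroid_totalSpace.add _ _ hs.2 ht.2⟩
  smul r s hs := ⟨contMDiff_sectionAlong contMDiff_bundleProj fun p =>
      (contMDiffAt_fun_smul (a := fun _ => r) contMDiffAt_const
        (contMDiffAt_trivCoord_self hs.1 p)).congr_of_eventuallyEq
        (Eventually.of_forall fun q => map_smul (trivCoord (FA := FA) (A := A) _ _) _ _),
    isAlgebroid_totalSpace.smul r _ hs.2⟩
  anchor_smooth s hs := hs.2
  anchor_bracket s t hs ht p := L.pullback_anchor_bracket contMDiff_bundleProj hs ht p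
  frame p := by
    obtain ⟨pf, hp⟩ := exists_patchFrame (L := L) (F := F) (E := E) p.proj
    exact ⟨pf.total.at pf.isOpen_preimage hp⟩

variable {E₁ : Type*} [NormedAddCommGroup E₁] [NormedSpace ℝ E₁] [CompleteSpace E₁]
    {H₁ : Type*} [TopologicalSpace H₁] {I₁ : ModelWithCorners ℝ E₁ H₁} [I₁.Boundaryless]
    {N : Type*} [TopologicalSpace N] [ChartedSpace H₁ N] [IsManifold I₁ ∞ N]
    {A₁ : AlgebroidData I₁ N} {W₁ : Type*} [NormedAddCommGroup W₁] [NormedSpace ℝ W₁]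

/-- A bundle map into the pull-back algebroid is a homomorphism if its two components are. -/
theorem PatchFrame.isHomAt (h₁ : IsAlgebroid A₁ W₁) {j : N → TotalSpace F E}
    {φ : ∀ x, A₁.Fib x →ₗ[ℝ] (L.bundlePullback F E).Fib (j x)}
    (hj : ContMDiff I₁ (𝓘(ℝ, EM).prod 𝓘(ℝ, F)) ∞ j)
    (ha : ∀ x v, (L.bundlePullback F E).anchor (j x) (φ x v) =
      mfderiv I₁ (𝓘(ℝ, EM).prod 𝓘(ℝ, F)) j x (A₁.anchor x v))
    {x₀ : M} (pf : PatchFrame L F E x₀) {p : N} (hp : (j p).proj ∈ pf.U)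
    (hproj : IsHomAt (A₁ := A₁) (A₂ := L.toData) (f := fun x => (j x).proj)
      (fun x => projHom (𝓘(ℝ, EM).prod 𝓘(ℝ, F)) L (π F E) (j x) ∘ₗ φ x) p
      (pf.base.at pf.isOpen hp)) :
    IsHomAt φ p (pf.total.at pf.isOpen_preimage hp) := by
  have hpp := pf.subset_patch hp
  let G : N → EM × F := fun q => bundleChart (EM := EM) F E x₀ (j q)
  have hG : ContMDiffAt I₁ 𝓘(ℝ, EM × F) ∞ G p := (contMDiffAt_bundleChart hpp).comp p (hj p)
  have hev : ∀ᶠ q in 𝓝 p, (j q).proj ∈ patch (EM := EM) F E x₀ :=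
    hj.continuous.continuousAt.preimage_mem_nhds
      ((isOpen_preimage_proj (isOpen_patch x₀)).mem_nhds hpp)
  have hc : ∀ q, (j q).proj ∈ patch (EM := EM) F E x₀ → ∀ v,
      fibreCoord L x₀ (j q) (φ q v) = (dirDeriv I₁ G q (A₁.anchor q v)).2 := by
    intro q hq v
    refine congrArg Prod.snd (Eq.trans ?_ (dirDeriv_comp_map (mdiffAt_of_contMDiffAt
      (contMDiffAt_bundleChart hq)) (hj.mdifferentiable (by simp) q) _).symm)
    exact congrArg _ (ha q v)
  have hs : ∀ X, A₁.IsSmooth X → ContMDiffAt I₁ 𝓘(ℝ, F) ∞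
      (fun q => fibreCoord L x₀ (j q) (φ q (X q))) p := by
    intro X hX
    refine ((contDiff_snd (E := EM)).contMDiff.contMDiffAt.comp p
      (contMDiffAt_dirDeriv hG (h₁.anchor_smooth X hX p))).congr_of_eventuallyEq ?_
    filter_upwards [hev] with q hq using hc q hq (X q)
  have hd : ∀ X, A₁.IsSmooth X → ∀ v, dirDeriv I₁ (fun q => fibreCoord L x₀ (j q) (φ q (X q))) p v =
      (dirDeriv I₁ (fun q => dirDeriv I₁ G q (A₁.anchor q (X q))) p v).2 := by
    intro X hX v
    refine Eq.trans (dirDeriv_congr ?_ v) (dirDeriv_clm (ContinuousLinearMap.snd ℝ EM F)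
      (mdiffAt_of_contMDiffAt (contMDiffAt_dirDeriv hG (h₁.anchor_smooth X hX p))) v)
    filter_upwards [hev] with q hq using hc q hq (X q)
  exact
  { map_smooth := hj p
    anchor := ha p
    smooth_coord := fun X hX => (hproj.smooth_coord X hX).prodMk_space (hs X hX)
    bracket := fun X Y hX hY => by
      have dX := mdiffAt_of_contMDiffAt (hproj.smooth_coord X hX)
      have dY := mdiffAt_of_contMDiffAt (hproj.smooth_coord Y hY)
      refine Eq.trans ?_ (congrArg₂ (· - ·) (congrArg₂ (· + ·) rfl
        (dirDeriv_prodMk dY (mdiffAt_of_contMDiffAt (hs Y hY)) _).symm)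
        (dirDeriv_prodMk dX (mdiffAt_of_contMDiffAt (hs X hX)) _).symm)
      refine Prod.ext (hproj.bracket X Y hX hY) ?_
      refine Eq.trans ?_ (congrArg₂ (· - ·) ((zero_add _).trans (hd Y hY _)) (hd X hX _)).symm
      refine Eq.trans ?_ (congrArg Prod.snd (dirDeriv_mlieBracket hG
        (h₁.anchor_smooth X hX p) (h₁.anchor_smooth Y hY p)))
      refine (hc p hpp _).trans ?_
      rw [h₁.anchor_bracket X Y hX hY] }

end PullbackFrames

/-! ### The bundle maps in the theorem are homomorphisms -/

section Homs

variable {E₁ : Type*} [NormedAddCommGroup E₁] [NormedSpace ℝ E₁] [CompleteSpace E₁]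
    {H₁ : Type*} [TopologicalSpace H₁] {I₁ : ModelWithCorners ℝ E₁ H₁} [I₁.Boundaryless]
    {N : Type*} [TopologicalSpace N] [ChartedSpace H₁ N] [IsManifold I₁ ∞ N]
    {A₁ : AlgebroidData I₁ N} {W₁ : Type*} [NormedAddCommGroup W₁] [NormedSpace ℝ W₁]

theorem exists_tangentFrame_isHomAt_anchor (h₁ : IsAlgebroid A₁ W₁) (hb : HasChartBumps I₁ N)
    (p : N) : ∃ fr : AFrame (tangentAlgebroid I₁ N) E₁ (id p),
      IsHomAt (A₁ := A₁) (A₂ := tangentAlgebroid I₁ N) (f := id) A₁.anchor p fr := by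
  obtain ⟨ψ, U, hψ, hs, hU, hp, h1⟩ := hb p
  have hq := mem_chart_source H₁ p
  exact ⟨(tangentFrameOn p hψ hs h1).at hU hp,
  { map_smooth := contMDiffAt_id
    anchor := fun v => by rw [mfderiv_id]; rfl
    smooth_coord := fun X hX => contMDiffAt_dirDeriv (contMDiffAt_extChartAt_of_mem hq)
      (h₁.anchor_smooth X hX p)
    bracket := fun X Y hX hY => by
      refine Eq.trans ?_ ((dirDeriv_mlieBracket (contMDiffAt_extChartAt_of_mem hq)
        (h₁.anchor_smooth X hX p) (h₁.anchor_smooth Y hY p)).trans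
        (congrArg₂ (· - ·) (zero_add _) rfl).symm)
      exact congrArg (dirDeriv I₁ (extChartAt I₁ p) p) (h₁.anchor_bracket X Y hX hY p) }⟩

variable {E₂ : Type*} [NormedAddCommGroup E₂] [NormedSpace ℝ E₂]
    {H₂ : Type*} [TopologicalSpace H₂] {I₂ : ModelWithCorners ℝ E₂ H₂}
    {M₂ : Type*} [TopologicalSpace M₂] [ChartedSpace H₂ M₂] {A₂ : AlgebroidData I₂ M₂}

theorem isHomAt_zero {W : Type*} [NormedAddCommGroup W] [NormedSpace ℝ W] {x : M₂} {p : N}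
    (fr : AFrame A₂ W x) :
    IsHomAt (A₁ := A₁) (A₂ := A₂) (f := fun _ => x) (fun _ => 0) p fr where
  map_smooth := contMDiffAt_const
  anchor v := by
    rw [LinearMap.zero_apply, map_zero, mfderiv_const]
    rfl
  smooth_coord X _ := by
    simp only [LinearMap.zero_apply, map_zero]
    exact contMDiffAt_const
  bracket X Y _ _ := by
    simp only [LinearMap.zero_apply, map_zero, dirDeriv_const, add_zero, sub_zero]

variable {EM : Type*} [NormedAddCommGroup EM] [NormedSpace ℝ EM] [FiniteDimensional ℝ EM]
    {M : Type*} [TopologicalSpace M] [ChartedSpace EM M] [IsManifold 𝓘(ℝ, EM) ∞ M]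
    [T2Space M] [CompactSpace M]

/-- The derivative of a map into a compact manifold is a homomorphism to its tangent algebroid. -/
theorem isHomAt_mfderiv {f : N → M} (hf : ContMDiff I₁ 𝓘(ℝ, EM) ∞ f) {W : Type*}
    [NormedAddCommGroup W] [NormedSpace ℝ W] {p : N}
    (fr : AFrame (tangentLieAlgebroid EM M).toData W (f p)) :
    IsHomAt (A₁ := tangentAlgebroid I₁ N) (A₂ := (tangentLieAlgebroid EM M).toData) (f := f)
      (fun q => (mfderiv I₁ 𝓘(ℝ, EM) f q).toLinearMap) p fr := by
  refine IsHomAt.of_decomposition (hf p) (fun v => rfl) fun ξ η hξ hη => ?_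
  have h1 : ∀ {ξ : ∀ q, TangentSpace I₁ q}, (tangentAlgebroid I₁ N).IsSmooth ξ →
      ContMDiff I₁ (𝓘(ℝ, EM).prod 𝓘(ℝ, EM)) ∞ (fun p => TotalSpace.mk' EM
        (E := (TangentSpace 𝓘(ℝ, EM) : M → Type _)) (f p) (mfderiv I₁ 𝓘(ℝ, EM) f p (ξ p))) := fun hξ =>
    (hf.contMDiff_tangentMap (m := ∞) (by simp)).comp hξ
  obtain ⟨n, S, hS⟩ := exists_generators (EM := EM) (IP := I₁) (P := N) (FA := EM)
    (A := (TangentSpace 𝓘(ℝ, EM) : M → Type _))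
  obtain ⟨a, ha, ea⟩ := hS f hf _ (h1 hξ)
  obtain ⟨b, hb, eb⟩ := hS f hf _ (h1 hη)
  refine ⟨n, n, a, fun i => S i, b, fun i => S i, ⟨ha, fun i => (S i).contMDiff, ea⟩,
    ⟨hb, fun i => (S i).contMDiff, eb⟩, ?_⟩
  simp only [LieAlgebroid.toData_bracket]
  exact ((tangentLieAlgebroid EM M).anchor_bracket_decomposition hf ha hb (X := S) (Y := S) hξ hη
    ea eb p).symm

variable {FA : Type*} [NormedAddCommGroup FA] [NormedSpace ℝ FA] [FiniteDimensional ℝ FA]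
    {A : M → Type*} [TopologicalSpace (TotalSpace FA A)]
    [∀ x, AddCommGroup (A x)] [∀ x, Module ℝ (A x)] [∀ x, TopologicalSpace (A x)]
    [FiberBundle FA A] [VectorBundle ℝ FA A] [ContMDiffVectorBundle ∞ FA A 𝓘(ℝ, EM)]
    (L : LieAlgebroid 𝓘(ℝ, EM) FA A)
    {F : Type*} [NormedAddCommGroup F] [NormedSpace ℝ F] [FiniteDimensional ℝ F]
    {E : M → Type*} [TopologicalSpace (TotalSpace F E)]
    [∀ x, AddCommMonoid (E x)] [∀ x, Module ℝ (E x)] [∀ x, TopologicalSpace (E x)]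
    [FiberBundle F E] [VectorBundle ℝ F E] [ContMDiffVectorBundle ∞ F E 𝓘(ℝ, EM)]

variable (F E) in
/-- The comparison map from `TE` to the pull-back of the tangent algebroid of the base. -/
def tangentLift : ∀ q, (tangentAlgebroid (𝓘(ℝ, EM).prod 𝓘(ℝ, F)) (TotalSpace F E)).Fib q →ₗ[ℝ]
    ((tangentLieAlgebroid EM M).bundlePullback F E).Fib (id q) := fun q =>
  LinearMap.codRestrict ((tangentLieAlgebroid EM M).pullbackFib (𝓘(ℝ, EM).prod 𝓘(ℝ, F)) (π F E) q)
    ((mfderiv (𝓘(ℝ, EM).prod 𝓘(ℝ, F)) 𝓘(ℝ, EM) (π F E) q).toLinearMap.prod LinearMap.id)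
    (fun _ => rfl)

theorem exists_frame_isHomAt_tangentLift (p : TotalSpace F E) :
    ∃ fr : AFrame ((tangentLieAlgebroid EM M).bundlePullback F E) (EM × F) (id p),
      IsHomAt (tangentLift F E) p fr := by
  obtain ⟨pf, hp⟩ := exists_patchFrame (L := tangentLieAlgebroid EM M) (F := F) (E := E) p.proj
  exact ⟨_, pf.isHomAt isAlgebroid_totalSpace contMDiff_id
    (fun x v => by rw [mfderiv_id]; rfl) hp (isHomAt_mfderiv contMDiff_bundleProj _)⟩

theorem isAlgebroid_euclidean (r : ℕ) :
    IsAlgebroid (euclideanTangent r) (EuclideanSpace ℝ (Fin r)) :=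
  isAlgebroid_tangent hasChartBumps

variable {r : ℕ}

theorem contMDiff_fibreInclusion (x : M) (u : EuclideanSpace ℝ (Fin r) ≃ₗ[ℝ] E x) :
    ContMDiff 𝓘(ℝ, EuclideanSpace ℝ (Fin r)) (𝓘(ℝ, EM).prod 𝓘(ℝ, F)) ∞ (fibreInclusion F x u) := by
  intro v
  rw [contMDiffAt_totalSpace]
  refine ⟨contMDiffAt_const, ?_⟩
  let e := (trivializationAt F E x).linearEquivAt ℝ x (mem_baseSet_trivializationAt F E x)
  have h : ContMDiff 𝓘(ℝ, EuclideanSpace ℝ (Fin r)) 𝓘(ℝ, F) ∞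
      (LinearMap.toContinuousLinearMap (e.toLinearMap ∘ₗ u.toLinearMap)) :=
    (LinearMap.toContinuousLinearMap (e.toLinearMap ∘ₗ u.toLinearMap)).contDiff.contMDiff
  exact h v

theorem fibreHom_anchor (x : M) (u : EuclideanSpace ℝ (Fin r) ≃ₗ[ℝ] E x)
    (v : EuclideanSpace ℝ (Fin r)) (w : (euclideanTangent r).Fib v) :
    (L.bundlePullback F E).anchor _ (fibreHom F L x u v w) =
      mfderiv 𝓘(ℝ, EuclideanSpace ℝ (Fin r)) (𝓘(ℝ, EM).prod 𝓘(ℝ, F)) (fibreInclusion F x u) v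
        ((euclideanTangent r).anchor v w) := rfl

theorem isHomAt_fibreHom (x : M) (u : EuclideanSpace ℝ (Fin r) ≃ₗ[ℝ] E x)
    {x₀ : M} (pf : PatchFrame L F E x₀) (v : EuclideanSpace ℝ (Fin r)) (hx : x ∈ pf.U) :
    IsHomAt (fibreHom F L x u) v
      (pf.total.at pf.isOpen_preimage (p := fibreInclusion F x u v) hx) :=
  pf.isHomAt (isAlgebroid_euclidean r) (contMDiff_fibreInclusion x u) (fibreHom_anchor L x u) hx
    (isHomAt_zero (A₁ := euclideanTangent r) (pf.base.at pf.isOpen hx))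

theorem isMorphism_fibreHom (x : M) (u : EuclideanSpace ℝ (Fin r) ≃ₗ[ℝ] E x) :
    IsMorphism (euclideanTangent r) (L.bundlePullback F E) (fibreInclusion F x u)
      (fibreHom F L x u) := by
  obtain ⟨pf, hx⟩ := exists_patchFrame (L := L) (F := F) (E := E) x
  have hh := fun v => isHomAt_fibreHom L x u pf v hx
  refine ⟨contMDiff_fibreInclusion x u, fun X hX => ?_, fibreHom_anchor L x u, ?_⟩
  · let b := Module.finBasis ℝ (FA × F)
    refine ⟨_, fun i v => b.coord i (pf.total.coord (fibreInclusion F x u v)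
      (fibreHom F L x u v (X v))), fun i => pf.total.sec (b i), fun i v => ?_,
      fun i => pf.total.isSmooth_sec _, fun v => ?_⟩
    · exact (LinearMap.toContinuousLinearMap (b.coord i)).contDiff.contMDiff.contMDiffAt.comp v
        ((hh v).smooth_coord X hX)
    · have h1 := pf.total.sec_coord (fibreInclusion F x u v) hx (fibreHom F L x u v (X v))
      have h2 := congrArg (LinearMap.proj (fibreInclusion F x u v) ∘ₗ pf.total.sec)
        (b.sum_repr (pf.total.coord (fibreInclusion F x u v) (fibreHom F L x u v (X v))))
      rw [map_sum] at h2
      simp only [map_smul] at h2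
      exact h1.symm.trans h2.symm
  · intro X Y hX hY m n a X' b Y' hdX hdY v
    refine (pf.total.at pf.isOpen_preimage (p := fibreInclusion F x u v) hx).coord_injective ?_
    rw [(hh v).bracket X Y hX hY]
    exact (AFrame.apply_bracket_decomposition _ (contMDiff_fibreInclusion x u v)
      (fibreHom_anchor L x u v) hdX hdY).symm

variable {EM' : Type*} [NormedAddCommGroup EM'] [NormedSpace ℝ EM'] [FiniteDimensional ℝ EM']
  {M' : Type*} [TopologicalSpace M'] [ChartedSpace EM' M'] [IsManifold 𝓘(ℝ, EM') ∞ M']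
  [T2Space M'] [CompactSpace M']
  {FA' : Type*} [NormedAddCommGroup FA'] [NormedSpace ℝ FA'] [FiniteDimensional ℝ FA']
  {A' : M' → Type*} [TopologicalSpace (TotalSpace FA' A')]
  [∀ x, AddCommGroup (A' x)] [∀ x, Module ℝ (A' x)] [∀ x, TopologicalSpace (A' x)]
  [FiberBundle FA' A'] [VectorBundle ℝ FA' A'] [ContMDiffVectorBundle ∞ FA' A' 𝓘(ℝ, EM')]
  (L' : LieAlgebroid 𝓘(ℝ, EM') FA' A')

variable {L L'} in
theorem exists_frame_isHomAt_inducedHom {f : C^∞⟮𝓘(ℝ, EM'), M'; 𝓘(ℝ, EM), M⟯}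
    {φ : ∀ x, A' x →ₗ[ℝ] A (f x)} (hφ : IsMorphism L'.toData L.toData f φ)
    (p : TotalSpace F (f *ᵖ E)) :
    ∃ fr : AFrame (L.bundlePullback F E) (FA × F) (Pullback.lift f p),
      IsHomAt (inducedHom F E L' L f φ hφ.anchor) p fr := by
  obtain ⟨pf, hp⟩ := exists_patchFrame (L := L) (F := F) (E := E) (f p.proj)
  refine ⟨_, pf.isHomAt (p := p) (isAlgebroid_bundlePullback L' F (f *ᵖ E))
    (contMDiff_pullbackLift F E f) (fun x v => rfl) hp ?_⟩
  exact IsHomAt.comp_projHom (IP := 𝓘(ℝ, EM').prod 𝓘(ℝ, F)) L' (f := π F (f *ᵖ E)) (A₃ := L.toData)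
    (ψ := φ) contMDiff_bundleProj hφ.isHomAt

end Homs

/-! ### Integration along lines -/

section LineIntegrals

variable {Y V : Type*} [NormedAddCommGroup Y] [NormedSpace ℝ Y] [NormedAddCommGroup V]
  [NormedSpace ℝ V] {U : Set Y} {s : Y →L[ℝ] ℝ} {e : Y} {f : ℝ → ℝ} {g : Y → V} {p : Y}

/-- The integral of `g` along the line through `p` in the direction `e`, with weight `f`. -/
def lineInt (f : ℝ → ℝ) (e : Y) (g : Y → V) (p : Y) : V := ∫ t, f t • g (p + t • e)

/-- On `U`, the support of `g` is bounded in the direction measured by the functional `s`. -/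
def BddIn (U : Set Y) (s : Y → ℝ) (g : Y → V) : Prop := ∃ R : ℝ, ∀ p ∈ U, R < |s p| → g p = 0

theorem continuous_line (hUe : ∀ p ∈ U, ∀ t : ℝ, p + t • e ∈ U)
    (hg : ContinuousOn g U) (hp : p ∈ U) : Continuous fun t : ℝ => g (p + t • e) :=
  hg.comp_continuous (by fun_prop) fun t => hUe p hp t

theorem hasCompactSupport_line (hse : s e = 1) (hUe : ∀ p ∈ U, ∀ t : ℝ, p + t • e ∈ U)
    (hb : BddIn U s g) (hp : p ∈ U) : HasCompactSupport fun t : ℝ => g (p + t • e) := by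
  obtain ⟨R, hR⟩ := hb
  refine HasCompactSupport.of_support_subset_isCompact
    (isCompact_Icc (a := -(R + |s p|)) (b := R + |s p|)) fun t ht => ?_
  by_contra hc
  refine ht (hR _ (hUe p hp t) ?_)
  rw [map_add, map_smul, hse, smul_eq_mul, mul_one]
  by_contra h
  refine hc (abs_le.1 ?_)
  have := abs_sub_abs_le_abs_sub t (-s p)
  rw [abs_neg, sub_neg_eq_add, add_comm t] at this
  linarith

theorem integrable_line (hse : s e = 1)
    (hUe : ∀ p ∈ U, ∀ t : ℝ, p + t • e ∈ U) (hf : LocallyIntegrable f)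
    (hg : ContinuousOn g U) (hb : BddIn U s g) (hp : p ∈ U) :
    Integrable fun t : ℝ => f t • g (p + t • e) :=
  hf.integrable_smul_right_of_hasCompactSupport (continuous_line hUe hg hp)
    (hasCompactSupport_line hse hUe hb hp)

theorem BddIn.fderiv (hU : IsOpen U) (hb : BddIn U s g) : BddIn U s (fderiv ℝ g) := by
  obtain ⟨R, hR⟩ := hb
  refine ⟨R, fun p hp h => ?_⟩
  have : g =ᶠ[𝓝 p] fun _ => 0 := by
    have h1 : {q | R < |s q|} ∈ 𝓝 p :=
      (isOpen_lt continuous_const (by fun_prop)).mem_nhds h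
    filter_upwards [hU.mem_nhds hp, h1] with q hq hq1 using hR q hq hq1
  rw [this.fderiv_eq]
  exact fderiv_const_apply _

theorem lineInt_clm {V' : Type*} [NormedAddCommGroup V'] [NormedSpace ℝ V'] [CompleteSpace V]
    [CompleteSpace V'] (hse : s e = 1)
    (hUe : ∀ p ∈ U, ∀ t : ℝ, p + t • e ∈ U) (hf : LocallyIntegrable f)
    (hg : ContinuousOn g U) (hb : BddIn U s g) (hp : p ∈ U) (T : V →L[ℝ] V') :
    lineInt f e (fun q => T (g q)) p = T (lineInt f e g p) := by
  rw [lineInt, lineInt, ← T.integral_comp_comm (integrable_line hse hUe hf hg hb hp)]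
  simp

/-- The convolution by which integrals along lines are computed near `p`. -/
theorem lineInt_eq_convolution (p : Y) :
    lineInt f e g p =
      convolution f (fun x : ℝ => g (p - x • e)) (ContinuousLinearMap.lsmul ℝ ℝ) volume 0 := by
  simp [lineInt, convolution]

theorem exists_line_nhds (hU : IsOpen U) (hse : s e = 1)
    (hUe : ∀ p ∈ U, ∀ t : ℝ, p + t • e ∈ U) (hb : BddIn U s g) (hp : p ∈ U) :
    ∃ S : Set Y, IsOpen S ∧ p ∈ S ∧ S ⊆ U ∧ ∃ k : Set ℝ, IsCompact k ∧
      ∀ q, ∀ x : ℝ, q ∈ S → x ∉ k → g (q - x • e) = 0 := by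
  obtain ⟨R, hR⟩ := hb
  refine ⟨U ∩ {q | |s q| < |s p| + 1}, hU.inter (isOpen_lt (by fun_prop) continuous_const),
    ⟨hp, by simp⟩, inter_subset_left, Icc (-(R + |s p| + 1)) (R + |s p| + 1), isCompact_Icc,
    fun q x hq hx => ?_⟩
  have h1 : q - x • e ∈ U := by simpa [sub_eq_add_neg] using hUe q hq.1 (-x)
  refine hR _ h1 ?_
  rw [map_sub, map_smul, hse, smul_eq_mul, mul_one]
  by_contra h
  refine hx (abs_le.1 ?_)
  have := abs_sub_abs_le_abs_sub x (s q)
  rw [abs_sub_comm] at this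
  have h2 : |s q| < |s p| + 1 := hq.2
  linarith

theorem contDiffOn_line {S : Set Y} (hUe : ∀ p ∈ U, ∀ t : ℝ, p + t • e ∈ U) (hSU : S ⊆ U)
    {n : WithTop ℕ∞} (hg : ContDiffOn ℝ n g U) :
    ContDiffOn ℝ n ↿(fun (q : Y) (x : ℝ) => g (q - x • e)) (S ×ˢ univ) := by
  refine hg.comp (f := fun q : Y × ℝ => q.1 - q.2 • e) (by fun_prop) fun q hq => ?_
  simpa [sub_eq_add_neg] using hUe q.1 (hSU hq.1) (-q.2)

theorem contDiffOn_lineInt (hU : IsOpen U) (hse : s e = 1)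
    (hUe : ∀ p ∈ U, ∀ t : ℝ, p + t • e ∈ U) (hf : LocallyIntegrable f)
    (hg : ContDiffOn ℝ ∞ g U) (hb : BddIn U s g) : ContDiffOn ℝ ∞ (lineInt f e g) U := by
  intro p hp
  obtain ⟨S, hS, hpS, hSU, k, hk, h0⟩ := exists_line_nhds hU hse hUe hb hp
  have h := contDiffOn_convolution_right_with_param_comp (n := ⊤) (ContinuousLinearMap.lsmul ℝ ℝ)
    (contDiffOn_const (c := (0 : ℝ))) (f := f) (g := fun q x => g (q - x • e)) (μ := volume)
    hS hk h0 hf (contDiffOn_line hUe hSU hg)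
  refine ((h.contDiffAt (hS.mem_nhds hpS)).congr_of_eventuallyEq ?_).contDiffWithinAt
  exact Eventually.of_forall fun q => lineInt_eq_convolution q

theorem hasFDerivAt_lineInt [CompleteSpace V] (hU : IsOpen U) (hse : s e = 1)
    (hUe : ∀ p ∈ U, ∀ t : ℝ, p + t • e ∈ U) (hf : LocallyIntegrable f)
    (hg : ContDiffOn ℝ ∞ g U) (hb : BddIn U s g) (hp : p ∈ U) :
    HasFDerivAt (lineInt f e g) (lineInt f e (fderiv ℝ g) p) p := by
  obtain ⟨S, hS, hpS, hSU, k, hk, h0⟩ := exists_line_nhds hU hse hUe hb hp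
  have hg1 : ContDiffOn ℝ 1 g U := hg.of_le (by exact_mod_cast le_top)
  -- A line integral is a convolution with a parameter, evaluated at `0`.
  have h := hasFDerivAt_convolution_right_with_param (ContinuousLinearMap.lsmul ℝ ℝ) (f := f)
    (g := fun q x => g (q - x • e)) (μ := volume)
    hS hk h0 hf (contDiffOn_line hUe hSU hg1) (p, 0) hpS
  have h1 : HasFDerivAt (fun q : Y => (q, (0 : ℝ))) (ContinuousLinearMap.inl ℝ Y ℝ) p :=
    (hasFDerivAt_id p).prodMk (hasFDerivAt_const _ _)
  have h2 := HasFDerivAt.comp (f := fun q : Y => (q, (0 : ℝ))) p h h1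
  have h3 : lineInt f e g = (fun q : Y × ℝ => convolution f (fun x : ℝ => g (q.1 - x • e))
      (ContinuousLinearMap.lsmul ℝ ℝ) volume q.2) ∘ fun q : Y => (q, (0 : ℝ)) :=
    funext lineInt_eq_convolution
  rw [h3]
  convert h2 using 1
  -- the derivative of `(q, x) ↦ g (q - x e)` in the direction of `q`
  have hfd : ∀ x : ℝ, (fderiv ℝ ↿(fun (q : Y) (x : ℝ) => g (q - x • e)) (p, x)).comp
      (ContinuousLinearMap.inl ℝ Y ℝ) = fderiv ℝ g (p - x • e) := fun x => by
    have hx : p - x • e ∈ U := by simpa [sub_eq_add_neg] using hUe p hp (-x)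
    have d1 : HasFDerivAt g (fderiv ℝ g (p - x • e)) (p - x • e) :=
      ((hg1.contDiffAt (hU.mem_nhds hx)).differentiableAt (by norm_num)).hasFDerivAt
    have d2 : HasFDerivAt (fun q : Y × ℝ => q.1 - q.2 • e)
        (ContinuousLinearMap.fst ℝ Y ℝ - (ContinuousLinearMap.snd ℝ Y ℝ).smulRight e) (p, x) :=
      ((ContinuousLinearMap.fst ℝ Y ℝ) -
        (ContinuousLinearMap.snd ℝ Y ℝ).smulRight e).hasFDerivAt
    have d3 : HasFDerivAt (↿(fun (q : Y) (x : ℝ) => g (q - x • e))) _ (p, x) :=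
      HasFDerivAt.comp (f := fun q : Y × ℝ => q.1 - q.2 • e) (p, x) d1 d2
    rw [d3.fderiv]
    ext v
    simp
  have hint : ConvolutionExistsAt f
      (fun x : ℝ => fderiv ℝ ↿(fun (q : Y) (x : ℝ) => g (q - x • e)) (p, x)) 0
      ((ContinuousLinearMap.lsmul ℝ ℝ).precompR (Y × ℝ)) volume := by
    have hcont : Continuous fun x : ℝ =>
        fderiv ℝ ↿(fun (q : Y) (x : ℝ) => g (q - x • e)) (p, x) := by
      have := (contDiffOn_line hUe hSU hg1).continuousOn_fderiv_of_isOpen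
        (hS.prod isOpen_univ) le_rfl
      exact this.comp_continuous (by fun_prop) fun x => ⟨hpS, mem_univ _⟩
    have hsupp : HasCompactSupport fun x : ℝ =>
        fderiv ℝ ↿(fun (q : Y) (x : ℝ) => g (q - x • e)) (p, x) := by
      refine HasCompactSupport.of_support_subset_isCompact hk fun x hx => ?_
      by_contra hc
      refine hx ?_
      have : ↿(fun (q : Y) (x : ℝ) => g (q - x • e)) =ᶠ[𝓝 (p, x)] fun _ => 0 := by
        filter_upwards [(hS.prod hk.isClosed.isOpen_compl).mem_nhds ⟨hpS, hc⟩] with q hq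
        exact h0 q.1 q.2 hq.1 hq.2
      change fderiv ℝ ↿(fun (q : Y) (x : ℝ) => g (q - x • e)) (p, x) = 0
      rw [this.fderiv_eq]
      exact fderiv_const_apply _
    exact hsupp.convolutionExists_right _ hf hcont 0
  ext v
  have hi := integrable_line hse hUe hf
    (hg1.continuousOn_fderiv_of_isOpen hU le_rfl) (hb.fderiv hU) hp
  rw [lineInt, ContinuousLinearMap.integral_apply hi]
  rw [ContinuousLinearMap.comp_apply, convolution, ContinuousLinearMap.integral_apply hint]
  refine integral_congr_ae (Eventually.of_forall fun t => ?_)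
  have := congrArg (fun T => T v) (hfd (0 - t))
  rw [ContinuousLinearMap.comp_apply, ContinuousLinearMap.inl_apply, zero_sub, neg_smul,
    sub_neg_eq_add] at this
  simp [this]

/-- The weight of integrals over a half-line. -/
def halfLine : ℝ → ℝ := (Iic 0).indicator 1

theorem locallyIntegrable_one : LocallyIntegrable (1 : ℝ → ℝ) := locallyIntegrable_const 1

theorem locallyIntegrable_halfLine : LocallyIntegrable halfLine :=
  locallyIntegrable_one.indicator measurableSet_Iic

theorem hasDerivAt_line (hU : IsOpen U) (hUe : ∀ p ∈ U, ∀ t : ℝ, p + t • e ∈ U)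
    (hg : ContDiffOn ℝ ∞ g U) (hp : p ∈ U) (t : ℝ) :
    HasDerivAt (fun t : ℝ => g (p + t • e)) (fderiv ℝ g (p + t • e) e) t := by
  have d1 : HasFDerivAt g (fderiv ℝ g (p + t • e)) (p + t • e) :=
    ((hg.contDiffAt (hU.mem_nhds (hUe p hp t))).differentiableAt (by simp)).hasFDerivAt
  have d2 : HasDerivAt (fun t : ℝ => p + t • e) e t := by
    simpa using ((hasDerivAt_id t).smul_const e).const_add p
  exact d1.comp_hasDerivAt t d2

theorem continuousOn_fderiv_apply (hU : IsOpen U) (hg : ContDiffOn ℝ ∞ g U) :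
    ContinuousOn (fun q => fderiv ℝ g q e) U :=
  (hg.continuousOn_fderiv_of_isOpen hU (by simp)).clm_apply continuousOn_const

theorem BddIn.fderiv_apply (hU : IsOpen U) (hb : BddIn U s g) :
    BddIn U s (fun q => _root_.fderiv ℝ g q e) := by
  obtain ⟨R, hR⟩ := hb.fderiv hU
  exact ⟨R, fun p hp h => by simp [hR p hp h]⟩

theorem lineInt_one_fderiv [CompleteSpace V] (hU : IsOpen U) (hse : s e = 1)
    (hUe : ∀ p ∈ U, ∀ t : ℝ, p + t • e ∈ U) (hg : ContDiffOn ℝ ∞ g U) (hb : BddIn U s g)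
    (hp : p ∈ U) : lineInt 1 e (fun q => fderiv ℝ g q e) p = 0 := by
  have h1 := integrable_line hse hUe locallyIntegrable_one
    (continuousOn_fderiv_apply (e := e) hU hg) (hb.fderiv_apply hU) hp
  have h2 := integrable_line hse hUe locallyIntegrable_one hg.continuousOn hb hp
  simp only [lineInt, Pi.one_apply, one_smul] at h1 h2 ⊢
  exact integral_eq_zero_of_hasDerivAt_of_integrable (hasDerivAt_line hU hUe hg hp) h1 h2

theorem lineInt_halfLine_fderiv [CompleteSpace V] (hU : IsOpen U) (hse : s e = 1)
    (hUe : ∀ p ∈ U, ∀ t : ℝ, p + t • e ∈ U) (hg : ContDiffOn ℝ ∞ g U) (hb : BddIn U s g)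
    (hp : p ∈ U) : lineInt halfLine e (fun q => fderiv ℝ g q e) p = g p := by
  have h1 := integrable_line hse hUe locallyIntegrable_one
    (continuousOn_fderiv_apply (e := e) hU hg) (hb.fderiv_apply hU) hp
  simp only [Pi.one_apply, one_smul] at h1
  have h2 : lineInt halfLine e (fun q => fderiv ℝ g q e) p =
      ∫ t in Iic (0 : ℝ), fderiv ℝ g (p + t • e) e := by
    rw [lineInt, ← integral_indicator measurableSet_Iic]
    refine integral_congr_ae (Eventually.of_forall fun t => ?_)
    by_cases ht : t ∈ Iic (0 : ℝ) <;> simp [halfLine, ht]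
  have h3 : Tendsto (fun t : ℝ => g (p + t • e)) atBot (𝓝 0) := by
    have := hasCompactSupport_line hse hUe hb hp
    rw [hasCompactSupport_iff_eventuallyEq, Filter.coclosedCompact_eq_cocompact] at this
    exact (this.filter_mono atBot_le_cocompact).tendsto
  rw [h2, integral_Iic_of_hasDerivAt_of_tendsto' (fun t _ => hasDerivAt_line hU hUe hg hp t)
    h1.integrableOn h3]
  simp

theorem lineInt_eq_zero (h : ∀ t : ℝ, g (p + t • e) = 0) : lineInt f e g p = 0 := by
  simp [lineInt, h]

theorem BddIn.lineInt {s' : Y →L[ℝ] ℝ} (hUe : ∀ p ∈ U, ∀ t : ℝ, p + t • e ∈ U) (hs' : s' e = 0)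
    (hb : BddIn U s' g) : BddIn U s' (lineInt f e g) := by
  obtain ⟨R, hR⟩ := hb
  exact ⟨R, fun p hp h => lineInt_eq_zero fun t => hR _ (hUe p hp t) (by simpa [hs'] using h)⟩

/-- A primitive along lines that is cut off far away on the positive side has bounded support. -/
theorem bddIn_lineInt_halfLine_sub (hse : s e = 1) (hUe : ∀ p ∈ U, ∀ t : ℝ, p + t • e ∈ U)
    (hb : BddIn U s g) {η : ℝ → ℝ} {C : ℝ} (h0 : ∀ t < -C, η t = 0) (h1 : ∀ t, C < t → η t = 1) :
    BddIn U s fun p => lineInt halfLine e g p - η (s p) • lineInt 1 e g p := by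
  obtain ⟨R, hR⟩ := hb
  refine ⟨max R C, fun p hp h => ?_⟩
  have key : ∀ t : ℝ, s (p + t • e) = s p + t := fun t => by simp [hse]
  beta_reduce
  rcases lt_abs.1 h with hpos | hneg
  -- the part of the line beyond `p` does not meet the support
  · rw [h1 _ ((le_max_right _ _).trans_lt hpos), one_smul, sub_eq_zero]
    refine integral_congr_ae (Eventually.of_forall fun t => ?_)
    by_cases ht : t ∈ Iic (0 : ℝ)
    · simp [halfLine, ht]
    · have : g (p + t • e) = 0 := by
        refine hR _ (hUe p hp t) ?_
        rw [key]
        exact lt_of_lt_of_le (by linarith [not_le.1 (mem_Iic.not.1 ht), le_max_left R C]) (le_abs_self _)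
      simp [this]
  -- the part of the line before `p` does not meet the support
  · rw [h0 _ (by linarith [le_max_right R C]), zero_smul, sub_zero]
    refine integral_eq_zero_of_ae (Eventually.of_forall fun t => ?_)
    by_cases ht : t ∈ Iic (0 : ℝ)
    · have : g (p + t • e) = 0 := by
        refine hR _ (hUe p hp t) ?_
        rw [key]
        exact lt_of_lt_of_le (by linarith [mem_Iic.1 ht, le_max_left R C]) (neg_le_abs _)
      simp [this]
    · simp [halfLine, ht]

end LineIntegrals

/-! ### Fibre integration and primitives in local coordinates -/

section LocalForms

variable {Y W N : Type*} [NormedAddCommGroup Y] [NormedSpace ℝ Y]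
  [NormedAddCommGroup W] [NormedSpace ℝ W] [FiniteDimensional ℝ W]
  [NormedAddCommGroup N] [NormedSpace ℝ N] [FiniteDimensional ℝ N] {n : ℕ}

/-- A continuous alternating map as an alternating map. -/
def toAltL : W [⋀^Fin n]→L[ℝ] N →ₗ[ℝ] W [⋀^Fin n]→ₗ[ℝ] N where
  toFun c := c.toAlternatingMap
  map_add' _ _ := rfl
  map_smul' _ _ := rfl

@[simp] theorem toAltL_toContAlt (c : W [⋀^Fin n]→ₗ[ℝ] N) : toAltL (toContAlt c) = c := rfl

/-- Contraction with a vector. -/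
def contract (b : W) : W [⋀^Fin (n + 1)]→L[ℝ] N →L[ℝ] W [⋀^Fin n]→L[ℝ] N :=
  LinearMap.toContinuousLinearMap (toContAlt ∘ₗ iota b ∘ₗ toAltL)

theorem contract_apply (b : W) (c : W [⋀^Fin (n + 1)]→L[ℝ] N) (v : Fin n → W) :
    contract b c v = c (Matrix.vecCons b v) := rfl

theorem contract_toContAlt (b : W) (c : W [⋀^Fin (n + 1)]→ₗ[ℝ] N) :
    contract b (toContAlt c) = toContAlt (iota b c) := rfl

/-- The wedge product with a covector. -/
def covWedge (l : W →ₗ[ℝ] ℝ) : W [⋀^Fin n]→L[ℝ] N →L[ℝ] W [⋀^Fin (n + 1)]→L[ℝ] N :=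
  LinearMap.toContinuousLinearMap (toContAlt ∘ₗ covecWedgeL l ∘ₗ toAltL)

theorem covWedge_eq (l : W →ₗ[ℝ] ℝ) (c : W [⋀^Fin n]→L[ℝ] N) :
    covWedge l c = toContAlt (covecWedge l (toAltL c)) := rfl

theorem covWedge_self (l : W →ₗ[ℝ] ℝ) (c : W [⋀^Fin n]→L[ℝ] N) :
    covWedge l (covWedge l c) = 0 := by
  have h := covecWedge_anticomm l l (toAltL c)
  have h2 : covecWedge l (covecWedge l (toAltL c)) = 0 := by
    have h3 := add_eq_zero_iff_eq_neg.2 h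
    rw [← two_smul ℝ, smul_eq_zero] at h3
    exact h3.resolve_left two_ne_zero
  rw [covWedge_eq, covWedge_eq, toAltL_toContAlt, h2, map_zero]

theorem covWedge_smul_left (r : ℝ) (l : W →ₗ[ℝ] ℝ) (c : W [⋀^Fin n]→L[ℝ] N) :
    covWedge (r • l) c = r • covWedge l c := by
  ext v
  simp only [covWedge_eq, toContAlt_apply, ContinuousAlternatingMap.smul_apply, covecWedge_apply,
    Finset.smul_sum, LinearMap.smul_apply, smul_eq_mul, mul_smul]
  exact Finset.sum_congr rfl fun i _ => smul_comm _ _ _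

theorem covWedge_apply (l : W →ₗ[ℝ] ℝ) (c : W [⋀^Fin n]→L[ℝ] N) (v : Fin (n + 1) → W) :
    covWedge l c v = ∑ i : Fin (n + 1), (-1 : ℝ) ^ (i : ℕ) • (l (v i) • c (i.removeNth v)) :=
  covecWedge_apply _ _ _

/-- The Koszul differential of a form with derivative `T` and value `c` at a point where the anchor
is `a` and the structure constants are `B`. -/
def theta (a : W →ₗ[ℝ] Y) (B : W →ₗ[ℝ] W →ₗ[ℝ] W) :
    (Y →L[ℝ] W [⋀^Fin n]→L[ℝ] N) × (W [⋀^Fin n]→L[ℝ] N) →ₗ[ℝ] W [⋀^Fin (n + 1)]→L[ℝ] N where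
  toFun z := toContAlt (chev LinearMap.id B (toAltL ∘ₗ z.1.toLinearMap ∘ₗ a) (toAltL z.2))
  map_add' z z' := by
    rw [← map_add]
    congr 1
    simp only [chev, Prod.fst_add, Prod.snd_add, map_add, bracketTerm_add, smul_add]
    rw [ContinuousLinearMap.toLinearMap_add, LinearMap.add_comp, LinearMap.comp_add, altU_add]
    abel
  map_smul' r z := by
    rw [RingHom.id_apply, ← map_smul]
    congr 1
    simp only [chev, Prod.smul_fst, Prod.smul_snd, map_smul, bracketTerm_smul, smul_sub]
    rw [ContinuousLinearMap.toLinearMap_smul, LinearMap.smul_comp, LinearMap.comp_smul, altU_smul,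
      smul_comm r]

theorem theta_apply (a : W →ₗ[ℝ] Y) (B : W →ₗ[ℝ] W →ₗ[ℝ] W) (T : Y →L[ℝ] W [⋀^Fin n]→L[ℝ] N)
    (c : W [⋀^Fin n]→L[ℝ] N) : theta a B (T, c) =
      toContAlt (chev LinearMap.id B (toAltL ∘ₗ T.toLinearMap ∘ₗ a) (toAltL c)) := rfl

theorem theta_smulRight (a : W →ₗ[ℝ] Y) (B : W →ₗ[ℝ] W →ₗ[ℝ] W) (l : Y →L[ℝ] ℝ)
    (c : W [⋀^Fin n]→L[ℝ] N) : theta a B (l.smulRight c, 0) = covWedge (l.toLinearMap ∘ₗ a) c := by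
  rw [theta_apply, covWedge_eq, chev, map_zero]
  have : bracketTerm LinearMap.id B (0 : W [⋀^Fin n]→ₗ[ℝ] N) = 0 := by
    have := bracketTerm_smul LinearMap.id B (0 : ℝ) (0 : W [⋀^Fin n]→ₗ[ℝ] N)
    rwa [zero_smul, zero_smul] at this
  rw [this, smul_zero, sub_zero]
  rfl

variable (A : Y → W →ₗ[ℝ] Y) (B : Y → W →ₗ[ℝ] W →ₗ[ℝ] W)

/-- The Koszul differential of a form that is given in a frame with anchor `A` and structure
constants `B`. -/
def locDiff (g : Y → W [⋀^Fin n]→L[ℝ] N) (p : Y) : W [⋀^Fin (n + 1)]→L[ℝ] N :=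
  theta (A p) (B p) (fderiv ℝ g p, g p)

variable {A B}

theorem fderiv_clm_comp {V V' : Type*} [NormedAddCommGroup V] [NormedSpace ℝ V]
    [NormedAddCommGroup V'] [NormedSpace ℝ V'] (T : V →L[ℝ] V') {g : Y → V} {p : Y}
    (hg : DifferentiableAt ℝ g p) :
    fderiv ℝ (fun q => T (g q)) p = T.comp (fderiv ℝ g p) :=
  (T.hasFDerivAt.comp p hg.hasFDerivAt).fderiv

theorem locDiff_sub {g g' : Y → W [⋀^Fin n]→L[ℝ] N} {p : Y} (hg : DifferentiableAt ℝ g p)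
    (hg' : DifferentiableAt ℝ g' p) :
    locDiff A B (fun q => g q - g' q) p = locDiff A B g p - locDiff A B g' p := by
  rw [locDiff, fderiv_fun_sub hg hg', locDiff, locDiff, ← map_sub]
  rfl

theorem locDiff_smul {φ : Y → ℝ} {g : Y → W [⋀^Fin n]→L[ℝ] N} {p : Y}
    (hφ : DifferentiableAt ℝ φ p) (hg : DifferentiableAt ℝ g p) :
    locDiff A B (fun q => φ q • g q) p =
      φ p • locDiff A B g p + covWedge ((fderiv ℝ φ p).toLinearMap ∘ₗ A p) (g p) := by
  rw [locDiff, fderiv_fun_smul hφ hg, locDiff, ← theta_smulRight (A p) (B p), ← map_smul, ← map_add]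
  congr 1
  simp

theorem locDiff_covWedge {l : W →ₗ[ℝ] ℝ} {g : Y → W [⋀^Fin n]→L[ℝ] N} {p : Y}
    (hl : ∀ X Z, l (B p X Z) = 0) (hg : DifferentiableAt ℝ g p) :
    locDiff A B (fun q => covWedge l (g q)) p = -covWedge l (locDiff A B g p) := by
  have h1 : fderiv ℝ (fun q => covWedge l (g q)) p =
      (covWedge l : W [⋀^Fin n]→L[ℝ] N →L[ℝ] _).comp (fderiv ℝ g p) :=
    fderiv_clm_comp (covWedge l) hg
  rw [locDiff, h1, locDiff, theta_apply, theta_apply, covWedge_eq, covWedge_eq, toAltL_toContAlt,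
    toAltL_toContAlt, ← map_neg]
  congr 1
  refine chev_covecWedge LinearMap.id (B p) l 0 (fun X Z => by simp [hl]) _ _ _ fun X => ?_
  have : covecWedge (0 : W →ₗ[ℝ] ℝ) (pullL LinearMap.id (toAltL (g p))) = 0 := by
    ext v; simp [covecWedge_apply]
  rw [LinearMap.zero_apply, this, zero_add]
  rfl

/-- The Cartan formula. -/
theorem contract_locDiff {g : Y → W [⋀^Fin (n + 1)]→L[ℝ] N} {p : Y} {b : W}
    (hb : ∀ X, B p b X = 0) (hb' : ∀ X, B p X b = 0) (hg : DifferentiableAt ℝ g p) :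
    contract b (locDiff A B g p) =
      fderiv ℝ g p (A p b) - locDiff A B (fun q => contract b (g q)) p := by
  have h1 : fderiv ℝ (fun q => contract b (g q)) p =
      (contract b : W [⋀^Fin (n + 1)]→L[ℝ] N →L[ℝ] _).comp (fderiv ℝ g p) :=
    fderiv_clm_comp (contract b) hg
  rw [locDiff, locDiff, h1, theta_apply, theta_apply, contract_toContAlt,
    iota_chev_of_central _ _ _ _ _ hb hb', map_sub]
  rfl

theorem contract_locDiff_zero {g : Y → W [⋀^Fin 0]→L[ℝ] N} {p : Y} {b : W} :
    contract b (locDiff A B g p) = fderiv ℝ g p (A p b) := by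
  rw [locDiff, theta_apply, contract_toContAlt, iota_chev_zero]
  rfl

end LocalForms

section VerticalDirections

variable {Y W N : Type*} [NormedAddCommGroup Y] [NormedSpace ℝ Y] [FiniteDimensional ℝ Y]
  [NormedAddCommGroup W] [NormedSpace ℝ W] [FiniteDimensional ℝ W]
  [NormedAddCommGroup N] [NormedSpace ℝ N] [FiniteDimensional ℝ N]
  {U : Set Y} {A : Y → W →ₗ[ℝ] Y} {B : Y → W →ₗ[ℝ] W →ₗ[ℝ] W} {ι : Type*} [DecidableEq ι]

/-- Linear vertical coordinates on a domain `U` with an algebroid given by the anchor `A` and the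
structure constants `B` of a frame: directions `e i` along which nothing depends on the point, frame
vectors `b i` that are mapped to them by the anchor, coordinates `s i` dual to the `e i`, and the
pull-backs `σ i` of their differentials along the anchor. -/
structure VertCoords (U : Set Y) (A : Y → W →ₗ[ℝ] Y) (B : Y → W →ₗ[ℝ] W →ₗ[ℝ] W) (ι : Type*)
    [DecidableEq ι] where
  e : ι → Y
  b : ι → W
  s : ι → Y →L[ℝ] ℝ
  σ : ι → W →ₗ[ℝ] ℝ
  isOpen : IsOpen U
  add_mem : ∀ i, ∀ p ∈ U, ∀ t : ℝ, p + t • e i ∈ U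
  s_e : ∀ i j, s i (e j) = if i = j then 1 else 0
  σ_b : ∀ i j, σ i (b j) = if i = j then 1 else 0
  A_b : ∀ i, ∀ p ∈ U, A p (b i) = e i
  s_A : ∀ i, ∀ p ∈ U, (s i).toLinearMap ∘ₗ A p = σ i
  A_add : ∀ i p (t : ℝ), A (p + t • e i) = A p
  B_add : ∀ i p (t : ℝ), B (p + t • e i) = B p
  B_b : ∀ i p X, B p (b i) X = 0
  b_B : ∀ i p X, B p X (b i) = 0
  σ_B : ∀ i p X Z, σ i (B p X Z) = 0

namespace VertCoords

variable (v : VertCoords U A B ι) {n : ℕ} {i : ι} {p : Y}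

theorem s_self : v.s i (v.e i) = 1 := by rw [v.s_e, if_pos rfl]

theorem diffAt (hU : IsOpen U) {V : Type*} [NormedAddCommGroup V] [NormedSpace ℝ V] {g : Y → V}
    (hg : ContDiffOn ℝ ∞ g U) (hp : p ∈ U) : DifferentiableAt ℝ g p :=
  (hg.contDiffAt (hU.mem_nhds hp)).differentiableAt (by simp)

theorem contDiffOn_clm {V V' : Type*} [NormedAddCommGroup V] [NormedSpace ℝ V]
    [NormedAddCommGroup V'] [NormedSpace ℝ V'] (T : V →L[ℝ] V') {g : Y → V}
    (hg : ContDiffOn ℝ ∞ g U) : ContDiffOn ℝ ∞ (fun q => T (g q)) U :=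
  T.contDiff.comp_contDiffOn hg

set_option synthInstance.maxHeartbeats 200000 in
theorem locDiff_lineInt {f : ℝ → ℝ} (hf : LocallyIntegrable f) {g : Y → W [⋀^Fin n]→L[ℝ] N}
    (hg : ContDiffOn ℝ ∞ g U) (hb : BddIn U (v.s i) g) (hp : p ∈ U) :
    locDiff A B (lineInt f (v.e i) g) p = lineInt f (v.e i) (locDiff A B g) p := by
  have hc : ContinuousOn (fun q => (fderiv ℝ g q, g q)) U :=
    (hg.continuousOn_fderiv_of_isOpen v.isOpen (by simp)).prodMk hg.continuousOn
  have hb' : BddIn U (v.s i) (fun q => (fderiv ℝ g q, g q)) := by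
    obtain ⟨R, hR⟩ := hb
    obtain ⟨R', hR'⟩ := BddIn.fderiv v.isOpen ⟨R, hR⟩
    refine ⟨max R R', fun q hq h => ?_⟩
    exact Prod.ext (hR' q hq ((le_max_right _ _).trans_lt h))
      (hR q hq ((le_max_left _ _).trans_lt h))
  have h1 := lineInt_clm v.s_self (v.add_mem i) hf hc hb' hp
    (LinearMap.toContinuousLinearMap (theta (n := n) (N := N) (A p) (B p)))
  have h2 := lineInt_clm v.s_self (v.add_mem i) hf hc hb' hp (ContinuousLinearMap.fst ℝ _ _)
  have h3 := lineInt_clm v.s_self (v.add_mem i) hf hc hb' hp (ContinuousLinearMap.snd ℝ _ _)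
  rw [locDiff, (hasFDerivAt_lineInt v.isOpen v.s_self (v.add_mem i) hf hg hb hp).fderiv]
  have h4 : (lineInt f (v.e i) (fderiv ℝ g) p, lineInt f (v.e i) g p) =
      lineInt f (v.e i) (fun q => (fderiv ℝ g q, g q)) p := Prod.ext h2 h3
  rw [h4]
  refine Eq.trans h1.symm ?_
  refine integral_congr_ae (Eventually.of_forall fun t => ?_)
  change f t • theta (A p) (B p) _ = f t • theta (A _) (B _) _
  rw [v.A_add, v.B_add]

/-- Integration over the `i`-th vertical direction. -/
def fibInt (i : ι) (g : Y → W [⋀^Fin (n + 1)]→L[ℝ] N) : Y → W [⋀^Fin n]→L[ℝ] N :=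
  lineInt 1 (v.e i) fun q => contract (v.b i) (g q)

theorem contDiffOn_contract {b : W} {g : Y → W [⋀^Fin (n + 1)]→L[ℝ] N}
    (hg : ContDiffOn ℝ ∞ g U) : ContDiffOn ℝ ∞ (fun q => contract b (g q)) U :=
  contDiffOn_clm (contract b) hg

theorem _root_.ThomAlgebroid.BddIn.contract {s : Y → ℝ} {b : W}
    {g : Y → W [⋀^Fin (n + 1)]→L[ℝ] N} (hb : BddIn U s g) :
    BddIn U s fun q => contract b (g q) := by
  obtain ⟨R, hR⟩ := hb
  exact ⟨R, fun p hp h => by simp only [hR p hp h, map_zero]⟩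

theorem contDiffOn_fibInt {g : Y → W [⋀^Fin (n + 1)]→L[ℝ] N} (hg : ContDiffOn ℝ ∞ g U)
    (hb : BddIn U (v.s i) g) : ContDiffOn ℝ ∞ (v.fibInt i g) U :=
  contDiffOn_lineInt v.isOpen v.s_self (v.add_mem i) locallyIntegrable_one
    (contDiffOn_contract hg) hb.contract

theorem bddIn_fibInt {g : Y → W [⋀^Fin (n + 1)]→L[ℝ] N} {j : ι} (hj : j ≠ i)
    (hb : BddIn U (v.s j) g) : BddIn U (v.s j) (v.fibInt i g) :=
  BddIn.lineInt (v.add_mem i) (by rw [v.s_e, if_neg hj]) hb.contract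

theorem locDiff_contract {g : Y → W [⋀^Fin (n + 1)]→L[ℝ] N} (hg : ContDiffOn ℝ ∞ g U)
    (hcl : ∀ q ∈ U, locDiff A B g q = 0) (hp : p ∈ U) :
    locDiff A B (fun q => contract (v.b i) (g q)) p = fderiv ℝ g p (v.e i) := by
  have h := contract_locDiff (v.B_b i p) (v.b_B i p) (diffAt v.isOpen hg hp) (A := A)
  rw [hcl p hp, map_zero, v.A_b i p hp] at h
  exact (sub_eq_zero.1 h.symm).symm

theorem locDiff_fibInt {g : Y → W [⋀^Fin (n + 1)]→L[ℝ] N} (hg : ContDiffOn ℝ ∞ g U)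
    (hb : BddIn U (v.s i) g) (hcl : ∀ q ∈ U, locDiff A B g q = 0) (hp : p ∈ U) :
    locDiff A B (v.fibInt i g) p = 0 := by
  rw [fibInt, v.locDiff_lineInt locallyIntegrable_one (contDiffOn_contract hg) hb.contract hp,
    ← lineInt_one_fderiv v.isOpen v.s_self (v.add_mem i) hg hb hp]
  refine integral_congr_ae (Eventually.of_forall fun t => ?_)
  exact congrArg _ (v.locDiff_contract hg hcl (v.add_mem i p hp t))

/-- Integration along the negative half-line in the `i`-th vertical direction, corrected far out on
the positive side so that the support stays bounded. -/
def prim (i : ι) (g : Y → W [⋀^Fin (n + 1)]→L[ℝ] N) : Y → W [⋀^Fin n]→L[ℝ] N := fun p =>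
  lineInt halfLine (v.e i) (fun q => contract (v.b i) (g q)) p -
    Real.smoothTransition (v.s i p) • v.fibInt i g p

theorem contDiff_step : ContDiff ℝ ∞ fun q : Y => Real.smoothTransition (v.s i q) :=
  Real.smoothTransition.contDiff.comp (v.s i).contDiff

theorem contDiffOn_prim {g : Y → W [⋀^Fin (n + 1)]→L[ℝ] N} (hg : ContDiffOn ℝ ∞ g U)
    (hb : BddIn U (v.s i) g) : ContDiffOn ℝ ∞ (v.prim i g) U :=
  (contDiffOn_lineInt v.isOpen v.s_self (v.add_mem i) locallyIntegrable_halfLine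
    (contDiffOn_contract hg) hb.contract).sub
    (v.contDiff_step.contDiffOn.smul (v.contDiffOn_fibInt hg hb))

theorem bddIn_prim_self {g : Y → W [⋀^Fin (n + 1)]→L[ℝ] N}
    (hb : BddIn U (v.s i) g) : BddIn U (v.s i) (v.prim i g) :=
  bddIn_lineInt_halfLine_sub v.s_self (v.add_mem i) hb.contract (C := 1)
    (fun _ ht => Real.smoothTransition.zero_of_nonpos (by linarith))
    fun _ ht => Real.smoothTransition.one_of_one_le ht.le

theorem bddIn_prim {g : Y → W [⋀^Fin (n + 1)]→L[ℝ] N} {j : ι} (hj : j ≠ i)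
    (hb : BddIn U (v.s j) g) : BddIn U (v.s j) (v.prim i g) := by
  obtain ⟨R, hR⟩ := v.bddIn_fibInt hj hb
  obtain ⟨R', hR'⟩ := BddIn.lineInt (f := halfLine) (v.add_mem i)
    (s' := v.s j) (by rw [v.s_e, if_neg hj]) (hb.contract (b := v.b i))
  refine ⟨max R R', fun q hq h => ?_⟩
  rw [prim, hR q hq ((le_max_left _ _).trans_lt h), hR' q hq ((le_max_right _ _).trans_lt h)]
  simp

/-- The derivative of the smooth step function is a bump function of integral one. -/
def bump : ℝ → ℝ := deriv Real.smoothTransition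

theorem contDiff_bump : ContDiff ℝ ∞ bump := by
  have h : ContDiff ℝ ∞ Real.smoothTransition := Real.smoothTransition.contDiff
  exact (contDiff_infty_iff_deriv.1 h).2

theorem hasDerivAt_smoothTransition (t : ℝ) : HasDerivAt Real.smoothTransition (bump t) t :=
  ((Real.smoothTransition.contDiff (n := 1)).differentiable (by simp) t).hasDerivAt

theorem bump_eq_zero {t : ℝ} (h : 1 < |t|) : bump t = 0 := by
  rcases lt_abs.1 h with h | h
  · have : Real.smoothTransition =ᶠ[𝓝 t] fun _ => 1 := by
      filter_upwards [Ioi_mem_nhds h] with x hx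
      exact Real.smoothTransition.one_of_one_le (mem_Ioi.1 hx).le
    rw [bump, this.deriv_eq, deriv_const]
  · have : Real.smoothTransition =ᶠ[𝓝 t] fun _ => 0 := by
      filter_upwards [Iio_mem_nhds (show t < 0 by linarith)] with x hx
      exact Real.smoothTransition.zero_of_nonpos (mem_Iio.1 hx).le
    rw [bump, this.deriv_eq, deriv_const]

theorem fderiv_step (p : Y) :
    fderiv ℝ (fun q : Y => Real.smoothTransition (v.s i q)) p = bump (v.s i p) • v.s i :=
  ((hasDerivAt_smoothTransition _).comp_hasFDerivAt p (v.s i).hasFDerivAt).fderiv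

/-- The homotopy formula for one vertical direction. -/
theorem locDiff_prim {g : Y → W [⋀^Fin (n + 1)]→L[ℝ] N} (hg : ContDiffOn ℝ ∞ g U)
    (hb : BddIn U (v.s i) g) (hcl : ∀ q ∈ U, locDiff A B g q = 0) (hp : p ∈ U) :
    locDiff A B (v.prim i g) p =
      g p - bump (v.s i p) • covWedge (v.σ i) (v.fibInt i g p) := by
  have h1 := contDiffOn_lineInt v.isOpen v.s_self (v.add_mem i) locallyIntegrable_halfLine
    (contDiffOn_contract hg) (hb.contract (b := v.b i))
  have h2 := v.contDiffOn_fibInt hg hb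
  have h3 := v.contDiff_step (i := i)
  have h4 : locDiff A B (lineInt halfLine (v.e i) fun q => contract (v.b i) (g q)) p = g p := by
    rw [v.locDiff_lineInt locallyIntegrable_halfLine (contDiffOn_contract hg) hb.contract hp,
      ← lineInt_halfLine_fderiv v.isOpen v.s_self (v.add_mem i) hg hb hp]
    refine integral_congr_ae (Eventually.of_forall fun t => ?_)
    exact congrArg _ (v.locDiff_contract hg hcl (v.add_mem i p hp t))
  have h5 := locDiff_sub (A := A) (B := B) (diffAt v.isOpen h1 hp)
    (diffAt v.isOpen (h3.contDiffOn.smul h2) hp)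
  have h6 := locDiff_smul (A := A) (B := B) (h3.differentiable (by simp) p) (diffAt v.isOpen h2 hp)
  refine h5.trans ?_
  rw [h4]
  refine congrArg _ (h6.trans ?_)
  rw [v.locDiff_fibInt hg hb hcl hp, smul_zero, zero_add, fderiv_step]
  rw [← covWedge_smul_left, ← v.s_A i p hp]
  rfl

/-- The wedge product with a bump one-form in the `i`-th vertical direction. -/
def bumpWedge (i : ι) (g : Y → W [⋀^Fin n]→L[ℝ] N) : Y → W [⋀^Fin (n + 1)]→L[ℝ] N := fun p =>
  bump (v.s i p) • covWedge (v.σ i) (g p)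

theorem contDiffOn_bumpWedge {g : Y → W [⋀^Fin n]→L[ℝ] N} (hg : ContDiffOn ℝ ∞ g U) :
    ContDiffOn ℝ ∞ (v.bumpWedge i g) U :=
  (contDiff_bump.comp (v.s i).contDiff).contDiffOn.smul
    (contDiffOn_clm (covWedge (v.σ i)) hg)

theorem bddIn_bumpWedge_self {g : Y → W [⋀^Fin n]→L[ℝ] N} : BddIn U (v.s i) (v.bumpWedge i g) :=
  ⟨1, fun q _ h => by rw [bumpWedge, bump_eq_zero h, zero_smul]⟩

theorem bddIn_bumpWedge {g : Y → W [⋀^Fin n]→L[ℝ] N} {s : Y → ℝ} (hb : BddIn U s g) :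
    BddIn U s (v.bumpWedge i g) := by
  obtain ⟨R, hR⟩ := hb
  exact ⟨R, fun q hq h => by rw [bumpWedge, hR q hq h, map_zero, smul_zero]⟩

theorem locDiff_bumpWedge {g : Y → W [⋀^Fin n]→L[ℝ] N} (hg : ContDiffOn ℝ ∞ g U) (hp : p ∈ U) :
    locDiff A B (v.bumpWedge i g) p = -(bump (v.s i p) • covWedge (v.σ i) (locDiff A B g p)) := by
  have h1 : ContDiff ℝ ∞ fun q : Y => bump (v.s i q) := contDiff_bump.comp (v.s i).contDiff
  have h6 := locDiff_smul (A := A) (B := B) (h1.differentiable (by simp) p)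
    (diffAt v.isOpen (contDiffOn_clm (covWedge (v.σ i)) hg) hp)
  refine h6.trans ?_
  have h7 : fderiv ℝ (fun q : Y => bump (v.s i q)) p = deriv bump (v.s i p) • v.s i :=
    (((contDiff_bump.differentiable (by simp) _).hasDerivAt).comp_hasFDerivAt p
      (v.s i).hasFDerivAt).fderiv
  have h8 : ((fderiv ℝ (fun q : Y => bump (v.s i q)) p).toLinearMap ∘ₗ A p) =
      deriv bump (v.s i p) • v.σ i := by
    rw [h7, ← v.s_A i p hp]; rfl
  rw [h8, covWedge_smul_left, covWedge_self, smul_zero, add_zero]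
  refine (congrArg _ (locDiff_covWedge (v.σ_B i p) (diffAt v.isOpen hg hp))).trans (smul_neg _ _)

end VertCoords

theorem integral_fin_succ {N : Type*} [NormedAddCommGroup N] [NormedSpace ℝ N] {n : ℕ}
    {f : (Fin (n + 1) → ℝ) → N} (hf : Integrable f) :
    ∫ t, f t = ∫ t : Fin n → ℝ, ∫ x : ℝ, f (Fin.cons x t) := by
  have h := (volume_preserving_piFinSuccAbove (fun _ : Fin (n + 1) => ℝ) 0).symm
  rw [← h.integral_comp (MeasurableEquiv.measurableEmbedding _)]
  have h2 := (h.integrable_comp_emb (MeasurableEquiv.measurableEmbedding _)).2 hf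
  rw [Measure.volume_eq_prod] at h2 ⊢
  refine (integral_prod_symm _ h2).trans
    (congrArg _ (funext fun t => congrArg _ (funext fun x => congrArg f ?_)))
  exact Fin.insertNth_zero' x t

theorem integral_fin_zero {N : Type*} [NormedAddCommGroup N] [NormedSpace ℝ N] [CompleteSpace N]
    (f : (Fin 0 → ℝ) → N) : ∫ t, f t = f 0 := by
  have : f = fun _ => f 0 := funext fun t => congrArg f (Subsingleton.elim _ _)
  rw [this]
  simp [Measure.real, volume_pi]

namespace VertCoords

variable (v : VertCoords U A B ι) {n d : ℕ} {i : ι} {p : Y}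

theorem add_sum_mem (c : Fin n → ι) (t : Fin n → ℝ) (hp : p ∈ U) :
    p + ∑ j, t j • v.e (c j) ∈ U := by
  induction n with
  | zero => simpa
  | succ n ih =>
    rw [Fin.sum_univ_castSucc, ← add_assoc]
    exact v.add_mem _ _ (ih _ _) _

theorem hasCompactSupport_vert {c : Fin n → ι} (hc : Function.Injective c) {V : Type*}
    [NormedAddCommGroup V] [NormedSpace ℝ V] {g : Y → V} (hb : ∀ j, BddIn U (v.s (c j)) g) (hp : p ∈ U) :
    HasCompactSupport fun t : Fin n → ℝ => g (p + ∑ j, t j • v.e (c j)) := by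
  choose R hR using hb
  refine HasCompactSupport.of_support_subset_isCompact
    (isCompact_univ_pi fun j => isCompact_Icc (a := -(R j + |v.s (c j) p|))
      (b := R j + |v.s (c j) p|)) fun t ht j _ => ?_
  by_contra hcon
  refine ht (hR j _ (v.add_sum_mem c t hp) ?_)
  have h1 : v.s (c j) (p + ∑ l, t l • v.e (c l)) = v.s (c j) p + t j := by
    simp [v.s_e, hc.eq_iff]
  rw [h1]
  by_contra h
  refine hcon (abs_le.1 ?_)
  have := abs_sub_abs_le_abs_sub (t j) (-v.s (c j) p)
  rw [abs_neg, sub_neg_eq_add, add_comm (t j)] at this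
  linarith

theorem continuous_vert (c : Fin n → ι) {V : Type*} [TopologicalSpace V] {g : Y → V}
    (hg : ContinuousOn g U) (hp : p ∈ U) :
    Continuous fun t : Fin n → ℝ => g (p + ∑ j, t j • v.e (c j)) :=
  hg.comp_continuous (by fun_prop) fun t => v.add_sum_mem c t hp

theorem integrable_vert {c : Fin n → ι} (hc : Function.Injective c) {V : Type*}
    [NormedAddCommGroup V] [NormedSpace ℝ V] {g : Y → V} (hg : ContinuousOn g U)
    (hb : ∀ j, BddIn U (v.s (c j)) g) (hp : p ∈ U) :
    Integrable fun t : Fin n → ℝ => g (p + ∑ j, t j • v.e (c j)) :=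
  (v.continuous_vert c hg hp).integrable_of_hasCompactSupport (v.hasCompactSupport_vert hc hb hp)

/-- The integrals of `g` over the vertical directions `c`, evaluated at arguments among which all
the vectors `b (c j)` occur, vanish. -/
def IntNull (c : Fin n → ι) (g : Y → W [⋀^Fin d]→L[ℝ] N) : Prop :=
  ∀ y : Fin d → W, (∀ j, ∃ k, y k = v.b (c j)) → ∀ p ∈ U,
    ∫ t : Fin n → ℝ, g (p + ∑ j, t j • v.e (c j)) y = 0

theorem contract_bdd {g : Y → W [⋀^Fin d]→L[ℝ] N} {s : Y → ℝ} (hb : BddIn U s g) (y : Fin d → W) :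
    BddIn U s fun q => g q y := by
  obtain ⟨R, hR⟩ := hb
  exact ⟨R, fun p hp h => by simp [hR p hp h]⟩

theorem continuousOn_apply {g : Y → W [⋀^Fin d]→L[ℝ] N} (hg : ContinuousOn g U) (y : Fin d → W) :
    ContinuousOn (fun q => g q y) U :=
  (ContinuousAlternatingMap.apply ℝ W N y).continuous.comp_continuousOn hg

theorem fibInt_apply {g : Y → W [⋀^Fin (d + 1)]→L[ℝ] N} (hg : ContinuousOn g U)
    (hb : BddIn U (v.s i) g) (hp : p ∈ U) (y : Fin d → W) :
    v.fibInt i g p y = ∫ x : ℝ, g (p + x • v.e i) (Matrix.vecCons (v.b i) y) := by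
  have h := lineInt_clm v.s_self (v.add_mem i) locallyIntegrable_one
    ((contract (v.b i)).continuous.comp_continuousOn hg) hb.contract hp
    (ContinuousAlternatingMap.apply ℝ W N y)
  refine h.symm.trans ?_
  simp only [lineInt, Pi.one_apply, one_smul]
  rfl

/-- Fubini's theorem for the integration over vertical directions. -/
theorem integral_fibInt {c : Fin (n + 1) → ι} (hc : Function.Injective c)
    {g : Y → W [⋀^Fin (d + 1)]→L[ℝ] N} (hg : ContinuousOn g U)
    (hb : ∀ j, BddIn U (v.s (c j)) g) (hp : p ∈ U) (y : Fin d → W) :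
    ∫ t : Fin n → ℝ, v.fibInt (c 0) g (p + ∑ j, t j • v.e (c j.succ)) y =
      ∫ t : Fin (n + 1) → ℝ, g (p + ∑ j, t j • v.e (c j)) (Matrix.vecCons (v.b (c 0)) y) := by
  rw [integral_fin_succ (v.integrable_vert hc (continuousOn_apply hg _)
    (fun j => contract_bdd (hb j) _) hp)]
  refine integral_congr_ae (Eventually.of_forall fun t => ?_)
  refine (v.fibInt_apply hg (hb 0) (v.add_sum_mem (fun j => c j.succ) t hp) y).trans ?_
  refine integral_congr_ae (Eventually.of_forall fun x => ?_)
  refine congrArg (fun q => g q (Matrix.vecCons (v.b (c 0)) y)) ?_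
  rw [Fin.sum_univ_succ]
  simp only [Fin.cons_zero, Fin.cons_succ]
  abel

theorem IntNull.fibInt {v : VertCoords U A B ι} {c : Fin (n + 1) → ι} (hc : Function.Injective c)
    {g : Y → W [⋀^Fin (d + 1)]→L[ℝ] N} (hg : ContinuousOn g U)
    (hb : ∀ j, BddIn U (v.s (c j)) g) (h : v.IntNull c g) :
    v.IntNull (fun j => c j.succ) (v.fibInt (c 0) g) := by
  intro y hy p hp
  refine (v.integral_fibInt hc hg hb hp y).trans (h _ (fun j => ?_) p hp)
  refine Fin.cases ⟨0, rfl⟩ (fun j => ?_) j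
  obtain ⟨k, hk⟩ := hy j
  exact ⟨k.succ, hk⟩

theorem eq_zero_of_closed {c : Fin n → ι} {g : Y → W [⋀^Fin 0]→L[ℝ] N}
    (hg : ContDiffOn ℝ ∞ g U) (hb : ∀ j, BddIn U (v.s (c j)) g)
    (hcl : ∀ q ∈ U, locDiff A B g q = 0) (h0 : v.IntNull c g) (hp : p ∈ U) : g p = 0 := by
  cases n with
  | zero =>
    ext y
    have := h0 y (fun j => j.elim0) p hp
    rw [integral_fin_zero] at this
    simpa using this
  | succ n =>
    rw [← lineInt_halfLine_fderiv v.isOpen v.s_self (v.add_mem (c 0)) hg (hb 0) hp]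
    refine lineInt_eq_zero fun t => ?_
    have hq := v.add_mem (c 0) p hp t
    have h := contract_locDiff_zero (A := A) (B := B) (g := g) (p := p + t • v.e (c 0))
      (b := v.b (c 0))
    rw [hcl _ hq, map_zero, v.A_b (c 0) _ hq] at h
    exact h.symm

/-- The form `g` vanishes if the vectors `b (c j)` occur among the arguments. -/
def Kills (c : Fin n → ι) (g : Y → W [⋀^Fin d]→L[ℝ] N) : Prop :=
  ∀ p (y : Fin d → W), (∀ j, ∃ k, y k = v.b (c j)) → g p y = 0

theorem contract_of_mem {b : W} {c : W [⋀^Fin (d + 1)]→L[ℝ] N} {y : Fin d → W}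
    (h : ∃ k, y k = b) : contract b c y = 0 := by
  obtain ⟨k, hk⟩ := h
  rw [contract_apply]
  exact c.toAlternatingMap.map_eq_zero_of_eq (Matrix.vecCons b y) (i := 0) (j := k.succ)
    (by simp [hk]) (Fin.succ_ne_zero k).symm

theorem lineInt_contract_of_mem {f : ℝ → ℝ} {e p : Y} {b : W} {g : Y → W [⋀^Fin (d + 1)]→L[ℝ] N}
    {y : Fin d → W} (h : ∃ k, y k = b) :
    lineInt f e (fun q => contract b (g q)) p y = 0 := by
  by_cases hi : Integrable fun t : ℝ => f t • contract b (g (p + t • e))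
  · have := (ContinuousAlternatingMap.apply ℝ W N y).integral_comp_comm hi
    refine this.symm.trans (integral_eq_zero_of_ae (Eventually.of_forall fun t => ?_))
    change f t • contract b (g (p + t • e)) y = 0
    rw [contract_of_mem h, smul_zero]
  · rw [lineInt, integral_undef hi]; rfl

theorem kills_prim {c : Fin (n + 1) → ι} (g : Y → W [⋀^Fin (d + 1)]→L[ℝ] N) :
    v.Kills c (v.prim (c 0) g) := fun p y hy => by
  change lineInt halfLine (v.e (c 0)) (fun q => contract (v.b (c 0)) (g q)) p y -
    Real.smoothTransition _ • lineInt 1 (v.e (c 0)) (fun q => contract (v.b (c 0)) (g q)) p y = 0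
  rw [lineInt_contract_of_mem (hy 0), lineInt_contract_of_mem (hy 0), smul_zero, sub_zero]

theorem Kills.bumpWedge {v : VertCoords U A B ι} {c : Fin (n + 1) → ι}
    (hc : Function.Injective c) {g : Y → W [⋀^Fin d]→L[ℝ] N}
    (h : v.Kills (fun j => c j.succ) g) : v.Kills c (v.bumpWedge (c 0) g) := fun p y hy => by
  change bump _ • covWedge _ (g p) y = 0
  rw [covWedge_apply, Finset.sum_eq_zero, smul_zero]
  intro l _
  -- if leaving out `y l` removes one of the vectors, then `σ (c 0)` vanishes on it
  by_cases hl : ∃ j : Fin n, y l = v.b (c j.succ)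
  · obtain ⟨j, hj⟩ := hl
    rw [hj, v.σ_b, if_neg fun hh => (Fin.succ_ne_zero j) (hc hh).symm, zero_smul, smul_zero]
  · push Not at hl
    rw [h p _ fun j => ?_, smul_zero, smul_zero]
    obtain ⟨k, hk⟩ := hy j.succ
    have hkl : k ≠ l := fun e => hl j (e ▸ hk)
    obtain ⟨m, rfl⟩ := Fin.exists_succAbove_eq hkl
    exact ⟨m, hk⟩

/-- A closed form with bounded support in the vertical directions and vanishing vertical integrals
has a primitive, again with bounded support, that vanishes where the form vanishes and that vanishes
on arguments among which all the vertical vectors occur. -/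
theorem exists_primitive (n d : ℕ) (c : Fin n → ι) (hc : Function.Injective c)
    (g : Y → W [⋀^Fin (d + 1)]→L[ℝ] N) (hg : ContDiffOn ℝ ∞ g U)
    (hb : ∀ j, BddIn U (v.s (c j)) g) (hcl : ∀ q ∈ U, locDiff A B g q = 0)
    (h0 : v.IntNull c g) :
    ∃ β : Y → W [⋀^Fin d]→L[ℝ] N, ContDiffOn ℝ ∞ β U ∧ (∀ j, BddIn U (v.s (c j)) β) ∧
      (∀ p ∈ U, locDiff A B β p = g p) ∧ v.Kills c β ∧
      ∀ S : Set Y, (∀ i, ∀ p ∈ S, ∀ t : ℝ, p + t • v.e i ∈ S) → (∀ p ∈ S, g p = 0) →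
        ∀ p ∈ S, β p = 0 := by
  induction n generalizing d with
  | zero =>
    refine ⟨0, contDiffOn_const, fun j => j.elim0, fun p hp => ?_, fun p y _ => rfl,
      fun S _ _ p _ => rfl⟩
    have h1 : g p = 0 := by
      ext y
      have := h0 y (fun j => j.elim0) p hp
      rw [integral_fin_zero] at this
      simpa using this
    rw [h1, locDiff]
    have : fderiv ℝ (0 : Y → W [⋀^Fin d]→L[ℝ] N) p = 0 := fderiv_const_apply _
    rw [this]
    exact map_zero _
  | succ n ih =>
    -- By the homotopy formula `prim (c 0) g` is a primitive up to a bump form times the integral of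
    -- `g` over the direction `c 0`, to which the induction hypothesis applies.
    have hc' : Function.Injective fun j : Fin n => c j.succ :=
      hc.comp (Fin.succ_injective n)
    have hne : ∀ j : Fin n, c j.succ ≠ c 0 := fun j h => Fin.succ_ne_zero j (hc h)
    have hsm := v.contDiffOn_fibInt hg (hb 0)
    have hbd : ∀ j : Fin n, BddIn U (v.s (c j.succ)) (v.fibInt (c 0) g) :=
      fun j => v.bddIn_fibInt (hne j) (hb j.succ)
    have hcl' : ∀ q ∈ U, locDiff A B (v.fibInt (c 0) g) q = 0 :=
      fun q hq => v.locDiff_fibInt hg (hb 0) hcl hq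
    have hn := IntNull.fibInt hc hg.continuousOn hb h0
    have hprim : ∀ j, BddIn U (v.s (c j)) (v.prim (c 0) g) := fun j => by
      refine Fin.cases (v.bddIn_prim_self (hb 0)) (fun j => ?_) j
      exact v.bddIn_prim (hne j) (hb j.succ)
    have hz : ∀ S : Set Y, (∀ i, ∀ p ∈ S, ∀ t : ℝ, p + t • v.e i ∈ S) → (∀ p ∈ S, g p = 0) →
        ∀ (f : ℝ → ℝ), ∀ p ∈ S,
          lineInt f (v.e (c 0)) (fun q => contract (v.b (c 0)) (g q)) p = 0 :=
      fun S hS hgS f p hp => lineInt_eq_zero fun t => by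
        simp only [hgS _ (hS _ p hp t), map_zero]
    have hzp : ∀ S : Set Y, (∀ i, ∀ p ∈ S, ∀ t : ℝ, p + t • v.e i ∈ S) → (∀ p ∈ S, g p = 0) →
        ∀ p ∈ S, v.prim (c 0) g p = 0 := fun S hS hgS p hp => by
      rw [prim, hz S hS hgS _ p hp, fibInt, hz S hS hgS _ p hp, smul_zero, sub_zero]
    cases d with
    | zero =>
      -- That integral is now a closed function with vanishing integrals, hence zero.
      refine ⟨v.prim (c 0) g, v.contDiffOn_prim hg (hb 0), hprim, fun p hp => ?_, v.kills_prim g,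
        hzp⟩
      rw [v.locDiff_prim hg (hb 0) hcl hp, v.eq_zero_of_closed hsm hbd hcl' hn hp, map_zero,
        smul_zero, sub_zero]
    | succ d =>
      obtain ⟨β, h1, h2, h3, h4, h5⟩ := ih d _ hc' _ hsm hbd hcl' hn
      refine ⟨fun q => v.prim (c 0) g q - v.bumpWedge (c 0) β q,
        (v.contDiffOn_prim hg (hb 0)).sub (v.contDiffOn_bumpWedge h1), fun j => ?_,
        fun p hp => ?_, fun p y hy => ?_, fun S hS hgS p hp => ?_⟩
      · have hw : BddIn U (v.s (c j)) (v.bumpWedge (c 0) β) := by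
          refine Fin.cases v.bddIn_bumpWedge_self (fun j => ?_) j
          exact v.bddIn_bumpWedge (h2 j)
        obtain ⟨R, hR⟩ := hprim j
        obtain ⟨R', hR'⟩ := hw
        refine ⟨max R R', fun q hq h => ?_⟩
        beta_reduce
        rw [hR q hq ((le_max_left _ _).trans_lt h), hR' q hq ((le_max_right _ _).trans_lt h),
          sub_zero]
      · rw [locDiff_sub (diffAt v.isOpen (v.contDiffOn_prim hg (hb 0)) hp)
          (diffAt v.isOpen (v.contDiffOn_bumpWedge h1) hp), v.locDiff_prim hg (hb 0) hcl hp,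
          v.locDiff_bumpWedge h1 hp, h3 p hp]
        abel
      · change v.prim (c 0) g p y - v.bumpWedge (c 0) β p y = 0
        rw [v.kills_prim g p y hy, h4.bumpWedge hc p y hy, sub_zero]
      · beta_reduce
        rw [hzp S hS hgS p hp, bumpWedge, h5 S hS (fun q hq => hz S hS hgS _ q hq) p hp, map_zero,
          smul_zero, sub_zero]

end VertCoords

section AlternatingVertical

variable {V F N : Type*} [AddCommGroup V] [Module ℝ V] [AddCommGroup F] [Module ℝ F]
  [AddCommGroup N] [Module ℝ N] {r d : ℕ}

/-- The tuple `y` with the entries at the positions `k` replaced by the vectors `(0, f i)`. -/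
def replaceVert (k : Fin r → Fin d) (y : Fin d → V × F) (f : Fin r → F) : Fin d → V × F :=
  Function.extend k (fun i => (0, f i)) y

theorem replaceVert_apply {k : Fin r → Fin d} (hk : Function.Injective k) (y : Fin d → V × F)
    (f : Fin r → F) (i : Fin r) : replaceVert k y f (k i) = (0, f i) :=
  hk.extend_apply _ _ _

theorem replaceVert_of_notMem {k : Fin r → Fin d} (y : Fin d → V × F) (f : Fin r → F) {j : Fin d}
    (hj : ¬ ∃ i, k i = j) : replaceVert k y f j = y j :=
  Function.extend_apply' _ _ _ hj

theorem replaceVert_update {k : Fin r → Fin d} (hk : Function.Injective k) (y : Fin d → V × F)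
    (f : Fin r → F) (i : Fin r) (w : F) :
    replaceVert k y (Function.update f i w) =
      Function.update (replaceVert k y f) (k i) (0, w) := by
  funext j
  by_cases hj : ∃ l, k l = j
  · obtain ⟨l, rfl⟩ := hj
    rw [replaceVert_apply hk]
    by_cases h : l = i
    · subst h; simp
    · rw [Function.update_of_ne h, Function.update_of_ne (hk.ne h), replaceVert_apply hk]
  · rw [replaceVert_of_notMem _ _ hj, Function.update_of_ne fun h => hj ⟨i, h.symm⟩,
      replaceVert_of_notMem _ _ hj]

/-- An alternating map as a function of some of its arguments, inserted in the second factor. -/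
def altVert (c : (V × F) [⋀^Fin d]→ₗ[ℝ] N) {k : Fin r → Fin d} (hk : Function.Injective k)
    (y : Fin d → V × F) : F [⋀^Fin r]→ₗ[ℝ] N where
  toFun f := c (replaceVert k y f)
  map_update_add' := by
    intro inst f i w w'
    rw [Subsingleton.elim inst (instDecidableEqFin r)]
    simp only [replaceVert_update hk, ← c.map_update_add]
    congr 2
    simp
  map_update_smul' := by
    intro inst f i t w
    rw [Subsingleton.elim inst (instDecidableEqFin r)]
    simp only [replaceVert_update hk, ← c.map_update_smul]
    congr 2
    simp
  map_eq_zero_of_eq' := by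
    intro f i j hij hne
    exact c.map_eq_zero_of_eq _ (i := k i) (j := k j)
      (by rw [replaceVert_apply hk, replaceVert_apply hk, hij]) (hk.ne hne)

theorem apply_eq_det_smul (b : Module.Basis (Fin r) ℝ F) (h : F [⋀^Fin r]→ₗ[ℝ] N)
    (f : Fin r → F) : h f = b.det f • h b := by
  have : h = (LinearMap.toSpanSingleton ℝ N (h b)).compAlternatingMap b.det := by
    refine Module.Basis.ext_alternating b fun v hv => ?_
    let σ : Equiv.Perm (Fin r) := Equiv.ofBijective v (Finite.injective_iff_bijective.1 hv)
    have h1 := h.map_perm b σ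
    have h2 := b.det.map_perm b σ
    rw [b.det_self] at h2
    change h (b ∘ σ) = b.det (b ∘ σ) • h b
    rw [h1, h2]
    rcases Int.units_eq_one_or (Equiv.Perm.sign σ) with hs | hs <;> simp [hs]
  exact congrArg (fun h : F [⋀^Fin r]→ₗ[ℝ] N => h f) this

/-- If an alternating map has a full set of vertical arguments, the vertical components of its other
arguments do not matter. -/
theorem apply_eq_of_fst_eq (c : (V × F) [⋀^Fin d]→ₗ[ℝ] N) (b : Module.Basis (Fin r) ℝ F)
    {k : Fin r → Fin d} {y y' : Fin d → V × F} (hy : ∀ i, y (k i) = (0, b i))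
    (hy' : ∀ i, y' (k i) = (0, b i)) (h : ∀ j, (y j).1 = (y' j).1) : c y = c y' := by
  -- Replace one argument at a time: the difference is a combination of other arguments.
  have key : ∀ s : Finset (Fin d), c (s.piecewise y y') = c y' := by
    intro s
    induction s using Finset.induction_on with
    | empty => simp
    | insert j s hj ih =>
      rw [Finset.piecewise_insert, ← ih, ← sub_eq_zero]
      have h1 : s.piecewise y y' = Function.update (s.piecewise y y') j (y' j) := by
        rw [Function.update_eq_self_iff.2]
        simp [hj]
      nth_rewrite 2 [h1]
      rw [← c.map_update_sub]
      by_cases hjk : ∃ i, k i = j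
      · obtain ⟨i, rfl⟩ := hjk
        rw [hy, hy', sub_self]
        exact c.map_update_zero _ _
      · have h2 : y j - y' j = ∑ i, b.repr (y j - y' j).2 i • ((0 : V), b i) := by
          refine Prod.ext ?_ ?_
          · rw [Prod.fst_sub, h, sub_self, Prod.fst_sum]
            simp
          · rw [Prod.snd_sum]
            exact (b.sum_repr _).symm
        rw [h2, c.map_update_sum]
        refine Finset.sum_eq_zero fun i _ => ?_
        rw [c.map_update_smul, c.map_eq_zero_of_eq _ (i := j) (j := k i), smul_zero]
        · rw [Function.update_self, Function.update_of_ne fun e => hjk ⟨i, e⟩]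
          by_cases hs : k i ∈ s <;> simp [hs, hy, hy']
        · exact fun e => hjk ⟨i, e.symm⟩
  simpa using key Finset.univ

theorem apply_eq_det_smul_apply (c : (V × F) [⋀^Fin d]→ₗ[ℝ] N) (b : Module.Basis (Fin r) ℝ F)
    {k : Fin r → Fin d} (hk : Function.Injective k) {f : Fin r → F} {y y' : Fin d → V × F}
    (hy : ∀ i, y (k i) = (0, f i)) (hy' : ∀ i, y' (k i) = (0, b i)) (h : ∀ j, (y j).1 = (y' j).1) :
    c y = b.det f • c y' := by
  have h1 : y = replaceVert k y f := by
    funext j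
    by_cases hj : ∃ i, k i = j
    · obtain ⟨i, rfl⟩ := hj
      rw [replaceVert_apply hk, hy]
    · rw [replaceVert_of_notMem _ _ hj]
  have h2 := apply_eq_det_smul b (altVert c hk y) f
  change c (replaceVert k y f) = b.det f • c (replaceVert k y b) at h2
  rw [h1, h2]
  congr 1
  refine apply_eq_of_fst_eq c b (k := k) (fun i => replaceVert_apply hk _ _ _) hy' fun j => ?_
  by_cases hj : ∃ i, k i = j
  · obtain ⟨i, rfl⟩ := hj
    rw [replaceVert_apply hk, hy']
  · rw [replaceVert_of_notMem _ _ hj, h]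

end AlternatingVertical

/-- The tuple `(b 0, …, b (n - 1), y 0, …, y (k - 1))`, with the index type that is natural for the
repeated contraction of a form of degree `k + n`. -/
def consArgs {k n : ℕ} (b : Fin n → W) (y : Fin k → W) : Fin (k + n) → W := fun j =>
  if h : j.1 < n then b ⟨j.1, h⟩ else y ⟨j.1 - n, by omega⟩

theorem consArgs_succ {k n : ℕ} (b : Fin (n + 1) → W) (y : Fin k → W) :
    consArgs b y = Matrix.vecCons (b 0) (consArgs (fun j => b j.succ) y) := by
  funext j
  refine Fin.cases ?_ (fun j => ?_) (show Fin (k + n + 1) from j)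
  · simp [consArgs]
  · rw [Matrix.cons_val_succ]
    simp only [consArgs, Fin.val_succ, add_lt_add_iff_right, Nat.add_sub_add_right]
    rfl

theorem consArgs_zero {k : ℕ} (b : Fin 0 → W) (y : Fin k → W) : consArgs b y = y := by
  funext j
  simp [consArgs]

/-- The permutation that moves the first `n` arguments behind the others. -/
def moveArgs (k n : ℕ) : Equiv.Perm (Fin (k + n)) :=
  finAddFlip.trans (finCongr (Nat.add_comm n k))

namespace VertCoords

variable (v : VertCoords U A B ι) {n k : ℕ} {i : ι} {p : Y}

/-- Successive integration over the vertical directions `c`. -/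
def iterInt {k : ℕ} : {n : ℕ} → (Fin n → ι) → (Y → W [⋀^Fin (k + n)]→L[ℝ] N) →
    Y → W [⋀^Fin k]→L[ℝ] N
  | 0, _, g => g
  | _ + 1, c, g => iterInt (fun j => c j.succ) (v.fibInt (c 0) g)

theorem iterInt_spec {c : Fin n → ι} (hc : Function.Injective c)
    {g : Y → W [⋀^Fin (k + n)]→L[ℝ] N} (hg : ContDiffOn ℝ ∞ g U)
    (hb : ∀ j, BddIn U (v.s (c j)) g) :
    ContDiffOn ℝ ∞ (v.iterInt c g) U ∧
    ∀ p ∈ U, ∀ y, v.iterInt c g p y = ∫ t : Fin n → ℝ,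
      g (p + ∑ j, t j • v.e (c j)) (consArgs (fun j => v.b (c j)) y) := by
  induction n with
  | zero =>
    refine ⟨hg, fun p _ y => ?_⟩
    rw [integral_fin_zero, consArgs_zero]
    simp [iterInt]
  | succ n ih =>
    have hc' : Function.Injective fun j : Fin n => c j.succ :=
      hc.comp (Fin.succ_injective n)
    have hne : ∀ j : Fin n, c j.succ ≠ c 0 := fun j h => Fin.succ_ne_zero j (hc h)
    obtain ⟨h1, h3⟩ := ih hc' (v.contDiffOn_fibInt hg (hb 0))
      fun j => v.bddIn_fibInt (hne j) (hb j.succ)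
    refine ⟨h1, fun p hp y => ?_⟩
    refine (h3 p hp y).trans ?_
    rw [consArgs_succ]
    exact v.integral_fibInt hc hg.continuousOn hb hp _

set_option synthInstance.maxHeartbeats 200000 in
theorem lineInt_contract_locDiff {g : Y → W [⋀^Fin (k + 1)]→L[ℝ] N} (hg : ContDiffOn ℝ ∞ g U)
    (hb : BddIn U (v.s i) g) (hp : p ∈ U) :
    (Integrable fun t : ℝ => contract (v.b i) (locDiff A B g (p + t • v.e i))) ∧
    ∫ t : ℝ, contract (v.b i) (locDiff A B g (p + t • v.e i)) = -locDiff A B (v.fibInt i g) p := by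
  have h1 : Integrable fun t : ℝ => fderiv ℝ g (p + t • v.e i) (v.e i) := by
    simpa using integrable_line v.s_self (v.add_mem i) locallyIntegrable_one
      (continuousOn_fderiv_apply (e := v.e i) v.isOpen hg) (hb.fderiv_apply v.isOpen) hp
  have h2 : Integrable fun t : ℝ =>
      locDiff A B (fun q => contract (v.b i) (g q)) (p + t • v.e i) := by
    have hc := contDiffOn_contract (U := U) (b := v.b i) hg
    obtain ⟨R, hR⟩ := hb.contract (b := v.b i)
    obtain ⟨R', hR'⟩ := BddIn.fderiv v.isOpen (hb.contract (b := v.b i))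
    refine Continuous.integrable_of_hasCompactSupport ?_ (hasCompactSupport_line v.s_self
      (v.add_mem i) ⟨max R R', fun q hq h => ?_⟩ hp)
    · have h3 : Continuous fun t : ℝ => (fderiv ℝ (fun q => contract (v.b i) (g q)) (p + t • v.e i),
          contract (v.b i) (g (p + t • v.e i))) :=
        (continuous_line (v.add_mem i) (hc.continuousOn_fderiv_of_isOpen v.isOpen (by simp))
          hp).prodMk (continuous_line (v.add_mem i) hc.continuousOn hp)
      refine ((LinearMap.toContinuousLinearMap
        (theta (n := k) (N := N) (A p) (B p))).continuous.comp h3).congr fun t => ?_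
      change theta (A p) (B p) _ = theta (A _) (B _) _
      rw [v.A_add, v.B_add]
    · have h4 : contract (v.b i) (g q) = 0 := hR q hq ((le_max_left _ _).trans_lt h)
      rw [locDiff, h4, hR' q hq ((le_max_right _ _).trans_lt h)]
      exact map_zero _
  have h3 : (fun t : ℝ => contract (v.b i) (locDiff A B g (p + t • v.e i))) = fun t =>
      fderiv ℝ g (p + t • v.e i) (v.e i) -
        locDiff A B (fun q => contract (v.b i) (g q)) (p + t • v.e i) := funext fun t => by
    have hq := v.add_mem i p hp t
    rw [contract_locDiff (v.B_b i _) (v.b_B i _) (diffAt v.isOpen hg hq), v.A_b i _ hq]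
  have h4 := lineInt_one_fderiv v.isOpen v.s_self (v.add_mem i) hg hb hp
  simp only [lineInt, Pi.one_apply, one_smul] at h4
  rw [h3]
  refine ⟨h1.sub h2, ?_⟩
  rw [integral_sub h1 h2, h4, zero_sub, fibInt, v.locDiff_lineInt locallyIntegrable_one
    (contDiffOn_contract hg) hb.contract hp]
  simp [lineInt]

/-- Integration over vertical directions commutes with the differential up to sign. -/
theorem iterInt_locDiff {c : Fin n → ι} (hc : Function.Injective c)
    {g : Y → W [⋀^Fin (k + n)]→L[ℝ] N} {G : Y → W [⋀^Fin (k + 1 + n)]→L[ℝ] N}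
    (hg : ContDiffOn ℝ ∞ g U) (hG : ContDiffOn ℝ ∞ G U) (hb : ∀ j, BddIn U (v.s (c j)) g)
    (hbG : ∀ j, BddIn U (v.s (c j)) G) (ε : ℝ)
    (h : ∀ q ∈ U, ∀ w, G q w = ε • locDiff A B g q (w ∘ Fin.cast (Nat.add_right_comm k n 1))) :
    ∀ p ∈ U, ε • locDiff A B (v.iterInt c g) p = (-1 : ℝ) ^ n • v.iterInt c G p := by
  induction n generalizing ε with
  | zero =>
    intro p hp
    rw [pow_zero, one_smul]
    ext w
    exact (h p hp w).symm
  | succ n ih =>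
    intro p hp
    have hc' : Function.Injective fun j : Fin n => c j.succ :=
      hc.comp (Fin.succ_injective n)
    have hne : ∀ j : Fin n, c j.succ ≠ c 0 := fun j h => Fin.succ_ne_zero j (hc h)
    have h1 := ih hc' (v.contDiffOn_fibInt hg (hb 0)) (v.contDiffOn_fibInt (n := k + 1 + n) hG (hbG 0))
      (fun j => v.bddIn_fibInt (hne j) (hb j.succ))
      (fun j => v.bddIn_fibInt (n := k + 1 + n) (hne j) (hbG j.succ)) (-ε) (fun q hq w => ?_) p hp
    · rw [neg_smul] at h1
      rw [pow_succ, mul_neg_one, neg_smul, eq_neg_iff_add_eq_zero, ← neg_eq_iff_add_eq_zero]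
      exact h1
    · rw [v.fibInt_apply (d := k + 1 + n) hG.continuousOn (hbG 0) hq, neg_smul, ← smul_neg]
      have h2 := v.lineInt_contract_locDiff (k := k + n) hg (hb 0) hq
      have h3 := (ContinuousAlternatingMap.apply ℝ W N
        (w ∘ Fin.cast (Nat.add_right_comm k n 1))).integral_comp_comm h2.1
      rw [h2.2] at h3
      refine Eq.trans ?_ (congrArg (ε • ·) h3)
      rw [← integral_smul]
      refine integral_congr_ae (Eventually.of_forall fun x => ?_)
      refine (h _ (v.add_mem _ _ hq x) _).trans (congrArg (fun u => ε • locDiff A B g _ u) ?_)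
      funext j
      refine Fin.cases rfl (fun j => rfl) (show Fin (k + n + 1 + 1) from j)

/-- A closed form of bounded support in the vertical directions `c` with vertical
integral `a`. -/
def bumpForm (a : N) : {n : ℕ} → (Fin n → ι) → Y → W [⋀^Fin n]→L[ℝ] N
  | 0, _ => fun _ => toContAlt (AlternatingMap.constOfIsEmpty ℝ W (Fin 0) a)
  | _ + 1, c => v.bumpWedge (c 0) (bumpForm a fun j => c j.succ)

theorem contDiffOn_bumpForm (a : N) (c : Fin n → ι) : ContDiffOn ℝ ∞ (v.bumpForm a c) U := by
  induction n with
  | zero => exact contDiffOn_const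
  | succ n ih => exact v.contDiffOn_bumpWedge (ih _)

theorem bddIn_bumpForm (a : N) (c : Fin n → ι) (j : Fin n) : BddIn U (v.s (c j)) (v.bumpForm a c) := by
  induction n with
  | zero => exact j.elim0
  | succ n ih =>
    refine Fin.cases v.bddIn_bumpWedge_self (fun j => ?_) j
    exact v.bddIn_bumpWedge (ih (fun j => c j.succ) j)

theorem locDiff_bumpForm (a : N) (c : Fin n → ι) (hp : p ∈ U) : locDiff A B (v.bumpForm a c) p = 0 := by
  induction n with
  | zero =>
    have h : ∀ b, contract b (locDiff A B (v.bumpForm a c) p) = 0 := fun b => by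
      rw [contract_locDiff_zero]
      have : fderiv ℝ (v.bumpForm a c) p = 0 := fderiv_const_apply _
      rw [this]; rfl
    ext y
    have := congrArg (fun z : W [⋀^Fin 0]→L[ℝ] N => z (Matrix.vecTail y)) (h (Matrix.vecHead y))
    beta_reduce at this
    rwa [contract_apply, Matrix.cons_head_tail] at this
  | succ n ih =>
    refine (v.locDiff_bumpWedge (v.contDiffOn_bumpForm a _) hp).trans ?_
    rw [ih, map_zero, smul_zero, neg_zero]

theorem bumpForm_apply (a : N) {c : Fin n → ι} (hc : Function.Injective c) :
    v.bumpForm a c p (fun j => v.b (c j)) = (∏ j, bump (v.s (c j) p)) • a := by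
  induction n with
  | zero => simp [bumpForm]
  | succ n ih =>
    have h1 := ih (hc.comp (Fin.succ_injective n))
    change bump _ • covWedge _ (v.bumpForm a (fun j => c j.succ) p) _ = _
    rw [covWedge_apply, Finset.sum_eq_single 0]
    · rw [Fin.prod_univ_succ, v.σ_b, if_pos rfl, mul_smul]
      simp only [Fin.val_zero, pow_zero, one_smul]
      refine congrArg _ ?_
      exact h1
    · intro j _ hj
      rw [v.σ_b, if_neg fun h => hj (hc h).symm, zero_smul, smul_zero]
    · simp

theorem integral_bump : ∫ t, bump t = 1 := by
  have hi : Integrable bump := by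
    refine contDiff_bump.continuous.integrable_of_hasCompactSupport ?_
    refine HasCompactSupport.of_support_subset_isCompact (isCompact_Icc (a := (-1 : ℝ)) (b := 1))
      fun t ht => ?_
    by_contra h
    exact ht (bump_eq_zero (by by_contra h'; exact h (abs_le.1 (not_lt.1 h'))))
  have h0 : Tendsto Real.smoothTransition atBot (𝓝 0) := by
    refine tendsto_const_nhds.congr' ?_
    filter_upwards [eventually_le_atBot 0] with t ht
    exact (Real.smoothTransition.zero_of_nonpos ht).symm
  have h1 : Tendsto Real.smoothTransition atTop (𝓝 1) := by
    refine tendsto_const_nhds.congr' ?_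
    filter_upwards [eventually_ge_atTop 1] with t ht
    exact (Real.smoothTransition.one_of_one_le ht).symm
  rw [integral_of_hasDerivAt_of_tendsto hasDerivAt_smoothTransition hi h0 h1, sub_zero]

theorem integral_bumpForm (a : N) {c : Fin n → ι} (hc : Function.Injective c) (p : Y) :
    ∫ t : Fin n → ℝ, v.bumpForm a c (p + ∑ j, t j • v.e (c j)) (fun j => v.b (c j)) = a := by
  have h : ∀ t : Fin n → ℝ, v.bumpForm a c (p + ∑ j, t j • v.e (c j)) (fun j => v.b (c j)) =
      (∏ j, bump (v.s (c j) p + t j)) • a := fun t => by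
    rw [v.bumpForm_apply a hc]
    simp [v.s_e, hc.eq_iff]
  simp only [h]
  rw [integral_smul_const, integral_fintype_prod_volume_eq_prod (fun j x => bump (v.s (c j) p + x))]
  refine (congrArg (· • a) (Finset.prod_eq_one fun j _ => ?_)).trans (one_smul ℝ a)
  rw [integral_add_left_eq_self (fun x => bump x), integral_bump]

end VertCoords

end VerticalDirections

/-- The linear change of variables, in the form needed for integrals over the fibres of an oriented
vector bundle. -/
theorem det_smul_integral_comp {r : ℕ} {F N : Type*} [AddCommGroup F] [Module ℝ F]
    [NormedAddCommGroup N] [NormedSpace ℝ N] (b : Module.Basis (Fin r) ℝ F)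
    (f : EuclideanSpace ℝ (Fin r) ≃ₗ[ℝ] F)
    (hf : 0 < b.det (fun i => f (EuclideanSpace.single i 1))) (h : F → N) :
    b.det (fun i => f (EuclideanSpace.single i 1)) • ∫ v, h (f v) =
      ∫ t : Fin r → ℝ, h (∑ i, t i • b i) := by
  -- `T` is the map `f` in the coordinates given by `b`.
  let T : (Fin r → ℝ) →ₗ[ℝ] (Fin r → ℝ) := b.equivFun.toLinearMap ∘ₗ f.toLinearMap ∘ₗ
    (WithLp.linearEquiv 2 ℝ (Fin r → ℝ)).symm.toLinearMap
  have hT : LinearMap.det T = b.det (fun i => f (EuclideanSpace.single i 1)) := by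
    rw [← LinearMap.det_toMatrix', Module.Basis.det_apply]
    congr 1
  have hd : LinearMap.det T ≠ 0 := by rw [hT]; exact hf.ne'
  have h1 : ∫ v, h (f v) = ∫ t, h (∑ i, T t i • b i) := by
    rw [← (PiLp.volume_preserving_toLp (Fin r)).integral_comp
      (MeasurableEquiv.toLp 2 _).measurableEmbedding]
    refine integral_congr_ae (Eventually.of_forall fun t => congrArg h ?_)
    exact (b.sum_equivFun _).symm
  have hemb : MeasurableEmbedding T :=
    (LinearEquiv.ofIsUnitDet (f := T) (v := Pi.basisFun ℝ (Fin r)) (v' := Pi.basisFun ℝ (Fin r))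
      (by rw [LinearMap.det_toMatrix]; exact isUnit_iff_ne_zero.2 hd)).toContinuousLinearEquiv.toHomeomorph.measurableEmbedding
  rw [h1, ← hemb.integral_map (fun s : Fin r → ℝ => h (∑ i, s i • b i)),
    Real.map_linearMap_volume_pi_eq_smul_volume_pi hd, integral_smul_measure, hT,
    ENNReal.toReal_ofReal (abs_nonneg _), abs_of_pos (inv_pos.2 hf), smul_smul,
    mul_inv_cancel₀ hf.ne', one_smul]

theorem det_pos_of_orientation {r : ℕ} {F V : Type*} [AddCommGroup F] [Module ℝ F]
    [AddCommMonoid V] [Module ℝ V] (b : Module.Basis (Fin r) ℝ F) {o : Orientation ℝ V (Fin r)}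
    (φ : V ≃ₗ[ℝ] F) (hφ : Orientation.map (Fin r) φ o = b.orientation)
    {u : EuclideanSpace ℝ (Fin r) ≃ₗ[ℝ] V} (hu : IsOriented o u) :
    0 < b.det (fun i => (u.trans φ) (EuclideanSpace.single i 1)) := by
  let f := (EuclideanSpace.basisFun (Fin r) ℝ).toBasis.map (u.trans φ)
  have h : b.orientation = f.orientation := by
    rw [← hφ, ← hu, Module.Basis.orientation_map]
    rfl
  have h2 := (b.orientation_eq_iff_det_pos f).1 h
  have h3 : (fun i => (u.trans φ) (EuclideanSpace.single i 1)) = f := by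
    funext i
    simp [f]
  rwa [h3]

/-! ### Pull-back of compactly supported classes -/

section Classes

variable {𝕜 : Type*} [RCLike 𝕜]
    {E₁ : Type*} [NormedAddCommGroup E₁] [NormedSpace ℝ E₁]
    {H₁ : Type*} [TopologicalSpace H₁] {I₁ : ModelWithCorners ℝ E₁ H₁}
    {M₁ : Type*} [TopologicalSpace M₁] [ChartedSpace H₁ M₁]
    {E₂ : Type*} [NormedAddCommGroup E₂] [NormedSpace ℝ E₂]
    {H₂ : Type*} [TopologicalSpace H₂] {I₂ : ModelWithCorners ℝ E₂ H₂}
    {M₂ : Type*} [TopologicalSpace M₂] [ChartedSpace H₂ M₂]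
    {A₁ : AlgebroidData I₁ M₁} {A₂ : AlgebroidData I₂ M₂} {f : M₁ → M₂}
    {φ : ∀ x, A₁.Fib x →ₗ[ℝ] A₂.Fib (f x)} {k : ℕ}

/-- The exact forms with a compactly supported primitive. -/
abbrev AlgebroidData.compactCoboundaries (𝕜 : Type*) [RCLike 𝕜] (A : AlgebroidData I₁ M₁) (k : ℕ) :
    Submodule 𝕜 (A.Form 𝕜 k) :=
  A.coboundaries 𝕜 (A.compactForms 𝕜) A.compactForms_le k

theorem AlgebroidData.exists_represents {A : AlgebroidData I₁ M₁} (c : A.CompactCohomology 𝕜 k) :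
    ∃ τ, A.Represents τ c := by
  obtain ⟨⟨τ, h⟩, rfl⟩ := Submodule.Quotient.mk_surjective _ c
  exact ⟨τ, h, rfl⟩

theorem AlgebroidData.represents_mk {A : AlgebroidData I₁ M₁} {τ : A.Form 𝕜 k}
    (h : τ ∈ A.compactCocycles 𝕜 k) : A.Represents τ (Submodule.Quotient.mk ⟨τ, h⟩) :=
  ⟨h, rfl⟩

theorem AlgebroidData.Represents.unique {A : AlgebroidData I₁ M₁} {τ : A.Form 𝕜 k}
    {c c' : A.CompactCohomology 𝕜 k} (h : A.Represents τ c) (h' : A.Represents τ c') : c = c' := by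
  obtain ⟨_, rfl⟩ := h
  obtain ⟨_, rfl⟩ := h'
  rfl

theorem AlgebroidData.Represents.represents_iff {A : AlgebroidData I₁ M₁} {τ σ : A.Form 𝕜 k}
    {c : A.CompactCohomology 𝕜 k} (h : A.Represents τ c) :
    A.Represents σ c ↔ σ ∈ A.compactCocycles 𝕜 k ∧ σ - τ ∈ A.compactCoboundaries 𝕜 k := by
  obtain ⟨hτ, rfl⟩ := h
  have key : ∀ hσ : σ ∈ A.compactCocycles 𝕜 k, (Submodule.Quotient.mk ⟨σ, hσ⟩ :
      A.CompactCohomology 𝕜 k) = Submodule.Quotient.mk ⟨τ, hτ⟩ ↔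
        σ - τ ∈ A.compactCoboundaries 𝕜 k := fun hσ => Submodule.Quotient.eq _
  exact ⟨fun ⟨hσ, h⟩ => ⟨hσ, (key hσ).1 h⟩, fun ⟨hσ, h⟩ => ⟨hσ, (key hσ).2 h⟩⟩

variable (𝕜 φ) in
/-- Pull-back along `φ` is a chain map between the complexes of compactly supported forms. -/
structure IsProperHom : Prop where
  compactForms : ∀ {k : ℕ} {τ : A₂.Form 𝕜 k}, τ ∈ A₂.compactForms 𝕜 k →
    pullbackForm φ τ ∈ A₁.compactForms 𝕜 k
  isDifferential : ∀ {k : ℕ} {τ : A₂.Form 𝕜 k} {τ' : A₂.Form 𝕜 (k + 1)}, τ ∈ A₂.compactForms 𝕜 k →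
    A₂.IsDifferential τ τ' → A₁.IsDifferential (pullbackForm φ τ) (pullbackForm φ τ')

theorem IsProperHom.of_isHomAt [IsManifold I₁ ∞ M₁] [IsManifold I₂ ∞ M₂]
    {W₁ : Type*} [NormedAddCommGroup W₁] [NormedSpace ℝ W₁] [FiniteDimensional ℝ W₁]
    {W : Type*} [NormedAddCommGroup W] [NormedSpace ℝ W] [FiniteDimensional ℝ W]
    (h₁ : IsAlgebroid A₁ W₁) (h : IsAlgebroid A₂ W)
    (hφ : ∀ p, ∃ fr : AFrame A₂ W (f p), IsHomAt φ p fr)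
    (hf : ∀ K : Set M₂, IsCompact K → IsCompact (f ⁻¹' K)) : IsProperHom 𝕜 φ where
  compactForms := fun ⟨hs, K, hK, h0⟩ => ⟨isSmoothForm_iff.2 fun p => by
      obtain ⟨fr, hfr⟩ := hφ p
      exact hfr.smoothFormAt (isSmoothForm_iff.1 hs _), f ⁻¹' K, hf K hK, fun x hx =>
    (congrArg (fun a => a.compLinearMap (φ x)) (h0 (f x) hx)).trans rfl⟩
  isDifferential := fun hτ hd => isDifferential_iff.2 fun p => by
    obtain ⟨fr, hfr⟩ := hφ p
    exact hfr.isDifferentialAt h₁ h (isSmoothForm_iff.1 hτ.1 _) (isDifferential_iff.1 hd _)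

variable (hφ : IsProperHom 𝕜 φ)
include hφ

theorem IsProperHom.compactCocycles {τ : A₂.Form 𝕜 k} (hτ : τ ∈ A₂.compactCocycles 𝕜 k) :
    pullbackForm φ τ ∈ A₁.compactCocycles 𝕜 k :=
  ⟨hφ.compactForms hτ.1, (hφ.compactForms hτ.1).1, hφ.isDifferential hτ.1 hτ.2.2⟩

theorem IsProperHom.compactCoboundaries {τ : A₂.Form 𝕜 k} (hτ : τ ∈ A₂.compactCoboundaries 𝕜 k) :
    pullbackForm φ τ ∈ A₁.compactCoboundaries 𝕜 k := by
  cases k with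
  | zero =>
    obtain rfl : τ = 0 := hτ
    rfl
  | succ k =>
    obtain ⟨β, hβ, hd⟩ := hτ
    exact ⟨_, hφ.compactForms hβ, hφ.isDifferential hβ hd⟩

/-- The pull-back of a class may be computed from any representative. -/
theorem IsProperHom.isPullbackClass_iff {τ : A₂.Form 𝕜 k} {c₂ : A₂.CompactCohomology 𝕜 k}
    {c₁ : A₁.CompactCohomology 𝕜 k} (h₂ : A₂.Represents τ c₂) :
    IsPullbackClass φ c₂ c₁ ↔ A₁.Represents (pullbackForm φ τ) c₁ := by
  refine ⟨fun h => h τ h₂, fun h₁ σ hσ => ?_⟩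
  obtain ⟨h3, h4⟩ := h₂.represents_iff.1 hσ
  exact h₁.represents_iff.2 ⟨hφ.compactCocycles h3, hφ.compactCoboundaries h4⟩

theorem IsProperHom.exists_isPullbackClass (c₂ : A₂.CompactCohomology 𝕜 k) :
    ∃ c₁ : A₁.CompactCohomology 𝕜 k, IsPullbackClass φ c₂ c₁ := by
  obtain ⟨τ, hτ⟩ := AlgebroidData.exists_represents c₂
  exact ⟨_, (hφ.isPullbackClass_iff hτ).2
    (AlgebroidData.represents_mk (hφ.compactCocycles hτ.1))⟩

end Classes

/-! ### Exact forms on a vector space -/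

section Stokes

variable {𝕜 : Type*} [RCLike 𝕜] {V : Type*} [NormedAddCommGroup V] [NormedSpace ℝ V]
    [FiniteDimensional ℝ V] [MeasurableSpace V] [BorelSpace V] {μ : Measure V} [μ.IsAddHaarMeasure]
    {d : ℕ}

theorem mlieBracket_const (a b : V) :
    VectorField.mlieBracket 𝓘(ℝ, V) (M := V) (fun _ => a) (fun _ => b) = 0 := by
  have h : VectorField.mlieBracket 𝓘(ℝ, V) (M := V) (fun _ => a) (fun _ => b) =
      VectorField.lieBracketWithin ℝ (fun _ : V => a) (fun _ => b) univ :=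
    VectorField.mlieBracketWithin_univ.symm.trans VectorField.mlieBracketWithin_eq_lieBracketWithin
  refine h.trans (funext fun x => ?_)
  simp [VectorField.lieBracketWithin_eq]
  rfl

theorem isSmooth_const (a : V) : (tangentAlgebroid 𝓘(ℝ, V) V).IsSmooth fun _ => a := fun v => by
  refine (contMDiffAt_vectorField_iff (X := fun _ : V => a) (mem_chart_source _ v)).2 ?_
  refine (contMDiffAt_const (c := a)).congr_of_eventuallyEq (Eventually.of_forall fun q => ?_)
  have h : mfderiv 𝓘(ℝ, V) 𝓘(ℝ, V) (extChartAt 𝓘(ℝ, V) v) q = ContinuousLinearMap.id ℝ V :=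
    (mfderiv_congr (by rw [extChartAt_model_space_eq_id]; rfl)).trans (mfderiv_id (x := q))
  exact congrArg (fun T : V →L[ℝ] V => T a) h

theorem hasCompactSupport_apply_const {τ : (tangentAlgebroid 𝓘(ℝ, V) V).Form 𝕜 d}
    (hτ : τ ∈ (tangentAlgebroid 𝓘(ℝ, V) V).compactForms 𝕜 d) (w : Fin d → V) :
    ContDiff ℝ ∞ (fun v => τ v w) ∧ HasCompactSupport fun v => τ v w := by
  obtain ⟨hs, K, hK, h0⟩ := hτ
  exact ⟨(hs (fun i _ => w i) fun i => isSmooth_const _).contDiff,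
    HasCompactSupport.intro hK fun v hv => congrArg (fun a => a w) (h0 v hv)⟩

theorem integrable_apply_const {τ : (tangentAlgebroid 𝓘(ℝ, V) V).Form 𝕜 d}
    (hτ : τ ∈ (tangentAlgebroid 𝓘(ℝ, V) V).compactForms 𝕜 d) (w : Fin d → V) :
    Integrable (fun v => τ v w) μ :=
  have h := hasCompactSupport_apply_const hτ w
  h.1.continuous.integrable_of_hasCompactSupport h.2

theorem integral_dirDeriv_eq_zero {g : V → 𝕜} (hg : ContDiff ℝ ∞ g)
    (hc : HasCompactSupport g) (a : V) :
    Integrable (fun v => dirDeriv 𝓘(ℝ, V) g v a) μ ∧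
      ∫ v, dirDeriv 𝓘(ℝ, V) g v a ∂μ = 0 := by
  have h1 : ∀ v, dirDeriv 𝓘(ℝ, V) g v a = fderiv ℝ g v a := fun v =>
    congrArg (fun T : V →L[ℝ] 𝕜 => T a) mfderiv_eq_fderiv
  simp only [h1]
  have hi : Integrable (fun v => fderiv ℝ g v a) μ :=
    ((hg.continuous_fderiv (by simp)).clm_apply continuous_const).integrable_of_hasCompactSupport
      (hc.fderiv_apply ℝ a)
  refine ⟨hi, ?_⟩
  have h2 := integral_smul_fderiv_eq_neg_fderiv_smul_of_integrable (μ := μ)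
    (f := fun _ : V => (1 : ℝ)) (g := g) (v := a)
    (by simp) (by simpa using hi)
    (by simpa using hg.continuous.integrable_of_hasCompactSupport hc)
    (fun _ _ => differentiableAt_const _) (fun x _ => hg.differentiable (by simp) x)
  simpa using h2

/-- The integral of the differential of a compactly supported form vanishes. -/
theorem integral_eq_zero_of_mem_coboundaries {τ : (tangentAlgebroid 𝓘(ℝ, V) V).Form 𝕜 d}
    (hτ : τ ∈ (tangentAlgebroid 𝓘(ℝ, V) V).compactCoboundaries 𝕜 d)
    (w : Fin d → V) : ∫ v, τ v w ∂μ = 0 := by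
  cases d with
  | zero =>
    obtain rfl : τ = 0 := hτ
    exact integral_zero _ _
  | succ d =>
    obtain ⟨β, hβ, hd⟩ := hτ
    have h0 : ∀ v, (tangentAlgebroid 𝓘(ℝ, V) V).koszulBracketSum β (fun i _ => w i) v = 0 := fun v => by
      cases d with
      | zero => rfl
      | succ d =>
        refine Finset.sum_eq_zero fun j _ => Finset.sum_eq_zero fun i _ => ?_
        split_ifs
        · refine mul_eq_zero_of_right _ ((β v).map_coord_zero 0 ?_)
          exact congrFun (mlieBracket_const (w i.castSucc) (w j)) v
        · rfl
    have h1 : ∀ v, τ v w = ∑ i : Fin (d + 1), (-1 : 𝕜) ^ (i : ℕ) *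
        dirDeriv 𝓘(ℝ, V) (fun y => β y fun l => w (i.succAbove l)) v (w i) :=
      fun v => (hd (fun i _ => w i) (fun i => isSmooth_const _) v).trans
        ((congrArg _ (h0 v)).trans (add_zero _))
    have h2 := fun i : Fin (d + 1) => integral_dirDeriv_eq_zero (μ := μ)
      (hasCompactSupport_apply_const hβ fun l => w (i.succAbove l)).1
      (hasCompactSupport_apply_const hβ fun l => w (i.succAbove l)).2 (w i)
    simp only [h1]
    rw [integral_finsetSum _ fun i _ => (h2 i).1.const_mul _]
    refine Finset.sum_eq_zero fun i _ => ?_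
    rw [integral_const_mul, (h2 i).2, mul_zero]

end Stokes

section Fibrewise

variable {𝕜 : Type*} [RCLike 𝕜]
    {EM : Type*} [NormedAddCommGroup EM] [NormedSpace ℝ EM] [FiniteDimensional ℝ EM]
    {M : Type*} [TopologicalSpace M] [ChartedSpace EM M] [IsManifold 𝓘(ℝ, EM) ∞ M]
    [T2Space M] [CompactSpace M]
    {FA : Type*} [NormedAddCommGroup FA] [NormedSpace ℝ FA] [FiniteDimensional ℝ FA]
    {A : M → Type*} [TopologicalSpace (TotalSpace FA A)]
    [∀ x, AddCommGroup (A x)] [∀ x, Module ℝ (A x)] [∀ x, TopologicalSpace (A x)]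
    [FiberBundle FA A] [VectorBundle ℝ FA A] [ContMDiffVectorBundle ∞ FA A 𝓘(ℝ, EM)]
    {L : LieAlgebroid 𝓘(ℝ, EM) FA A}
    {F : Type*} [NormedAddCommGroup F] [NormedSpace ℝ F] [FiniteDimensional ℝ F]
    {E : M → Type*} [TopologicalSpace (TotalSpace F E)]
    [∀ x, AddCommMonoid (E x)] [∀ x, Module ℝ (E x)] [∀ x, TopologicalSpace (E x)]
    [FiberBundle F E] [VectorBundle ℝ F E] [ContMDiffVectorBundle ∞ F E 𝓘(ℝ, EM)]
    {x₀ x : M} {r d k : ℕ} {o : ∀ x, Orientation ℝ (E x) (Fin r)}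

/-- The pull-back algebroid of `L` along the bundle projection. -/
local notation "π^!" => LieAlgebroid.bundlePullback F E L

/-- The pull-back of forms on `L` along the bundle projection. -/
local notation "π^*" =>
  pullbackForm (projHom (ModelWithCorners.prod 𝓘(ℝ, EM) 𝓘(ℝ, F)) L (π F E))

/-- The chart of the total space over the patch around `x₀`. -/
local notation "𝒯₀" => bundleChart (EM := EM) F E x₀

/-! ### Forms in local coordinates -/

section Transfer

variable {n : ℕ}

namespace PatchFrame

variable (pf : PatchFrame L F E x₀)

/-- The domain of the local coordinates on the total space. -/
def dom : Set (EM × F) := ((chartAt EM x₀).target ∩ (chartAt EM x₀).symm ⁻¹' pf.U) ×ˢ univ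

theorem isOpen_dom : IsOpen pf.dom :=
  ((chartAt EM x₀).isOpen_inter_preimage_symm pf.isOpen).prod isOpen_univ

theorem dom_subset : pf.dom ⊆ (𝒯₀).target := by
  rw [bundleChart_target]
  exact prod_mono (fun z hz => ⟨hz.1, (pf.subset_patch hz.2).2⟩) Subset.rfl

theorem map_mem_dom {q : TotalSpace F E} (hq : q.proj ∈ pf.U) :
    𝒯₀ q ∈ pf.dom := by
  have h := pf.subset_patch hq
  refine ⟨?_, mem_univ _⟩
  rw [bundleChart_fst h]
  refine ⟨(chartAt EM x₀).map_source h.1, ?_⟩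
  change (chartAt EM x₀).symm (chartAt EM x₀ q.proj) ∈ pf.U
  rwa [(chartAt EM x₀).left_inv h.1]

theorem symm_left {q : TotalSpace F E} (hq : q.proj ∈ pf.U) :
    (𝒯₀).symm (𝒯₀ q) = q :=
  (𝒯₀).left_inv (mem_bundleChart_source.2 (pf.subset_patch hq))

theorem symm_right {z : EM × F} (hz : z ∈ pf.dom) :
    𝒯₀ ((𝒯₀).symm z) = z :=
  (𝒯₀).right_inv (pf.dom_subset hz)

theorem proj_symm {z : EM × F} (hz : z ∈ pf.dom) :
    ((𝒯₀).symm z).proj = (chartAt EM x₀).symm z.1 := by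
  rw [bundleChart_symm]
  exact (trivializationAt F E x₀).proj_symm_apply' (pf.subset_patch hz.1.2).2

theorem proj_symm_mem {z : EM × F} (hz : z ∈ pf.dom) :
    ((𝒯₀).symm z).proj ∈ pf.U := by
  rw [pf.proj_symm hz]
  exact hz.1.2

/-- The anchor of the algebroid on the base in local coordinates. -/
def baseAnchor (z : EM) : FA →ₗ[ℝ] EM :=
  (mfderiv 𝓘(ℝ, EM) 𝓘(ℝ, EM) (extChartAt 𝓘(ℝ, EM) x₀) ((chartAt EM x₀).symm z)).toLinearMap ∘ₗ
    L.anchor ((chartAt EM x₀).symm z) ∘ₗ LinearMap.proj ((chartAt EM x₀).symm z) ∘ₗ pf.base.sec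

theorem baseAnchor_apply (z : EM) (a : FA) {x : M} (hx : (chartAt EM x₀).symm z = x) :
    pf.baseAnchor z a =
      dirDeriv 𝓘(ℝ, EM) (extChartAt 𝓘(ℝ, EM) x₀) x (L.anchor x (pf.base.sec a x)) := by
  subst hx; rfl

/-- The anchor in local coordinates. -/
def locA (p : EM × F) : FA × F →ₗ[ℝ] EM × F := (pf.baseAnchor p.1).prodMap LinearMap.id

/-- The structure constants in local coordinates. -/
def locB (p : EM × F) : FA × F →ₗ[ℝ] FA × F →ₗ[ℝ] FA × F :=
  ((pf.base.B ((chartAt EM x₀).symm p.1)).compl₁₂ (LinearMap.fst ℝ FA F)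
    (LinearMap.fst ℝ FA F)).compr₂ (LinearMap.inl ℝ FA F)

/-- The linear vertical coordinates given by a basis of the model fibre. -/
def vertCoords (b : Module.Basis (Fin r) ℝ F) : VertCoords pf.dom pf.locA pf.locB (Fin r) where
  e i := (0, b i)
  b i := (0, b i)
  s i := (LinearMap.toContinuousLinearMap (b.coord i)).comp (ContinuousLinearMap.snd ℝ EM F)
  σ i := b.coord i ∘ₗ LinearMap.snd ℝ FA F
  isOpen := pf.isOpen_dom
  add_mem i p hp t := ⟨by simpa using hp.1, mem_univ _⟩
  s_e i j := by simp [Finsupp.single_apply, eq_comm]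
  σ_b i j := by simp [Finsupp.single_apply, eq_comm]
  A_b i p _ := by simp [locA]
  s_A i p _ := by ext <;> simp [locA]
  A_add i p t := by simp [locA]
  B_add i p t := by simp [locB]
  B_b i p X := by simp [locB]
  b_B i p X := by simp [locB]
  σ_B i p X Z := by simp [locB]

/-- The components of a form in local coordinates. -/
def ofForm (τ : π^!.Form 𝕜 n) (z : EM × F) : (FA × F) [⋀^Fin n]→L[ℝ] 𝕜 :=
  toContAlt ((τ ((𝒯₀).symm z)).compLinearMap
    (LinearMap.proj ((𝒯₀).symm z) ∘ₗ pf.total.sec))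

/-- The form with given components. -/
def toForm (G : EM × F → (FA × F) [⋀^Fin n]→L[ℝ] 𝕜) : π^!.Form 𝕜 n := fun q =>
  (toAltL (G (𝒯₀ q))).compLinearMap (pf.total.coord q)

theorem toForm_apply (G : EM × F → (FA × F) [⋀^Fin n]→L[ℝ] 𝕜) (q : TotalSpace F E)
    (w : Fin n → π^!.Fib q) :
    pf.toForm G q w = G (𝒯₀ q) fun i => pf.total.coord q (w i) := rfl

theorem toForm_ofForm (τ : π^!.Form 𝕜 n) {q : TotalSpace F E}
    (hq : q.proj ∈ pf.U) : pf.toForm (pf.ofForm τ) q = τ q := by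
  ext w
  rw [toForm_apply]
  change τ ((𝒯₀).symm (𝒯₀ q))
    (fun i => pf.total.sec (pf.total.coord q (w i)) _) = τ q w
  rw [pf.symm_left hq]
  congr 1
  funext i
  exact pf.total.sec_coord q hq (w i)

theorem apply_eq_ofForm (τ : π^!.Form 𝕜 n) {q : TotalSpace F E}
    (hq : q.proj ∈ pf.U) (w : Fin n → π^!.Fib q) :
    τ q w = pf.ofForm τ (𝒯₀ q) fun i => pf.total.coord q (w i) := by
  rw [← pf.toForm_ofForm τ hq]
  rfl

theorem ofForm_toForm (G : EM × F → (FA × F) [⋀^Fin n]→L[ℝ] 𝕜) {z : EM × F} (hz : z ∈ pf.dom) :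
    pf.ofForm (pf.toForm G) z = G z := by
  ext w
  change G (𝒯₀ ((𝒯₀).symm z))
    (fun i => pf.total.coord _ (pf.total.sec (w i) _)) = G z w
  rw [pf.symm_right hz]
  congr 1
  funext i
  exact pf.total.coord_sec _ (pf.proj_symm_mem hz) (w i)

theorem ofForm_eq_repA (τ : π^!.Form 𝕜 n) {q : TotalSpace F E}
    (hq : q.proj ∈ pf.U) {q' : TotalSpace F E} (fr : AFrame π^! (FA × F) q')
    (hfr : fr.sec = pf.total.sec) :
    pf.ofForm τ (𝒯₀ q) = toContAlt (fr.repA τ q) := by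
  rw [ofForm, pf.symm_left hq, AFrame.repA, hfr]

theorem contDiffAt_ofForm {τ : π^!.Form 𝕜 n} {q : TotalSpace F E}
    (hq : q.proj ∈ pf.U) (hτ : SmoothFormAt τ q) :
    ContDiffAt ℝ ∞ (pf.ofForm τ) (bundleChart (EM := EM) F E x₀ q) := by
  let fr := pf.total.at pf.isOpen_preimage (p := q) hq
  have h1 := fr.contMDiffAt_rep hτ
  have h2 : ContMDiffAt 𝓘(ℝ, EM × F) (𝓘(ℝ, EM).prod 𝓘(ℝ, F)) ∞
      (bundleChart (EM := EM) F E x₀).symm (bundleChart (EM := EM) F E x₀ q) :=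
    (contMDiffOn_extChartAt_symm (⟨x₀, 0⟩ : TotalSpace F E)).contMDiffAt
      (extChartAt_target_mem_nhds' ((bundleChart (EM := EM) F E x₀).map_source
        (mem_bundleChart_source.2 (pf.subset_patch hq))))
  exact (h1.comp_of_eq h2 (pf.symm_left hq)).contDiffAt

theorem smoothFormAt_toForm {G : EM × F → (FA × F) [⋀^Fin n]→L[ℝ] 𝕜} {q : TotalSpace F E}
    (hq : q.proj ∈ pf.U) (hG : ContDiffAt ℝ ∞ G (𝒯₀ q)) :
    SmoothFormAt (pf.toForm G) q := fun X hX =>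
  contMDiffAt_alt_apply (g := fun q => G (𝒯₀ q))
    (hG.contMDiffAt.comp q (contMDiffAt_bundleChart (pf.subset_patch hq)))
    fun i => pf.total.smooth_coord (X i) (hX i) q hq

theorem isDifferentialAt_iff {τ : π^!.Form 𝕜 n}
    {τ' : π^!.Form 𝕜 (n + 1)} {q : TotalSpace F E}
    (hq : q.proj ∈ pf.U) (hτ : SmoothFormAt τ q) :
    IsDifferentialAt τ τ' q ↔ pf.ofForm τ' (bundleChart (EM := EM) F E x₀ q) =
      locDiff pf.locA pf.locB (pf.ofForm τ) (bundleChart (EM := EM) F E x₀ q) := by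
  let fr := pf.total.at pf.isOpen_preimage (p := q) hq
  have hp := pf.subset_patch hq
  rw [fr.isDifferentialAt_iff (isAlgebroid_bundlePullback L F E) hτ τ']
  have hx : (chartAt EM x₀).symm (bundleChart (EM := EM) F E x₀ q).1 = q.proj := by
    rw [bundleChart_fst hp]
    exact (chartAt EM x₀).left_inv hp.1
  have h1 : locDiff pf.locA pf.locB (pf.ofForm τ) (bundleChart (EM := EM) F E x₀ q) =
      toContAlt (fr.dhat τ) := by
    rw [locDiff, theta_apply, AFrame.dhat]
    congr 1
    have hB : pf.locB (bundleChart (EM := EM) F E x₀ q) = fr.B := by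
      unfold locB
      rw [hx]
      rfl
    rw [hB, pf.ofForm_eq_repA τ hq fr rfl, toAltL_toContAlt]
    congr 1
    refine LinearMap.ext fun w => ?_
    change toAltL (fderiv ℝ (pf.ofForm τ) _ (pf.locA _ w)) =
      toAltL (dirDeriv (𝓘(ℝ, EM).prod 𝓘(ℝ, F)) (fun q => toContAlt (fr.repA τ q)) q _)
    congr 1
    have hd := dirDeriv_eq_fderiv_chart (I := 𝓘(ℝ, EM).prod 𝓘(ℝ, F))
      (p := (⟨x₀, 0⟩ : TotalSpace F E)) (mem_bundleChart_source.2 hp)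
      (mdiffAt_of_contMDiffAt (fr.contMDiffAt_rep hτ))
      (π^!.anchor q (fr.sec w q))
    refine Eq.trans ?_ hd.symm
    refine congrArg (fderiv ℝ (pf.ofForm τ) _) (Eq.trans ?_
      (dirDeriv_bundleLift (L := L) hp (pf.base.sec w.1 q.proj, w.2)).symm |>.trans ?_)
    · exact Prod.ext (pf.baseAnchor_apply _ _ hx) rfl
    · refine congrArg (fun z : π^!.Fib q => dirDeriv (𝓘(ℝ, EM).prod 𝓘(ℝ, F))
        (bundleChart (EM := EM) F E x₀) q z.1.2) ?_
      have h2 := bundleSec_of_mem (L := L) hp pf.ψ pf.base.sec w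
      rw [pf.eq_one _ hq, one_smul] at h2
      exact h2.symm
  rw [h1, pf.ofForm_eq_repA τ' hq fr rfl]
  exact ⟨fun h => congrArg _ h, fun h => congrArg toAltL h⟩

end PatchFrame

end Transfer

/-! ### Integrals over the fibres -/

section FibreIntegrals

variable (L) in
/-- Arguments `Y v` of a form of degree `d` at the points of the fibre over `x`: at the positions `k`
the basis vectors tangent to the fibre, at the others arbitrary lifts of fixed vectors `y`. -/
structure VertArgs (x : M)
    (u : EuclideanSpace ℝ (Fin r) ≃ₗ[ℝ] E x) (k : Fin r → Fin d)
    (Y : ∀ v, Fin d → π^!.Fib (fibreInclusion F x u v)) (y : Fin d → A x) :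
    Prop where
  inj : Function.Injective k
  vert : ∀ v i, Y v (k i) = fibreHom F L x u v (EuclideanSpace.single i (1 : ℝ))
  proj : ∀ v j, (Y v j).1.1 = y j

/-- All integrals of the form `τ` over fibres vanish. -/
def FibNull (o : ∀ x, Orientation ℝ (E x) (Fin r)) (τ : π^!.Form 𝕜 d) : Prop :=
  ∀ (x : M) (u : EuclideanSpace ℝ (Fin r) ≃ₗ[ℝ] E x), IsOriented (o x) u →
    ∀ (k : Fin r → Fin d) (Y : ∀ v, Fin d → π^!.Fib (fibreInclusion F x u v))
      (y : Fin d → A x), VertArgs L x u k Y y → ∫ v, τ (fibreInclusion F x u v) (Y v) = 0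

/-- The form `β` vanishes at arguments among which there is a basis of the fibre direction. -/
def KillsVert (r : ℕ) (β : π^!.Form 𝕜 d) (x : M) : Prop :=
  ∀ (u : EuclideanSpace ℝ (Fin r) ≃ₗ[ℝ] E x) v (k : Fin r → Fin d)
    (z : Fin d → π^!.Fib (fibreInclusion F x u v)), Function.Injective k →
    (∀ i, z (k i) = fibreHom F L x u v (EuclideanSpace.single i (1 : ℝ))) →
    β (fibreInclusion F x u v) z = 0

/-- The trivialization as a linear isomorphism of the fibre over a point of a patch. -/
def PatchFrame.fibreEquiv (pf : PatchFrame L F E x₀) {x : M} (hx : x ∈ pf.U) : E x ≃ₗ[ℝ] F :=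
  (trivializationAt F E x₀).linearEquivAt ℝ x (pf.subset_patch hx).2

/-- The basis `b` induces the given orientations over the patch. -/
def PatchFrame.OrientedBy (pf : PatchFrame L F E x₀) (o : ∀ x, Orientation ℝ (E x) (Fin r))
    (b : Module.Basis (Fin r) ℝ F) : Prop :=
  ∀ (x : M) (hx : x ∈ pf.U), Orientation.map (Fin r) (pf.fibreEquiv hx) (o x) = b.orientation

/-- The restriction of a patch to a smaller open set. -/
def PatchFrame.restrict (pf : PatchFrame L F E x₀) {V : Set M} (hV : IsOpen V) (h : V ⊆ pf.U) :
    PatchFrame L F E x₀ where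
  U := V
  isOpen := hV
  ψ := pf.ψ
  smooth := pf.smooth
  tsupport_subset := pf.tsupport_subset
  eq_one x hx := pf.eq_one x (h hx)
  base :=
    { coord := pf.base.coord
      sec := pf.base.sec
      B := pf.base.B
      isSmooth_sec := pf.base.isSmooth_sec
      coord_sec := fun q hq => pf.base.coord_sec q (h hq)
      sec_coord := fun q hq => pf.base.sec_coord q (h hq)
      smooth_coord := fun X hX q hq => pf.base.smooth_coord X hX q (h hq)
      B_skew := pf.base.B_skew
      bracket := fun X Y hX hY p hp => pf.base.bracket X Y hX hY p (h hp) }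

variable (L) in
theorem exists_orientedPatch (ho : IsBundleOrientation F o) (x₀ : M) :
    ∃ (pf : PatchFrame L F E x₀) (b : Module.Basis (Fin r) ℝ F), x₀ ∈ pf.U ∧
      pf.OrientedBy o b := by
  obtain ⟨b, hb⟩ := ho x₀
  obtain ⟨V, hV, hVo, hxV⟩ := eventually_nhds_iff.1 hb
  obtain ⟨pf, hx⟩ := exists_patchFrame (L := L) (F := F) (E := E) x₀
  exact ⟨pf.restrict (hVo.inter pf.isOpen) inter_subset_right, b, ⟨hxV, hx⟩,
    fun x hx => hV x hx.1 _⟩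

namespace PatchFrame

variable (pf : PatchFrame L F E x₀) {x : M}

theorem bundleChart_fibreInclusion (hx : x ∈ pf.U) (u : EuclideanSpace ℝ (Fin r) ≃ₗ[ℝ] E x)
    (v : EuclideanSpace ℝ (Fin r)) : 𝒯₀ (fibreInclusion F x u v) =
      (extChartAt 𝓘(ℝ, EM) x₀ x, pf.fibreEquiv hx (u v)) := by
  refine Prod.ext (bundleChart_fst (q := fibreInclusion F x u v) (pf.subset_patch hx)) ?_
  rw [bundleChart_apply]
  rfl

theorem coord_fibreHom (hx : x ∈ pf.U) (u : EuclideanSpace ℝ (Fin r) ≃ₗ[ℝ] E x)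
    (v w : EuclideanSpace ℝ (Fin r)) :
    pf.total.coord (fibreInclusion F x u v) (fibreHom F L x u v w) =
      (0, pf.fibreEquiv hx (u w)) := by
  refine Prod.ext (map_zero (pf.base.coord x)) ?_
  let T : EuclideanSpace ℝ (Fin r) →L[ℝ] F :=
    LinearMap.toContinuousLinearMap ((pf.fibreEquiv hx).toLinearMap ∘ₗ u.toLinearMap)
  have hT : MDifferentiableAt 𝓘(ℝ, EuclideanSpace ℝ (Fin r)) 𝓘(ℝ, F) T v :=
    T.differentiableAt.mdifferentiableAt
  have h1 := dirDeriv_comp_map (V := EM × F) (h := 𝒯₀) (x := v)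
    (f := fibreInclusion F x u)
    (mdiffAt_of_contMDiffAt (contMDiffAt_bundleChart
      (q := fibreInclusion F x u v) (pf.subset_patch hx)))
    ((contMDiff_fibreInclusion x u).mdifferentiable (by simp) v) w
  have h2 : (fun y => 𝒯₀ (fibreInclusion F x u y)) =
      fun y => (extChartAt 𝓘(ℝ, EM) x₀ x, T y) :=
    funext fun y => pf.bundleChart_fibreInclusion hx u y
  rw [h2] at h1
  have h4 := dirDeriv_prodMk (x := v) (mdifferentiableAt_const (c := extChartAt 𝓘(ℝ, EM) x₀ x)) hT w
  refine (congrArg Prod.snd (h1.symm.trans h4)).trans ?_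
  have h3 := dirDeriv_comp (I := 𝓘(ℝ, EuclideanSpace ℝ (Fin r))) (Φ := T) (f := id) (x := v)
    T.differentiableAt mdifferentiableAt_id w
  refine h3.trans ?_
  exact (congrArg (fun S : EuclideanSpace ℝ (Fin r) →L[ℝ] F => S _) T.fderiv).trans
    (congrArg T (congrArg (fun S : EuclideanSpace ℝ (Fin r) →L[ℝ] EuclideanSpace ℝ (Fin r) => S w)
      (mfderiv_id (I := 𝓘(ℝ, EuclideanSpace ℝ (Fin r))) (x := v))))

theorem coord_fst {q : TotalSpace F E} (z : π^!.Fib q) :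
    (pf.total.coord q z).1 = pf.base.coord q.proj z.1.1 := rfl

theorem sec_fst {q : TotalSpace F E} (hq : q.proj ∈ pf.U) (w : FA × F) :
    (pf.total.sec w q).1.1 = pf.base.sec w.1 q.proj := by
  have h2 := bundleSec_of_mem (L := L) (pf.subset_patch hq) pf.ψ pf.base.sec w
  rw [pf.eq_one _ hq, one_smul] at h2
  exact congrArg (fun z : π^!.Fib q => z.1.1) h2

/-- Forms along a fibre in local coordinates. -/
theorem apply_vertArgs (b : Module.Basis (Fin r) ℝ F) (hx : x ∈ pf.U)
    {u : EuclideanSpace ℝ (Fin r) ≃ₗ[ℝ] E x} {k : Fin r → Fin d}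
    {Y : ∀ v, Fin d → π^!.Fib (fibreInclusion F x u v)} {y : Fin d → A x}
    (hY : VertArgs L x u k Y y) {y' : Fin d → FA × F} (hk : ∀ i, y' (k i) = (0, b i))
    (hy : ∀ j, (y' j).1 = pf.base.coord x (y j)) (τ : π^!.Form 𝕜 d)
    (v : EuclideanSpace ℝ (Fin r)) : τ (fibreInclusion F x u v) (Y v) =
      b.det (fun i => (u.trans (pf.fibreEquiv hx)) (EuclideanSpace.single i 1)) •
        pf.ofForm τ (extChartAt 𝓘(ℝ, EM) x₀ x, (u.trans (pf.fibreEquiv hx)) v) y' := by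
  refine (pf.apply_eq_ofForm τ (q := fibreInclusion F x u v) hx (Y v)).trans ?_
  rw [pf.bundleChart_fibreInclusion hx]
  refine apply_eq_det_smul_apply (toAltL (pf.ofForm τ _)) b hY.inj (fun i => ?_) hk fun j => ?_
  · rw [hY.vert]
    exact pf.coord_fibreHom hx u v _
  · rw [hy, pf.coord_fst]
    exact congrArg _ (hY.proj v j)

/-- Integrals over a fibre in local coordinates. -/
theorem integral_vertArgs {b : Module.Basis (Fin r) ℝ F} (hb : pf.OrientedBy o b) (hx : x ∈ pf.U)
    {u : EuclideanSpace ℝ (Fin r) ≃ₗ[ℝ] E x} (hu : IsOriented (o x) u) {k : Fin r → Fin d}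
    {Y : ∀ v, Fin d → π^!.Fib (fibreInclusion F x u v)} {y : Fin d → A x}
    (hY : VertArgs L x u k Y y) {y' : Fin d → FA × F} (hk : ∀ i, y' (k i) = (0, b i))
    (hy : ∀ j, (y' j).1 = pf.base.coord x (y j)) (τ : π^!.Form 𝕜 d) :
    ∫ v, τ (fibreInclusion F x u v) (Y v) =
      ∫ t : Fin r → ℝ, pf.ofForm τ (extChartAt 𝓘(ℝ, EM) x₀ x, ∑ i, t i • b i) y' := by
  have h1 := det_pos_of_orientation b (pf.fibreEquiv hx) (hb x hx) hu
  refine Eq.trans ?_ (det_smul_integral_comp b (u.trans (pf.fibreEquiv hx))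
    h1 (fun w => pf.ofForm τ (extChartAt 𝓘(ℝ, EM) x₀ x, w) y'))
  rw [← integral_smul]
  exact integral_congr_ae (Eventually.of_forall fun v => pf.apply_vertArgs b hx hY hk hy τ v)

/-- The oriented identification of a fibre with `ℝ^r` by a basis. -/
def fibreFrame (b : Module.Basis (Fin r) ℝ F) (hx : x ∈ pf.U) :
    EuclideanSpace ℝ (Fin r) ≃ₗ[ℝ] E x :=
  ((EuclideanSpace.basisFun (Fin r) ℝ).toBasis.equiv b (Equiv.refl _)).trans
    (pf.fibreEquiv hx).symm

theorem fibreEquiv_fibreFrame (b : Module.Basis (Fin r) ℝ F) (hx : x ∈ pf.U) (i : Fin r) :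
    pf.fibreEquiv hx (pf.fibreFrame b hx (EuclideanSpace.single i 1)) = b i := by
  have := (EuclideanSpace.basisFun (Fin r) ℝ).toBasis.equiv_apply i b (Equiv.refl _)
  simp only [OrthonormalBasis.coe_toBasis, EuclideanSpace.basisFun_apply] at this
  rw [fibreFrame, LinearEquiv.trans_apply, LinearEquiv.apply_symm_apply, this]
  rfl

theorem isOriented_fibreFrame {b : Module.Basis (Fin r) ℝ F} (hb : pf.OrientedBy o b)
    (hx : x ∈ pf.U) : IsOriented (o x) (pf.fibreFrame b hx) := by
  refine (Orientation.map (Fin r) (pf.fibreEquiv hx)).injective ?_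
  rw [hb x hx]
  have h : (EuclideanSpace.basisFun (Fin r) ℝ).toBasis.map
      ((pf.fibreFrame b hx).trans (pf.fibreEquiv hx)) = b := by
    refine Module.Basis.eq_of_apply_eq fun i => ?_
    simpa using pf.fibreEquiv_fibreFrame b hx i
  conv_rhs => rw [← h, Module.Basis.orientation_map]
  rfl

theorem vertArgs_sec (b : Module.Basis (Fin r) ℝ F) (hx : x ∈ pf.U) {k : Fin r → Fin d}
    (hk : Function.Injective k) {y' : Fin d → FA × F} (hy' : ∀ i, y' (k i) = (0, b i)) :
    VertArgs L x (pf.fibreFrame b hx) k (fun _ j => pf.total.sec (y' j) _)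
      fun j => pf.base.sec (y' j).1 x where
  inj := hk
  vert v i := by
    refine Eq.trans ?_ (pf.total.sec_coord (fibreInclusion F x (pf.fibreFrame b hx) v) hx
      (fibreHom F L x (pf.fibreFrame b hx) v (EuclideanSpace.single i (1 : ℝ))))
    rw [hy', pf.coord_fibreHom hx, pf.fibreEquiv_fibreFrame]
  proj v j := pf.sec_fst (q := fibreInclusion F x (pf.fibreFrame b hx) v) hx _

theorem integral_translate (b : Module.Basis (Fin r) ℝ F) {N : Type*} [NormedAddCommGroup N]
    [NormedSpace ℝ N] (h : F → N) (w : F) :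
    ∫ t : Fin r → ℝ, h (w + ∑ i, t i • b i) = ∫ t : Fin r → ℝ, h (∑ i, t i • b i) := by
  rw [← integral_add_left_eq_self (fun t : Fin r → ℝ => h (∑ i, t i • b i)) (b.equivFun w)]
  refine integral_congr_ae (Eventually.of_forall fun t => congrArg h ?_)
  simp only [Pi.add_apply, add_smul, Finset.sum_add_distrib, b.sum_equivFun]

theorem add_sum_e (b : Module.Basis (Fin r) ℝ F) (p : EM × F) (t : Fin r → ℝ) :
    p + ∑ j, t j • (pf.vertCoords b).e j = (p.1, p.2 + ∑ j, t j • b j) := by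
  refine Prod.ext ?_ ?_
  · simp [vertCoords, Prod.fst_sum]
  · simp [vertCoords, Prod.snd_sum]

theorem ext_symm {p : EM × F} (hp : p ∈ pf.dom) :
    extChartAt 𝓘(ℝ, EM) x₀ ((chartAt EM x₀).symm p.1) = p.1 :=
  (chartAt EM x₀).right_inv hp.1.1

theorem intNull_ofForm {b : Module.Basis (Fin r) ℝ F} (hb : pf.OrientedBy o b)
    {τ : π^!.Form 𝕜 d} (hτ : FibNull o τ) :
    (pf.vertCoords b).IntNull id (pf.ofForm τ) := by
  intro y' hy' p hp
  choose k hk using hy'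
  have hkinj : Function.Injective k := fun i j h => b.injective (by
    have := (hk i).symm.trans ((congrArg y' h).trans (hk j))
    exact congrArg Prod.snd this)
  have hx : (chartAt EM x₀).symm p.1 ∈ pf.U := hp.1.2
  have h1 := hτ _ _ (pf.isOriented_fibreFrame hb hx) k _ _ (pf.vertArgs_sec b hx hkinj hk)
  rw [pf.integral_vertArgs hb hx (pf.isOriented_fibreFrame hb hx)
    (pf.vertArgs_sec b hx hkinj hk) hk (fun j => (pf.base.coord_sec _ hx _).symm),
    pf.ext_symm hp] at h1
  refine Eq.trans ?_ ((integral_translate b (fun w => pf.ofForm τ (p.1, w) y') p.2).trans h1)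
  refine integral_congr_ae (Eventually.of_forall fun t => ?_)
  exact congrArg (fun q => pf.ofForm τ q y') (pf.add_sum_e b p t)

/-- A form with compact support has bounded support in local coordinates. -/
theorem bddIn_ofForm (b : Module.Basis (Fin r) ℝ F) {τ : π^!.Form 𝕜 d}
    {K : Set (TotalSpace F E)} (hK : IsCompact K) (hτ : ∀ q ∉ K, τ q = 0) (i : Fin r) :
    BddIn pf.dom ((pf.vertCoords b).s i) (pf.ofForm τ) := by
  let K' : Set (TotalSpace F E) := K ∩ {q | pf.ψ q.proj = 1}
  have hc : Continuous fun q : TotalSpace F E => pf.ψ q.proj :=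
    pf.smooth.continuous.comp (FiberBundle.continuous_proj F E)
  have hK' : IsCompact K' := hK.inter_right (isClosed_eq hc continuous_const)
  have hsub : ∀ q ∈ K', q.proj ∈ patch (EM := EM) F E x₀ := fun q hq =>
    pf.tsupport_subset (subset_tsupport _ (by
      have h1 : pf.ψ q.proj = 1 := hq.2
      rw [Function.mem_support, h1]; exact one_ne_zero))
  have hcont : ContinuousOn (fun q => (pf.vertCoords b).s i (𝒯₀ q)) K' :=
    fun q hq => (((pf.vertCoords b).s i).continuous.continuousAt.comp
      (contMDiffAt_bundleChart (hsub q hq)).continuousAt).continuousWithinAt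
  obtain ⟨R, hR⟩ := hK'.exists_bound_of_continuousOn hcont
  refine ⟨R, fun z hz h => ?_⟩
  have h2 : (𝒯₀).symm z ∉ K := fun hzK => by
    have := hR _ ⟨hzK, pf.eq_one _ (pf.proj_symm_mem hz)⟩
    rw [pf.symm_right hz] at this
    exact absurd h (not_lt.2 this)
  rw [ofForm, hτ _ h2]
  rfl

theorem contDiffOn_ofForm {τ : π^!.Form 𝕜 d}
    (hτ : ∀ q : TotalSpace F E, q.proj ∈ pf.U → SmoothFormAt τ q) :
    ContDiffOn ℝ ∞ (pf.ofForm τ) pf.dom := fun z hz => by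
  have := pf.contDiffAt_ofForm (pf.proj_symm_mem hz) (hτ _ (pf.proj_symm_mem hz))
  rw [pf.symm_right hz] at this
  exact this.contDiffWithinAt

theorem locDiff_ofForm {τ : π^!.Form 𝕜 d}
    {τ' : π^!.Form 𝕜 (d + 1)}
    (hτ : ∀ q : TotalSpace F E, q.proj ∈ pf.U → SmoothFormAt τ q)
    (hd : ∀ q : TotalSpace F E, q.proj ∈ pf.U → IsDifferentialAt τ τ' q)
    {z : EM × F} (hz : z ∈ pf.dom) :
    locDiff pf.locA pf.locB (pf.ofForm τ) z = pf.ofForm τ' z := by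
  have h1 := pf.proj_symm_mem hz
  have := (pf.isDifferentialAt_iff h1 (hτ _ h1)).1 (hd _ h1)
  rw [pf.symm_right hz] at this
  exact this.symm

theorem isDifferentialAt_toForm {G : EM × F → (FA × F) [⋀^Fin d]→L[ℝ] 𝕜}
    {G' : EM × F → (FA × F) [⋀^Fin (d + 1)]→L[ℝ] 𝕜} (hG : ContDiffOn ℝ ∞ G pf.dom)
    (h : ∀ z ∈ pf.dom, locDiff pf.locA pf.locB G z = G' z) {q : TotalSpace F E}
    (hq : q.proj ∈ pf.U) : SmoothFormAt (pf.toForm G) q ∧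
      IsDifferentialAt (pf.toForm G) (pf.toForm G') q := by
  have hz := pf.map_mem_dom hq
  have hs := pf.smoothFormAt_toForm hq (hG.contDiffAt (pf.isOpen_dom.mem_nhds hz))
  refine ⟨hs, (pf.isDifferentialAt_iff hq hs).2 ?_⟩
  rw [pf.ofForm_toForm G' hz, ← h _ hz]
  have he : pf.ofForm (pf.toForm G) =ᶠ[𝓝 (𝒯₀ q)] G := by
    filter_upwards [pf.isOpen_dom.mem_nhds hz] with z hz using pf.ofForm_toForm G hz
  rw [locDiff, locDiff, he.fderiv_eq, he.self_of_nhds]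

end PatchFrame

end FibreIntegrals

theorem exists_perm_apply_eq {r : ℕ} {α : Type*} [Fintype α] [DecidableEq α] {f g : Fin r → α}
    (hf : Function.Injective f) (hg : Function.Injective g) :
    ∃ σ : Equiv.Perm α, ∀ i, σ (f i) = g i := by
  classical
  let e : {x // x ∈ range f} ≃ {x // x ∈ range g} :=
    (Equiv.ofInjective f hf).symm.trans (Equiv.ofInjective g hg)
  refine ⟨e.extendSubtype, fun i => ?_⟩
  rw [e.extendSubtype_apply_of_mem _ (mem_range_self i)]
  have : (Equiv.ofInjective f hf).symm ⟨f i, mem_range_self i⟩ = i :=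
    (Equiv.ofInjective f hf).symm_apply_eq.2 (Subtype.ext rfl)
  simp [e, this]

section FibreIntegration

/-- The form `γ` on the base is the fibre integral of `τ`: the first `r` arguments of `τ` are
the tangent vectors of the fibre over which one integrates. -/
def IsFibInt (o : ∀ x, Orientation ℝ (E x) (Fin r)) (h : k + r = d)
    (τ : π^!.Form 𝕜 d) (γ : L.toData.Form 𝕜 k) : Prop :=
  ∀ (x : M) (u : EuclideanSpace ℝ (Fin r) ≃ₗ[ℝ] E x), IsOriented (o x) u →
    ∀ (Y : ∀ v, Fin d → π^!.Fib (fibreInclusion F x u v)) (z : Fin d → A x),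
      VertArgs L x u (fun i => ⟨i, by omega⟩) Y z →
      ∫ v, τ (fibreInclusion F x u v) (Y v) = γ x fun j => z ⟨r + j, by omega⟩

theorem VertArgs.perm {u : EuclideanSpace ℝ (Fin r) ≃ₗ[ℝ] E x} {κ κ' : Fin r → Fin d}
    {Y : ∀ v, Fin d → π^!.Fib (fibreInclusion F x u v)} {y : Fin d → A x}
    (h : VertArgs L x u κ Y y) (σ : Equiv.Perm (Fin d)) (hσ : ∀ i, σ (κ' i) = κ i) :
    VertArgs L x u κ' (fun v => Y v ∘ σ) (y ∘ σ) where
  inj i j hij := h.inj (by rw [← hσ, ← hσ, hij])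
  vert v i := by
    change Y v (σ (κ' i)) = _
    rw [hσ, h.vert]
  proj v j := h.proj v (σ j)

theorem fibNull_of_isFibInt (h : k + r = d) {τ : π^!.Form 𝕜 d}
    (hτ : IsFibInt o h τ 0) : FibNull o τ := by
  intro x u hu κ Y y hY
  obtain ⟨σ, hσ⟩ := exists_perm_apply_eq (f := fun i : Fin r => (⟨i, by omega⟩ : Fin d))
    (fun i j hij => Fin.ext (Fin.mk.inj_iff.1 hij)) hY.inj
  have h1 : ∫ v, τ (fibreInclusion F x u v) (Y v ∘ σ) = 0 := hτ x u hu _ _ (hY.perm σ hσ)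
  have h2 : ∀ v, τ (fibreInclusion F x u v) (Y v ∘ σ) =
      Equiv.Perm.sign σ • τ (fibreInclusion F x u v) (Y v) := fun v =>
    AlternatingMap.map_perm _ _ _
  simp only [h2, Units.smul_def, ← Int.cast_smul_eq_zsmul ℝ] at h1
  rw [integral_smul] at h1
  rcases Int.units_eq_one_or (Equiv.Perm.sign σ) with hs | hs
  · rw [hs] at h1
    simpa using h1
  · rw [hs] at h1
    simpa using h1

/-- A compactly supported form in local coordinates is integrable over the fibres. -/
theorem integrable_vertArgs (ho : IsBundleOrientation F o) {κ : Fin r → Fin d}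
    {u : EuclideanSpace ℝ (Fin r) ≃ₗ[ℝ] E x}
    {Y : ∀ v, Fin d → π^!.Fib (fibreInclusion F x u v)} {y : Fin d → A x}
    (hY : VertArgs L x u κ Y y) {τ : π^!.Form 𝕜 d}
    (hτ : τ ∈ π^!.compactForms 𝕜 d) :
    Integrable fun v => τ (fibreInclusion F x u v) (Y v) := by
  obtain ⟨pf, b, hx, hb⟩ := exists_orientedPatch L ho x
  obtain ⟨hs, K, hK, hKτ⟩ := hτ
  classical
  let y' : Fin d → FA × F := fun j =>
    if h : ∃ i, κ i = j then (0, b h.choose) else (pf.base.coord x (y j), 0)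
  have hk : ∀ i, y' (κ i) = (0, b i) := fun i => by
    have h : ∃ i', κ i' = κ i := ⟨i, rfl⟩
    simp only [y', dif_pos h]
    rw [hY.inj h.choose_spec]
  have hy : ∀ j, (y' j).1 = pf.base.coord x (y j) := fun j => by
    by_cases h : ∃ i, κ i = j
    · obtain ⟨i, rfl⟩ := h
      have h1 := hY.proj 0 (κ i)
      rw [hY.vert] at h1
      rw [hk, ← h1]
      exact (map_zero (pf.base.coord x)).symm
    · simp only [y', dif_neg h]
  have hc := pf.contDiffOn_ofForm (τ := τ) fun q _ => isSmoothForm_iff.1 hs q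
  let p : EM × F := (extChartAt 𝓘(ℝ, EM) x x, 0)
  have hp : p ∈ pf.dom := ⟨(pf.map_mem_dom (q := (⟨x, 0⟩ : TotalSpace F E)) hx).1 |> fun h => by
    rwa [bundleChart_fst (pf.subset_patch hx)] at h, mem_univ _⟩
  have h1 := VertCoords.continuousOn_apply hc.continuousOn y'
  have h2 := (pf.vertCoords b).hasCompactSupport_vert (c := id) Function.injective_id
    (fun j => VertCoords.contract_bdd (pf.bddIn_ofForm b hK hKτ j) y') hp
  have h3 := (pf.vertCoords b).continuous_vert id h1 hp
  let T : EuclideanSpace ℝ (Fin r) ≃ₜ (Fin r → ℝ) :=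
    ((u.trans (pf.fibreEquiv hx)).trans b.equivFun).toContinuousLinearEquiv.toHomeomorph
  refine (((h3.comp T.continuous).integrable_of_hasCompactSupport
    (h2.comp_homeomorph T)).smul (b.det fun i => (u.trans (pf.fibreEquiv hx))
      (EuclideanSpace.single i 1))).congr (Eventually.of_forall fun v => ?_)
  refine Eq.trans ?_ (pf.apply_vertArgs b hx hY hk hy τ v).symm
  refine congrArg (fun w => b.det _ • pf.ofForm τ w y') ?_
  refine (pf.add_sum_e b p _).trans (Prod.ext rfl ((zero_add _).trans ?_))
  exact b.sum_equivFun _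

end FibreIntegration

section FibreIntegration

theorem PatchFrame.base_mem_dom (pf : PatchFrame L F E x₀) (hx : x ∈ pf.U) (w : F) :
    ((extChartAt 𝓘(ℝ, EM) x₀ x, w) : EM × F) ∈ pf.dom := by
  have h := (pf.map_mem_dom (q := (⟨x, 0⟩ : TotalSpace F E)) hx).1
  rw [bundleChart_fst (pf.subset_patch hx)] at h
  exact ⟨h, mem_univ _⟩

theorem PatchFrame.symm_ext (pf : PatchFrame L F E x₀) (hx : x ∈ pf.U) :
    (chartAt EM x₀).symm (extChartAt 𝓘(ℝ, EM) x₀ x) = x :=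
  (chartAt EM x₀).left_inv (pf.subset_patch hx).1

/-- A compactly supported form, integrated over the fibres in local coordinates. -/
def PatchFrame.locFibInt (pf : PatchFrame L F E x₀) (b : Module.Basis (Fin r) ℝ F)
    (τ : π^!.Form 𝕜 (k + r)) : EM × F → (FA × F) [⋀^Fin k]→L[ℝ] 𝕜 :=
  (pf.vertCoords b).iterInt id (pf.ofForm τ)

theorem PatchFrame.locFibInt_apply (pf : PatchFrame L F E x₀) (b : Module.Basis (Fin r) ℝ F)
    {τ : π^!.Form 𝕜 (k + r)}
    (hτ : τ ∈ π^!.compactForms 𝕜 (k + r)) :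
    ContDiffOn ℝ ∞ (pf.locFibInt b τ) pf.dom ∧ ∀ p ∈ pf.dom, ∀ y, pf.locFibInt b τ p y =
      ∫ t : Fin r → ℝ, pf.ofForm τ (p.1, ∑ i, t i • b i) (consArgs (fun j => (0, b j)) y) := by
  obtain ⟨hs, K, hK, hKτ⟩ := hτ
  have h := (pf.vertCoords b).iterInt_spec (k := k) (c := id) Function.injective_id
    (pf.contDiffOn_ofForm fun q _ => isSmoothForm_iff.1 hs q) fun j => pf.bddIn_ofForm b hK hKτ j
  refine ⟨h.1, fun p hp y => (h.2 p hp y).trans (Eq.trans ?_ (PatchFrame.integral_translate b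
    (fun w => pf.ofForm τ (p.1, w) (consArgs (fun j => ((0 : FA), b j)) y)) p.2))⟩
  exact integral_congr_ae (Eventually.of_forall fun t =>
    congrArg (fun q => pf.ofForm τ q _) (pf.add_sum_e b p t))

theorem PatchFrame.locFibInt_eq (pf : PatchFrame L F E x₀) {b : Module.Basis (Fin r) ℝ F}
    (hb : pf.OrientedBy o b) {τ : π^!.Form 𝕜 (k + r)}
    (hτ : τ ∈ π^!.compactForms 𝕜 (k + r)) {γ : L.toData.Form 𝕜 k}
    (h : IsFibInt o rfl τ γ) (hx : x ∈ pf.U) (w : F) (y : Fin k → FA × F) :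
    pf.locFibInt b τ (extChartAt 𝓘(ℝ, EM) x₀ x, w) y = γ x fun j => pf.base.sec (y j).1 x := by
  rw [(pf.locFibInt_apply b hτ).2 _ (pf.base_mem_dom hx w)]
  have hk : ∀ i : Fin r, consArgs (k := k) (fun j => ((0 : FA), b j)) y ⟨i, by omega⟩ = (0, b i) :=
    fun i => by simp [consArgs]
  have h1 := pf.vertArgs_sec (L := L) b hx (k := fun i : Fin r => (⟨i, by omega⟩ : Fin (k + r)))
    (fun i j hij => Fin.ext (Fin.mk.inj_iff.1 hij)) hk
  have h2 := h x _ (pf.isOriented_fibreFrame hb hx) _ _ h1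
  rw [pf.integral_vertArgs hb hx (pf.isOriented_fibreFrame hb hx) h1 hk
    (fun j => (pf.base.coord_sec _ hx _).symm)] at h2
  refine h2.trans (congrArg (γ x) (funext fun j => ?_))
  simp [consArgs]

theorem isFibInt_of_locFibInt {τ : π^!.Form 𝕜 (k + r)}
    (hτ : τ ∈ π^!.compactForms 𝕜 (k + r)) {γ : L.toData.Form 𝕜 k}
    (h : ∀ x, ∃ (pf : PatchFrame L F E x) (b : Module.Basis (Fin r) ℝ F), x ∈ pf.U ∧
      pf.OrientedBy o b ∧ ∀ y, γ x y = pf.locFibInt b τ (extChartAt 𝓘(ℝ, EM) x x, 0)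
        fun j => (pf.base.coord x (y j), 0)) : IsFibInt o rfl τ γ := by
  intro x u hu Y z hY
  obtain ⟨pf, b, hx, hb, hγ⟩ := h x
  refine Eq.trans ?_ ((hγ fun j => z ⟨r + j, by omega⟩).trans
    ((pf.locFibInt_apply b hτ).2 _ (pf.base_mem_dom hx 0) _)).symm
  refine pf.integral_vertArgs hb hx hu hY (fun i => ?_) (fun j => ?_) τ
  · simp [consArgs]
  · by_cases hj : j.1 < r
    · have h1 := hY.proj 0 ⟨j, by omega⟩
      have h2 := hY.vert 0 ⟨j, hj⟩
      simp only at h2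
      rw [h2] at h1
      rw [← h1]
      simp only [consArgs, dif_pos hj]
      exact (map_zero (pf.base.coord x)).symm
    · simp only [consArgs, dif_neg hj]
      have e : (⟨r + (j.1 - r), by omega⟩ : Fin (k + r)) = j :=
        Fin.ext (show r + (j.1 - r) = j.1 by omega)
      exact congrArg (fun l => pf.base.coord x (z l)) e

theorem exists_isFibInt (ho : IsBundleOrientation F o) (h : k + r = d)
    {τ : π^!.Form 𝕜 d} (hτ : τ ∈ π^!.compactForms 𝕜 d) :
    ∃ γ : L.toData.Form 𝕜 k, IsFibInt o h τ γ := by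
  subst h
  choose pf b hx hb using fun x => exists_orientedPatch (L := L) ho x
  refine ⟨fun x => (toAltL ((pf x).locFibInt (b x) τ (extChartAt 𝓘(ℝ, EM) x x, 0))).compLinearMap
    (LinearMap.inl ℝ FA F ∘ₗ (pf x).base.coord x), isFibInt_of_locFibInt hτ fun x =>
      ⟨pf x, b x, hx x, hb x, fun y => rfl⟩⟩

theorem IsFibInt.pullbackForm_eq {τ : π^!.Form 𝕜 (k + r)}
    (hτ : τ ∈ π^!.compactForms 𝕜 (k + r)) {γ : L.toData.Form 𝕜 k}
    (h : IsFibInt o rfl τ γ) (pf : PatchFrame L F E x₀) {b : Module.Basis (Fin r) ℝ F}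
    (hb : pf.OrientedBy o b) {q : TotalSpace F E} (hq : q.proj ∈ pf.U) :
    π^* γ q =
      pf.toForm (pf.locFibInt b τ) q := by
  ext w
  rw [pf.toForm_apply]
  have h1 : 𝒯₀ q = (extChartAt 𝓘(ℝ, EM) x₀ q.proj,
      (𝒯₀ q).2) := Prod.ext (bundleChart_fst (pf.subset_patch hq)) rfl
  rw [h1, pf.locFibInt_eq hb hτ h hq]
  refine congrArg (γ q.proj) (funext fun j => ?_)
  exact (pf.base.sec_coord _ hq _).symm

theorem IsFibInt.isSmoothForm (ho : IsBundleOrientation F o) (h : k + r = d)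
    {τ : π^!.Form 𝕜 d} (hτ : τ ∈ π^!.compactForms 𝕜 d)
    {γ : L.toData.Form 𝕜 k} (hγ : IsFibInt o h τ γ) : L.toData.IsSmoothForm γ := by
  subst h
  refine isSmoothForm_iff.2 fun x X hX => ?_
  obtain ⟨pf, b, hx, hb⟩ := exists_orientedPatch L ho x
  have h1 := (pf.locFibInt_apply b hτ).1.contDiffAt (pf.isOpen_dom.mem_nhds (pf.base_mem_dom hx 0))
  have h2 : ContMDiffAt 𝓘(ℝ, EM) 𝓘(ℝ, EM × F) ∞
      (fun y => ((extChartAt 𝓘(ℝ, EM) x y, 0) : EM × F)) x :=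
    (contMDiffAt_extChartAt' (pf.subset_patch hx).1).prodMk_space contMDiffAt_const
  refine (contMDiffAt_alt_apply (h1.contMDiffAt.comp x h2) (c := fun j y =>
    ((pf.base.coord y (X j y), 0) : FA × F)) fun j =>
      (pf.base.smooth_coord (X j) (hX j) x hx).prodMk_space contMDiffAt_const).congr_of_eventuallyEq ?_
  filter_upwards [pf.isOpen.mem_nhds hx] with y hy
  refine Eq.trans ?_ (pf.locFibInt_eq hb hτ hγ hy 0 _).symm
  exact congrArg (γ y) (funext fun j => (pf.base.sec_coord _ hy _).symm)

theorem projHom_surjective (q : TotalSpace F E) :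
    Function.Surjective (projHom (𝓘(ℝ, EM).prod 𝓘(ℝ, F)) L (π F E) q) := by
  intro X
  obtain ⟨pf, hx⟩ := exists_patchFrame (L := L) (F := F) (E := E) q.proj
  refine ⟨pf.total.sec (pf.base.coord q.proj X, 0) q, (pf.sec_fst hx _).trans ?_⟩
  exact pf.base.sec_coord _ hx X

/-- Differentials of forms on the base can be tested after pulling back to the total space. -/
theorem isDifferentialAt_of_projHom {γ : L.toData.Form 𝕜 k} {γ' : L.toData.Form 𝕜 (k + 1)}
    {q : TotalSpace F E} (hγ : SmoothFormAt γ q.proj)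
    (h : IsDifferentialAt (π^* γ)
      (π^* γ') q) :
    IsDifferentialAt γ γ' q.proj := by
  obtain ⟨fr⟩ := L.isAlgebroid.frame q.proj
  let δ : L.toData.Form 𝕜 (k + 1) := fun x => (fr.dhat γ).compLinearMap (fr.coord x)
  have h1 : IsDifferentialAt γ δ q.proj := by
    rw [fr.isDifferentialAt_iff L.isAlgebroid hγ]
    ext w
    rw [fr.repA_apply]
    exact congrArg (fr.dhat γ) (funext fun i => fr.coord_sec_self _)
  have h2 := isHomAt_projHom (IP := 𝓘(ℝ, EM).prod 𝓘(ℝ, F)) L (f := π F E) contMDiff_bundleProj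
    (p := q) fr
  have h3 := h2.isDifferentialAt (isAlgebroid_bundlePullback L F E) L.isAlgebroid hγ h1
  have h4 := h3.unique (isAlgebroid_bundlePullback L F E) h (h2.smoothFormAt hγ)
  refine h1.congr_right ?_
  ext w
  choose w' hw' using fun i => projHom_surjective (L := L) q (w i)
  have h5 := congrArg (fun c => c w') h4
  change δ q.proj (fun i => projHom (𝓘(ℝ, EM).prod 𝓘(ℝ, F)) L (π F E) q (w' i)) =
    γ' q.proj fun i => projHom (𝓘(ℝ, EM).prod 𝓘(ℝ, F)) L (π F E) q (w' i) at h5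
  simp only [hw'] at h5
  exact h5.symm

/-- Fibre integration commutes with the differential up to sign. -/
theorem IsFibInt.isDifferential (ho : IsBundleOrientation F o) (h : k + r = d)
    (h' : k + 1 + r = d + 1) {τ : π^!.Form 𝕜 d}
    {τ' : π^!.Form 𝕜 (d + 1)}
    (hτ : τ ∈ π^!.compactForms 𝕜 d)
    (hτ' : τ' ∈ π^!.compactForms 𝕜 (d + 1))
    (hd : π^!.IsDifferential τ τ') {γ : L.toData.Form 𝕜 k}
    {γ' : L.toData.Form 𝕜 (k + 1)} (hγ : IsFibInt o h τ γ) (hγ' : IsFibInt o h' τ' γ') :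
    L.toData.IsDifferential γ (((-1 : 𝕜) ^ r) • γ') := by
  subst h
  -- The degrees `k + 1 + r` and `k + r + 1` are not equal by definition; `σ` is `τ'` in the former.
  have key : ∀ (e : ℕ) (h : k + 1 + r = e) (σ : π^!.Form 𝕜 e),
      σ ∈ π^!.compactForms 𝕜 e → IsFibInt o h σ γ' →
      ∃ σ' ∈ π^!.compactForms 𝕜 (k + 1 + r), IsFibInt o rfl σ' γ' ∧
        ∀ q w, σ' q w = σ q (w ∘ Fin.cast h.symm) := by
    rintro _ rfl σ h1 h2
    exact ⟨σ, h1, h2, fun _ _ => rfl⟩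
  obtain ⟨σ, hσ, hγσ, hσe⟩ := key _ h' τ' hτ' hγ'
  refine isDifferential_iff.2 fun x => ?_
  obtain ⟨pf, b, hx, hb⟩ := exists_orientedPatch L ho x
  let q : TotalSpace F E := ⟨x, 0⟩
  have hs : ∀ p : TotalSpace F E, p.proj ∈ pf.U → SmoothFormAt τ p :=
    fun p _ => isSmoothForm_iff.1 hτ.1 p
  obtain ⟨K, hK, hKτ⟩ := hτ.2
  obtain ⟨K', hK', hKσ⟩ := hσ.2
  have h1 : ∀ z ∈ pf.dom, locDiff pf.locA pf.locB (pf.locFibInt b τ) z =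
      (-1 : ℝ) ^ r • pf.locFibInt b σ z := fun z hz => by
    have h2 := (pf.vertCoords b).iterInt_locDiff (c := id) Function.injective_id (k := k)
      (g := pf.ofForm τ) (G := pf.ofForm σ) (pf.contDiffOn_ofForm hs)
      (pf.contDiffOn_ofForm fun p _ => isSmoothForm_iff.1 hσ.1 p)
      (fun j => pf.bddIn_ofForm b hK hKτ j) (fun j => pf.bddIn_ofForm b hK' hKσ j) 1
      (fun p hp w => ?_) z hz
    · rwa [one_smul] at h2
    · rw [one_smul, pf.locDiff_ofForm hs (fun p _ => isDifferential_iff.1 hd p) hp]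
      exact hσe _ _
  -- Over the patch the local fibre integrals are `π^*γ` and `π^*γ'`.
  have h2 := (pf.isDifferentialAt_toForm (pf.locFibInt_apply b hτ).1 h1 (q := q) hx).2
  refine isDifferentialAt_of_projHom (q := q) (isSmoothForm_iff.1 (hγ.isSmoothForm ho rfl hτ) x) ?_
  refine (h2.congr ?_).congr_right ?_
  · filter_upwards [pf.isOpen_preimage.mem_nhds (x := q) hx] with p hp
    exact hγ.pullbackForm_eq hτ pf hb hp
  · ext w
    have h3 := congrArg (fun c => c w) (hγσ.pullbackForm_eq hσ pf hb (q := q) hx)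
    rw [pf.toForm_apply] at h3
    rw [pf.toForm_apply]
    refine (congrArg ((-1 : 𝕜) ^ r * ·) h3).trans ?_
    change _ = (-1 : ℝ) ^ r • (_ : 𝕜)
    rw [RCLike.real_smul_eq_coe_mul]
    simp

end FibreIntegration

/-! ### Forms with vanishing fibre integrals -/

section Primitives

theorem t2Space_totalSpace : T2Space (TotalSpace F E) := by
  refine ⟨fun p q hpq => ?_⟩
  by_cases h : p.proj = q.proj
  · let e := trivializationAt F E p.proj
    have hp : p ∈ e.source := e.mem_source.2 (mem_baseSet_trivializationAt F E p.proj)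
    have hq : q ∈ e.source := e.mem_source.2 (h ▸ mem_baseSet_trivializationAt F E p.proj)
    obtain ⟨u, v, hu, hv, hpu, hqv, huv⟩ := t2_separation (e.injOn.ne hp hq hpq)
    exact ⟨e.source ∩ e ⁻¹' u, e.source ∩ e ⁻¹' v, e.continuousOn.isOpen_inter_preimage e.open_source hu,
      e.continuousOn.isOpen_inter_preimage e.open_source hv, ⟨hp, hpu⟩, ⟨hq, hqv⟩,
      (huv.preimage e).mono inter_subset_right inter_subset_right⟩
  · exact separated_by_continuous (FiberBundle.continuous_proj F E) h

theorem dcov_comp_proj {χ : M → ℝ} (hχ : ContMDiff 𝓘(ℝ, EM) 𝓘(ℝ, ℝ) ∞ χ) (q : TotalSpace F E)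
    (z : π^!.Fib q) : dcov π^! (fun q => χ q.proj) q z =
      dirDeriv 𝓘(ℝ, EM) χ q.proj (L.anchor q.proj z.1.1) := by
  refine (dirDeriv_comp_map (h := χ) (f := π F E) (x := q)
    (hχ.mdifferentiable (by simp) _) (contMDiff_bundleProj.mdifferentiable (by simp) q) z.1.2).trans ?_
  exact congrArg (dirDeriv 𝓘(ℝ, EM) χ q.proj) z.2.symm

theorem dwedge_eq_zero {χ : M → ℝ} (hχ : ContMDiff 𝓘(ℝ, EM) 𝓘(ℝ, ℝ) ∞ χ) {q : TotalSpace F E} {c : ℝ}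
    (h : χ =ᶠ[𝓝 q.proj] fun _ => c) (β : π^!.Form 𝕜 d) :
    dwedge (fun q => χ q.proj) β q = 0 := by
  ext w
  refine (covecWedge_apply _ _ _).trans (Finset.sum_eq_zero fun l _ => ?_)
  rw [dcov_comp_proj hχ, dirDeriv_congr h, dirDeriv_const, zero_smul, smul_zero]

theorem KillsVert.dwedge {χ : M → ℝ} (hχ : ContMDiff 𝓘(ℝ, EM) 𝓘(ℝ, ℝ) ∞ χ)
    {β : π^!.Form 𝕜 d} (hβ : KillsVert r β x) :
    KillsVert r (dwedge (fun q => χ q.proj) β) x := by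
  intro u v κ z hκ hz
  refine (covecWedge_apply _ _ _).trans (Finset.sum_eq_zero fun l _ => ?_)
  by_cases hl : ∃ i, κ i = l
  · obtain ⟨i, rfl⟩ := hl
    have h1 : dcov π^! (fun q => χ q.proj) (fibreInclusion F x u v) (z (κ i)) = 0 := by
      rw [hz, dcov_comp_proj hχ]
      refine Eq.trans (congrArg _ (map_zero (L.anchor x))) ?_
      exact map_zero (mfderiv 𝓘(ℝ, EM) 𝓘(ℝ, ℝ) χ x)
    rw [h1, zero_smul, smul_zero]
  · push Not at hl
    choose m hm using fun i => Fin.exists_succAbove_eq (hl i)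
    have h1 : β (fibreInclusion F x u v) (l.removeNth z) = 0 :=
      hβ u v m _ (fun i j hij => hκ (by rw [← hm, ← hm, hij]))
        fun i => (congrArg z (hm i)).trans (hz i)
    rw [h1, smul_zero, smul_zero]

/-- The local primitive of a closed form with vanishing fibre integrals. -/
theorem PatchFrame.exists_primitive (pf : PatchFrame L F E x₀) {b : Module.Basis (Fin r) ℝ F}
    (hb : pf.OrientedBy o b) {τ : π^!.Form 𝕜 (d + 1)}
    (hτ : τ ∈ π^!.compactCocycles 𝕜 (d + 1)) (h0 : FibNull o τ) :
    ∃ β : π^!.Form 𝕜 d,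
      (∀ q : TotalSpace F E, q.proj ∈ pf.U → SmoothFormAt β q ∧ IsDifferentialAt β τ q) ∧
      (∀ i, ∃ R : ℝ, ∀ q : TotalSpace F E, q.proj ∈ pf.U →
        R < |b.coord i (𝒯₀ q).2| → β q = 0) ∧
      (∀ x ∈ pf.U, KillsVert r β x) ∧
      ∀ V : Set M, (∀ q : TotalSpace F E, q.proj ∈ V → τ q = 0) →
        ∀ q : TotalSpace F E, q.proj ∈ V → q.proj ∈ pf.U → β q = 0 := by
  obtain ⟨⟨hs, K, hK, hKτ⟩, -, hcl⟩ := hτ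
  have hs' : ∀ q : TotalSpace F E, q.proj ∈ pf.U → SmoothFormAt τ q :=
    fun q _ => isSmoothForm_iff.1 hs q
  obtain ⟨β, h1, h2, h3, h4, h5⟩ := (pf.vertCoords b).exists_primitive r d id
    Function.injective_id (pf.ofForm τ) (pf.contDiffOn_ofForm hs') (pf.bddIn_ofForm b hK hKτ)
    (fun z hz => by
      rw [pf.locDiff_ofForm hs' (fun q _ => isDifferential_iff.1 hcl q) hz]
      rfl) (pf.intNull_ofForm hb h0)
  have h0' : ∀ q : TotalSpace F E, β (𝒯₀ q) = 0 → pf.toForm β q = 0 :=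
    fun q h => by
      ext w
      rw [pf.toForm_apply, h]
      rfl
  refine ⟨pf.toForm β, fun q hq => ?_, fun i => ?_, fun x hx u v κ z hκ hz => ?_,
    fun V hV q hqV hq => ?_⟩
  · obtain ⟨h6, h7⟩ := pf.isDifferentialAt_toForm h1 h3 hq
    exact ⟨h6, h7.congr_right (pf.toForm_ofForm τ hq).symm⟩
  · obtain ⟨R, hR⟩ := h2 i
    exact ⟨R, fun q hq h => h0' q (hR _ (pf.map_mem_dom hq) h)⟩
  · rw [pf.toForm_apply]
    have h6 := apply_eq_det_smul_apply (toAltL (β (𝒯₀ (fibreInclusion F x u v)))) b hκ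
      (f := fun i => pf.fibreEquiv hx (u (EuclideanSpace.single i 1)))
      (y := fun j => pf.total.coord _ (z j))
      (y' := replaceVert κ (fun j => pf.total.coord _ (z j)) b) (fun i => by
        rw [hz]
        exact pf.coord_fibreHom hx u v _) (fun i => replaceVert_apply hκ _ _ _) fun j => by
          by_cases hj : ∃ i, κ i = j
          · obtain ⟨i, rfl⟩ := hj
            rw [replaceVert_apply hκ, hz]
            exact (congrArg Prod.fst (pf.coord_fibreHom hx u v _)).trans rfl
          · rw [replaceVert_of_notMem _ _ hj]
    exact h6.trans ((congrArg _ (h4 _ _ fun i => ⟨κ i, replaceVert_apply hκ _ _ _⟩)).trans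
      (smul_zero _))
  · refine h0' q (h5 {z | z ∈ pf.dom ∧ (chartAt EM x₀).symm z.1 ∈ V} (fun i p hp t => ?_)
      (fun p hp => ?_) _ ⟨pf.map_mem_dom hq, ?_⟩)
    · refine ⟨(pf.vertCoords b).add_mem i p hp.1 t, ?_⟩
      have : (p + t • (pf.vertCoords b).e i).1 = p.1 := by simp [vertCoords]
      rw [this]
      exact hp.2
    · rw [ofForm, hV _ (by rw [pf.proj_symm hp.1]; exact hp.2)]
      rfl
    · rw [bundleChart_fst (pf.subset_patch hq)]
      have := pf.symm_ext hq
      rwa [this]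

/-- A form on a patch with bounded support in the fibre direction, cut off by a function on the
base. -/
theorem PatchFrame.fsmul_mem_compactForms (pf : PatchFrame L F E x₀) (b : Module.Basis (Fin r) ℝ F)
    {χ : M → ℝ} (hχ : ContMDiff 𝓘(ℝ, EM) 𝓘(ℝ, ℝ) ∞ χ) (hs : tsupport χ ⊆ pf.U)
    {β : π^!.Form 𝕜 d}
    (hβ : ∀ q : TotalSpace F E, q.proj ∈ pf.U → SmoothFormAt β q)
    (hbd : ∀ i, ∃ R : ℝ, ∀ q : TotalSpace F E, q.proj ∈ pf.U →
        R < |b.coord i (bundleChart (EM := EM) F E x₀ q).2| → β q = 0) :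
    fsmul (fun q : TotalSpace F E => χ q.proj) β ∈ π^!.compactForms 𝕜 d := by
  have hπ := contMDiff_bundleProj (EM := EM) (F := F) (E := E)
  have h0 : ∀ q : TotalSpace F E, q.proj ∉ tsupport χ → ∀ᶠ p : TotalSpace F E in 𝓝 q, χ p.proj = 0 :=
    fun q hq => by
      filter_upwards [(isOpen_preimage_proj (isClosed_tsupport χ).isOpen_compl).mem_nhds
        (x := q) hq] with p hp
      exact image_eq_zero_of_notMem_tsupport hp
  refine ⟨isSmoothForm_iff.2 fun q => ?_, ?_⟩
  · by_cases hq : q.proj ∈ tsupport χ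
    · exact (hβ q (hs hq)).fsmul (hχ.comp hπ q)
    · refine smoothFormAt_zero.congr ((h0 q hq).mono fun p hp => ?_)
      change χ p.proj • β p = 0
      rw [hp, zero_smul]
  · choose R hR using hbd
    let T : F ≃L[ℝ] (Fin r → ℝ) := b.equivFun.toContinuousLinearEquiv
    let C : Set F := T ⁻¹' univ.pi fun i => Icc (-R i) (R i)
    have hC : IsCompact C := T.toHomeomorph.isCompact_preimage.2
      (isCompact_univ_pi fun i => isCompact_Icc)
    have h1 : IsCompact (extChartAt 𝓘(ℝ, EM) x₀ '' tsupport χ) :=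
      (isClosed_tsupport χ).isCompact.image_of_continuousOn fun x hx =>
        (contMDiffAt_extChartAt' (I := 𝓘(ℝ, EM)) (n := ∞)
          (pf.subset_patch (hs hx)).1).continuousAt.continuousWithinAt
    refine ⟨(bundleChart (EM := EM) F E x₀).symm '' ((extChartAt 𝓘(ℝ, EM) x₀ '' tsupport χ) ×ˢ C),
      (h1.prod hC).image_of_continuousOn ((continuousOn_extChartAt_symm
        (⟨x₀, 0⟩ : TotalSpace F E)).mono ?_), fun q hq => ?_⟩
    · rintro ⟨_, w⟩ ⟨⟨y, hy, rfl⟩, -⟩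
      exact pf.dom_subset (pf.base_mem_dom (hs hy) w)
    · change χ q.proj • β q = 0
      by_cases hχq : q.proj ∈ tsupport χ
      · by_cases hi : ∃ i, R i < |b.coord i (bundleChart (EM := EM) F E x₀ q).2|
        · obtain ⟨i, hi⟩ := hi
          rw [hR i q (hs hχq) hi, smul_zero]
        · push Not at hi
          refine absurd ⟨bundleChart (EM := EM) F E x₀ q, ⟨?_, fun i _ => abs_le.1 (hi i)⟩,
            pf.symm_left (hs hχq)⟩ hq
          rw [bundleChart_fst (pf.subset_patch (hs hχq))]
          exact mem_image_of_mem _ hχq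
      · rw [image_eq_zero_of_notMem_tsupport hχq, zero_smul]

theorem PatchFrame.isDifferential_fsmul (pf : PatchFrame L F E x₀)
    {χ : M → ℝ} (hχ : ContMDiff 𝓘(ℝ, EM) 𝓘(ℝ, ℝ) ∞ χ) (hs : tsupport χ ⊆ pf.U)
    {β : π^!.Form 𝕜 d} {β' : π^!.Form 𝕜 (d + 1)}
    (hβ : ∀ q : TotalSpace F E, q.proj ∈ pf.U → SmoothFormAt β q ∧ IsDifferentialAt β β' q) :
    π^!.IsDifferential (fsmul (fun q : TotalSpace F E => χ q.proj) β)
      (dwedge (fun q => χ q.proj) β + fsmul (fun q => χ q.proj) β') := by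
  have hπ := contMDiff_bundleProj (EM := EM) (F := F) (E := E)
  refine isDifferential_iff.2 fun q => ?_
  by_cases hq : q.proj ∈ tsupport χ
  · exact (hβ q (hs hq)).2.fsmul (isAlgebroid_bundlePullback L F E) (hβ q (hs hq)).1 (hχ.comp hπ q)
  · have h0 : ∀ᶠ p : TotalSpace F E in 𝓝 q, χ p.proj = 0 := by
      filter_upwards [(isOpen_preimage_proj (isClosed_tsupport χ).isOpen_compl).mem_nhds
        (x := q) hq] with p hp
      exact image_eq_zero_of_notMem_tsupport hp
    refine ((isDifferential_iff.1 (π^!.isDifferential_zero d) q).congr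
      (h0.mono fun p hp => ?_)).congr_right ?_
    · change χ p.proj • β p = 0
      rw [hp, zero_smul]
    · refine (congrArg₂ (· + ·) (dwedge_eq_zero hχ (c := 0)
        (notMem_tsupport_iff_eventuallyEq.1 hq) β) (?_ : χ q.proj • β' q = 0)).trans (add_zero _)
      rw [h0.self_of_nhds, zero_smul]

theorem PatchFrame.mem_compactCocycles (pf : PatchFrame L F E x₀)
    {χ : M → ℝ} (hχ : ContMDiff 𝓘(ℝ, EM) 𝓘(ℝ, ℝ) ∞ χ) (hs : tsupport χ ⊆ pf.U)
    {β : π^!.Form 𝕜 d} {β' : π^!.Form 𝕜 (d + 1)}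
    (hβ : ∀ q : TotalSpace F E, q.proj ∈ pf.U → SmoothFormAt β q ∧ IsDifferentialAt β β' q)
    (hβ' : β' ∈ π^!.cocycles 𝕜 (d + 1))
    (hσ : fsmul (fun q : TotalSpace F E => χ q.proj) β ∈ π^!.compactForms 𝕜 d) :
    dwedge (fun q => χ q.proj) β + fsmul (fun q => χ q.proj) β' ∈
      π^!.compactCocycles 𝕜 (d + 1) := by
  have hP := isAlgebroid_bundlePullback L F E
  have hT := t2Space_totalSpace (F := F) (E := E)
  have hπ : ContMDiff (𝓘(ℝ, EM).prod 𝓘(ℝ, F)) 𝓘(ℝ, ℝ) ∞ fun q : TotalSpace F E => χ q.proj :=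
    hχ.comp (contMDiff_bundleProj (EM := EM) (F := F) (E := E))
  have hs' := fun q => isSmoothForm_iff.1 hβ'.1 q
  have hout : ∀ q : TotalSpace F E, q.proj ∉ tsupport χ → ∀ᶠ p in 𝓝 q,
      (dwedge (fun q => χ q.proj) β + fsmul (fun q => χ q.proj) β') p = 0 := fun q hq => by
    filter_upwards [(isOpen_preimage_proj (isClosed_tsupport χ).isOpen_compl).mem_nhds
      (x := q) hq] with p hp
    refine (congrArg₂ (· + ·) (dwedge_eq_zero hχ (c := 0)
      (notMem_tsupport_iff_eventuallyEq.1 hp) β) (?_ : χ p.proj • β' p = 0)).trans (add_zero _)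
    rw [image_eq_zero_of_notMem_tsupport hp, zero_smul]
  have hsm : ∀ q, SmoothFormAt (dwedge (fun q : TotalSpace F E => χ q.proj) β +
      fsmul (fun q => χ q.proj) β') q := fun q => by
    by_cases hq : q.proj ∈ tsupport χ
    · exact ((hβ q (hs hq)).1.dwedge hP (hπ q)).add ((hs' q).fsmul (hπ q))
    · exact smoothFormAt_zero.congr (hout q hq)
  obtain ⟨hσs, K, hK, hKσ⟩ := hσ
  refine ⟨⟨isSmoothForm_iff.2 hsm, K, hK, fun q hq => ?_⟩, isSmoothForm_iff.2 hsm,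
    isDifferential_iff.2 fun q => ?_⟩
  · have h1 := isDifferential_iff.1 (pf.isDifferential_fsmul hχ hs hβ) q
    have h2 := (isDifferential_iff.1 (π^!.isDifferential_zero (𝕜 := 𝕜) d) q).congr
      (σ := fsmul (fun q : TotalSpace F E => χ q.proj) β) (by
        filter_upwards [hK.isClosed.isOpen_compl.mem_nhds hq] with p hp using hKσ p hp)
    exact h1.unique hP h2 (isSmoothForm_iff.1 hσs q)
  · by_cases hq : q.proj ∈ tsupport χ
    · obtain ⟨h1, h2⟩ := hβ q (hs hq)
      have h3 := (h2.dwedge hP h1 (hπ q)).add hP ((isDifferential_iff.1 hβ'.2 q).fsmul hP (hs' q)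
        (hπ q)) (h1.dwedge hP (hπ q)) ((hs' q).fsmul (hπ q))
      refine h3.congr_right ?_
      refine Eq.symm ((neg_add_cancel_left (dwedge (fun q : TotalSpace F E => χ q.proj) β' q) _).trans ?_)
      exact smul_zero (χ q.proj)
    · exact (isDifferential_iff.1 (π^!.isDifferential_zero (d + 1)) q).congr
        (hout q hq)

end Primitives

/-! ### Closed forms with vanishing fibre integrals are exact -/

section KeyLemma

/-- In degree `0` there is nothing to integrate to: closed forms with vanishing fibre integrals are zero. -/
theorem eq_zero_of_fibNull (ho : IsBundleOrientation F o)
    {τ : π^!.Form 𝕜 0}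
    (hτ : τ ∈ π^!.compactCocycles 𝕜 0) (h0 : FibNull o τ) : τ = 0 := by
  funext q
  obtain ⟨pf, b, hx, hb⟩ := exists_orientedPatch L ho q.proj
  obtain ⟨⟨hs, K, hK, hKτ⟩, -, hcl⟩ := hτ
  have hs' : ∀ q : TotalSpace F E, q.proj ∈ pf.U → SmoothFormAt τ q :=
    fun q _ => isSmoothForm_iff.1 hs q
  have h1 : pf.ofForm τ _ = 0 := (pf.vertCoords b).eq_zero_of_closed (c := id)
    (g := pf.ofForm τ) (pf.contDiffOn_ofForm hs')
    (fun j => pf.bddIn_ofForm b hK hKτ j)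
    (fun z hz => by
      rw [pf.locDiff_ofForm hs' (fun q _ => isDifferential_iff.1 hcl q) hz]
      rfl) (pf.intNull_ofForm hb h0) (pf.map_mem_dom hx)
  refine (pf.toForm_ofForm τ hx).symm.trans ?_
  ext w
  rw [pf.toForm_apply, h1]
  rfl

variable (L) in
theorem exists_cutoff (ho : IsBundleOrientation F o) (x : M) :
    ∃ (pf : PatchFrame L F E x) (b : Module.Basis (Fin r) ℝ F) (χ : M → ℝ) (V : Set M),
      pf.OrientedBy o b ∧ ContMDiff 𝓘(ℝ, EM) 𝓘(ℝ, ℝ) ∞ χ ∧ tsupport χ ⊆ pf.U ∧ IsOpen V ∧ x ∈ V ∧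
        ∀ y ∈ V, χ y = 1 := by
  obtain ⟨pf, b, hx, hb⟩ := exists_orientedPatch L ho x
  obtain ⟨χ, V, h⟩ := exists_bump (I := 𝓘(ℝ, EM)) x (pf.isOpen.mem_nhds hx)
  exact ⟨pf, b, χ, V, hb, h⟩

/-- A closed, compactly supported form with vanishing fibre integrals has a compactly supported
primitive. Such a primitive is found by killing the form successively over the elements of a finite
cover of the base; each local primitive vanishes where the form has been killed before. -/
theorem exists_primitive_of_fibNull (ho : IsBundleOrientation F o)
    {τ : π^!.Form 𝕜 (d + 1)}
    (hτ : τ ∈ π^!.compactCocycles 𝕜 (d + 1)) (h0 : FibNull o τ) :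
    ∃ β ∈ π^!.compactForms 𝕜 d,
      π^!.IsDifferential β τ ∧ ∀ x, KillsVert r β x := by
  have hP := isAlgebroid_bundlePullback L F E
  choose pf b χ V hb hχ hs hV hxV h1 using exists_cutoff L ho
  obtain ⟨t, ht⟩ := isCompact_univ.elim_nhds_subcover V fun x _ => (hV x).mem_nhds (hxV x)
  -- `β'` is the differential of `β`, and `τ - β'` is what is left after treating the patches in `s`.
  suffices h : ∀ s : Finset M, ∃ β ∈ π^!.compactForms 𝕜 d,
      (∀ x, KillsVert r β x) ∧ ∃ β', π^!.IsDifferential β β' ∧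
        τ - β' ∈ π^!.compactCocycles 𝕜 (d + 1) ∧ FibNull o (τ - β') ∧
        ∀ i ∈ s, ∀ q : TotalSpace F E, q.proj ∈ V i → (τ - β') q = 0 by
    obtain ⟨β, h2, h3, β', h4, -, -, h5⟩ := h t
    have h6 : τ = β' := funext fun q => sub_eq_zero.1 (by
      obtain ⟨i, hi, hq⟩ := mem_iUnion₂.1 (ht.2 (mem_univ q.proj))
      exact h5 i hi q hq)
    exact ⟨β, h2, h6 ▸ h4, h3⟩
  intro s
  classical
  induction s using Finset.induction_on with
  | empty =>
    refine ⟨0, Submodule.zero_mem _, fun x _ _ _ _ _ _ => rfl, 0,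
      π^!.isDifferential_zero d, ?_⟩
    rw [sub_zero]
    exact ⟨hτ, h0, by simp⟩
  | insert j s _ ih =>
    obtain ⟨β, h2, h3, β', h4, h5, h6, h7⟩ := ih
    obtain ⟨κ, h8, h9, h10, h11⟩ := (pf j).exists_primitive (hb j) h5 h6
    -- `σ = χ κ` has the differential `σ' = dχ ∧ κ + χ (τ - β')`, where `dχ ∧ κ` has vanishing fibre
    -- integrals because `κ` vanishes on tuples that contain a basis of the fibre direction.
    let σ : π^!.Form 𝕜 d := fsmul (fun q : TotalSpace F E => χ j q.proj) κ
    let σ' : π^!.Form 𝕜 (d + 1) := dwedge (fun q => χ j q.proj) κ +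
      fsmul (fun q => χ j q.proj) (τ - β')
    have hσ : σ ∈ π^!.compactForms 𝕜 d :=
      (pf j).fsmul_mem_compactForms (b j) (hχ j) (hs j) (fun q hq => (h8 q hq).1) h9
    have hdσ : π^!.IsDifferential σ σ' :=
      (pf j).isDifferential_fsmul (hχ j) (hs j) h8
    have hout : ∀ q : TotalSpace F E, q.proj ∉ tsupport (χ j) →
        dwedge (fun q => χ j q.proj) κ q = 0 := fun q hq =>
      dwedge_eq_zero (hχ j) (c := 0) (notMem_tsupport_iff_eventuallyEq.1 hq) κ
    have hσK : ∀ x, KillsVert r (dwedge (fun q : TotalSpace F E => χ j q.proj) κ) x := fun x => by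
      by_cases hx : x ∈ tsupport (χ j)
      · exact (h10 x (hs j hx)).dwedge (hχ j)
      · intro u v _ z _ _
        exact congrArg (fun c => c z) (hout (fibreInclusion F x u v) hx)
    refine ⟨β + σ, Submodule.add_mem _ h2 hσ, fun x u v κ' z hκ hz => ?_, β' + σ',
      h4.add hdσ h2.1 hσ.1, ?_⟩
    · refine (congrArg₂ (· + ·) (h3 x u v κ' z hκ hz) (?_ : σ _ z = 0)).trans (add_zero 0)
      change χ j x • κ (fibreInclusion F x u v) z = 0
      by_cases hx : x ∈ tsupport (χ j)
      · rw [h10 x (hs j hx) u v κ' z hκ hz, smul_zero]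
      · rw [image_eq_zero_of_notMem_tsupport hx, zero_smul]
    rw [← sub_sub]
    refine ⟨Submodule.sub_mem _ h5 ((pf j).mem_compactCocycles (hχ j) (hs j) h8 h5.2 hσ),
      fun x u hu κ' Y y hY => ?_, fun i hi q hq => ?_⟩
    · refine Eq.trans ?_ ((congrArg ((1 - χ j x) • ·) (h6 x u hu κ' Y y hY)).trans (smul_zero _))
      rw [← integral_smul]
      refine integral_congr_ae (Eventually.of_forall fun v => ?_)
      change (τ - β') _ (Y v) - (dwedge (fun q : TotalSpace F E => χ j q.proj) κ _ (Y v) +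
        χ j x • (τ - β') _ (Y v)) = (1 - χ j x) • (τ - β') _ (Y v)
      rw [hσK x u v κ' _ hY.inj (hY.vert v), zero_add, sub_smul, one_smul]
    · change (τ - β') q - (dwedge (fun q : TotalSpace F E => χ j q.proj) κ q +
        χ j q.proj • (τ - β') q) = 0
      -- Over `V j` the cut-off function is `1`; over `V i` with `i ∈ s` both `τ - β'` and `κ` vanish.
      rcases Finset.mem_insert.1 hi with rfl | hi
      · rw [dwedge_eq_zero (hχ i) (c := 1), h1 i _ hq, one_smul, zero_add, sub_self]
        filter_upwards [(hV i).mem_nhds hq] with y hy using h1 i y hy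
      · rw [h7 i hi q hq, smul_zero, add_zero, zero_sub, neg_eq_zero]
        by_cases hx : q.proj ∈ tsupport (χ j)
        · change covecWedge _ (κ q) = 0
          rw [h11 (V i) (h7 i hi) q hq (hs j hx)]
          exact map_zero (covecWedgeL _)
        · exact hout q hx

end KeyLemma

/-! ### Thom forms -/

section ThomForm

theorem IsFibInt.sub (ho : IsBundleOrientation F o) (h : k + r = d)
    {τ σ : π^!.Form 𝕜 d} (hτ : τ ∈ π^!.compactForms 𝕜 d)
    (hσ : σ ∈ π^!.compactForms 𝕜 d) {γ δ : L.toData.Form 𝕜 k}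
    (h1 : IsFibInt o h τ γ) (h2 : IsFibInt o h σ δ) : IsFibInt o h (τ - σ) (γ - δ) :=
  fun x u hu Y z hY => (integral_sub (integrable_vertArgs ho hY hτ)
    (integrable_vertArgs ho hY hσ)).trans (congrArg₂ (· - ·) (h1 x u hu Y z hY) (h2 x u hu Y z hY))

variable (𝕜 L) in
/-- The constant function `1` as a form of degree `0`. -/
def oneForm : L.toData.Form 𝕜 0 := fun _ => AlternatingMap.constOfIsEmpty ℝ _ (Fin 0) 1

theorem isDifferential_oneForm : L.toData.IsDifferential (oneForm 𝕜 L) 0 := fun X _ x => by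
  symm
  refine (add_zero _).trans (Finset.sum_eq_zero fun i _ => ?_)
  exact (congrArg _ (dirDeriv_const (1 : 𝕜) x _)).trans (mul_zero _)

/-- The form on a patch that is given by a bump function in the fibre directions. -/
def PatchFrame.thomBump (𝕜 : Type*) [RCLike 𝕜] (pf : PatchFrame L F E x₀)
    (b : Module.Basis (Fin r) ℝ F) : π^!.Form 𝕜 r :=
  pf.toForm ((pf.vertCoords b).bumpForm (1 : 𝕜) id)

theorem PatchFrame.isDifferentialAt_thomBump (pf : PatchFrame L F E x₀)
    (b : Module.Basis (Fin r) ℝ F) {q : TotalSpace F E} (hq : q.proj ∈ pf.U) :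
    SmoothFormAt (pf.thomBump 𝕜 b) q ∧ IsDifferentialAt (pf.thomBump 𝕜 b) 0 q :=
  (pf.isDifferentialAt_toForm ((pf.vertCoords b).contDiffOn_bumpForm (1 : 𝕜) id) (G' := 0)
    (fun _ hz => (pf.vertCoords b).locDiff_bumpForm _ _ hz) hq).imp_right fun h =>
      h.congr_right rfl

theorem PatchFrame.integral_thomBump (pf : PatchFrame L F E x₀) {b : Module.Basis (Fin r) ℝ F}
    (hb : pf.OrientedBy o b) (hx : x ∈ pf.U) {u : EuclideanSpace ℝ (Fin r) ≃ₗ[ℝ] E x}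
    (hu : IsOriented (o x) u)
    {Y : ∀ v, Fin r → π^!.Fib (fibreInclusion F x u v)} {z : Fin r → A x}
    (hY : VertArgs L x u (fun i => i) Y z) :
    ∫ v, pf.thomBump 𝕜 b (fibreInclusion F x u v) (Y v) = 1 := by
  refine (pf.integral_vertArgs hb hx hu hY (y' := fun i => (0, b i)) (fun i => rfl) (fun j => ?_)
    (τ := pf.thomBump 𝕜 b)).trans (Eq.trans ?_ ((pf.vertCoords b).integral_bumpForm (1 : 𝕜)
      Function.injective_id (extChartAt 𝓘(ℝ, EM) x₀ x, 0)))
  · have h1 := hY.proj 0 j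
    rw [hY.vert] at h1
    rw [← h1]
    exact (map_zero (pf.base.coord x)).symm
  · refine integral_congr_ae (Eventually.of_forall fun t => ?_)
    refine (congrArg (fun c : (FA × F) [⋀^Fin r]→L[ℝ] 𝕜 => c fun i => (0, b i))
      (pf.ofForm_toForm _ (pf.base_mem_dom hx _))).trans ?_
    refine congrArg (fun p => (pf.vertCoords b).bumpForm (1 : 𝕜) id p _) ?_
    exact ((pf.add_sum_e b (extChartAt 𝓘(ℝ, EM) x₀ x, 0) t).trans
      (congrArg (Prod.mk _) (zero_add _))).symm

variable (𝕜 L) in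
/-- There is a closed, compactly supported form all of whose integrals over the fibres are `1`. Local
bump forms are glued by a partition of unity; the differential of the result has vanishing fibre
integrals, hence has a primitive that does not contribute to the integrals over the fibres. -/
theorem exists_thomForm (ho : IsBundleOrientation F o) :
    ∃ τ ∈ π^!.compactCocycles 𝕜 r, IsFibInt o (zero_add r) τ (oneForm 𝕜 L) := by
  have hP := isAlgebroid_bundlePullback L F E
  choose pf b hx hb using fun x => exists_orientedPatch (L := L) ho x
  obtain ⟨t, ht⟩ := isCompact_univ.elim_nhds_subcover (fun x : M => (pf x).U)
    fun x _ => (pf x).isOpen.mem_nhds (hx x)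
  obtain ⟨f, hf⟩ := SmoothPartitionOfUnity.exists_isSubordinate 𝓘(ℝ, EM) (isClosed_univ (X := M))
    (fun i : t => (pf i).U) (fun i => (pf i).isOpen) fun x _ => by
      obtain ⟨i, hi, h⟩ := mem_iUnion₂.1 (ht.2 (mem_univ x))
      exact mem_iUnion.2 ⟨⟨i, hi⟩, h⟩
  have hsum : ∀ x, ∑ i, f i x = 1 := fun x => by
    rw [← finsum_eq_sum_of_fintype]
    exact f.sum_eq_one (mem_univ x)
  let σ : t → π^!.Form 𝕜 r := fun i =>
    fsmul (fun q : TotalSpace F E => f i q.proj) ((pf i).thomBump 𝕜 (b i))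
  let σ' : t → π^!.Form 𝕜 (r + 1) := fun i =>
    dwedge (fun q : TotalSpace F E => f i q.proj) ((pf i).thomBump 𝕜 (b i)) +
      fsmul (fun q : TotalSpace F E => f i q.proj) 0
  have hσ : ∀ i, σ i ∈ π^!.compactForms 𝕜 r := fun i =>
    (pf i).fsmul_mem_compactForms (b i) (f i).contMDiff (hf i)
      (fun q hq => ((pf i).isDifferentialAt_thomBump (b i) hq).1) fun j => by
        obtain ⟨R, hR⟩ := ((pf i).vertCoords (b i)).bddIn_bumpForm (1 : 𝕜) id j
        refine ⟨R, fun q hq h => ?_⟩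
        ext w
        rw [PatchFrame.thomBump, (pf i).toForm_apply, hR _ ((pf i).map_mem_dom hq) h]
        rfl
  have hσ' : ∀ i, σ' i ∈ π^!.compactCocycles 𝕜 (r + 1) := fun i =>
    (pf i).mem_compactCocycles (f i).contMDiff (hf i)
      (fun q hq => (pf i).isDifferentialAt_thomBump (b i) hq) (Submodule.zero_mem _) (hσ i)
  have hd : π^!.IsDifferential (∑ i, σ i) (∑ i, σ' i) :=
    isDifferential_iff.2 fun q => IsDifferentialAt.sum hP
      (fun i _ => isDifferential_iff.1 ((pf i).isDifferential_fsmul (f i).contMDiff (hf i)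
        fun q hq => (pf i).isDifferentialAt_thomBump (b i) hq) q)
      fun i _ => isSmoothForm_iff.1 (hσ i).1 q
  have hs := Submodule.sum_mem _ fun i (_ : i ∈ Finset.univ) => hσ i
  have hs' := Submodule.sum_mem _ fun i (_ : i ∈ Finset.univ) => hσ' i
  have h1 : IsFibInt o (zero_add r) (∑ i, σ i) (oneForm 𝕜 L) := fun x u hu Y z hY => by
    have h2 : ∀ v, (∑ i, σ i) (fibreInclusion F x u v) (Y v) =
        ∑ i, σ i (fibreInclusion F x u v) (Y v) := fun v =>
      map_sum (AddMonoidHom.mk' (fun τ : π^!.Form 𝕜 r =>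
        τ (fibreInclusion F x u v) (Y v)) fun _ _ => rfl) σ Finset.univ
    refine (integral_congr_ae (Eventually.of_forall h2)).trans ?_
    rw [integral_finsetSum _ fun i _ => integrable_vertArgs ho hY (hσ i)]
    refine Eq.trans (Finset.sum_congr rfl fun i _ => ?_) (?_ : ∑ i, ((f i x : ℝ) • (1 : 𝕜)) = 1)
    · refine (integral_smul (f i x) fun v =>
        (pf i).thomBump 𝕜 (b i) (fibreInclusion F x u v) (Y v)).trans ?_
      by_cases h : x ∈ (pf i).U
      · rw [(pf i).integral_thomBump (hb i) h hu hY]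
      · rw [image_eq_zero_of_notMem_tsupport fun h' => h (hf i h'), zero_smul, zero_smul]
    · rw [← Finset.sum_smul, hsum, one_smul]
  -- The fibre integral of the differential is, up to sign, the differential of the function `1`.
  obtain ⟨γ, hγ⟩ := exists_isFibInt ho (show 0 + 1 + r = r + 1 by omega) hs'.1
  have h2 : γ = 0 := by
    have h3 := IsFibInt.isDifferential ho (zero_add r) _ hs hs'.1 hd h1 hγ
    funext x
    have h4 := (isDifferential_iff.1 h3 x).unique L.isAlgebroid
      (isDifferential_iff.1 isDifferential_oneForm x)
      (isSmoothForm_iff.1 (h1.isSmoothForm ho _ hs) x)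
    have h5 : ((-1 : 𝕜) ^ r) • γ x = 0 := h4
    exact (smul_eq_zero.1 h5).resolve_left (pow_ne_zero _ (neg_ne_zero.2 one_ne_zero))
  subst h2
  obtain ⟨β, hβ, hdβ, hk⟩ := exists_primitive_of_fibNull ho hs' (fibNull_of_isFibInt _ hγ)
  refine ⟨∑ i, σ i - β, ⟨Submodule.sub_mem _ hs hβ, (Submodule.sub_mem _ hs hβ).1,
    isDifferential_iff.2 fun q => ?_⟩, fun x u hu Y z hY => ?_⟩
  · have h3 := (isDifferential_iff.1 hd q).sub hP (isDifferential_iff.1 hdβ q)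
      (isSmoothForm_iff.1 hs.1 q) (isSmoothForm_iff.1 hβ.1 q)
    rwa [sub_self] at h3
  · refine Eq.trans (integral_congr_ae (Eventually.of_forall fun v => ?_)) (h1 x u hu Y z hY)
    refine (congrArg (fun c => (∑ i, σ i) _ (Y v) - c) (hk x u v _ (Y v) hY.inj (hY.vert v))).trans
      (sub_zero _)

end ThomForm

/-! ### Thom forms and the fibre integral of `π^*α ∧ τ` -/

section WedgeThom

/-- If `a` vanishes as soon as one of its arguments is one of the last arguments, only the trivial
shuffle contributes to `a ∧ b`. -/
theorem wedgeL_apply_of_eq_zero {V : Type*} [AddCommGroup V] [Module ℝ V] {k l : ℕ}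
    (a : V [⋀^Fin k]→ₗ[ℝ] 𝕜) (b : V [⋀^Fin l]→ₗ[ℝ] 𝕜) (w : Fin (k + l) → V)
    (h : ∀ (y : Fin k → V) (i : Fin k) (j : Fin l), y i = w (Fin.natAdd k j) → a y = 0) :
    wedgeL a b w = a (fun i => w (Fin.castAdd l i)) * b fun j => w (Fin.natAdd k j) := by
  let w' : Fin k ⊕ Fin l → V := fun i => w (finSumFinEquiv i)
  have h1 := congrArg (fun m => LinearMap.mul' ℝ 𝕜 (m w')) (AlternatingMap.domCoprod_coe a b)
  refine Eq.trans h1 ?_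
  simp only [sum_apply, map_sum]
  refine (Finset.sum_eq_single (Quotient.mk'' 1 : Equiv.Perm.ModSumCongr (Fin k) (Fin l))
    ?_ ?_).trans ?_
  · intro s _ hs
    induction s using Quotient.inductionOn' with | _ σ
    have h2 : ∃ i : Fin k, ∃ j : Fin l, σ (Sum.inl i) = Sum.inr j := by
      by_contra! hc
      refine hs (Quotient.sound' (QuotientGroup.leftRel_apply.2 ?_))
      rw [mul_one]
      refine inv_mem (Equiv.Perm.mem_sumCongrHom_range_of_perm_mapsTo_inl ?_)
      rintro _ ⟨i, rfl⟩
      rcases hσ : σ (Sum.inl i) with j | j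
      · exact ⟨j, rfl⟩
      · exact (hc i j hσ).elim
    obtain ⟨i, j, hij⟩ := h2
    rw [AlternatingMap.domCoprod.summand_mk'', smul_apply,
      MultilinearMap.domDomCongr_apply, MultilinearMap.domCoprod_apply]
    have h3 : a (fun i => w' (σ (Sum.inl i))) = 0 := h _ i j (by rw [hij]; simp [w'])
    refine (congrArg (LinearMap.mul' ℝ 𝕜) (congrArg (Equiv.Perm.sign σ • ·)
      (congrArg (TensorProduct.tmul ℝ · _) h3))).trans ?_
    rw [TensorProduct.zero_tmul, smul_zero, map_zero]
  · exact fun h => (h (Finset.mem_univ _)).elim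
  · rw [AlternatingMap.domCoprod.summand_mk'']
    simp [w', MultilinearMap.domCoprod_apply, LinearMap.mul'_apply]

variable (𝕜) in
/-- The sign of the permutation that exchanges blocks of `k` and `r` arguments. -/
def fibSign (k r : ℕ) : 𝕜 := ((Equiv.Perm.sign (moveArgs k r) : ℤ) : 𝕜)

theorem fibSign_mul_self (k r : ℕ) : fibSign 𝕜 k r * fibSign 𝕜 k r = 1 := by
  unfold fibSign
  rcases Int.units_eq_one_or (Equiv.Perm.sign (moveArgs k r)) with h | h <;> simp [h]

/-- The fibre integral of `π^*α ∧ τ` is `±α` if `τ` has fibre integral `1`. -/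
theorem isFibInt_wedge {τ : π^!.Form 𝕜 r}
    (hτ : IsFibInt o (zero_add r) τ (oneForm 𝕜 L)) (α : L.toData.Form 𝕜 k) :
    IsFibInt o rfl (AlgebroidData.wedge
      (π^* α) τ) (fibSign 𝕜 k r • α) := by
  intro x u hu Y z hY
  let Y' : ∀ v, Fin r → π^!.Fib (fibreInclusion F x u v) :=
    fun v i => Y v ⟨i, by omega⟩
  have h1 : ∀ j : Fin k, moveArgs k r (Fin.castAdd r j) = ⟨r + j, by omega⟩ := fun j => by
    ext
    simp [moveArgs, Nat.add_comm]
  have h2 : ∀ i : Fin r, moveArgs k r (Fin.natAdd k i) = ⟨i, by omega⟩ := fun i => by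
    ext
    simp [moveArgs]
  have h0 : ∀ (v : EuclideanSpace ℝ (Fin r)) (i : Fin r), z ⟨i, by omega⟩ = 0 := fun v i =>
    (hY.proj v _).symm.trans (congrArg (fun s => s.1.1) (hY.vert v i))
  -- In `Y v` the vectors tangent to the fibre come first. After exchanging the two blocks they are the
  -- arguments of `τ`; no other shuffle contributes, as `π^*α` vanishes on them.
  have h3 : ∀ v, AlgebroidData.wedge
      (π^* α) τ (fibreInclusion F x u v) (Y v)
      = (fibSign 𝕜 k r * α x fun j => z ⟨r + j, by omega⟩) * τ (fibreInclusion F x u v) (Y' v) := by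
    intro v
    have h4 := (AlgebroidData.wedge (π^* α) τ (fibreInclusion F x u v)).map_perm (Y v)
        (moveArgs k r)
    have h5 := wedgeL_apply_of_eq_zero (π^* α
      (fibreInclusion F x u v)) (τ (fibreInclusion F x u v)) (Y v ∘ moveArgs k r)
      (fun y i j hij => (α x).map_coord_zero i ?_)
    · rw [Units.smul_def, ← Int.cast_smul_eq_zsmul 𝕜] at h4
      have h6 : AlgebroidData.wedge (π^* α) τ (fibreInclusion F x u v)
          (Y v ∘ moveArgs k r) = (α x fun j => z ⟨r + j, by omega⟩) *
            τ (fibreInclusion F x u v) (Y' v) := by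
        refine h5.trans (congrArg₂ (· * ·) (congrArg (α x) (funext fun j => ?_))
          (congrArg (τ _) (funext fun i => congrArg (Y v) (h2 i))))
        exact (congrArg (fun i => (Y v i).1.1) (h1 j)).trans (hY.proj v _)
      have h7 := h4.symm.trans h6
      rw [mul_assoc, ← h7, smul_eq_mul]
      exact ((mul_assoc _ _ _).symm.trans ((congrArg (· * _) (fibSign_mul_self k r)).trans
        (one_mul _))).symm
    · refine (congrArg (fun s => s.1.1) hij).trans ?_
      exact (congrArg (fun i => (Y v i).1.1) (h2 j)).trans ((hY.proj v _).trans (h0 v j))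
  refine (integral_congr_ae (Eventually.of_forall h3)).trans ?_
  rw [integral_const_mul]
  refine (congrArg _ (hτ x u hu Y' (fun i => z ⟨i, by omega⟩)
    ⟨fun i j hij => hij, fun v i => hY.vert v i, fun v i => hY.proj v _⟩)).trans (mul_one _)

/-- A closed, compactly supported form with vanishing fibre integrals is exact. -/
theorem mem_coboundaries_of_fibNull (ho : IsBundleOrientation F o)
    {τ : π^!.Form 𝕜 d} (hτ : τ ∈ π^!.compactCocycles 𝕜 d)
    (h0 : FibNull o τ) : τ ∈ π^!.coboundaries 𝕜
      (π^!.compactForms 𝕜) π^!.compactForms_le d := by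
  cases d with
  | zero => exact eq_zero_of_fibNull ho hτ h0
  | succ d =>
    obtain ⟨β, hβ, hd, -⟩ := exists_primitive_of_fibNull ho hτ h0
    exact ⟨β, hβ, hd⟩

end WedgeThom

/-! ### Thom classes -/

section ThomClass

theorem isProperHom_anchorHom : IsProperHom 𝕜 (anchorHom (𝓘(ℝ, EM).prod 𝓘(ℝ, F)) L (π F E)) :=
  .of_isHomAt (isAlgebroid_bundlePullback L F E) isAlgebroid_totalSpace
    (exists_tangentFrame_isHomAt_anchor (isAlgebroid_bundlePullback L F E)
      hasChartBumps_totalSpace) fun _ hK => hK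

theorem isProperHom_tangentLift : IsProperHom 𝕜 (tangentLift (EM := EM) (M := M) F E) :=
  .of_isHomAt isAlgebroid_totalSpace (isAlgebroid_bundlePullback (tangentLieAlgebroid EM M) F E)
    exists_frame_isHomAt_tangentLift fun _ hK => hK

theorem isCompact_preimage_fibreInclusion (u : EuclideanSpace ℝ (Fin r) ≃ₗ[ℝ] E x)
    (hu : Continuous (fibreInclusion F x u)) {K : Set (TotalSpace F E)} (hK : IsCompact K) : IsCompact (fibreInclusion F x u ⁻¹' K) := by
  have : T2Space (TotalSpace F E) := t2Space_totalSpace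
  let e := trivializationAt F E x
  let w : EuclideanSpace ℝ (Fin r) ≃ₗ[ℝ] F :=
    u.trans (e.linearEquivAt ℝ x (mem_baseSet_trivializationAt F E x))
  have h1 : IsCompact (K ∩ π F E ⁻¹' {x}) :=
    hK.inter_right (isClosed_singleton.preimage (FiberBundle.continuous_proj F E))
  have h2 : IsCompact ((fun q => w.symm (e q).2) '' (K ∩ π F E ⁻¹' {x})) := by
    refine h1.image_of_continuousOn (w.symm.toLinearMap.continuous_of_finiteDimensional.comp_continuousOn
      (continuous_snd.comp_continuousOn (e.continuousOn.mono ?_)))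
    rintro q ⟨-, rfl⟩
    exact e.mem_source.2 (mem_baseSet_trivializationAt F E q.proj)
  refine h2.of_isClosed_subset (hK.isClosed.preimage hu) fun v hv =>
    ⟨fibreInclusion F x u v, ⟨hv, rfl⟩, ?_⟩
  exact w.symm_apply_apply v

theorem isProperHom_fibreHom (x : M) (u : EuclideanSpace ℝ (Fin r) ≃ₗ[ℝ] E x) :
    IsProperHom 𝕜 (fibreHom F L x u) := by
  obtain ⟨pf, hx⟩ := exists_patchFrame (L := L) (F := F) (E := E) x
  exact .of_isHomAt (isAlgebroid_euclidean r) (isAlgebroid_bundlePullback L F E)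
    (fun v => ⟨_, isHomAt_fibreHom L x u pf v hx⟩)
    fun _ hK => isCompact_preimage_fibreInclusion u
      (contMDiff_fibreInclusion (EM := EM) x u).continuous hK

theorem isCompact_preimage_lift {M' : Type*} [TopologicalSpace M'] [CompactSpace M']
    {f : M' → M} (hf : Continuous f) {K : Set (TotalSpace F E)} (hK : IsCompact K) :
    IsCompact ((Pullback.lift f : TotalSpace F (f *ᵖ E) → TotalSpace F E) ⁻¹' K) := by
  have h1 : IsCompact ((univ ×ˢ K) ∩ {p : M' × TotalSpace F E | f p.1 = p.2.proj}) :=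
    (isCompact_univ.prod hK).inter_right (isClosed_eq (hf.comp continuous_fst)
      ((FiberBundle.continuous_proj F E).comp continuous_snd))
  have h2 := (inducing_pullbackTotalSpaceEmbedding F E f).isCompact_preimage' h1 ?_
  · refine (congrArg IsCompact (Set.ext fun z => ?_)).mp h2
    exact ⟨fun h => h.1.2, fun h => ⟨⟨mem_univ _, h⟩, rfl⟩⟩
  · rintro ⟨y, ⟨z, v⟩⟩ ⟨-, h⟩
    obtain rfl : f y = z := h
    exact ⟨⟨y, v⟩, rfl⟩

variable (o) in
/-- A Thom form on the pull-back algebroid: a closed, compactly supported form whose integrals over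
the oriented fibres are `1`. -/
def IsThomForm (τ : π^!.Form 𝕜 r) : Prop :=
  τ ∈ π^!.compactCocycles 𝕜 r ∧ IsFibInt o (zero_add r) τ (oneForm 𝕜 L)

/-- A closed, compactly supported form is a Thom form if and only if its restrictions to the fibres
represent the canonical generator. -/
theorem isThomForm_iff {τ : π^!.Form 𝕜 r}
    (hτ : τ ∈ π^!.compactCocycles 𝕜 r) :
    IsThomForm o τ ↔ ∀ (x : M) (u : EuclideanSpace ℝ (Fin r) ≃ₗ[ℝ] E x), IsOriented (o x) u →
      ∃ g : (euclideanTangent r).CompactCohomology 𝕜 r, IsCanonicalGenerator g ∧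
        (euclideanTangent r).Represents (pullbackForm (fibreHom F L x u) τ) g := by
  refine ⟨fun h x u hu => ?_, fun h => ⟨hτ, fun x u hu Y z hY => ?_⟩⟩
  · have h1 := AlgebroidData.represents_mk ((isProperHom_fibreHom (L := L) x u).compactCocycles hτ)
    refine ⟨_, ⟨_, h1, ?_⟩, h1⟩
    exact h.2 x u hu (fun v i => fibreHom F L x u v (EuclideanSpace.single i (1 : ℝ))) 0
      ⟨fun i j hij => hij, fun v i => rfl, fun v j => rfl⟩
  · obtain ⟨g, ⟨η, hη, h1⟩, hg⟩ := h x u hu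
    obtain ⟨h2, h3⟩ := hη.represents_iff.1 hg
    have h4 := integral_eq_zero_of_mem_coboundaries (μ := volume) h3
      fun i => (EuclideanSpace.single i 1 : EuclideanSpace ℝ (Fin r))
    have h5 := (integral_sub (integrable_apply_const (μ := volume) h2.1 _)
      (integrable_apply_const (μ := volume) hη.1.1 _)).symm.trans h4
    refine Eq.trans (integral_congr_ae (Eventually.of_forall fun v => ?_))
      ((sub_eq_zero.1 h5).trans h1)
    exact congrArg (τ (fibreInclusion F x u v)) (funext fun i => hY.vert v i)

/-- Closed, compactly supported forms with the same fibre integral are cohomologous. -/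
theorem sub_mem_compactCoboundaries (ho : IsBundleOrientation F o) (h : k + r = d)
    {τ σ : π^!.Form 𝕜 d} (hτ : τ ∈ π^!.compactCocycles 𝕜 d)
    (hσ : σ ∈ π^!.compactCocycles 𝕜 d) {γ : L.toData.Form 𝕜 k}
    (h1 : IsFibInt o h τ γ) (h2 : IsFibInt o h σ γ) :
    τ - σ ∈ π^!.compactCoboundaries 𝕜 d := by
  refine mem_coboundaries_of_fibNull ho (Submodule.sub_mem _ hτ hσ) (fibNull_of_isFibInt h ?_)
  have h := IsFibInt.sub ho h hτ.1 hσ.1 h1 h2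
  rwa [sub_self] at h

theorem isThomForm_iff_isPullbackClass {τ : π^!.Form 𝕜 r}
    {c : π^!.CompactCohomology 𝕜 r} (hτ : π^!.Represents τ c) :
    IsThomForm o τ ↔ ∀ (x : M) (u : EuclideanSpace ℝ (Fin r) ≃ₗ[ℝ] E x), IsOriented (o x) u →
      ∃ g : (euclideanTangent r).CompactCohomology 𝕜 r, IsCanonicalGenerator g ∧
        IsPullbackClass (fibreHom F L x u) c g := by
  rw [isThomForm_iff hτ.1]
  refine forall_congr' fun x => forall_congr' fun u => forall_congr' fun _ => exists_congr fun g => ?_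
  rw [(isProperHom_fibreHom (L := L) x u).isPullbackClass_iff hτ]

/-- A class on the total space is a Thom class if and only if its pull-back along the anchor is
represented by Thom forms. -/
theorem isThomClass_iff {τ : (tangentAlgebroid (𝓘(ℝ, EM).prod 𝓘(ℝ, F)) (TotalSpace F E)).Form 𝕜 r}
    {c : (tangentAlgebroid (𝓘(ℝ, EM).prod 𝓘(ℝ, F)) (TotalSpace F E)).CompactCohomology 𝕜 r}
    (hτ : (tangentAlgebroid (𝓘(ℝ, EM).prod 𝓘(ℝ, F)) (TotalSpace F E)).Represents τ c) :
    IsThomClass 𝓘(ℝ, EM) F o c ↔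
      IsThomForm o (pullbackForm (anchorHom (𝓘(ℝ, EM).prod 𝓘(ℝ, F)) L (π F E)) τ) := by
  rw [isThomForm_iff ((isProperHom_anchorHom (L := L)).compactCocycles hτ.1)]
  refine forall_congr' fun x => forall_congr' fun u => forall_congr' fun _ => exists_congr fun g => ?_
  have h : IsProperHom 𝕜 (tangentMapHom (I₁ := 𝓘(ℝ, EuclideanSpace ℝ (Fin r)))
      (I₂ := 𝓘(ℝ, EM).prod 𝓘(ℝ, F)) (fibreInclusion F x u)) :=
    { compactForms := fun hσ => (isProperHom_fibreHom (L := L) x u).compactForms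
        ((isProperHom_anchorHom (L := L)).compactForms hσ)
      isDifferential := fun hσ hd => (isProperHom_fibreHom (L := L) x u).isDifferential
        ((isProperHom_anchorHom (L := L)).compactForms hσ)
          ((isProperHom_anchorHom (L := L)).isDifferential hσ hd) }
  rw [h.isPullbackClass_iff hτ]
  rfl

theorem isThomClass_thomClass (ho : IsBundleOrientation F o) :
    IsThomClass 𝓘(ℝ, EM) F o (thomClass 𝕜 𝓘(ℝ, EM) F o) := by
  obtain ⟨τ, h1, h2⟩ := exists_thomForm 𝕜 (tangentLieAlgebroid EM M) ho
  refine Classical.epsilon_spec ⟨_, (isThomClass_iff (L := tangentLieAlgebroid EM M)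
    (AlgebroidData.represents_mk (isProperHom_tangentLift.compactCocycles h1))).2 ?_⟩
  have h3 : pullbackForm (anchorHom (𝓘(ℝ, EM).prod 𝓘(ℝ, F)) (tangentLieAlgebroid EM M) (π F E))
      (pullbackForm (tangentLift F E) τ) = τ := by
    funext q
    ext w
    refine congrArg (τ q) (funext fun i => Subtype.ext (Prod.ext ?_ rfl))
    exact (w i).2.symm
  rw [h3]
  exact ⟨h1, h2⟩

theorem IsThomClass.unique (ho : IsBundleOrientation F o)
    {c c' : (tangentAlgebroid (𝓘(ℝ, EM).prod 𝓘(ℝ, F)) (TotalSpace F E)).CompactCohomology 𝕜 r}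
    (h : IsThomClass 𝓘(ℝ, EM) F o c) (h' : IsThomClass 𝓘(ℝ, EM) F o c') : c = c' := by
  obtain ⟨τ, hτ⟩ := AlgebroidData.exists_represents c
  obtain ⟨σ, hσ⟩ := AlgebroidData.exists_represents c'
  have h1 := (isThomClass_iff (L := tangentLieAlgebroid EM M) hτ).1 h
  have h2 := (isThomClass_iff (L := tangentLieAlgebroid EM M) hσ).1 h'
  exact hτ.unique (hσ.represents_iff.2 ⟨hτ.1, isProperHom_tangentLift.compactCoboundaries
    (sub_mem_compactCoboundaries ho (zero_add r) h1.1 h2.1 h1.2 h2.2)⟩)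

theorem isPullbackClass_thomClass :
    IsPullbackClass (anchorHom (𝓘(ℝ, EM).prod 𝓘(ℝ, F)) L (π F E))
      (thomClass 𝕜 𝓘(ℝ, EM) F o) (L.thomClass 𝕜 F o) :=
  Classical.epsilon_spec (isProperHom_anchorHom.exists_isPullbackClass _)

/-- The representatives of the Lie algebroid Thom class are the Thom forms. -/
theorem represents_thomClass_iff (ho : IsBundleOrientation F o)
    {τ : π^!.Form 𝕜 r} :
    π^!.Represents τ (L.thomClass 𝕜 F o) ↔ IsThomForm o τ := by
  obtain ⟨σ, hσ⟩ := AlgebroidData.exists_represents (thomClass 𝕜 𝓘(ℝ, EM) F o)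
  have h1 := isPullbackClass_thomClass (L := L) σ hσ
  have h2 := (isThomClass_iff (L := L) hσ).1 (isThomClass_thomClass ho)
  refine ⟨fun h => (isThomForm_iff_isPullbackClass h).2 ?_,
    fun h => h1.represents_iff.2 ⟨h.1,
      sub_mem_compactCoboundaries ho (zero_add r) h.1 h2.1 h.2 h2.2⟩⟩
  exact (isThomForm_iff_isPullbackClass h1).1 h2

end ThomClass

/-! ### Naturality of the Thom class -/

section Naturality

variable {EM' : Type*} [NormedAddCommGroup EM'] [NormedSpace ℝ EM'] [FiniteDimensional ℝ EM']
  {M' : Type*} [TopologicalSpace M'] [ChartedSpace EM' M'] [IsManifold 𝓘(ℝ, EM') ∞ M']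
  [T2Space M'] [CompactSpace M']
  {FA' : Type*} [NormedAddCommGroup FA'] [NormedSpace ℝ FA'] [FiniteDimensional ℝ FA']
  {A' : M' → Type*} [TopologicalSpace (TotalSpace FA' A')]
  [∀ x, AddCommGroup (A' x)] [∀ x, Module ℝ (A' x)] [∀ x, TopologicalSpace (A' x)]
  [FiberBundle FA' A'] [VectorBundle ℝ FA' A'] [ContMDiffVectorBundle ∞ FA' A' 𝓘(ℝ, EM')]
  {L' : LieAlgebroid 𝓘(ℝ, EM') FA' A'} {f : C^∞⟮𝓘(ℝ, EM'), M'; 𝓘(ℝ, EM), M⟯}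
  {φ : ∀ x, A' x →ₗ[ℝ] A (f x)}

theorem isBundleOrientation_pullback (ho : IsBundleOrientation F o) :
    IsBundleOrientation F (E := f *ᵖ E) fun x => o (f x) := by
  intro x₀
  obtain ⟨b, hb⟩ := ho (f x₀)
  refine ⟨b, ?_⟩
  filter_upwards [f.contMDiff.continuous.continuousAt.eventually hb] with y hy hy'
  have h : ((trivializationAt F (f *ᵖ E) x₀).linearEquivAt ℝ y hy' : E (f y) ≃ₗ[ℝ] F) =
      (trivializationAt F E (f x₀)).linearEquivAt ℝ (f y) hy' := LinearEquiv.ext fun v => rfl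
  exact (congrArg (fun e : E (f y) ≃ₗ[ℝ] F => Orientation.map (Fin r) e (o (f y))) h).trans (hy hy')

theorem isProperHom_inducedHom (hφ : IsMorphism L'.toData L.toData f φ) :
    IsProperHom 𝕜 (inducedHom F E L' L f φ hφ.anchor) :=
  .of_isHomAt (isAlgebroid_bundlePullback L' F (f *ᵖ E)) (isAlgebroid_bundlePullback L F E)
    (exists_frame_isHomAt_inducedHom hφ)
    fun _ hK => isCompact_preimage_lift f.contMDiff.continuous hK

theorem inducedHom_fibreHom (hφ : IsMorphism L'.toData L.toData f φ) (x : M')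
    (u : EuclideanSpace ℝ (Fin r) ≃ₗ[ℝ] (f *ᵖ E) x) (v : EuclideanSpace ℝ (Fin r))
    (w : (euclideanTangent r).Fib v) :
    inducedHom F E L' L f φ hφ.anchor (fibreInclusion F (E := f *ᵖ E) x u v)
        (fibreHom F (E := f *ᵖ E) L' x u v w) =
      fibreHom F (E := E) L (f x) u v w := by
  refine Subtype.ext (Prod.ext (map_zero (φ x)) ?_)
  have h := mfderiv_comp v ((contMDiff_pullbackLift (I' := 𝓘(ℝ, EM')) (I := 𝓘(ℝ, EM)) F E f).mdifferentiable
      (by simp) (fibreInclusion F (E := f *ᵖ E) x u v))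
    ((contMDiff_fibreInclusion (EM := EM') (F := F) (E := f *ᵖ E) x u).mdifferentiable (by simp) v)
  exact (congrArg (fun T => T w) h).symm

/-- The Thom class is natural: its pull-back restricts to the canonical generator on each fibre. -/
theorem isPullbackClass_inducedHom (ho : IsBundleOrientation F o)
    (hφ : IsMorphism L'.toData L.toData f φ) :
    IsPullbackClass (inducedHom F E L' L f φ hφ.anchor)
      (L.thomClass 𝕜 F o) (L'.thomClass 𝕜 F (E := f *ᵖ E) (fun x => o (f x))) := by
  intro τ hτ
  rw [represents_thomClass_iff ho] at hτ
  have h1 := (isProperHom_inducedHom (F := F) (E := E) hφ).compactCocycles hτ.1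
  refine (represents_thomClass_iff (isBundleOrientation_pullback ho)).2 ((isThomForm_iff h1).2
    fun x u hu => ?_)
  obtain ⟨g, hg, h2⟩ := (isThomForm_iff hτ.1).1 hτ (f x) u hu
  refine ⟨g, hg, ?_⟩
  have h3 : pullbackForm (fibreHom F (E := f *ᵖ E) L' x u)
      (pullbackForm (inducedHom F E L' L f φ hφ.anchor) τ) =
      pullbackForm (fibreHom F (E := E) L (f x) u) τ := by
    funext v
    ext w
    exact congrArg (τ (fibreInclusion F (E := E) (f x) u v))
      (funext fun i => inducedHom_fibreHom hφ x u v (w i))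
  rwa [h3]

end Naturality

/-! ### The Thom isomorphism -/

section ThomIsomorphism

theorem wedgeL_smul_left {V : Type*} [AddCommGroup V] [Module ℝ V] {k l : ℕ} (c : 𝕜)
    (a : V [⋀^Fin k]→ₗ[ℝ] 𝕜) (b : V [⋀^Fin l]→ₗ[ℝ] 𝕜) : wedgeL (c • a) b = c • wedgeL a b := by
  ext w
  refine smul_right_injective 𝕜 (factorial_mul_ne_zero k l) ?_
  change _ • wedgeL (c • a) b w = _ • c • wedgeL a b w
  rw [smul_comm _ c, factorial_smul_wedgeL_apply, factorial_smul_wedgeL_apply, Finset.smul_sum]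
  refine Finset.sum_congr rfl fun s _ => ?_
  rw [smul_comm c, AlternatingMap.smul_apply, smul_mul_assoc]

/-- The map `α ↦ π^*α ∧ τ`. -/
def thomMap (τ : π^!.Form 𝕜 r) (k : ℕ) :
    L.toData.Form 𝕜 k →ₗ[𝕜] π^!.Form 𝕜 (k + r) where
  toFun α := AlgebroidData.wedge (π^* α) τ
  map_add' α β := funext fun q => LinearMap.map_add₂ wedgeL
    (π^* α q)
    (π^* β q) (τ q)
  map_smul' c α := funext fun q => wedgeL_smul_left c
    (π^* α q) (τ q)

/-- A form of degree `d` as a form of degree `e = d`. -/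
def castForm {H N : Type*} [TopologicalSpace H] [TopologicalSpace N] [ChartedSpace H N]
    {V : Type*} [NormedAddCommGroup V] [NormedSpace ℝ V] {I : ModelWithCorners ℝ V H}
    {B : AlgebroidData I N} {e : ℕ} (h : d = e) (τ : B.Form 𝕜 d) : B.Form 𝕜 e :=
  fun x => (τ x).domDomCongr (finCongr h)

variable {τ : (L.bundlePullback F E).Form 𝕜 r}

theorem castForm_mem {e : ℕ} (h : d = e) {σ : π^!.Form 𝕜 d}
    (hσ : σ ∈ π^!.compactForms 𝕜 d) :
    castForm h σ ∈ π^!.compactForms 𝕜 e := by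
  subst h
  exact hσ

theorem IsFibInt.castForm {e : ℕ} (h : k + r = d) (h' : d = e)
    {σ : π^!.Form 𝕜 d} {γ : L.toData.Form 𝕜 k} (hσ : IsFibInt o h σ γ) :
    IsFibInt o (h.trans h') (castForm h' σ) γ := by
  subst h'
  exact hσ

theorem mem_compactCoboundaries_iff {e : ℕ} (h : d = e + 1)
    {σ : π^!.Form 𝕜 d} :
    σ ∈ π^!.compactCoboundaries 𝕜 d ↔
      ∃ β ∈ π^!.compactForms 𝕜 e,
        π^!.IsDifferential β (castForm h σ) := by
  subst h
  exact Iff.rfl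

theorem isDifferential_thomMap (hτ : τ ∈ π^!.compactCocycles 𝕜 r)
    {α : L.toData.Form 𝕜 k} (hα : L.toData.IsSmoothForm α) {α' : L.toData.Form 𝕜 (k + 1)}
    (hd : L.toData.IsDifferential α α') :
    thomMap τ k α ∈ π^!.compactForms 𝕜 (k + r) ∧
      π^!.IsDifferential (thomMap τ k α)
        (castForm (Nat.add_right_comm k 1 r) (thomMap τ (k + 1) α')) := by
  have hP := isAlgebroid_bundlePullback L F E
  have h1 : ∀ q, SmoothFormAt (π^* α) q ∧
      IsDifferentialAt (π^* α)
        (π^* α') q := fun q => by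
    obtain ⟨fr⟩ := L.isAlgebroid.frame q.proj
    have h2 := isHomAt_projHom (IP := 𝓘(ℝ, EM).prod 𝓘(ℝ, F)) L (f := π F E) contMDiff_bundleProj
      (p := q) fr
    exact ⟨h2.smoothFormAt (isSmoothForm_iff.1 hα _), h2.isDifferentialAt hP L.isAlgebroid
      (isSmoothForm_iff.1 hα _) (isDifferential_iff.1 hd _)⟩
  have hs := fun q => isSmoothForm_iff.1 hτ.1.1 q
  obtain ⟨-, K, hK, h0⟩ := hτ.1
  refine ⟨⟨isSmoothForm_iff.2 fun q => (h1 q).1.wedge (hs q), K, hK, fun q hq => ?_⟩,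
    isDifferential_iff.2 fun q => ?_⟩
  · exact (congrArg (wedgeL (π^* α q))
      (h0 q hq)).trans (map_zero _)
  · have h2 : wedgeSign k r • AlgebroidData.wedge
        (π^* α) 0 q = 0 :=
      (congrArg (wedgeSign k r • ·) (map_zero (wedgeL (l := r + 1)
        (π^* α q)))).trans (smul_zero _)
    have h3 := IsDifferentialAt.wedge hP (h1 q).2 (isDifferential_iff.1 hτ.2.2 q) (h1 q).1 (hs q)
    exact h3.congr_right ((congrArg (castForm (Nat.add_right_comm k 1 r) (thomMap τ (k + 1) α') q + ·)
      h2).trans (add_zero _)).symm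

theorem thomMap_mem_compactCocycles (hτ : τ ∈ π^!.compactCocycles 𝕜 r)
    {α : L.toData.Form 𝕜 k} (hα : α ∈ L.toData.cocycles 𝕜 k) :
    thomMap τ k α ∈ π^!.compactCocycles 𝕜 (k + r) := by
  obtain ⟨h1, h2⟩ := isDifferential_thomMap hτ hα.1 hα.2
  rw [map_zero] at h2
  exact ⟨h1, h1.1, h2⟩

theorem thomMap_mem_compactCoboundaries (hτ : τ ∈ π^!.compactCocycles 𝕜 r)
    {α : L.toData.Form 𝕜 k}
    (hα : α ∈ L.toData.coboundaries 𝕜 (L.toData.smoothForms 𝕜) (fun _ => le_rfl) k) :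
    thomMap τ k α ∈ π^!.compactCoboundaries 𝕜 (k + r) := by
  cases k with
  | zero =>
    obtain rfl : α = 0 := hα
    rw [map_zero]
    exact Submodule.zero_mem _
  | succ k =>
    obtain ⟨γ, hγ, hd⟩ := hα
    exact (mem_compactCoboundaries_iff (Nat.add_right_comm k 1 r)).2
      ⟨_, isDifferential_thomMap hτ hγ hd⟩

/-- The Thom map is injective in cohomology: the fibre integral of a primitive of `π^*α ∧ τ` is,
up to sign, a primitive of `α`. -/
theorem mem_coboundaries_of_thomMap (ho : IsBundleOrientation F o) (hτ : IsThomForm o τ)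
    {α : L.toData.Form 𝕜 k} (hα : α ∈ L.toData.cocycles 𝕜 k)
    (h : thomMap τ k α ∈ π^!.compactCoboundaries 𝕜 (k + r)) :
    α ∈ L.toData.coboundaries 𝕜 (L.toData.smoothForms 𝕜) (fun _ => le_rfl) k := by
  have hε : fibSign 𝕜 k r ≠ 0 := left_ne_zero_of_mul_eq_one (fibSign_mul_self k r)
  have h1 := isFibInt_wedge hτ.2 α
  cases k with
  | zero =>
    -- There are no forms of degree `-1` to integrate to; an exact form has integral `0` on each fibre.
    refine funext fun x => ?_
    ext w
    obtain ⟨pf, b, hx, hb⟩ := exists_orientedPatch L ho x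
    let u := pf.fibreFrame b hx
    have h2 := h1 x u (pf.isOriented_fibreFrame hb hx)
      (fun v i => fibreHom F L x u v (EuclideanSpace.single (Fin.cast (zero_add r) i) (1 : ℝ))) 0
      ⟨fun i j hij => Fin.ext (Fin.mk.inj_iff.1 hij), fun v i => rfl, fun v j => rfl⟩
    have h3 := integral_eq_zero_of_mem_coboundaries (μ := volume)
      ((isProperHom_fibreHom (L := L) x u).compactCoboundaries h)
      fun i => (EuclideanSpace.single (Fin.cast (zero_add r) i) (1 : ℝ))
    have h4 := (smul_eq_zero.1 (h2.symm.trans h3)).resolve_left hε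
    exact (congrArg (α x) (Subsingleton.elim _ _)).trans h4
  | succ k =>
    obtain ⟨β, hβ, hd⟩ := (mem_compactCoboundaries_iff (Nat.add_right_comm k 1 r)).1 h
    obtain ⟨δ, hδ⟩ := exists_isFibInt ho (rfl : k + r = k + r) hβ
    have h2 := hδ.isDifferential ho rfl _ hβ
      (castForm_mem _ (thomMap_mem_compactCocycles hτ.1 hα).1) hd (h1.castForm rfl _)
    have h3 : ((-1 : 𝕜) ^ r) • fibSign 𝕜 (k + 1) r • α ∈
        L.toData.coboundaries 𝕜 (L.toData.smoothForms 𝕜) (fun _ => le_rfl) (k + 1) :=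
      ⟨δ, hδ.isSmoothForm ho rfl hβ, h2⟩
    rwa [Submodule.smul_mem_iff _ (pow_ne_zero _ (neg_ne_zero.2 one_ne_zero)),
      Submodule.smul_mem_iff _ hε] at h3

/-- The Thom map is surjective in cohomology: a closed form `σ` is cohomologous to `π^*α ∧ τ` where
`α` is, up to sign, the fibre integral of `σ`. -/
theorem exists_sub_thomMap_mem (ho : IsBundleOrientation F o) (hτ : IsThomForm o τ)
    {σ : π^!.Form 𝕜 (k + r)}
    (hσ : σ ∈ π^!.compactCocycles 𝕜 (k + r)) :
    ∃ α ∈ L.toData.cocycles 𝕜 k,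
      thomMap τ k α - σ ∈ π^!.compactCoboundaries 𝕜 (k + r) := by
  obtain ⟨γ, hγ⟩ := exists_isFibInt ho rfl hσ.1
  have h1 := hγ.isDifferential ho rfl (Nat.add_right_comm k 1 r) hσ.1 (Submodule.zero_mem _) hσ.2.2
    (γ' := 0) fun x u hu Y z hY => integral_zero _ _
  rw [smul_zero] at h1
  have h2 := (L.toData.cocycles 𝕜 k).smul_mem (fibSign 𝕜 k r) ⟨hγ.isSmoothForm ho rfl hσ.1, h1⟩
  refine ⟨_, h2, sub_mem_compactCoboundaries ho rfl (thomMap_mem_compactCocycles hτ.1 h2) hσ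
    ?_ hγ⟩
  have h3 := isFibInt_wedge hτ.2 (fibSign 𝕜 k r • γ)
  rwa [smul_smul, fibSign_mul_self, one_smul] at h3

/-- The isomorphism is induced by one Thom form; all Thom forms give the same map in cohomology. -/
theorem exists_thomIsomorphism (ho : IsBundleOrientation F o) (k : ℕ) :
    ∃ Ψ : L.toData.Cohomology 𝕜 k ≃ₗ[𝕜] π^!.CompactCohomology 𝕜 (k + r),
      ∀ (α : L.toData.Form 𝕜 k) (hα : α ∈ L.toData.cocycles 𝕜 k)
        (τ : π^!.Form 𝕜 r), IsThomForm o τ →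
        π^!.Represents (thomMap τ k α)
          (Ψ (L.toData.cohomologyClass α hα)) := by
  obtain ⟨σ, h1, h2⟩ := exists_thomForm 𝕜 L ho
  have hσ : IsThomForm o σ := ⟨h1, h2⟩
  let θ : L.toData.cocycles 𝕜 k →ₗ[𝕜] π^!.CompactCohomology 𝕜 (k + r) :=
    Submodule.mkQ _ ∘ₗ (thomMap σ k).restrict fun α hα => thomMap_mem_compactCocycles h1 hα
  have hθ : ∀ α hα, π^!.Represents (thomMap σ k α) (θ ⟨α, hα⟩) :=
    fun α hα => AlgebroidData.represents_mk (thomMap_mem_compactCocycles h1 hα)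
  have hker : LinearMap.ker θ = (L.toData.coboundaries 𝕜 (L.toData.smoothForms 𝕜)
      (fun _ => le_rfl) k).submoduleOf (L.toData.cocycles 𝕜 k) := by
    ext ⟨α, hα⟩
    have h3 : θ ⟨α, hα⟩ = 0 ↔
        thomMap σ k α ∈ π^!.compactCoboundaries 𝕜 (k + r) :=
      Submodule.Quotient.mk_eq_zero _
    exact h3.trans ⟨mem_coboundaries_of_thomMap ho hσ hα, thomMap_mem_compactCoboundaries h1⟩
  refine ⟨LinearEquiv.ofBijective (Submodule.liftQ _ θ hker.ge) ⟨?_, fun c => ?_⟩,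
    fun α hα τ hτ => (hθ α hα).represents_iff.2 ⟨thomMap_mem_compactCocycles hτ.1 hα,
      sub_mem_compactCoboundaries ho rfl (thomMap_mem_compactCocycles hτ.1 hα)
        (thomMap_mem_compactCocycles h1 hα) (isFibInt_wedge hτ.2 α) (isFibInt_wedge h2 α)⟩⟩
  · exact LinearMap.ker_eq_bot.1 (Submodule.ker_liftQ_eq_bot _ _ _ hker.le)
  · obtain ⟨ρ, hρ⟩ := AlgebroidData.exists_represents c
    obtain ⟨α, hα, h3⟩ := exists_sub_thomMap_mem ho hσ hρ.1
    refine ⟨Submodule.Quotient.mk ⟨α, hα⟩, ?_⟩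
    exact (hθ α hα).unique (hρ.represents_iff.2 ⟨thomMap_mem_compactCocycles h1 hα, h3⟩)

end ThomIsomorphism

end Fibrewise

end ThomAlgebroid

open ThomAlgebroid in
theorem mainTheorem1
    {𝕜 : Type*} [RCLike 𝕜]
    {EM : Type*} [NormedAddCommGroup EM] [NormedSpace ℝ EM] [FiniteDimensional ℝ EM]
    {M : Type*} [TopologicalSpace M] [ChartedSpace EM M] [IsManifold 𝓘(ℝ, EM) ∞ M]
    [T2Space M] [CompactSpace M]
    {FA : Type*} [NormedAddCommGroup FA] [NormedSpace ℝ FA] [FiniteDimensional ℝ FA]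
    {A : M → Type*} [TopologicalSpace (TotalSpace FA A)]
    [∀ x, AddCommGroup (A x)] [∀ x, Module ℝ (A x)] [∀ x, TopologicalSpace (A x)]
    [FiberBundle FA A] [VectorBundle ℝ FA A] [ContMDiffVectorBundle ∞ FA A 𝓘(ℝ, EM)]
    (L : LieAlgebroid 𝓘(ℝ, EM) FA A)
    {F : Type*} [NormedAddCommGroup F] [NormedSpace ℝ F] [FiniteDimensional ℝ F]
    {E : M → Type*} [TopologicalSpace (TotalSpace F E)]
    [∀ x, AddCommMonoid (E x)] [∀ x, Module ℝ (E x)] [∀ x, TopologicalSpace (E x)]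
    [FiberBundle F E] [VectorBundle ℝ F E] [ContMDiffVectorBundle ∞ F E 𝓘(ℝ, EM)]
    (r : ℕ) (o : ∀ x, Orientation ℝ (E x) (Fin r)) (ho : IsBundleOrientation F o) :
    -- the ordinary Thom class `Th(E)` and its pull-back along the anchor are well defined
    (IsThomClass 𝓘(ℝ, EM) F o (thomClass 𝕜 𝓘(ℝ, EM) F o) ∧
      (∀ c : (tangentAlgebroid (𝓘(ℝ, EM).prod 𝓘(ℝ, F)) (TotalSpace F E)).CompactCohomology 𝕜 r,
        IsThomClass 𝓘(ℝ, EM) F o c → c = thomClass 𝕜 𝓘(ℝ, EM) F o) ∧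
      IsPullbackClass (anchorHom (𝓘(ℝ, EM).prod 𝓘(ℝ, F)) L (π F E))
        (thomClass 𝕜 𝓘(ℝ, EM) F o) (L.thomClass 𝕜 F o)) ∧
    -- naturality under morphisms of Lie algebroids
    (∀ {EM' : Type*} [NormedAddCommGroup EM'] [NormedSpace ℝ EM'] [FiniteDimensional ℝ EM']
      {M' : Type*} [TopologicalSpace M'] [ChartedSpace EM' M'] [IsManifold 𝓘(ℝ, EM') ∞ M']
      [T2Space M'] [CompactSpace M']
      {FA' : Type*} [NormedAddCommGroup FA'] [NormedSpace ℝ FA'] [FiniteDimensional ℝ FA']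
      {A' : M' → Type*} [TopologicalSpace (TotalSpace FA' A')]
      [∀ x, AddCommGroup (A' x)] [∀ x, Module ℝ (A' x)] [∀ x, TopologicalSpace (A' x)]
      [FiberBundle FA' A'] [VectorBundle ℝ FA' A'] [ContMDiffVectorBundle ∞ FA' A' 𝓘(ℝ, EM')]
      (L' : LieAlgebroid 𝓘(ℝ, EM') FA' A')
      (f : C^∞⟮𝓘(ℝ, EM'), M'; 𝓘(ℝ, EM), M⟯) (φ : ∀ x, A' x →ₗ[ℝ] A (f x))
      (hφ : IsMorphism L'.toData L.toData f φ),
      IsPullbackClass (inducedHom F E L' L f φ hφ.anchor)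
        (L.thomClass 𝕜 F o) (L'.thomClass 𝕜 F (E := f *ᵖ E) (fun x => o (f x)))) ∧
    -- restriction to the fibres
    (∀ (x : M) (u : EuclideanSpace ℝ (Fin r) ≃ₗ[ℝ] E x), IsOriented (o x) u →
      IsMorphism (euclideanTangent r) (L.bundlePullback F E) (fibreInclusion F x u)
        (fibreHom F L x u) ∧
      ∃ g : (euclideanTangent r).CompactCohomology 𝕜 r, IsCanonicalGenerator g ∧
        IsPullbackClass (fibreHom F L x u) (L.thomClass 𝕜 F o) g) ∧
    -- uniqueness
    (∀ c : (L.bundlePullback F E).CompactCohomology 𝕜 r,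
      (∀ (x : M) (u : EuclideanSpace ℝ (Fin r) ≃ₗ[ℝ] E x), IsOriented (o x) u →
        ∃ g : (euclideanTangent r).CompactCohomology 𝕜 r, IsCanonicalGenerator g ∧
          IsPullbackClass (fibreHom F L x u) c g) →
      c = L.thomClass 𝕜 F o) ∧
    -- the Thom isomorphism `[α] ↦ [π^*α ∧ Th^A(E)]`
    (∀ k : ℕ, ∃ Ψ : L.toData.Cohomology 𝕜 k ≃ₗ[𝕜]
        (L.bundlePullback F E).CompactCohomology 𝕜 (k + r),
      ∀ (α : L.toData.Form 𝕜 k) (hα : α ∈ L.toData.cocycles 𝕜 k)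
        (τ : (L.bundlePullback F E).Form 𝕜 r),
        (L.bundlePullback F E).Represents τ (L.thomClass 𝕜 F o) →
        (L.bundlePullback F E).Represents
          (AlgebroidData.wedge
            (pullbackForm (projHom (𝓘(ℝ, EM).prod 𝓘(ℝ, F)) L (π F E)) α) τ)
          (Ψ (L.toData.cohomologyClass α hα))) := by
  refine ⟨⟨isThomClass_thomClass ho, fun c hc => hc.unique ho (isThomClass_thomClass ho),
    isPullbackClass_thomClass⟩, ?_, fun x u hu => ⟨isMorphism_fibreHom L x u, ?_⟩,
    fun c hc => ?_, fun k => ?_⟩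
  · intro _ _ _ _ _ _ _ _ _ _ _ _ _ _ _ _ _ _ _ _ _ _ _ _ _ hφ
    exact isPullbackClass_inducedHom ho hφ
  · obtain ⟨τ, hτ⟩ := AlgebroidData.exists_represents (L.thomClass 𝕜 F o)
    exact (isThomForm_iff_isPullbackClass hτ).1 ((represents_thomClass_iff ho).1 hτ) x u hu
  · obtain ⟨τ, hτ⟩ := AlgebroidData.exists_represents c
    exact hτ.unique ((represents_thomClass_iff ho).2 ((isThomForm_iff_isPullbackClass hτ).2 hc))
  · obtain ⟨Ψ, hΨ⟩ := exists_thomIsomorphism (𝕜 := 𝕜) (L := L) ho k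
    exact ⟨Ψ, fun α hα τ hτ => hΨ α hα τ ((represents_thomClass_iff ho).1 hτ)⟩
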